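/- **Conventions.** For a graph $P$, a *dominating $P$-pattern* in a graph $G$ is a set $D\subseteq V(G)$ such that every vertex of $G$ lies in $D$ or has a neighbour in $D$, and such that the induced subgraph $G[D]$ is isomorphic to $P$. The problem *Dominating $K_4$* asks whether a given graph $G$ has a dominating $K_4$-pattern. The graph $G$ has $n$ vertices and $m$ edges and is given by $n$, $m$ and a list of its edges; running times are stated for $1\le n\le m$. Algorithms are programs of a random access machine that can flip fair coins, each operation being charged the bit lengths of the numbers it handles. A bound $T(n,m)^{1+o(1)}$ means: for every $\varepsilon>0$ the running time is $O(T(n,m)^{1+\varepsilon})$, for all outcomes of the coins; a bound $n^{\omega+o(1)}$ means: for every $\varepsilon>0$ the running time is $O(n^{\omega+\varepsilon})$. For a graph $P$, let $S$ be an independent set of non-isolated vertices of $P$ that maximizes $|S|-|N(S)|$ (where $N(S)$ is the open neighbourhood of $S$) and, among these, maximizes $|S|$. Put $\rho(P)=|S|-|N(S)|$ if $S\neq\emptyset$ and $\rho(P)=-1$ if $S=\emptyset$, and $$t_P(n,m)=n^{\rho(P)}\,m^{(|V(P)|-\rho(P))/2}.$$ **Theorem.** Let $\omega$ be a real number for which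 there is a deterministic algorithm that multiplies any two $n\times n$ matrices with non-negative integer entries of $O(\log n)$ bits in time $n^{\omega+o(1)}$; the matrix multiplication exponent is the smallest such $\omega$. Then for every constant $c\in\mathbb N$ there is a randomized algorithm that solves Dominating $K_4$ on every graph with $n\ge1$ vertices with error probability at most $n^{-c}$ and runs in time $$\left(\frac{m^{(\omega+3)/2}}{n}\right)^{1+o(1)}.$$ If $\omega=2$, then $\dfrac{m^{(\omega+3)/2}}{n}=\dfrac{m^{5/2}}{n}=t_{K_4}(n,m)$ for all $n,m\ge 1$, so that this algorithm runs in time $t_{K_4}(n,m)^{1+o(1)}$. -/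

import Mathlib

open Finset MeasureTheory
open scoped ENNReal

/-! ## Dominating patterns -/

/-- A set `D` of vertices dominates `G` if every vertex is in `D` or has a neighbour in `D`. -/
def Dominates {V : Type*} (G : SimpleGraph V) (D : Set V) : Prop :=
  ∀ v, v ∈ D ∨ ∃ u ∈ D, G.Adj u v

/-- `G` has a dominating `P`-pattern: a dominating set inducing a subgraph isomorphic to `P`. -/
def HasDominatingPattern {W V : Type*} (P : SimpleGraph W) (G : SimpleGraph V) : Prop :=
  ∃ D : Set V, Dominates G D ∧ Nonempty (G.induce D ≃g P)

/-! ## The parameter `ρ(P)` and the bound `t_P(n, m)` -/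

section Rho

variable {W : Type*} [Fintype W]

open Classical in
/-- The open neighbourhood `N(S)`. -/
noncomputable def openNbhd (P : SimpleGraph W) (S : Finset W) : Finset W :=
  univ.filter fun v => ∃ s ∈ S, P.Adj s v

/-- The independent sets of non-isolated vertices. -/
def IsRhoCandidate (P : SimpleGraph W) (S : Finset W) : Prop :=
  (∀ u ∈ S, ∀ v ∈ S, ¬ P.Adj u v) ∧ ∀ v ∈ S, ∃ u, P.Adj v u

/-- The quantity `|S| - |N(S)|`. -/
noncomputable def surplus (P : SimpleGraph W) (S : Finset W) : ℤ :=
  (#S : ℤ) - (#(openNbhd P S) : ℤ)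

/-- A candidate that maximizes `|S| - |N(S)|` and, among the maximizers, maximizes `|S|`. -/
def IsRhoSet (P : SimpleGraph W) (S : Finset W) : Prop :=
  IsRhoCandidate P S ∧ ∀ S' : Finset W, IsRhoCandidate P S' →
    surplus P S' < surplus P S ∨ (surplus P S' = surplus P S ∧ #S' ≤ #S)

theorem exists_isRhoSet (P : SimpleGraph W) : ∃ S : Finset W, IsRhoSet P S := by
  classical
  obtain ⟨S, hS, hmax⟩ := Finset.exists_max_image
    ((univ : Finset (Finset W)).filter fun S => IsRhoCandidate P S)
    (fun S => toLex (surplus P S, #S)) ⟨∅, mem_filter.2 ⟨mem_univ _, by simp [IsRhoCandidate]⟩⟩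
  refine ⟨S, (mem_filter.1 hS).2, fun S' hS' => ?_⟩
  have h := hmax S' (mem_filter.2 ⟨mem_univ _, hS'⟩)
  rw [Prod.Lex.toLex_le_toLex] at h
  simpa using h

open Classical in
/-- The parameter `ρ(P)`: the optimal `|S| - |N(S)|`, or `-1` if the optimal set is empty. -/
noncomputable def rho (P : SimpleGraph W) : ℤ :=
  if (exists_isRhoSet P).choose.Nonempty then surplus P (exists_isRhoSet P).choose else -1

/-- `t_P(n, m) = n ^ ρ(P) * m ^ ((|V(P)| - ρ(P)) / 2)`. -/
noncomputable def patternTime (P : SimpleGraph W) (n m : ℕ) : ℝ :=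
  (n : ℝ) ^ (rho P : ℝ) * (m : ℝ) ^ (((Fintype.card W : ℝ) - (rho P : ℝ)) / 2)

end Rho

/-! ## The machine model: a random access machine with coin flips and logarithmic cost

Registers and memory cells are indexed by natural numbers and hold natural numbers. An algorithm is
one finite program. Every operation is charged the bit lengths of the numbers and addresses that it
handles; for numbers that are polynomially bounded in the input size this is, up to logarithmic
factors, the number of steps of a word RAM. -/

namespace RAM

/-- Arithmetic operations; subtraction is truncated at `0`, and `x / 0 = 0`. -/
inductive Op
  | add | sub | mul | div

def Op.eval : Op → ℕ → ℕ → ℕ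
  | .add, a, b => a + b
  | .sub, a, b => a - b
  | .mul, a, b => a * b
  | .div, a, b => a / b

/-- Expressions: constants, registers, memory cells (indirect addressing), operations. -/
inductive Expr
  | const (k : ℕ)
  | reg (x : ℕ)
  | load (addr : Expr)
  | op (o : Op) (a b : Expr)

/-- Programs; the tests of `ite` and `while` mean `≠ 0`, and `flip x` puts a random bit into the
register `x`. -/
inductive Prog
  | skip
  | assign (x : ℕ) (e : Expr)
  | store (addr e : Expr)
  | flip (x : ℕ)
  | seq (p q : Prog)
  | ite (e : Expr) (p q : Prog)
  | while (e : Expr) (p : Prog)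

/-- A configuration: registers, memory, and the number of coins flipped so far. -/
structure Config where
  reg : ℕ → ℕ
  mem : ℕ → ℕ
  coins : ℕ

/-- The cost of handling the number `k`: its bit length plus one. -/
def bits (k : ℕ) : ℕ := Nat.size k + 1

def Expr.eval (s : Config) : Expr → ℕ
  | .const k => k
  | .reg x => s.reg x
  | .load a => s.mem (a.eval s)
  | .op o a b => o.eval (a.eval s) (b.eval s)

def Expr.cost (s : Config) : Expr → ℕ
  | .const k => bits k
  | .reg x => bits (s.reg x)
  | .load a => a.cost s + bits (a.eval s) + bits (s.mem (a.eval s))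
  | .op _ a b => a.cost s + b.cost s + bits (a.eval s) + bits (b.eval s)

/-- `Exec r p s s' t`: with the coin sequence `r`, the program `p` started in `s` halts in `s'`,
at cost `t`. -/
inductive Exec (r : ℕ → Bool) : Prog → Config → Config → ℕ → Prop
  | skip (s : Config) : Exec r .skip s s 1
  | assign (x : ℕ) (e : Expr) (s : Config) :
      Exec r (.assign x e) s { s with reg := Function.update s.reg x (e.eval s) }
        (e.cost s + bits (e.eval s))
  | store (a e : Expr) (s : Config) :
      Exec r (.store a e) s { s with mem := Function.update s.mem (a.eval s) (e.eval s) }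
        (a.cost s + e.cost s + bits (a.eval s) + bits (e.eval s))
  | flip (x : ℕ) (s : Config) :
      Exec r (.flip x) s
        { s with reg := Function.update s.reg x (r s.coins).toNat, coins := s.coins + 1 } 1
  | seq {p q : Prog} {s s' s'' : Config} {t t' : ℕ} :
      Exec r p s s' t → Exec r q s' s'' t' → Exec r (.seq p q) s s'' (t + t')
  | ite_true {e : Expr} {p q : Prog} {s s' : Config} {t : ℕ} :
      e.eval s ≠ 0 → Exec r p s s' t → Exec r (.ite e p q) s s' (e.cost s + 1 + t)
  | ite_false {e : Expr} {p q : Prog} {s s' : Config} {t : ℕ} :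
      e.eval s = 0 → Exec r q s s' t → Exec r (.ite e p q) s s' (e.cost s + 1 + t)
  | while_true {e : Expr} {p : Prog} {s s' s'' : Config} {t t' : ℕ} :
      e.eval s ≠ 0 → Exec r p s s' t → Exec r (.while e p) s' s'' t' →
      Exec r (.while e p) s s'' (e.cost s + 1 + t + t')
  | while_false {e : Expr} {p : Prog} {s : Config} :
      e.eval s = 0 → Exec r (.while e p) s s (e.cost s + 1)

/-- The distribution of a sequence of independent fair coins. -/
noncomputable def coinMeasure : Measure (ℕ → Bool) :=
  Measure.infinitePi fun _ : ℕ => (PMF.uniformOfFintype Bool).toMeasure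

end RAM

open RAM

/-! ## Matrix multiplication -/

/-- The input of matrix multiplication: `n` in register `0`, then the entries of `A` and of `B`,
row by row, in the memory cells `0, …, 2 n ^ 2 - 1`; everything else is `0`. -/
def matMulInput {n : ℕ} (A B : Matrix (Fin n) (Fin n) ℕ) : Config where
  reg x := if x = 0 then n else 0
  mem a := if h : a < n * n then A (Fin.divNat ⟨a, h⟩) (Fin.modNat ⟨a, h⟩)
    else if h : a - n * n < n * n then B (Fin.divNat ⟨a - n * n, h⟩) (Fin.modNat ⟨a - n * n, h⟩)
    else 0
  coins := 0

/-- Two `n × n` matrices can be multiplied in time `n ^ (τ + o(1))`: a single program, which works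
for every outcome of the coins (equivalently, is deterministic), multiplies matrices with entries of
`O(log n)` bits and leaves the product, row by row, in the memory cells from `2 n ^ 2` on. The
matrix multiplication exponent is the least such `τ`. (Matrices with entries of both signs reduce to
four such products of non-negative matrices, so the sign restriction does not affect the
exponent.) -/
def MatMulInTime (τ : ℝ) : Prop :=
  ∃ M : Prog, ∀ d : ℕ, ∀ ε : ℝ, 0 < ε → ∃ C : ℝ, ∀ n : ℕ, 1 ≤ n →
    ∀ A B : Matrix (Fin n) (Fin n) ℕ, (∀ i j, A i j ≤ n ^ d) → (∀ i j, B i j ≤ n ^ d) →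
    ∀ r : ℕ → Bool, ∃ (s : Config) (t : ℕ), Exec r M (matMulInput A B) s t ∧
      (∀ i j : Fin n, s.mem (2 * (n * n) + (i * n + j)) = (A * B) i j) ∧
      (t : ℝ) ≤ C * (n : ℝ) ^ (τ + ε)

/-! ## Randomized graph algorithms -/

/-- `L` lists every edge of `G` exactly once (in any order, with any orientation). -/
def IsEdgeList {n : ℕ} (G : SimpleGraph (Fin n)) (L : List (Fin n × Fin n)) : Prop :=
  (L.map fun e => s(e.1, e.2)).Nodup ∧
    ∀ u v, G.Adj u v ↔ s(u, v) ∈ L.map fun e => s(e.1, e.2)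

/-- The input of a graph algorithm: the number `n` of vertices in register `0`, the number `m` of
edges in register `1`, the endpoints of the `i`-th edge (`i < m`) in the memory cells `2 i` and
`2 i + 1`; everything else is `0`. -/
def graphInput {n : ℕ} (L : List (Fin n × Fin n)) : Config where
  reg x := if x = 0 then n else if x = 1 then L.length else 0
  mem a := if h : a / 2 < L.length then
      (if a % 2 = 0 then ((L[a / 2]'h).1 : ℕ) else ((L[a / 2]'h).2 : ℕ)) else 0
  coins := 0

/-- The program `A` decides the graph property `Q` with error probability at most `n ^ (-c)`: on
every graph it halts, and with probability at least `1 - n ^ (-c)` register `0` then holds `1` if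
the graph has the property and `0` if it has not. -/
def DecidesWHP (A : Prog) (c : ℕ) (Q : ∀ n : ℕ, SimpleGraph (Fin n) → Prop) : Prop :=
  ∀ n : ℕ, 1 ≤ n → ∀ (G : SimpleGraph (Fin n)) (L : List (Fin n × Fin n)), IsEdgeList G L →
    (∀ r, ∃ (s : Config) (t : ℕ), Exec r A (graphInput L) s t) ∧
    1 - ((n : ℝ≥0∞) ^ c)⁻¹ ≤ coinMeasure {r | ∃ (s : Config) (t : ℕ),
      Exec r A (graphInput L) s t ∧ ((Q n G ∧ s.reg 0 = 1) ∨ (¬ Q n G ∧ s.reg 0 = 0))}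

/-- On all graphs with `1 ≤ n ≤ m`, and for all outcomes of the coins, the program `A` runs in time
`T(n, m) ^ (1 + o(1))`: for every `ε > 0` its cost is `O(T(n, m) ^ (1 + ε))`. -/
def RunsInTime (A : Prog) (T : ℕ → ℕ → ℝ) : Prop :=
  ∀ ε : ℝ, 0 < ε → ∃ C : ℝ, ∀ n : ℕ, 1 ≤ n →
    ∀ (G : SimpleGraph (Fin n)) (L : List (Fin n × Fin n)), IsEdgeList G L → n ≤ L.length →
    ∀ r : ℕ → Bool, ∃ (s : Config) (t : ℕ), Exec r A (graphInput L) s t ∧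
      (t : ℝ) ≤ C * T n L.length ^ (1 + ε)

namespace DomClique

/-! ## An injective pairing function that is a polynomial -/

/-! Call a vertex heavy if its degree exceeds `s`, the integer square root of n + m plus one. As the
degrees sum to at most 2m, at most 2s vertices are heavy (`Par.length_hl`). A dominating clique
meets the closed neighbourhood of every vertex, in particular that of a vertex w of minimum degree δ
(`exists_domA_nbr`). Since nδ ≤ 2m, it suffices to decide for O(m/n) vertices a whether a lies in a
dominating clique, spending about m^((ω+1)/2) on each.

Fix a and let X be the set of vertices outside its closed neighbourhood. Wanted are b, c, d,
adjacent to a and to each other, that cover X. For fixed d, mark in a 0/1 matrix which vertices of X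
are missed by both the candidate and d; the product of this matrix with its transpose vanishes at
(b, c) exactly when b, c, d cover X (`does_checkMain`). If the clique is ordered so that a heavy d
comes with heavy b and c, there are at most 2s candidates for each d (`Par.length_sel_le`).

Let y have least degree in X and suppose that y is light (`Par.DomA.light_cases`). If the clique
vertex that covers y can play the role of d, all d in N(y) can be tried, because deg(y)|X| ≤ 2m
(`cost_checkY`). Otherwise y is covered by a heavy b while d is light. Then the set U of vertices
missed by a, b and c lies in N(d), so it has at most s elements, and these sets can be listed for
all such b, c in time O(s³) (`cost_build`). If U contains a light vertex v, then d is a neighbour of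
v. Testing U ⊆ N(d), for all U filed under v and all light d in N(v), is again a matrix product once
the sets are hashed into O(s log n) columns (`hash_sep_iff`, `does_procV`); over all v these
products have O(m) rows and columns. If all of U is heavy, the pair (b, c) is flagged, and a last
pass over all d in N(a) checks the flagged pairs against the at most 2s heavy vertices of X only
(`cost_checkA`, `does_heavyPart`). Without flags the same pass settles the case that all of X is
heavy.

Rectangular products are cut into g × g squares (`does_prod`). For g = O(√m) a square costs at most
κg² with κ about m^((ω-2)/2), which gives κ·s²·L·B for each a (`does_perA`). With L = (c+2)·size(n)
independent hash functions, some light neighbourhood fails to be separated from some other vertex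
with probability at most n^(-c) (`measure_good`).

The algorithm is written in a small language with arrays, bounded loops and a primitive for matrix
products, and is compiled to the machine at the price of a factor logarithmic in the numbers that
occur (`compile_correct`). The given multiplication program runs in relocated memory, in a fresh
zeroed copy for each product (`trProg_spec`, `mmProg_spec`). Writing down a product takes g² steps,
so ω ≥ 2 (`two_le_of_bound`), and this makes the final comparison of exponents work
(`cost_mainCmd_le`). -/

def pr (i j : ℕ) : ℕ := (i + j) * (i + j) + i

/-- Since i ≤ i + j, the value lies between the square of i + j and the next square. This determines
i + j, and then i. -/
theorem pr_inj {i j i' j' : ℕ} (h : pr i j = pr i' j') : i = i' ∧ j = j' := by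
  unfold pr at h
  have key : i + j = i' + j' := by
    rcases lt_trichotomy (i + j) (i' + j') with h1 | h1 | h1
    · exfalso; nlinarith
    · exact h1
    · exfalso; nlinarith
  rw [key] at h
  omega

/-! ## Bit lengths -/

theorem bits_mono {a b : ℕ} (h : a ≤ b) : bits a ≤ bits b :=
  Nat.add_le_add_right (Nat.size_le_size h) 1

theorem one_le_bits (a : ℕ) : 1 ≤ bits a := Nat.le_add_left _ _

theorem size_le_of_lt {a k : ℕ} (h : a < 2 ^ k) : Nat.size a ≤ k := Nat.size_le.2 h

theorem bits_add_le (a b : ℕ) : bits (a + b) ≤ bits a + bits b := by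
  unfold bits
  have h : a + b < 2 ^ (max a.size b.size + 1) := by
    have h1 : a < 2 ^ max a.size b.size :=
      (Nat.lt_size_self a).trans_le (Nat.pow_le_pow_right (by norm_num) (le_max_left _ _))
    have h2 : b < 2 ^ max a.size b.size :=
      (Nat.lt_size_self b).trans_le (Nat.pow_le_pow_right (by norm_num) (le_max_right _ _))
    rw [pow_succ]; omega
  have := size_le_of_lt h
  omega

theorem bits_mul_le (a b : ℕ) : bits (a * b) ≤ bits a + bits b := by
  unfold bits
  have h : a * b < 2 ^ (a.size + b.size) := by
    rw [pow_add]
    exact Nat.mul_lt_mul_of_lt_of_le (Nat.lt_size_self a) (Nat.lt_size_self b).le (by positivity)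
  have := size_le_of_lt h
  omega

theorem bits_op_le (o : Op) (a b : ℕ) : bits (o.eval a b) ≤ bits a + bits b := by
  cases o
  · exact bits_add_le a b
  · exact (bits_mono (Nat.sub_le a b)).trans (Nat.le_add_right _ _)
  · exact bits_mul_le a b
  · exact (bits_mono (Nat.div_le_self a b)).trans (Nat.le_add_right _ _)

/-! ## Machine expressions whose values and cost are within a constant factor of a bound -/

/-- Value and cost of the expression `e` have at most `K * β` bits. -/
def Small (cfg : Config) (β K : ℕ) (e : Expr) : Prop :=
  bits (e.eval cfg) ≤ K * β ∧ e.cost cfg ≤ K * β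

theorem Small.mono {cfg : Config} {β β' K K' : ℕ} {e : Expr} (h : Small cfg β K e)
    (hβ : β ≤ β') (hK : K ≤ K') : Small cfg β' K' e :=
  ⟨h.1.trans (Nat.mul_le_mul hK hβ), h.2.trans (Nat.mul_le_mul hK hβ)⟩

/-- An operation adds the bit lengths of its operands to their costs, and the result is no longer
than both together. Hence the constant depends only on the shape of the expression and not on the
numbers. -/
theorem small_op {cfg : Config} {β K L : ℕ} {a b : Expr} (o : Op) (ha : Small cfg β K a)
    (hb : Small cfg β L b) : Small cfg β (2 * (K + L)) (.op o a b) := by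
  obtain ⟨h1, h2⟩ := ha
  obtain ⟨h3, h4⟩ := hb
  have h5 := bits_op_le o (a.eval cfg) (b.eval cfg)
  constructor
  · simp only [Expr.eval]; nlinarith
  · simp only [Expr.cost]; nlinarith

theorem small_const {cfg : Config} {β : ℕ} (k : ℕ) (hβ : 1 ≤ β) :
    Small cfg β (bits k) (.const k) :=
  ⟨Nat.le_mul_of_pos_right _ hβ, Nat.le_mul_of_pos_right _ hβ⟩

theorem small_reg {cfg : Config} {β : ℕ} {x : ℕ} (h : bits (cfg.reg x) ≤ β) :
    Small cfg β 1 (.reg x) := by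
  constructor <;> simpa [Expr.eval, Expr.cost] using h

theorem small_load {cfg : Config} {β K : ℕ} {a : Expr} (ha : Small cfg β K a)
    (h : bits (cfg.mem (a.eval cfg)) ≤ β) : Small cfg β (2 * K + 1) (.load a) := by
  obtain ⟨h1, h2⟩ := ha
  constructor
  · simp only [Expr.eval]; nlinarith
  · simp only [Expr.cost]; nlinarith

def eadd (a b : Expr) : Expr := .op .add a b
def emul (a b : Expr) : Expr := .op .mul a b
def esub (a b : Expr) : Expr := .op .sub a b
def ediv (a b : Expr) : Expr := .op .div a b
def epr (a b : Expr) : Expr := eadd (emul (eadd a b) (eadd a b)) a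

@[simp] theorem eval_eadd (c : Config) (a b : Expr) :
    (eadd a b).eval c = a.eval c + b.eval c := rfl
@[simp] theorem eval_emul (c : Config) (a b : Expr) :
    (emul a b).eval c = a.eval c * b.eval c := rfl
@[simp] theorem eval_esub (c : Config) (a b : Expr) :
    (esub a b).eval c = a.eval c - b.eval c := rfl
@[simp] theorem eval_ediv (c : Config) (a b : Expr) :
    (ediv a b).eval c = a.eval c / b.eval c := rfl
@[simp] theorem eval_const (c : Config) (k : ℕ) : (Expr.const k).eval c = k := rfl
@[simp] theorem eval_reg (c : Config) (x : ℕ) : (Expr.reg x).eval c = c.reg x := rfl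
@[simp] theorem eval_load (c : Config) (a : Expr) :
    (Expr.load a).eval c = c.mem (a.eval c) := rfl

/-- A common bound for the constants of all operations on small expressions. -/
theorem small_pr {cfg : Config} {β K L : ℕ} {a b : Expr} (ha : Small cfg β K a)
    (hb : Small cfg β L b) :
    Small cfg β (2 * (2 * (2 * (K + L) + 2 * (K + L)) + K)) (epr a b) :=
  small_op _ (small_op _ (small_op _ ha hb) (small_op _ ha hb)) ha

/-! ## Memory layout: registers `3 x` hold the variables, registers `3 d + 1` are internal,
registers `3 x + 2` belong to the matrix multiplication program -/

/-- The input lies below `b`; above it, even offsets serve the arrays and odd offsets the private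
memories of the matrix products. Both addresses are polynomials, so the machine can evaluate them.
-/
def arrAddr (b k i j : ℕ) : ℕ := b + 2 * pr k (pr i j)
def mmAddr (b t a : ℕ) : ℕ := b + (2 * pr t a + 1)

theorem arrAddr_inj {b k i j k' i' j' : ℕ} (h : arrAddr b k i j = arrAddr b k' i' j') :
    k = k' ∧ i = i' ∧ j = j' := by
  have h1 : pr k (pr i j) = pr k' (pr i' j') := by unfold arrAddr at h; omega
  obtain ⟨h2, h3⟩ := pr_inj h1
  exact ⟨h2, pr_inj h3⟩

theorem mmAddr_inj {b t a t' a' : ℕ} (h : mmAddr b t a = mmAddr b t' a') : t = t' ∧ a = a' := by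
  have h1 : pr t a = pr t' a' := by unfold mmAddr at h; omega
  exact pr_inj h1

theorem arrAddr_ne_mmAddr (b k i j t a : ℕ) : arrAddr b k i j ≠ mmAddr b t a := by
  unfold arrAddr mmAddr; omega

theorem le_arrAddr (b k i j : ℕ) : b ≤ arrAddr b k i j := Nat.le_add_right _ _

theorem le_mmAddr (b t a : ℕ) : b ≤ mmAddr b t a := Nat.le_add_right _ _

/-- Register 1 holds the base address, register 4 the number of matrix products so far. -/
def eArrAddr (k : ℕ) (i j : Expr) : Expr :=
  eadd (.reg 1) (emul (.const 2) (epr (.const k) (epr i j)))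
def eMMAddr (a : Expr) : Expr :=
  eadd (.reg 1) (eadd (emul (.const 2) (epr (.reg 4) a)) (.const 1))

@[simp] theorem eval_eArrAddr (c : Config) (k : ℕ) (i j : Expr) :
    (eArrAddr k i j).eval c = arrAddr (c.reg 1) k (i.eval c) (j.eval c) := rfl
@[simp] theorem eval_eMMAddr (c : Config) (a : Expr) :
    (eMMAddr a).eval c = mmAddr (c.reg 1) (c.reg 4) (a.eval c) := rfl

/-! ## The matrix multiplication program, relocated and with its coins replaced by zeros -/

def trExpr : Expr → Expr
  | .const k => .const k
  | .reg x => .reg (3 * x + 2)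
  | .load a => .load (eMMAddr (trExpr a))
  | .op o a b => .op o (trExpr a) (trExpr b)

def trProg : Prog → Prog
  | .skip => .skip
  | .assign x e => .assign (3 * x + 2) (trExpr e)
  | .store a e => .store (eMMAddr (trExpr a)) (trExpr e)
  | .flip x => .assign (3 * x + 2) (.const 0)
  | .seq p q => .seq (trProg p) (trProg q)
  | .ite e p q => .ite (trExpr e) (trProg p) (trProg q)
  | .while e p => .while (trExpr e) (trProg p)

/-- The registers of an expression or a program are below the bound. -/
def exprRegs : Expr → ℕ
  | .const _ => 0
  | .reg x => x + 1
  | .load a => exprRegs a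
  | .op _ a b => max (exprRegs a) (exprRegs b)

def progRegs : Prog → ℕ
  | .skip => 0
  | .assign x e => max (x + 1) (exprRegs e)
  | .store a e => max (exprRegs a) (exprRegs e)
  | .flip x => x + 1
  | .seq p q => max (progRegs p) (progRegs q)
  | .ite e p q => max (exprRegs e) (max (progRegs p) (progRegs q))
  | .while e p => max (exprRegs e) (progRegs p)

/-- `cfg` simulates the configuration `c` of the matrix multiplication program in the `t`-th
copy of its memory. -/
structure Sim (R b t : ℕ) (c cfg : Config) : Prop where
  reg : ∀ x < R, cfg.reg (3 * x + 2) = c.reg x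
  mem : ∀ a, cfg.mem (mmAddr b t a) = c.mem a
  base : cfg.reg 1 = b
  cnt : cfg.reg 4 = t

/-- The constant is chosen before the configuration, so that all steps of a run share it; the
placeholder is filled in by the constants of the nested `small_op`. -/
theorem small_eMMAddr (K : ℕ) : ∃ K', ∀ (cfg : Config) (β : ℕ) (a : Expr), 1 ≤ β →
    bits (cfg.reg 1) ≤ β → bits (cfg.reg 4) ≤ β → Small cfg β K a →
    Small cfg β K' (eMMAddr a) :=
  ⟨_, fun _ _ _ h1 h2 h3 h4 => small_op .add (small_reg h2) (small_op .add
    (small_op .mul (small_const 2 h1) (small_pr (small_reg h3) h4)) (small_const 1 h1))⟩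

theorem small_eArrAddr (k K L : ℕ) : ∃ K', ∀ (cfg : Config) (β : ℕ) (i j : Expr), 1 ≤ β →
    bits (cfg.reg 1) ≤ β → Small cfg β K i → Small cfg β L j →
    Small cfg β K' (eArrAddr k i j) :=
  ⟨_, fun _ _ _ _ h1 h2 h3 h4 => small_op .add (small_reg h2)
    (small_op .mul (small_const 2 h1) (small_pr (small_const k h1) (small_pr h3 h4)))⟩

/-- The hypothesis is the conclusion of `trExpr_spec` for the address, so that the lemma serves
inside that induction as well as for stores. -/
theorem trAddr_spec {a : Expr} {K : ℕ} (hK : ∀ R b t c cfg, exprRegs a ≤ R → Sim R b t c cfg →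
      (trExpr a).eval cfg = a.eval c ∧
      (trExpr a).cost cfg ≤ K * ((bits b + bits t) * a.cost c)) :
    ∃ K', ∀ R b t c cfg, exprRegs a ≤ R → Sim R b t c cfg →
      (eMMAddr (trExpr a)).eval cfg = mmAddr b t (a.eval c) ∧
      Small cfg ((bits b + bits t) * (a.cost c + bits (a.eval c))) K' (eMMAddr (trExpr a)) := by
  obtain ⟨K', hK'⟩ := small_eMMAddr (K + 1)
  refine ⟨K', fun R b t c cfg hR hs => ?_⟩
  obtain ⟨h1, h2⟩ := hK R b t c cfg hR hs
  refine ⟨by rw [eval_eMMAddr, hs.base, hs.cnt, h1], ?_⟩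
  have hb := one_le_bits b
  have ht := one_le_bits t
  have hl := one_le_bits (a.eval c)
  set x := a.cost c + bits (a.eval c) with hx
  have hx1 : 1 ≤ x := by omega
  have hxβ : x ≤ (bits b + bits t) * x := Nat.le_mul_of_pos_left _ (by omega)
  have hbt : bits b + bits t ≤ (bits b + bits t) * x := Nat.le_mul_of_pos_right _ hx1
  refine hK' cfg _ _ (hx1.trans hxβ) (by rw [hs.base]; omega) (by rw [hs.cnt]; omega) ⟨?_, ?_⟩
  · rw [h1]
    exact (le_trans (by omega) hxβ).trans (Nat.le_mul_of_pos_left _ (by omega))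
  · exact h2.trans (Nat.mul_le_mul (by omega) (Nat.mul_le_mul le_rfl (by omega)))

/-- Only the relocation of addresses adds cost: a relocated address is a polynomial in the base, the
number of the copy and the old address. As all bit lengths are at least 1, the sum of the three is
bounded by a product. -/
theorem trExpr_spec (e : Expr) : ∃ K, ∀ R b t c cfg, exprRegs e ≤ R → Sim R b t c cfg →
    (trExpr e).eval cfg = e.eval c ∧
    (trExpr e).cost cfg ≤ K * ((bits b + bits t) * e.cost c) := by
  induction e with
  | const k =>
    refine ⟨1, fun R b t c cfg _ _ => ⟨rfl, ?_⟩⟩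
    simp only [trExpr, Expr.cost]
    nlinarith [one_le_bits b, one_le_bits k]
  | reg x =>
    refine ⟨1, fun R b t c cfg hR hs => ?_⟩
    have h := hs.reg x hR
    refine ⟨h, ?_⟩
    simp only [trExpr, Expr.cost, h]
    nlinarith [one_le_bits b, one_le_bits (c.reg x)]
  | load a ih =>
    obtain ⟨K, hK⟩ := ih
    obtain ⟨L, hL⟩ := trAddr_spec hK
    refine ⟨2 * L + 1, fun R b t c cfg hR hs => ?_⟩
    obtain ⟨h1, h2⟩ := hL R b t c cfg hR hs
    have hev : (trExpr (.load a)).eval cfg = (Expr.load a).eval c := by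
      simp only [trExpr, eval_load, h1, hs.mem]
    refine ⟨hev, ?_⟩
    have hb := one_le_bits b
    set w := bits b + bits t with hw
    have h3 : a.cost c + bits (a.eval c) ≤ (Expr.load a).cost c := by simp only [Expr.cost]; omega
    have h4 : bits (c.mem (a.eval c)) ≤ (Expr.load a).cost c := by simp only [Expr.cost]; omega
    refine (small_load (h2.mono (Nat.mul_le_mul le_rfl h3) le_rfl) ?_).2
    have : cfg.mem ((eMMAddr (trExpr a)).eval cfg) = c.mem (a.eval c) := hev
    rw [this]
    exact h4.trans (Nat.le_mul_of_pos_left _ (by omega))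
  | op o a b iha ihb =>
    obtain ⟨K, hK⟩ := iha
    obtain ⟨L, hL⟩ := ihb
    refine ⟨K + L + 1, fun R b' t c cfg hR hs => ?_⟩
    obtain ⟨h1, h2⟩ := hK R b' t c cfg (le_trans (le_max_left _ _) hR) hs
    obtain ⟨h3, h4⟩ := hL R b' t c cfg (le_trans (le_max_right _ _) hR) hs
    refine ⟨by simp only [trExpr, Expr.eval, h1, h3], ?_⟩
    simp only [trExpr, Expr.cost, h1, h3]
    have hb := one_le_bits b'
    set w := bits b' + bits t with hw
    have hw1 : 1 ≤ w := by omega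
    set x := a.cost c
    set y := b.cost c
    set z := bits (a.eval c) + bits (b.eval c) with hz
    have e1 : z ≤ w * z := Nat.le_mul_of_pos_left _ hw1
    calc (trExpr a).cost cfg + (trExpr b).cost cfg + bits (a.eval c) + bits (b.eval c)
        ≤ K * (w * x) + L * (w * y) + w * z := by omega
      _ ≤ K * (w * (x + y + z)) + L * (w * (x + y + z)) + w * (x + y + z) := by
          gcongr <;> omega
      _ = (K + L + 1) * (w * (x + y + bits (a.eval c) + bits (b.eval c))) := by
          rw [hz]; ring

/-- What the relocated program leaves alone. -/
structure Frame (b t : ℕ) (cfg cfg' : Config) : Prop where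
  reg : ∀ x, x % 3 ≠ 2 → cfg'.reg x = cfg.reg x
  mem : ∀ a, (∀ a', a ≠ mmAddr b t a') → cfg'.mem a = cfg.mem a
  coins : cfg'.coins = cfg.coins

theorem Frame.refl (b t : ℕ) (cfg : Config) : Frame b t cfg cfg :=
  ⟨fun _ _ => rfl, fun _ _ => rfl, rfl⟩

theorem Frame.trans {b t : ℕ} {c1 c2 c3 : Config} (h : Frame b t c1 c2) (h' : Frame b t c2 c3) :
    Frame b t c1 c3 :=
  ⟨fun x hx => (h'.reg x hx).trans (h.reg x hx), fun a ha => (h'.mem a ha).trans (h.mem a ha),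
    h'.coins.trans h.coins⟩

theorem Sim.assign {R b t : ℕ} {c cfg : Config} (hs : Sim R b t c cfg) (x v : ℕ) :
    Sim R b t { c with reg := Function.update c.reg x v }
      { cfg with reg := Function.update cfg.reg (3 * x + 2) v } := by
  refine ⟨fun y hy => ?_, hs.mem, ?_, ?_⟩
  · simp only [Function.update_apply]
    by_cases h : y = x
    · simp [h]
    · rw [if_neg (by omega), if_neg h]; exact hs.reg y hy
  · simp only [Function.update_apply]; rw [if_neg (by omega)]; exact hs.base
  · simp only [Function.update_apply]; rw [if_neg (by omega)]; exact hs.cnt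

theorem Sim.store {R b t : ℕ} {c cfg : Config} (hs : Sim R b t c cfg) (a v : ℕ) :
    Sim R b t { c with mem := Function.update c.mem a v }
      { cfg with mem := Function.update cfg.mem (mmAddr b t a) v } := by
  refine ⟨hs.reg, fun y => ?_, hs.base, hs.cnt⟩
  simp only [Function.update_apply]
  by_cases h : y = a
  · simp [h]
  · rw [if_neg (fun h' => h (mmAddr_inj h').2), if_neg h]; exact hs.mem y

theorem Frame.assign (b t : ℕ) (cfg : Config) (x v : ℕ) :
    Frame b t cfg { cfg with reg := Function.update cfg.reg (3 * x + 2) v } := by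
  refine ⟨fun y hy => ?_, fun _ _ => rfl, rfl⟩
  simp only [Function.update_apply]; rw [if_neg (by omega)]

theorem Frame.store (b t : ℕ) (cfg : Config) (a v : ℕ) :
    Frame b t cfg { cfg with mem := Function.update cfg.mem (mmAddr b t a) v } := by
  refine ⟨fun _ _ => rfl, fun y hy => ?_, rfl⟩
  simp only [Function.update_apply]; rw [if_neg (hy a)]

/-- The simulation: constants for all parts of a program are bounded by one constant. -/
theorem trProg_spec (p : Prog) : ∃ K, ∀ (R b t : ℕ) (r : ℕ → Bool), progRegs p ≤ R →
    ∀ c c' T, Exec (fun _ => false) p c c' T → ∀ cfg, Sim R b t c cfg →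
    ∃ cfg' T', Exec r (trProg p) cfg cfg' T' ∧ Sim R b t { c' with coins := 0 } cfg' ∧
      Frame b t cfg cfg' ∧ T' ≤ K * ((bits b + bits t) * T) := by
  induction p with
  | skip =>
    refine ⟨1, fun R b t r _ c c' T h cfg hs => ?_⟩
    cases h
    -- `Sim` does not mention the coins, so it is rebuilt field by field although the coin counters
    -- differ.
    refine ⟨cfg, 1, .skip _, ⟨hs.reg, hs.mem, hs.base, hs.cnt⟩, .refl _ _ _, ?_⟩
    nlinarith [one_le_bits b]
  | assign x e =>
    obtain ⟨K, hK⟩ := trExpr_spec e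
    refine ⟨K + 1, fun R b t r hR c c' T h cfg hs => ?_⟩
    cases h
    obtain ⟨h1, h2⟩ := hK R b t c cfg (le_trans (le_max_right _ _) hR) hs
    have h3 := hs.assign x (e.eval c)
    refine ⟨_, _, .assign _ _ _, ⟨?_, ?_, ?_, ?_⟩, Frame.assign _ _ _ _ _, ?_⟩
    · rw [h1]; exact h3.reg
    · rw [h1]; exact h3.mem
    · rw [h1]; exact h3.base
    · rw [h1]; exact h3.cnt
    · rw [h1]
      have hb := one_le_bits b
      have e1 : bits (e.eval c) ≤ (bits b + bits t) * bits (e.eval c) :=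
        Nat.le_mul_of_pos_left _ (by omega)
      nlinarith
  | store a e =>
    obtain ⟨K, hK⟩ := trExpr_spec a
    obtain ⟨L, hL⟩ := trExpr_spec e
    obtain ⟨M, hM⟩ := trAddr_spec hK
    refine ⟨2 * M + L + 1, fun R b t r hR c c' T h cfg hs => ?_⟩
    cases h
    obtain ⟨h1, h2, h2'⟩ := hM R b t c cfg (le_trans (le_max_left _ _) hR) hs
    obtain ⟨h3, h4⟩ := hL R b t c cfg (le_trans (le_max_right _ _) hR) hs
    have h5 := hs.store (a.eval c) (e.eval c)
    refine ⟨_, _, .store _ _ _, ⟨?_, ?_, ?_, ?_⟩, ?_, ?_⟩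
    · rw [h1, h3]; exact h5.reg
    · rw [h1, h3]; exact h5.mem
    · rw [h1, h3]; exact h5.base
    · rw [h1, h3]; exact h5.cnt
    · rw [h1, h3]; exact Frame.store _ _ _ _ _
    · rw [h3]
      have hb := one_le_bits b
      set w := bits b + bits t
      set x := a.cost c
      set y := bits (a.eval c)
      set z := e.cost c
      set u := bits (e.eval c)
      have e1 : u ≤ w * u := Nat.le_mul_of_pos_left _ (by omega)
      calc _ ≤ M * (w * (x + y)) + L * (w * z) + M * (w * (x + y)) + w * u := by omega
        _ ≤ M * (w * (x + z + y + u)) + L * (w * (x + z + y + u)) + M * (w * (x + z + y + u)) +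
            w * (x + z + y + u) := by
          have q1 : x + y ≤ x + z + y + u := by omega
          have q2 : z ≤ x + z + y + u := by omega
          have q3 : u ≤ x + z + y + u := by omega
          generalize x + z + y + u = S at *
          gcongr
        _ = _ := by ring
  | flip x =>
    -- The simulated run sees only zeros as coins, so a flip stores 0, just like the assignment that
    -- replaces it. The real coins stay untouched.
    refine ⟨2, fun R b t r hR c c' T h cfg hs => ?_⟩
    cases h
    have h3 := hs.assign x 0
    refine ⟨_, _, .assign _ _ _, ⟨?_, ?_, ?_, ?_⟩, Frame.assign _ _ _ _ _, ?_⟩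
    · exact h3.reg
    · exact h3.mem
    · exact h3.base
    · exact h3.cnt
    · have hb := one_le_bits b
      simp only [Expr.cost, Expr.eval, bits, Nat.size_zero]; omega
  | seq p q ihp ihq =>
    obtain ⟨K, hK⟩ := ihp
    obtain ⟨L, hL⟩ := ihq
    refine ⟨K + L, fun R b t r hR c c' T h cfg hs => ?_⟩
    cases h with
    | seq hp hq =>
    rename_i c1 t1 t2
    obtain ⟨cfg1, T1, e1, s1, f1, l1⟩ := hK R b t r (le_trans (le_max_left _ _) hR) _ _ _ hp cfg hs
    obtain ⟨cfg2, T2, e2, s2, f2, l2⟩ := hL R b t r (le_trans (le_max_right _ _) hR) _ _ _ hq cfg1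
      ⟨s1.reg, s1.mem, s1.base, s1.cnt⟩
    refine ⟨cfg2, T1 + T2, .seq e1 e2, s2, f1.trans f2, ?_⟩
    calc T1 + T2 ≤ K * ((bits b + bits t) * t1) + L * ((bits b + bits t) * t2) := by omega
      _ ≤ K * ((bits b + bits t) * (t1 + t2)) + L * ((bits b + bits t) * (t1 + t2)) := by
        gcongr <;> omega
      _ = _ := by ring
  | ite e p q ihp ihq =>
    obtain ⟨N, hN⟩ := trExpr_spec e
    obtain ⟨K, hK⟩ := ihp
    obtain ⟨L, hL⟩ := ihq
    refine ⟨N + K + L + 1, fun R b t r hR c c' T h cfg hs => ?_⟩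
    have hRe : exprRegs e ≤ R := le_trans (le_max_left _ _) hR
    have hRp : progRegs p ≤ R := le_trans (le_trans (le_max_left _ _) (le_max_right _ _)) hR
    have hRq : progRegs q ≤ R := le_trans (le_trans (le_max_right _ _) (le_max_right _ _)) hR
    obtain ⟨he1, he2⟩ := hN R b t c cfg hRe hs
    have hb := one_le_bits b
    cases h with
    | ite_true hne hp =>
      rename_i t1
      obtain ⟨cfg1, T1, e1, s1, f1, l1⟩ := hK R b t r hRp _ _ _ hp cfg hs
      refine ⟨cfg1, _, .ite_true (by rwa [he1]) e1, s1, f1, ?_⟩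
      set w := bits b + bits t
      calc (trExpr e).cost cfg + 1 + T1 ≤ N * (w * e.cost c) + w * 1 + K * (w * t1) := by omega
        _ ≤ N * (w * (e.cost c + 1 + t1)) + w * (e.cost c + 1 + t1) +
            K * (w * (e.cost c + 1 + t1)) + L * (w * (e.cost c + 1 + t1)) :=
          le_trans (by gcongr <;> omega) (Nat.le_add_right _ _)
        _ = _ := by ring
    | ite_false hne hp =>
      rename_i t1
      obtain ⟨cfg1, T1, e1, s1, f1, l1⟩ := hL R b t r hRq _ _ _ hp cfg hs
      refine ⟨cfg1, _, .ite_false (by rwa [he1]) e1, s1, f1, ?_⟩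
      set w := bits b + bits t
      calc (trExpr e).cost cfg + 1 + T1 ≤ N * (w * e.cost c) + w * 1 + L * (w * t1) := by omega
        _ ≤ N * (w * (e.cost c + 1 + t1)) + w * (e.cost c + 1 + t1) +
            L * (w * (e.cost c + 1 + t1)) + K * (w * (e.cost c + 1 + t1)) :=
          le_trans (by gcongr <;> omega) (Nat.le_add_right _ _)
        _ = _ := by ring
  | _ e p ih =>
    obtain ⟨N, hN⟩ := trExpr_spec e
    obtain ⟨K, hK⟩ := ih
    refine ⟨N + K + 1, fun R b t r hR c c' T h => ?_⟩
    have hRe : exprRegs e ≤ R := le_trans (le_max_left _ _) hR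
    have hRp : progRegs p ≤ R := le_trans (le_max_right _ _) hR
    have hb := one_le_bits b
    set w := bits b + bits t with hw
    -- Within the induction on programs, loops need an induction on the execution. Abstracting the
    -- program makes it possible, and `hq` discards the rules for the other constructs.
    generalize hq : Prog.while e p = q at h
    induction h with
    | while_true hne hp hrest _ ih2 =>
      rename_i c0 c1 c2 t1 t2 _
      cases hq
      intro cfg hs
      obtain ⟨he1, he2⟩ := hN R b t _ cfg hRe hs
      obtain ⟨cfg1, T1, e1, s1, f1, l1⟩ := hK R b t r hRp _ _ _ hp cfg hs
      obtain ⟨cfg2, T2, e2, s2, f2, l2⟩ := ih2 rfl cfg1 ⟨s1.reg, s1.mem, s1.base, s1.cnt⟩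
      refine ⟨cfg2, _, .while_true (by rwa [he1]) e1 e2, s2, f1.trans f2, ?_⟩
      rw [← hw] at he2 l1
      calc (trExpr e).cost cfg + 1 + T1 + T2
          ≤ N * (w * e.cost c0) + w * 1 + K * (w * t1) + (N + K + 1) * (w * t2) := by omega
        _ ≤ N * (w * (e.cost c0 + 1 + t1)) + w * (e.cost c0 + 1 + t1) +
            K * (w * (e.cost c0 + 1 + t1)) + (N + K + 1) * (w * t2) := by gcongr <;> omega
        _ = _ := by ring
    | while_false hne =>
      cases hq
      intro cfg hs
      obtain ⟨he1, he2⟩ := hN R b t _ cfg hRe hs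
      refine ⟨cfg, _, .while_false (by rwa [he1]), ⟨hs.reg, hs.mem, hs.base, hs.cnt⟩,
        .refl _ _ _, ?_⟩
      rw [← hw] at he2
      rename_i c0
      calc (trExpr e).cost cfg + 1 ≤ N * (w * e.cost c0) + w * 1 := by omega
        _ ≤ N * (w * (e.cost c0 + 1)) + w * (e.cost c0 + 1) + K * (w * (e.cost c0 + 1)) :=
          le_trans (by gcongr <;> omega) (Nat.le_add_right _ _)
        _ = _ := by ring
    | _ => cases hq

/-! ## A structured language with two-dimensional arrays and bounded loops -/

inductive E
  | const (k : ℕ)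
  | var (x : ℕ)
  | arr (k : ℕ) (i j : E)
  | inp (i : E)
  | op (o : Op) (a b : E)

/-- The state: variables, arrays, the read-only input (of length `base`), the number of matrix
products and of coin flips so far. -/
structure St where
  var : ℕ → ℕ
  arr : ℕ → ℕ → ℕ → ℕ
  inp : ℕ → ℕ
  base : ℕ
  mmc : ℕ
  coins : ℕ

def E.eval (s : St) : E → ℕ
  | .const k => k
  | .var x => s.var x
  | .arr k i j => s.arr k (i.eval s) (j.eval s)
  | .inp i => if i.eval s < s.base then s.inp (i.eval s) else 0
  | .op o a b => o.eval (a.eval s) (b.eval s)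

/-- A constant by which the value of an expression can exceed all numbers in the state, for
expressions that grow the numbers slowly. -/
def E.slack : E → Option ℕ
  | .const k => some k
  | .var _ => some 0
  | .arr _ _ _ => some 0
  | .inp _ => some 0
  | .op .sub a _ => a.slack
  | .op .div a _ => a.slack
  | .op .add a (.const k) => a.slack.map (· + k)
  | .op _ _ _ => none

/-- The price of assigning the value of `e`: it pays for the growth of the numbers. -/
def E.price (s : St) (e : E) : ℕ := if e.slack.isSome then 1 else 1 + e.eval s

inductive Cmd
  | skip
  | set (x : ℕ) (e : E)
  | put (k : ℕ) (i j e : E)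
  | flip (x : ℕ)
  | seq (p q : Cmd)
  | ite (e : E) (p q : Cmd)
  | loop (e c : E) (p : Cmd)
  | mm (g A B C : ℕ)

def St.setVar (s : St) (x v : ℕ) : St := { s with var := Function.update s.var x v }

def St.setArr (s : St) (k i j v : ℕ) : St :=
  { s with arr := fun k' i' j' => if k' = k ∧ i' = i ∧ j' = j then v else s.arr k' i' j' }

/-- `0` for `0` and `1` for the other numbers. -/
def bool01 (x : ℕ) : ℕ := 1 - (1 - x)

/-- The product of the supports of two arrays, as `g × g` matrices. -/
def prodEntry (s : St) (g A B i j : ℕ) : ℕ :=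
  ∑ k ∈ range g, bool01 (s.arr A i k) * bool01 (s.arr B k j)

def St.mmStep (s : St) (g A B C : ℕ) : St :=
  { s with
    arr := fun k i j => if k = C ∧ i < g ∧ j < g then prodEntry s g A B i j else s.arr k i j
    mmc := s.mmc + 1 }

/-- Iterate `f` at most `n` times, as long as `c` is nonzero. -/
def iter (c : St → ℕ) (f : St → St) : ℕ → St → St
  | 0, s => s
  | n + 1, s => if c s = 0 then s else iter c f n (f s)

def iterCost (c : St → ℕ) (f : St → St) (k : St → ℕ) : ℕ → St → ℕ
  | 0, _ => 1
  | n + 1, s => if c s = 0 then 1 else 1 + k s + iterCost c f k n (f s)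

def run (r : ℕ → Bool) : Cmd → St → St
  | .skip, s => s
  | .set x e, s => s.setVar x (e.eval s)
  | .put k i j e, s => s.setArr k (i.eval s) (j.eval s) (e.eval s)
  | .flip x, s => { s.setVar x (r s.coins).toNat with coins := s.coins + 1 }
  | .seq p q, s => run r q (run r p s)
  | .ite e p q, s => if e.eval s = 0 then run r q s else run r p s
  | .loop e c p, s => iter (fun s => c.eval s) (run r p) (e.eval s) s
  | .mm g A B C, s => s.mmStep (s.var g) A B C

/-- The cost, where `τ g` is the cost of a product of two `g × g` matrices. -/
def cost (τ : ℕ → ℕ) (r : ℕ → Bool) : Cmd → St → ℕ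
  | .skip, _ => 1
  | .set _ e, s => e.price s
  | .put _ _ _ e, s => e.price s
  | .flip _, _ => 1
  | .seq p q, s => cost τ r p s + cost τ r q (run r p s)
  | .ite e p q, s => 1 + if e.eval s = 0 then cost τ r q s else cost τ r p s
  | .loop e c p, s => 1 + iterCost (fun s => c.eval s) (run r p) (cost τ r p) (e.eval s) s
  | .mm g _ _ _, s => 1 + s.var g * s.var g + τ (s.var g)

/-- All numbers in the state are at most `U`. -/
structure St.Bdd (s : St) (U : ℕ) : Prop where
  var : ∀ x, s.var x ≤ U
  arr : ∀ k i j, s.arr k i j ≤ U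
  inp : ∀ i < s.base, s.inp i ≤ U
  base : s.base ≤ U
  mmc : s.mmc ≤ U

theorem St.Bdd.mono {s : St} {U V : ℕ} (h : s.Bdd U) (hUV : U ≤ V) : s.Bdd V :=
  ⟨fun x => (h.var x).trans hUV, fun k i j => (h.arr k i j).trans hUV,
    fun i hi => (h.inp i hi).trans hUV, h.base.trans hUV, h.mmc.trans hUV⟩

theorem E.eval_le_of_slack {s : St} {U : ℕ} (h : s.Bdd U) (e : E) :
    ∀ k, e.slack = some k → e.eval s ≤ U + k := by
  induction e with
  | const k' => intro k hk; simp only [E.slack, Option.some.injEq] at hk; simp [E.eval, hk]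
  | var x => intro k hk; exact (h.var x).trans (Nat.le_add_right _ _)
  | arr k' i j => intro k hk; exact (h.arr _ _ _).trans (Nat.le_add_right _ _)
  | inp i =>
    intro k hk
    simp only [E.eval]
    split_ifs with hi
    · exact (h.inp _ hi).trans (Nat.le_add_right _ _)
    · omega
  | op o a b iha ihb =>
    intro k hk
    cases o with
    | sub => exact (Nat.sub_le _ _).trans (iha k (by simpa [E.slack] using hk))
    | div => exact (Nat.div_le_self _ _).trans (iha k (by simpa [E.slack] using hk))
    | mul => simp [E.slack] at hk
    | add =>
      cases b with
      | const k' =>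
        simp only [E.slack, Option.map_eq_some_iff] at hk
        obtain ⟨l, hl, rfl⟩ := hk
        have := iha l hl
        simp only [E.eval, Op.eval]
        omega
      | _ => simp [E.slack] at hk

theorem E.eval_le_of_price {s : St} {U : ℕ} (h : s.Bdd U) (e : E) :
    e.eval s ≤ U + (e.slack.getD 0 + 1) * e.price s := by
  unfold E.price
  cases hk : e.slack with
  | none => simp; omega
  | some k => have := E.eval_le_of_slack h e k hk; simp; omega

theorem E.one_le_price (s : St) (e : E) : 1 ≤ e.price s := by
  unfold E.price; split_ifs <;> omega

/-! ## Compilation -/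

def cE : E → Expr
  | .const k => .const k
  | .var x => .reg (3 * x)
  | .arr k i j => .load (eArrAddr k (cE i) (cE j))
  | .inp i =>
    -- `t` is 1 for indices below the base and 0 otherwise. The factor in the address redirects a
    -- bad read to cell 0, whose content is bounded, and the factor outside turns its value into 0.
    let t := esub (.const 1) (esub (eadd (cE i) (.const 1)) (.reg 1))
    emul (.load (emul (cE i) t)) t
  | .op o a b => .op o (cE a) (cE b)

/-- `pos` makes cell 0 an input cell, which the guarded reads fall back on. -/
structure RelCore (s : St) (cfg : Config) : Prop where
  var : ∀ x, cfg.reg (3 * x) = s.var x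
  base : cfg.reg 1 = s.base
  pos : 0 < s.base
  mmc : cfg.reg 4 = s.mmc
  inp : ∀ i < s.base, cfg.mem i = s.inp i
  arr : ∀ k i j, cfg.mem (arrAddr s.base k i j) = s.arr k i j
  coins : cfg.coins = s.coins

/-- The copies for future products must be zero, because the multiplication program expects zeros
outside its input. During a product this fails for the current copy, hence the separate `RelCore`.
-/
structure Rel (s : St) (cfg : Config) : Prop extends RelCore s cfg where
  fresh : ∀ t a, s.mmc ≤ t → cfg.mem (mmAddr s.base t a) = 0

theorem cE_spec (e : E) : ∃ K, ∀ s cfg U, St.Bdd s U → RelCore s cfg →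
    (cE e).eval cfg = e.eval s ∧ Small cfg (bits U) K (cE e) := by
  induction e with
  | const k => exact ⟨bits k, fun s cfg U _ _ => ⟨rfl, small_const k (one_le_bits U)⟩⟩
  | var x =>
    exact ⟨1, fun s cfg U hU h => ⟨h.var x, small_reg (by rw [h.var]; exact bits_mono (hU.var x))⟩⟩
  | arr k i j ihi ihj =>
    obtain ⟨K, hK⟩ := ihi
    obtain ⟨L, hL⟩ := ihj
    obtain ⟨M, hM⟩ := small_eArrAddr k K L
    refine ⟨2 * M + 1, fun s cfg U hU h => ?_⟩
    obtain ⟨h1, h2⟩ := hK s cfg U hU h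
    obtain ⟨h3, h4⟩ := hL s cfg U hU h
    have hv : cfg.mem ((eArrAddr k (cE i) (cE j)).eval cfg) = s.arr k (i.eval s) (j.eval s) := by
      rw [eval_eArrAddr, h.base, h.arr, h1, h3]
    refine ⟨hv, small_load (hM cfg _ _ _ (one_le_bits U) ?_ h2 h4) ?_⟩
    · rw [h.base]; exact bits_mono hU.base
    · rw [hv]; exact bits_mono (hU.arr _ _ _)
  | inp i ih =>
    obtain ⟨K, hK⟩ := ih
    refine ⟨2 * (2 * (2 * (K + 2 * (bits 1 + 2 * (2 * (K + bits 1) + 1)))) + 1 +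
      2 * (bits 1 + 2 * (2 * (K + bits 1) + 1))), fun s cfg U hU h => ?_⟩
    · obtain ⟨h1, h2⟩ := hK s cfg U hU h
      have hb : bits (cfg.reg 1) ≤ bits U := by rw [h.base]; exact bits_mono hU.base
      have hm : cfg.mem ((emul (cE i) (esub (.const 1) (esub (eadd (cE i) (.const 1))
          (.reg 1)))).eval cfg) ≤ U := by
        simp only [eval_emul, eval_esub, eval_eadd, eval_const, eval_reg, h1, h.base]
        by_cases hi : i.eval s < s.base
        · have : i.eval s + 1 - s.base = 0 := by omega
          rw [this, Nat.sub_zero, mul_one, h.inp _ hi]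
          exact hU.inp _ hi
        · have : 1 - (i.eval s + 1 - s.base) = 0 := by omega
          rw [this, mul_zero, h.inp _ h.pos]
          exact hU.inp _ h.pos
      refine ⟨?_, small_op .mul (small_load (small_op .mul h2 (small_op .sub
        (small_const 1 (one_le_bits U)) (small_op .sub (small_op .add h2
        (small_const 1 (one_le_bits U))) (small_reg hb)))) (bits_mono hm)) (small_op .sub
        (small_const 1 (one_le_bits U)) (small_op .sub (small_op .add h2
        (small_const 1 (one_le_bits U))) (small_reg hb)))⟩
      simp only [cE, E.eval, eval_emul, eval_esub, eval_eadd, eval_const, eval_reg, eval_load, h1,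
        h.base]
      by_cases hi : i.eval s < s.base
      · have : i.eval s + 1 - s.base = 0 := by omega
        rw [this, Nat.sub_zero, mul_one, mul_one, h.inp _ hi, if_pos hi]
      · have : 1 - (i.eval s + 1 - s.base) = 0 := by omega
        rw [this, mul_zero, if_neg hi]
  | op o a b iha ihb =>
    obtain ⟨K, hK⟩ := iha
    obtain ⟨L, hL⟩ := ihb
    refine ⟨2 * (K + L), fun s cfg U hU h => ?_⟩
    obtain ⟨h1, h2⟩ := hK s cfg U hU h
    obtain ⟨h3, h4⟩ := hL s cfg U hU h
    exact ⟨by simp only [cE, Expr.eval, E.eval, h1, h3], small_op o h2 h4⟩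

/-- A counting loop of the machine. -/
theorem exec_count {r : ℕ → Bool} {e : Expr} {p : Prog} {N κ : ℕ} (I : ℕ → Config → Prop)
    (he : ∀ i c, i ≤ N → I i c → e.eval c = N - i ∧ e.cost c ≤ κ)
    (hp : ∀ i c, i < N → I i c → ∃ c' t, Exec r p c c' t ∧ I (i + 1) c' ∧ t ≤ κ) {c : Config}
    (h0 : I 0 c) : ∃ c' t, Exec r (.while e p) c c' t ∧ I N c' ∧ t ≤ (N + 1) * (2 * κ + 1) := by
  suffices H : ∀ k i c, i + k = N → I i c →
      ∃ c' t, Exec r (.while e p) c c' t ∧ I N c' ∧ t ≤ (k + 1) * (2 * κ + 1) from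
    H N 0 c (by omega) h0
  intro k
  induction k with
  | zero =>
    intro i c hi hc
    obtain rfl : i = N := by omega
    obtain ⟨h1, h2⟩ := he i c le_rfl hc
    exact ⟨c, _, .while_false (by omega), hc, by omega⟩
  | succ k ih =>
    intro i c hi hc
    obtain ⟨h1, h2⟩ := he i c (by omega) hc
    obtain ⟨c1, t1, e1, hc1, l1⟩ := hp i c (by omega) hc
    obtain ⟨c2, t2, e2, hc2, l2⟩ := ih (i + 1) c1 (by omega) hc1
    refine ⟨c2, _, .while_true (by omega) e1 e2, hc2, ?_⟩
    calc e.cost c + 1 + t1 + t2 ≤ κ + 1 + κ + (k + 1) * (2 * κ + 1) := by omega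
      _ = _ := by ring

/-! ## Compilation of the matrix product -/

def zeroRegs : ℕ → Prog
  | 0 => .skip
  | R + 1 => .seq (zeroRegs R) (.assign (3 * R + 2) (.const 0))

theorem zeroRegs_spec (r : ℕ → Bool) (R : ℕ) (cfg : Config) : ∃ cfg' t,
    Exec r (zeroRegs R) cfg cfg' t ∧ t ≤ 2 * R + 1 ∧ (∀ x < R, cfg'.reg (3 * x + 2) = 0) ∧ (∀ x, x % 3 ≠ 2 → cfg'.reg x = cfg.reg x) ∧
    cfg'.mem = cfg.mem ∧ cfg'.coins = cfg.coins := by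
  induction R with
  | zero => exact ⟨cfg, 1, .skip _, by simp, by simp, by simp, rfl, rfl⟩
  | succ R ih =>
    obtain ⟨c, t, h1, ht, h2, h3, h4, h5⟩ := ih
    refine ⟨_, _, .seq h1 (.assign _ _ _), ?_, ?_, ?_, h4, h5⟩
    · simp only [Expr.cost, Expr.eval, bits, Nat.size_zero]; omega
    · intro x hx
      simp only [Function.update_apply, Expr.eval]
      split_ifs with h
      · rfl
      · exact h2 x (by omega)
    · intro x hx
      simp only [Function.update_apply]
      rw [if_neg (by omega), h3 x hx]

def eBool (e : Expr) : Expr := esub (.const 1) (esub (.const 1) e)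

/-- The array entry at row `i / g` and column `i % g` for the counter `i` in register 7. -/
def eEntry (g A : ℕ) : Expr :=
  eArrAddr A (ediv (.reg 7) (.reg (3 * g)))
    (esub (.reg 7) (emul (ediv (.reg 7) (.reg (3 * g))) (.reg (3 * g))))

def incr7 : Prog := .assign 7 (eadd (.reg 7) (.const 1))

def e7 (g : ℕ) : Expr := esub (emul (.reg (3 * g)) (.reg (3 * g))) (.reg 7)

def copyIn (g A B : ℕ) : Prog :=
  .seq (.assign 7 (.const 0)) (.while (e7 g)
    (.seq (.store (eMMAddr (.reg 7)) (eBool (.load (eEntry g A))))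
    (.seq (.store (eMMAddr (eadd (emul (.reg (3 * g)) (.reg (3 * g))) (.reg 7)))
      (eBool (.load (eEntry g B)))) incr7)))

def copyOut (g C : ℕ) : Prog :=
  .seq (.assign 7 (.const 0)) (.while (e7 g)
    (.seq (.store (eEntry g C) (.load (eMMAddr (eadd (emul (.const 2)
      (emul (.reg (3 * g)) (.reg (3 * g)))) (.reg 7))))) incr7))

def mmProg (M : Prog) (g A B C : ℕ) : Prog :=
  .seq (.ite (.reg (3 * g)) (.seq (zeroRegs (progRegs M)) (.seq (.assign 2 (.reg (3 * g)))
    (.seq (copyIn g A B) (.seq (trProg M) (copyOut g C))))) .skip)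
    (.assign 4 (eadd (.reg 4) (.const 1)))

/-- The registers of the multiplication program, register 7 and the private memories are scratch
space. -/
theorem RelCore.congr {s : St} {c c' : Config} (h : RelCore s c) (hr : ∀ x, x % 3 ≠ 2 → x ≠ 7 →
    c'.reg x = c.reg x) (hm : ∀ a, (∀ t a', a ≠ mmAddr s.base t a') → c'.mem a = c.mem a)
    (hc : c'.coins = c.coins) : RelCore s c' := by
  refine ⟨fun x => ?_, ?_, h.pos, ?_, fun i hi => ?_, fun k i j => ?_, hc.trans h.coins⟩
  · rw [hr _ (by omega) (by omega), h.var]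
  · rw [hr _ (by omega) (by omega), h.base]
  · rw [hr _ (by omega) (by omega), h.mmc]
  · rw [hm _ fun t a' => ?_, h.inp i hi]
    have := le_mmAddr s.base t a'
    omega
  · rw [hm _ fun t a' => arrAddr_ne_mmAddr _ _ _ _ _ _, h.arr]

theorem small_entry (g A : ℕ) : ∃ K, ∀ s cfg U, St.Bdd s U → RelCore s cfg → cfg.reg 7 ≤ U →
    (eEntry g A).eval cfg = arrAddr s.base A (cfg.reg 7 / s.var g) (cfg.reg 7 % s.var g) ∧
    Small cfg (bits U) K (eEntry g A) := by
  obtain ⟨K, hK⟩ := small_eArrAddr A 4 22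
  refine ⟨K, fun s cfg U hU h h7 => ⟨?_, ?_⟩⟩
  · simp only [eEntry, eval_eArrAddr, eval_ediv, eval_esub, eval_emul, eval_reg, h.base, h.var]
    congr 1
    rw [Nat.mod_def, mul_comm]
  · have h1 : Small cfg (bits U) 1 (.reg 7) := small_reg (bits_mono h7)
    have h2 : Small cfg (bits U) 1 (.reg (3 * g)) :=
      small_reg (by rw [h.var]; exact bits_mono (hU.var g))
    have h3 : Small cfg (bits U) 4 (ediv (.reg 7) (.reg (3 * g))) := small_op _ h1 h2
    have h4 : Small cfg (bits U) 10 (emul (ediv (.reg 7) (.reg (3 * g))) (.reg (3 * g))) :=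
      small_op _ h3 h2
    have h5 : Small cfg (bits U) 22 (esub (.reg 7) (emul (ediv (.reg 7) (.reg (3 * g)))
        (.reg (3 * g)))) := small_op _ h1 h4
    exact hK cfg _ _ _ (one_le_bits U) (by rw [h.base]; exact bits_mono hU.base) h3 h5

theorem small_bool {cfg : Config} {β K : ℕ} {e : Expr} (hβ : 1 ≤ β) (h : Small cfg β K e) :
    Small cfg β (2 * (bits 1 + 2 * (bits 1 + K))) (eBool e) :=
  small_op _ (small_const 1 hβ) (small_op _ (small_const 1 hβ) h)

def storeAt (c : Config) (a v : ℕ) : Config := { c with mem := Function.update c.mem a v }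

def assignAt (c : Config) (x v : ℕ) : Config := { c with reg := Function.update c.reg x v }

theorem exec_store {r : ℕ → Bool} {a e : Expr} {c : Config} {A v β K L : ℕ}
    (ha : a.eval c = A) (he : e.eval c = v) (sa : Small c β K a) (se : Small c β L e) :
    ∃ t, Exec r (.store a e) c (storeAt c A v) t ∧ t ≤ 2 * (K + L) * β := by
  subst ha he
  refine ⟨_, .store a e c, ?_⟩
  obtain ⟨h1, h2⟩ := sa
  obtain ⟨h3, h4⟩ := se
  nlinarith

theorem exec_assign {r : ℕ → Bool} {x : ℕ} {e : Expr} {c : Config} {v β L : ℕ}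
    (he : e.eval c = v) (se : Small c β L e) :
    ∃ t, Exec r (.assign x e) c (assignAt c x v) t ∧ t ≤ 2 * L * β := by
  subst he
  refine ⟨_, .assign x e c, ?_⟩
  obtain ⟨h3, h4⟩ := se
  nlinarith

theorem copyIn_spec (g A B : ℕ) : ∃ K, ∀ r s cfg V, St.Bdd s V → s.var g * s.var g ≤ V →
    RelCore s cfg → (∀ a, cfg.mem (mmAddr s.base s.mmc a) = 0) →
    ∃ cfg' t, Exec r (copyIn g A B) cfg cfg' t ∧ (∀ x ≠ 7, cfg'.reg x = cfg.reg x) ∧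
      (∀ a, (∀ a', a ≠ mmAddr s.base s.mmc a') → cfg'.mem a = cfg.mem a) ∧
      cfg'.coins = cfg.coins ∧
      (∀ a, cfg'.mem (mmAddr s.base s.mmc a) =
        if a < s.var g * s.var g then bool01 (s.arr A (a / s.var g) (a % s.var g)) else
        if a - s.var g * s.var g < s.var g * s.var g then
          bool01 (s.arr B ((a - s.var g * s.var g) / s.var g) ((a - s.var g * s.var g) % s.var g))
        else 0) ∧ t ≤ K * ((s.var g * s.var g + 1) * bits V) := by
  obtain ⟨KA, hKA⟩ := small_entry g A
  obtain ⟨KB, hKB⟩ := small_entry g B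
  obtain ⟨KC, hKC⟩ := small_eMMAddr 1
  obtain ⟨KD, hKD⟩ := small_eMMAddr (2 * (2 * (1 + 1) + 1))
  set LA := 2 * (bits 1 + 2 * (bits 1 + (2 * KA + 1))) with hLA
  set LB := 2 * (bits 1 + 2 * (bits 1 + (2 * KB + 1))) with hLB
  set K := 2 * (KC + LA) + 2 * (KD + LB) + (2 * (2 * (1 + bits 1))) + (2 * (2 * (1 + 1) + 1))
    with hK
  refine ⟨2 * K + 3, fun r s cfg V hV hg h h0 => ?_⟩
  set G := s.var g with hG
  have hbV := one_le_bits V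
  -- After `i` rounds the first `i` entries of both matrices are in place and the other cells are
  -- still 0. The copy was zero at the start, so nothing has to be erased.
  let I : ℕ → Config → Prop := fun i c => c.reg 7 = i ∧ (∀ x ≠ 7, c.reg x = cfg.reg x) ∧
      (∀ a, (∀ a', a ≠ mmAddr s.base s.mmc a') → c.mem a = cfg.mem a) ∧ c.coins = cfg.coins ∧
      ∀ a, c.mem (mmAddr s.base s.mmc a) =
        if a < G * G then (if a < i then bool01 (s.arr A (a / G) (a % G)) else 0) else
        if a - G * G < i then bool01 (s.arr B ((a - G * G) / G) ((a - G * G) % G)) else 0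
  have hcore : ∀ i c, I i c → RelCore s c := fun i c hI =>
    h.congr (fun x _ hx => hI.2.1 x hx) (fun a ha => hI.2.2.1 a (ha _)) hI.2.2.2.1
  have hs7 : ∀ i c, i ≤ G * G → I i c → Small c (bits V) 1 (.reg 7) := fun i c hi hI =>
    small_reg (bits_mono (by rw [hI.1]; omega))
  have hsg : ∀ i c, I i c → Small c (bits V) 1 (.reg (3 * g)) := fun i c hI =>
    small_reg (bits_mono (by rw [(hcore i c hI).var]; exact hV.var g))
  have hb1 : ∀ i c, I i c → bits (c.reg 1) ≤ bits V := fun i c hI =>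
    bits_mono (by rw [(hcore i c hI).base]; exact hV.base)
  have hb4 : ∀ i c, I i c → bits (c.reg 4) ≤ bits V := fun i c hI =>
    bits_mono (by rw [(hcore i c hI).mmc]; exact hV.mmc)
  have hstart : I 0 { cfg with reg := Function.update cfg.reg 7 0 } := by
    refine ⟨by simp, fun x hx => by simp [hx], fun a _ => rfl, rfl, fun a => ?_⟩
    simp [h0]
  obtain ⟨c', t, he, hI, ht⟩ := exec_count (r := r) (e := e7 g) (p := _) (N := G * G)
    (κ := K * bits V) I
    (fun i c hi hI => ⟨by
      simp only [e7, eval_esub, eval_emul, eval_reg, (hcore i c hI).var, hI.1, hG],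
      (small_op .sub (small_op .mul (hsg i c hI) (hsg i c hI)) (hs7 i c hi hI)).2.trans
        (Nat.mul_le_mul (by omega) le_rfl)⟩)
    (by
      intro i c hi hI
      have hc := hcore i c hI
      obtain ⟨ea, sa⟩ := hKA s c V hV hc (by rw [hI.1]; omega)
      have la : Small c (bits V) (2 * KA + 1) (.load (eEntry g A)) :=
        small_load sa (by rw [ea, hc.arr]; exact bits_mono (hV.arr _ _ _))
      have va : (Expr.load (eEntry g A)).eval c = s.arr A (i / G) (i % G) := by
        rw [eval_load, ea, hc.arr, hI.1]
      have ba := small_bool hbV la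
      have m1 := hKC c _ _ hbV (hb1 i c hI) (hb4 i c hI) (hs7 i c hi.le hI)
      have v1 : (eMMAddr (.reg 7)).eval c = mmAddr s.base s.mmc i := by
        rw [eval_eMMAddr, hc.base, hc.mmc, eval_reg, hI.1]
      set c1 : Config := storeAt c (mmAddr s.base s.mmc i) (bool01 (s.arr A (i / G) (i % G)))
        with hc1
      obtain ⟨t1, x1, l1⟩ := exec_store (r := r) v1
        (show _ = bool01 (s.arr A (i / G) (i % G)) by
          simp only [eBool, eval_esub, eval_const, va, bool01]) m1 ba
      have hc1' : RelCore s c1 := hc.congr (fun x _ _ => rfl) (fun a ha => by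
        simp only [hc1, storeAt, Function.update_apply]; rw [if_neg (ha _ _)]) rfl
      obtain ⟨eb, sb⟩ := hKB s c1 V hV hc1' (by show c.reg 7 ≤ V; rw [hI.1]; omega)
      have lb : Small c1 (bits V) (2 * KB + 1) (.load (eEntry g B)) :=
        small_load sb (by rw [eb, hc1'.arr]; exact bits_mono (hV.arr _ _ _))
      have vb : (Expr.load (eEntry g B)).eval c1 = s.arr B (i / G) (i % G) := by
        rw [eval_load, eb, hc1'.arr]; show s.arr B (c.reg 7 / G) (c.reg 7 % G) = _; rw [hI.1]
      have bb := small_bool hbV lb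
      have s7 : Small c1 (bits V) 1 (.reg 7) := hs7 i c hi.le hI
      have sg : Small c1 (bits V) 1 (.reg (3 * g)) := hsg i c hI
      have m2 := hKD c1 _ _ hbV (hb1 i c hI) (hb4 i c hI)
        (small_op .add (small_op .mul sg sg) s7)
      have v2 : (eMMAddr (eadd (emul (.reg (3 * g)) (.reg (3 * g))) (.reg 7))).eval c1 =
          mmAddr s.base s.mmc (G * G + i) := by
        rw [eval_eMMAddr, hc1'.base, hc1'.mmc]
        simp only [eval_eadd, eval_emul, eval_reg, hc1'.var]
        rw [show c1.reg 7 = i from hI.1]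
      set c2 : Config := storeAt c1 (mmAddr s.base s.mmc (G * G + i))
        (bool01 (s.arr B (i / G) (i % G))) with hc2
      obtain ⟨t2, x2, l2⟩ := exec_store (r := r) v2
        (show _ = bool01 (s.arr B (i / G) (i % G)) by
          simp only [eBool, eval_esub, eval_const, vb, bool01]) m2 bb
      have s7' : Small c2 (bits V) 1 (.reg 7) := s7
      obtain ⟨t3, x3, l3⟩ := exec_assign (r := r) (x := 7) (v := i + 1) (by
        show c2.reg 7 + 1 = i + 1
        rw [show c2.reg 7 = i from hI.1])
        (small_op .add s7' (small_const 1 hbV))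
      refine ⟨_, _, .seq x1 (.seq x2 x3), ⟨?_, ?_, ?_, hI.2.2.2.1, ?_⟩, ?_⟩
      · simp only [assignAt, Function.update_self]
      · intro x hx
        simp only [assignAt, Function.update_of_ne hx]
        exact hI.2.1 x hx
      · intro a ha
        show Function.update (Function.update c.mem _ _) _ _ a = _
        rw [Function.update_of_ne (ha _), Function.update_of_ne (ha _), hI.2.2.1 a ha]
      · intro a
        show Function.update (Function.update c.mem _ _) _ _ _ = _
        simp only [Function.update_apply]
        have e1 : ∀ b b', mmAddr s.base s.mmc b = mmAddr s.base s.mmc b' ↔ b = b' := fun b b' =>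
          ⟨fun h => (mmAddr_inj h).2, fun h => by rw [h]⟩
        simp only [e1]
        by_cases q1 : a = G * G + i
        · subst q1
          rw [if_pos rfl, if_neg (by omega), if_pos (by omega), Nat.add_sub_cancel_left]
        · rw [if_neg q1]
          by_cases q2 : a = i
          · subst q2
            rw [if_pos rfl, if_pos hi, if_pos (by omega)]
          · rw [if_neg q2, hI.2.2.2.2 a]
            by_cases q3 : a < G * G
            · rw [if_pos q3, if_pos q3]
              by_cases q4 : a < i
              · rw [if_pos q4, if_pos (by omega)]
              · rw [if_neg q4, if_neg (by omega)]
            · rw [if_neg q3, if_neg q3]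
              by_cases q4 : a - G * G < i
              · rw [if_pos q4, if_pos (by omega)]
              · rw [if_neg q4, if_neg (by omega)]
      · rw [← hLA] at l1
        rw [← hLB] at l2
        have : K * bits V = 2 * (KC + LA) * bits V + 2 * (KD + LB) * bits V +
          2 * (2 * (1 + bits 1)) * bits V + (2 * (2 * (1 + 1) + 1)) * bits V := by rw [hK]; ring
        omega) hstart
  refine ⟨c', _, .seq (.assign _ _ _) he, hI.2.1, hI.2.2.1, hI.2.2.2.1, fun a => ?_, ?_⟩
  · rw [hI.2.2.2.2 a]
    by_cases q3 : a < G * G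
    · simp [q3]
    · simp [q3]
  · have : bits 0 = 1 := by simp [bits]
    simp only [Expr.cost, Expr.eval, this]
    have e3 : 1 ≤ (G * G + 1) * bits V := Nat.mul_pos (by omega) (by omega)
    have e4 : G * G + 1 ≤ (G * G + 1) * bits V := Nat.le_mul_of_pos_right _ (by omega)
    calc 1 + 1 + t ≤ 2 * ((G * G + 1) * bits V) + (G * G + 1) * (2 * (K * bits V) + 1) := by omega
      _ = 2 * ((G * G + 1) * bits V) + 2 * K * ((G * G + 1) * bits V) + (G * G + 1) := by ring
      _ ≤ 2 * ((G * G + 1) * bits V) + 2 * K * ((G * G + 1) * bits V) + (G * G + 1) * bits V := by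
        omega
      _ = _ := by ring

/-- Overwrite the top left `G × G` part of an array. -/
def St.over (s : St) (C G : ℕ) (P : ℕ → ℕ → ℕ) (q : ℕ) : St :=
  { s with arr := fun k i j =>
      if k = C ∧ i < G ∧ j < G ∧ i * G + j < q then P i j else s.arr k i j }

theorem copyOut_spec (g C : ℕ) : ∃ K, ∀ r s cfg V P, St.Bdd s V → s.var g * s.var g ≤ V →
    RelCore s cfg → (∀ i < s.var g, ∀ j < s.var g, P i j ≤ V ∧
      cfg.mem (mmAddr s.base s.mmc (2 * (s.var g * s.var g) + (i * s.var g + j))) = P i j) →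
    ∃ cfg' t, Exec r (copyOut g C) cfg cfg' t ∧ (∀ x ≠ 7, cfg'.reg x = cfg.reg x) ∧
      (∀ a, (∀ k i j, a ≠ arrAddr s.base k i j) → cfg'.mem a = cfg.mem a) ∧
      RelCore (s.over C (s.var g) P (s.var g * s.var g)) cfg' ∧
      t ≤ K * ((s.var g * s.var g + 1) * bits V) := by
  obtain ⟨KA, hKA⟩ := small_entry g C
  obtain ⟨KD, hKD⟩ := small_eMMAddr (2 * (2 * (bits 2 + 2 * (1 + 1)) + 1))
  set K := 2 * (KA + (2 * KD + 1)) + (2 * (2 * (1 + bits 1))) + (2 * (2 * (1 + 1) + 1))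
    with hK
  refine ⟨2 * K + 3, fun r s cfg V P hV hg h hP => ?_⟩
  set G := s.var g with hG
  have hbV := one_le_bits V
  let I : ℕ → Config → Prop := fun q c => c.reg 7 = q ∧ (∀ x ≠ 7, c.reg x = cfg.reg x) ∧
      (∀ a, (∀ k i j, a ≠ arrAddr s.base k i j) → c.mem a = cfg.mem a) ∧ c.coins = cfg.coins ∧
      ∀ k i j, c.mem (arrAddr s.base k i j) = (s.over C G P q).arr k i j
  have hcore : ∀ i c, I i c → RelCore (s.over C G P i) c := fun i c hI => by
    refine ⟨fun x => ?_, ?_, h.pos, ?_, fun j hj => ?_, hI.2.2.2.2, hI.2.2.2.1.trans h.coins⟩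
    · rw [hI.2.1 _ (by omega)]; exact h.var x
    · rw [hI.2.1 _ (by omega)]; exact h.base
    · rw [hI.2.1 _ (by omega)]; exact h.mmc
    · rw [hI.2.2.1 _ fun k i' j' => ?_]
      · exact h.inp j hj
      · have h1 := le_arrAddr s.base k i' j'
        have h2 : j < s.base := hj
        omega
  have hB : ∀ q, (s.over C G P q).Bdd V := fun q => by
    refine ⟨hV.var, fun k i j => ?_, hV.inp, hV.base, hV.mmc⟩
    simp only [St.over]
    split_ifs with hc
    · exact (hP i hc.2.1 j hc.2.2.1).1
    · exact hV.arr _ _ _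
  have hs7 : ∀ i c, i ≤ G * G → I i c → Small c (bits V) 1 (.reg 7) := fun i c hi hI =>
    small_reg (bits_mono (by rw [hI.1]; omega))
  have hsg : ∀ i c, I i c → Small c (bits V) 1 (.reg (3 * g)) := fun i c hI =>
    small_reg (bits_mono (by rw [(hcore i c hI).var]; exact hV.var g))
  have hb1 : ∀ i c, I i c → bits (c.reg 1) ≤ bits V := fun i c hI =>
    bits_mono (by rw [(hcore i c hI).base]; exact hV.base)
  have hb4 : ∀ i c, I i c → bits (c.reg 4) ≤ bits V := fun i c hI =>
    bits_mono (by rw [(hcore i c hI).mmc]; exact hV.mmc)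
  have hstart : I 0 { cfg with reg := Function.update cfg.reg 7 0 } := by
    refine ⟨by simp, fun x hx => by simp [hx], fun a _ => rfl, rfl, fun k i j => ?_⟩
    simp [St.over, h.arr]
  obtain ⟨c', t, he, hI, ht⟩ := exec_count (r := r) (e := e7 g) (p := _) (N := G * G)
    (κ := K * bits V) I
    (fun i c hi hI => ⟨by
      simp only [e7, eval_esub, eval_emul, eval_reg, (hcore i c hI).var, hI.1, hG]; rfl,
      (small_op .sub (small_op .mul (hsg i c hI) (hsg i c hI)) (hs7 i c hi hI)).2.trans
        (Nat.mul_le_mul (by omega) le_rfl)⟩)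
    (by
      intro q c hq hI
      have hc := hcore q c hI
      have hGpos : 0 < G := Nat.pos_of_ne_zero fun h0 => by rw [h0] at hq; omega
      have hd : q / G < G := Nat.div_lt_of_lt_mul hq
      have hmod : q % G < G := Nat.mod_lt _ hGpos
      have hdm : q / G * G + q % G = q := Nat.div_add_mod' q G
      obtain ⟨ea, sa⟩ := hKA _ c V (hB q) hc (by rw [hI.1]; omega)
      have ea' : (eEntry g C).eval c = arrAddr s.base C (q / G) (q % G) := by
        rw [ea, hI.1]; rfl
      have m2 := hKD c _ _ hbV (hb1 q c hI) (hb4 q c hI)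
        (small_op .add (small_op .mul (small_const 2 hbV)
          (small_op .mul (hsg q c hI) (hsg q c hI))) (hs7 q c hq.le hI))
      have v2 : (eMMAddr (eadd (emul (.const 2) (emul (.reg (3 * g)) (.reg (3 * g))))
          (.reg 7))).eval c = mmAddr s.base s.mmc (2 * (G * G) + q) := by
        rw [eval_eMMAddr, hc.base, hc.mmc]
        simp only [eval_eadd, eval_emul, eval_reg, eval_const, hc.var]
        rw [show c.reg 7 = q from hI.1]; rfl
      have v3 : (Expr.load (eMMAddr (eadd (emul (.const 2) (emul (.reg (3 * g)) (.reg (3 * g))))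
          (.reg 7)))).eval c = P (q / G) (q % G) := by
        rw [eval_load, v2, hI.2.2.1 _ fun k i j => (arrAddr_ne_mmAddr _ _ _ _ _ _).symm,
          ← (hP _ hd _ hmod).2, hdm]
      obtain ⟨t2, x2, l2⟩ := exec_store (r := r) ea' v3 sa (small_load m2 (by
        rw [show c.mem _ = _ from v3]; exact bits_mono (hP _ hd _ hmod).1))
      set c2 : Config := storeAt c (arrAddr s.base C (q / G) (q % G)) (P (q / G) (q % G)) with hc2
      have s7' : Small c2 (bits V) 1 (.reg 7) := hs7 q c hq.le hI
      obtain ⟨t3, x3, l3⟩ := exec_assign (r := r) (x := 7) (v := q + 1) (by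
        show c2.reg 7 + 1 = q + 1
        rw [show c2.reg 7 = q from hI.1])
        (small_op .add s7' (small_const 1 hbV))
      refine ⟨_, _, .seq x2 x3, ⟨?_, ?_, ?_, hI.2.2.2.1, ?_⟩, ?_⟩
      · simp only [assignAt, Function.update_self]
      · intro x hx
        simp only [assignAt, Function.update_of_ne hx]
        exact hI.2.1 x hx
      · intro a ha
        show Function.update c.mem _ _ a = _
        rw [Function.update_of_ne (ha _ _ _), hI.2.2.1 a ha]
      · intro k i j
        show Function.update c.mem _ _ _ = _
        simp only [Function.update_apply]
        by_cases e1 : arrAddr s.base k i j = arrAddr s.base C (q / G) (q % G)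
        · obtain ⟨rfl, rfl, rfl⟩ := arrAddr_inj e1
          rw [if_pos rfl]
          show _ = if _ ∧ _ ∧ _ ∧ _ then _ else _
          rw [if_pos ⟨rfl, hd, hmod, by omega⟩]
        · rw [if_neg e1, hI.2.2.2.2]
          simp only [St.over]
          congr 1
          apply propext
          constructor
          · rintro ⟨h1, h2, h3, h4⟩
            exact ⟨h1, h2, h3, by omega⟩
          · rintro ⟨h1, h2, h3, h4⟩
            refine ⟨h1, h2, h3, ?_⟩
            by_contra h5
            -- The position in row-major order determines row and column, so only the cell written
            -- in this round can have changed.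
            have h6 : i * G + j = q := by omega
            apply e1
            have h7 : q / G = i := by
              rw [← h6, add_comm, Nat.add_mul_div_right _ _ hGpos, Nat.div_eq_of_lt h3, zero_add]
            have h8 : q % G = j := by
              rw [← h6, add_comm, Nat.add_mul_mod_self_right, Nat.mod_eq_of_lt h3]
            rw [h1, h7, h8]
      · have : K * bits V = 2 * (KA + (2 * KD + 1)) * bits V +
          2 * (2 * (1 + bits 1)) * bits V + (2 * (2 * (1 + 1) + 1)) * bits V := by rw [hK]; ring
        omega) hstart
  refine ⟨c', _, .seq (.assign _ _ _) he, hI.2.1, hI.2.2.1, hcore _ _ hI, ?_⟩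
  have : bits 0 = 1 := by simp [bits]
  simp only [Expr.cost, Expr.eval, this]
  have e3 : 1 ≤ (G * G + 1) * bits V := Nat.mul_pos (by omega) (by omega)
  have e4 : G * G + 1 ≤ (G * G + 1) * bits V := Nat.le_mul_of_pos_right _ (by omega)
  calc 1 + 1 + t ≤ 2 * ((G * G + 1) * bits V) + (G * G + 1) * (2 * (K * bits V) + 1) := by omega
    _ = 2 * ((G * G + 1) * bits V) + 2 * K * ((G * G + 1) * bits V) + (G * G + 1) := by ring
    _ ≤ 2 * ((G * G + 1) * bits V) + 2 * K * ((G * G + 1) * bits V) + (G * G + 1) * bits V := by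
      omega
    _ = _ := by ring

/-- The program `M` multiplies zero-one matrices of size `g ≥ 1`, with all coins zero, in time
`τ g`. -/
def MulsIn (M : Prog) (τ : ℕ → ℕ) : Prop :=
  ∀ g, 1 ≤ g → ∀ A B : Matrix (Fin g) (Fin g) ℕ, (∀ i j, A i j ≤ 1) → (∀ i j, B i j ≤ 1) →
    ∃ (s : Config) (t : ℕ), Exec (fun _ => false) M (matMulInput A B) s t ∧
      (∀ i j : Fin g, s.mem (2 * (g * g) + (i * g + j)) = (A * B) i j) ∧ t ≤ τ g

theorem bool01_le (x : ℕ) : bool01 x ≤ 1 := Nat.sub_le _ _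

theorem prodEntry_le (s : St) (g A B i j : ℕ) : prodEntry s g A B i j ≤ g := by
  calc prodEntry s g A B i j ≤ ∑ k ∈ range g, 1 := Finset.sum_le_sum fun k _ =>
        (Nat.mul_le_mul (bool01_le _) (bool01_le _)).trans (by norm_num)
    _ = g := by simp

/-- Apart from scratch registers, only the product counter in register 4 and the target array
change. Internal registers used here are 1, 4 and 7, so loop counters survive from depth 3 on. The
additive `G * G` in the price pays for copying the matrices in and out. -/
theorem mmProg_spec {M : Prog} {τ : ℕ → ℕ} (hM : MulsIn M τ) (g A B C : ℕ) : ∃ K, ∀ r s cfg U,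
    St.Bdd s U → Rel s cfg →
    ∃ cfg' t, Exec r (mmProg M g A B C) cfg cfg' t ∧ Rel (s.mmStep (s.var g) A B C) cfg' ∧
      (∀ h, 3 ≤ h → cfg'.reg (3 * h + 1) = cfg.reg (3 * h + 1)) ∧
      t ≤ K * (1 + s.var g * s.var g + τ (s.var g)) * bits U := by
  obtain ⟨K1, hK1⟩ := copyIn_spec g A B
  obtain ⟨K2, hK2⟩ := trProg_spec M
  obtain ⟨K3, hK3⟩ := copyOut_spec g C
  refine ⟨1 + 1 + (2 * progRegs M + 1) + 2 + 3 * K1 + 2 * K2 + 3 * K3 + 2 * (2 * (1 + bits 1)),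
    fun r s cfg U hU h => ?_⟩
  set G := s.var g with hG
  have hbU := one_le_bits U
  -- Raising register 4 switches to the next private memory; hence only copies from `s.mmc + 1` on
  -- need to be zero afterwards.
  have hlast : ∀ (c : Config) (s' : St), RelCore s' c → s'.mmc = s.mmc → s'.base = s.base →
      (∀ t a, s.mmc + 1 ≤ t → c.mem (mmAddr s.base t a) = 0) →
      ∃ t, Exec r (.assign 4 (eadd (.reg 4) (.const 1))) c (assignAt c 4 (s.mmc + 1)) t ∧
        Rel { s' with mmc := s.mmc + 1 } (assignAt c 4 (s.mmc + 1)) ∧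
        t ≤ 2 * (2 * (1 + bits 1)) * bits U := by
    intro c s' hc h1 h2 h3
    have s4 : Small c (bits U) 1 (.reg 4) :=
      small_reg (bits_mono (by rw [hc.mmc, h1]; exact hU.mmc))
    obtain ⟨t, x, l⟩ := exec_assign (r := r) (x := 4) (v := s.mmc + 1) (by
      show c.reg 4 + 1 = _
      rw [hc.mmc, h1]) (small_op .add s4 (small_const 1 hbU))
    refine ⟨t, x, ⟨⟨fun x => ?_, ?_, hc.pos, ?_, hc.inp, hc.arr, hc.coins⟩, fun t a ht => ?_⟩, l⟩
    · simp only [assignAt, Function.update_apply]; rw [if_neg (by omega)]; exact hc.var x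
    · simp only [assignAt, Function.update_apply]; exact hc.base
    · simp only [assignAt, Function.update_self]
    · show c.mem (mmAddr s'.base t a) = 0
      rw [h2]; exact h3 t a ht
  have hcond : (Expr.reg (3 * g)).eval cfg = G := h.var g
  have hcost : (Expr.reg (3 * g)).cost cfg ≤ bits U := by
    simp only [Expr.cost, h.var]; exact bits_mono (hU.var g)
  -- `MulsIn` says nothing about empty matrices, so the program skips the multiplication for them.
  by_cases hG0 : G = 0
  · obtain ⟨t, x, hr, l⟩ := hlast cfg s h.toRelCore rfl rfl fun t a ht => h.fresh t a (by omega)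
    refine ⟨_, _, .seq (.ite_false (by rw [hcond, hG0]) (.skip _)) x, ?_, ?_, ?_⟩
    · have : s.mmStep G A B C = { s with mmc := s.mmc + 1 } := by
        simp [St.mmStep, hG0]
      rw [this]; exact hr
    · intro k hk
      simp only [assignAt, Function.update_apply]; rw [if_neg (by omega)]
    · set X := 1 + G * G + τ G
      have e1 : bits U ≤ X * bits U := Nat.le_mul_of_pos_left _ (by omega)
      calc _ ≤ (1 + 1 + 1) * (X * bits U) + 2 * (2 * (1 + bits 1)) * (X * bits U) := by
            have := Nat.mul_le_mul_left (2 * (2 * (1 + bits 1))) e1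
            omega
        _ ≤ (1 + 1 + (2 * progRegs M + 1) + 2 + 3 * K1 + 2 * K2 + 3 * K3 + 2 * (2 * (1 + bits 1)))
            * (X * bits U) := by rw [← add_mul]; apply Nat.mul_le_mul_right; omega
        _ = _ := by ring
  have hG1 : 1 ≤ G := Nat.pos_of_ne_zero hG0
  -- The copying counters run up to `G * G`, which may exceed `U`. Passing to `V` costs only a
  -- factor 3 in bit length.
  set V := U * U + U with hV
  have hGU : G ≤ U := hU.var g
  have hGV : G * G ≤ V := (Nat.mul_le_mul hGU hGU).trans (Nat.le_add_right _ _)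
  have hUV : U ≤ V := Nat.le_add_left _ _
  have hbV : bits V ≤ 3 * bits U := by
    have h1 := bits_add_le (U * U) U
    have h2 := bits_mul_le U U
    rw [← hV] at h1
    omega
  obtain ⟨c1, t1, x1, l1, z1, z2, z3, z4⟩ := zeroRegs_spec r (progRegs M) cfg
  have hc1 : RelCore s c1 := h.toRelCore.congr (fun x hx _ => z2 x hx) (fun a _ => by rw [z3]) z4
  obtain ⟨t2, x2, l2⟩ := exec_assign (r := r) (x := 2) (e := .reg (3 * g)) (c := c1) (v := G)
    (hc1.var g) (small_reg (β := bits U) (by rw [hc1.var]; exact bits_mono (hU.var g)))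
  set c2 := assignAt c1 2 G with hc2
  have hc2' : RelCore s c2 := hc1.congr (fun x hx _ => by
    simp only [hc2, assignAt, Function.update_apply]; rw [if_neg (by omega)]) (fun a _ => rfl) rfl
  have hm2 : c2.mem = cfg.mem := z3
  obtain ⟨c3, t3, x3, r3, m3, n3, v3, l3⟩ := hK1 r s c2 V (hU.mono hUV) hGV hc2'
    (fun a => by rw [hm2]; exact h.fresh _ _ le_rfl)
  have hc3 : RelCore s c3 := hc2'.congr (fun x _ hx => r3 x hx) (fun a ha => m3 a (ha _)) n3
  let MA : Matrix (Fin G) (Fin G) ℕ := fun i j => bool01 (s.arr A i j)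
  let MB : Matrix (Fin G) (Fin G) ℕ := fun i j => bool01 (s.arr B i j)
  obtain ⟨sM, tM, xM, pM, lM⟩ := hM G hG1 MA MB (fun _ _ => bool01_le _) (fun _ _ => bool01_le _)
  have hsim : Sim (progRegs M) s.base s.mmc (matMulInput MA MB) c3 := by
    refine ⟨fun x hx => ?_, fun a => ?_, hc3.base, hc3.mmc⟩
    · rw [r3 _ (by omega)]
      simp only [hc2, assignAt, Function.update_apply, matMulInput]
      by_cases hx0 : x = 0
      · simp [hx0]
      · rw [if_neg (by omega), if_neg hx0]; exact z1 x hx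
    · rw [v3 a]
      simp only [matMulInput, MA, MB, Fin.coe_divNat, Fin.coe_modNat]
      rfl
  obtain ⟨c4, t4, x4, s4, f4, l4⟩ := hK2 (progRegs M) s.base s.mmc r le_rfl _ _ _ xM c3 hsim
  have hc4 : RelCore s c4 := hc3.congr (fun x hx _ => f4.reg x hx) (fun a ha => f4.mem a (ha _))
    f4.coins
  have hprod : ∀ i < G, ∀ j < G, prodEntry s G A B i j ≤ V ∧
      c4.mem (mmAddr s.base s.mmc (2 * (G * G) + (i * G + j))) = prodEntry s G A B i j := by
    intro i hi j hj
    refine ⟨(prodEntry_le _ _ _ _ _ _).trans (hGU.trans hUV), ?_⟩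
    rw [s4.mem]
    have := pM ⟨i, hi⟩ ⟨j, hj⟩
    show sM.mem _ = _
    rw [this, Matrix.mul_apply, prodEntry, Finset.sum_range]
  obtain ⟨c5, t5, x5, r5, m5, hc5, l5⟩ := hK3 r s c4 V (prodEntry s G A B) (hU.mono hUV) hGV hc4
    hprod
  obtain ⟨t6, x6, hr6, l6⟩ := hlast c5 _ hc5 rfl rfl fun t a ht => by
    rw [m5 _ fun k i j => (arrAddr_ne_mmAddr _ _ _ _ _ _).symm, f4.mem _ fun a' ha' => ?_,
      m3 _ fun a' ha' => ?_, hm2]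
    · exact h.fresh _ _ (by omega)
    · have := (mmAddr_inj ha').1; omega
    · have := (mmAddr_inj ha').1; omega
  refine ⟨_, _, .seq (.ite_true (by rw [hcond]; exact hG0)
    (.seq x1 (.seq x2 (.seq x3 (.seq x4 x5))))) x6, ?_, ?_, ?_⟩
  · have : s.mmStep G A B C =
        { s.over C G (prodEntry s G A B) (G * G) with mmc := s.mmc + 1 } := by
      simp only [St.mmStep, St.over, St.mk.injEq, true_and, and_true]
      funext k i j
      congr 1
      apply propext
      constructor
      · rintro ⟨q1, q2, q3⟩
        refine ⟨q1, q2, q3, ?_⟩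
        calc i * G + j < i * G + G := by omega
          _ = (i + 1) * G := by ring
          _ ≤ G * G := Nat.mul_le_mul_right _ q2
      · rintro ⟨q1, q2, q3, _⟩
        exact ⟨q1, q2, q3⟩
    rw [this]; exact hr6
  · intro k hk
    simp only [assignAt, Function.update_apply]
    rw [if_neg (by omega), r5 _ (by omega), f4.reg _ (by omega), r3 _ (by omega)]
    simp only [hc2, assignAt, Function.update_apply]
    rw [if_neg (by omega), z2 _ (by omega)]
  · set X := 1 + G * G + τ G with hX
    have e1 : bits U ≤ X * bits U := Nat.le_mul_of_pos_left _ (by omega)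
    have e2 : (G * G + 1) * bits V ≤ 3 * (X * bits U) := by
      calc (G * G + 1) * bits V ≤ X * (3 * bits U) := Nat.mul_le_mul (by omega) hbV
        _ = _ := by ring
    have e3 : (bits s.base + bits s.mmc) * tM ≤ 2 * (X * bits U) := by
      calc _ ≤ (2 * bits U) * X := by
            apply Nat.mul_le_mul
            · have q1 := bits_mono hU.base
              have q2 := bits_mono hU.mmc
              omega
            · omega
        _ = _ := by ring
    rw [← hG] at l3 l5
    have e4 := Nat.mul_le_mul_left K1 e2
    have e5 := Nat.mul_le_mul_left K2 e3
    have e6 := Nat.mul_le_mul_left K3 e2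
    have e7 := Nat.mul_le_mul_left (2 * (2 * (1 + bits 1))) e1
    have e8 : 2 * progRegs M + 1 ≤ (2 * progRegs M + 1) * (X * bits U) :=
      Nat.le_mul_of_pos_right _ (by omega)
    calc _ ≤ X * bits U + X * bits U + (2 * progRegs M + 1) * (X * bits U) + 2 * (X * bits U) +
          K1 * (3 * (X * bits U)) + K2 * (2 * (X * bits U)) + K3 * (3 * (X * bits U)) +
          2 * (2 * (1 + bits 1)) * (X * bits U) := by omega
      _ = _ := by ring

/-- Loops at nesting depth `d` use the internal register `3 d + 1` as a counter. -/
def compile (M : Prog) : ℕ → Cmd → Prog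
  | _, .skip => .skip
  | _, .set x e => .assign (3 * x) (cE e)
  | _, .put k i j e => .store (eArrAddr k (cE i) (cE j)) (cE e)
  | _, .flip x => .flip (3 * x)
  | d, .seq p q => .seq (compile M d p) (compile M d q)
  | d, .ite e p q => .ite (cE e) (compile M d p) (compile M d q)
  | d, .loop e c p => .seq (.assign (3 * d + 1) (cE e))
      (.while (emul (.reg (3 * d + 1)) (cE c))
        (.seq (compile M (d + 1) p) (.assign (3 * d + 1) (esub (.reg (3 * d + 1)) (.const 1)))))
  | _, .mm g A B C => mmProg M g A B C

/-! ### Correctness and cost of compiled commands -/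

theorem RelCore.reg_congr {s : St} {c c' : Config} (h : RelCore s c)
    (hr : ∀ x, x % 3 = 0 ∨ x = 1 ∨ x = 4 → c'.reg x = c.reg x) (hm : c'.mem = c.mem)
    (hc : c'.coins = c.coins) : RelCore s c' :=
  ⟨fun x => by rw [hr _ (by omega), h.var], by rw [hr _ (by omega), h.base], h.pos,
    by rw [hr _ (by omega), h.mmc], fun i hi => by rw [hm, h.inp i hi],
    fun k i j => by rw [hm, h.arr], hc.trans h.coins⟩

theorem Rel.reg_congr {s : St} {c c' : Config} (h : Rel s c)
    (hr : ∀ x, x % 3 = 0 ∨ x = 1 ∨ x = 4 → c'.reg x = c.reg x) (hm : c'.mem = c.mem)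
    (hc : c'.coins = c.coins) : Rel s c' :=
  ⟨h.toRelCore.reg_congr hr hm hc, fun t a ht => by rw [hm]; exact h.fresh t a ht⟩

theorem Rel.setVar {s : St} {c : Config} (h : Rel s c) (x v : ℕ) :
    Rel (s.setVar x v) (assignAt c (3 * x) v) := by
  refine ⟨⟨fun y => ?_, ?_, h.pos, ?_, h.inp, h.arr, h.coins⟩, h.fresh⟩
  · simp only [assignAt, St.setVar, Function.update_apply]
    by_cases hy : y = x
    · simp [hy]
    · rw [if_neg (by omega), if_neg hy]; exact h.var y
  · simp only [assignAt, Function.update_apply]; rw [if_neg (by omega)]; exact h.base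
  · simp only [assignAt, Function.update_apply]; rw [if_neg (by omega)]; exact h.mmc

theorem Rel.setArr {s : St} {c : Config} (h : Rel s c) (k i j v : ℕ) :
    Rel (s.setArr k i j v) (storeAt c (arrAddr s.base k i j) v) := by
  refine ⟨⟨h.var, h.base, h.pos, h.mmc, fun y hy => ?_, fun k' i' j' => ?_, h.coins⟩,
    fun t a ht => ?_⟩
  · have h1 := le_arrAddr s.base k i j
    have h2 : y < s.base := hy
    simp only [storeAt, Function.update_apply]; rw [if_neg (by omega)]; exact h.inp y hy
  · show Function.update c.mem _ _ (arrAddr s.base k' i' j') = _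
    simp only [St.setArr, Function.update_apply]
    by_cases hk : k' = k ∧ i' = i ∧ j' = j
    · obtain ⟨rfl, rfl, rfl⟩ := hk
      simp
    · rw [if_neg hk, if_neg fun h' => hk (arrAddr_inj h')]
      exact h.arr k' i' j'
  · show Function.update c.mem _ _ (mmAddr s.base t a) = 0
    simp only [Function.update_apply]
    rw [if_neg fun h' => arrAddr_ne_mmAddr _ _ _ _ _ _ h'.symm]
    exact h.fresh t a ht

theorem St.Bdd.setVar {s : St} {U V : ℕ} (h : s.Bdd U) (hUV : U ≤ V) (x : ℕ) {v : ℕ}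
    (hv : v ≤ V) : (s.setVar x v).Bdd V := by
  refine ⟨fun y => ?_, (h.mono hUV).arr, (h.mono hUV).inp, (h.mono hUV).base, (h.mono hUV).mmc⟩
  simp only [St.setVar, Function.update_apply]
  split_ifs
  · exact hv
  · exact (h.var y).trans hUV

theorem St.Bdd.setArr {s : St} {U V : ℕ} (h : s.Bdd U) (hUV : U ≤ V) (k i j : ℕ) {v : ℕ}
    (hv : v ≤ V) : (s.setArr k i j v).Bdd V := by
  refine ⟨(h.mono hUV).var, fun k' i' j' => ?_, (h.mono hUV).inp, (h.mono hUV).base,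
    (h.mono hUV).mmc⟩
  simp only [St.setArr]
  split_ifs
  · exact hv
  · exact (h.arr _ _ _).trans hUV

/-- The compiled command simulates the command with a logarithmic overhead. -/
def Compiles (M : Prog) (τ : ℕ → ℕ) (c : Cmd) (d K : ℕ) : Prop :=
  ∀ r s cfg U, St.Bdd s U → Rel s cfg →
    (run r c s).Bdd (U + K * cost τ r c s) ∧
    ∃ cfg' t, Exec r (compile M d c) cfg cfg' t ∧ Rel (run r c s) cfg' ∧
      (∀ h, 3 ≤ h → h < d → cfg'.reg (3 * h + 1) = cfg.reg (3 * h + 1)) ∧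
      t ≤ K * cost τ r c s * bits (U + K * cost τ r c s)

/-- The number of rounds is the value of an arbitrary expression and may exceed all numbers in the
state, but its bit length is at most a constant times that of `U`, and the counter only decreases.
The test multiplies the counter by the condition, so that the loop ends when either vanishes. -/
theorem compiles_loop {M : Prog} {τ : ℕ → ℕ} {e c : E} {p : Cmd} {d K : ℕ} (hd : 3 ≤ d)
    (hp : Compiles M τ p (d + 1) K) : ∃ L, Compiles M τ (.loop e c p) d L := by
  obtain ⟨A, hA⟩ := cE_spec e
  obtain ⟨B, hB⟩ := cE_spec c
  -- The overhead of one round: the test, the decrement and the unit charge of the loop.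
  set D := 2 * (A + B) + 2 * (2 * (A + bits 1)) + 1 with hD
  refine ⟨K + 2 * A + D + 1, fun r s cfg U hU h => ?_⟩
  obtain ⟨e1, s1⟩ := hA s cfg U hU h.toRelCore
  obtain ⟨t1, x1, l1⟩ := exec_assign (r := r) (x := 3 * d + 1) e1 s1
  set c1 := assignAt cfg (3 * d + 1) (e.eval s) with hc1
  have hr1 : Rel s c1 := h.reg_congr (fun x hx => by
    simp only [hc1, assignAt, Function.update_apply]; rw [if_neg (by omega)]) rfl rfl
  -- `U'` bounds the numbers at the current round and grows with the cost spent so far; `bits n` is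
  -- bounded in terms of the initial `U`.
  have main : ∀ n s' cfg' U', St.Bdd s' U' → U ≤ U' → bits n ≤ A * bits U → Rel s' cfg' →
      cfg'.reg (3 * d + 1) = n →
      (iter (fun s => c.eval s) (run r p) n s').Bdd (U' + (K + D) *
        iterCost (fun s => c.eval s) (run r p) (cost τ r p) n s') ∧
      ∃ cfg'' t, Exec r (.while (emul (.reg (3 * d + 1)) (cE c)) (.seq (compile M (d + 1) p)
          (.assign (3 * d + 1) (esub (.reg (3 * d + 1)) (.const 1))))) cfg' cfg'' t ∧
        Rel (iter (fun s => c.eval s) (run r p) n s') cfg'' ∧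
        (∀ h, 3 ≤ h → h < d → cfg''.reg (3 * h + 1) = cfg'.reg (3 * h + 1)) ∧
        t ≤ (K + D) * iterCost (fun s => c.eval s) (run r p) (cost τ r p) n s' *
          bits (U' + (K + D) * iterCost (fun s => c.eval s) (run r p) (cost τ r p) n s') := by
    intro n
    induction n with
    | zero =>
      intro s' cfg' U' hU' hUU hn hr hreg
      refine ⟨hU'.mono (Nat.le_add_right _ _), cfg', _, .while_false ?_, hr, fun _ _ _ => rfl, ?_⟩
      · rw [eval_emul, eval_reg, hreg, zero_mul]
      · obtain ⟨e2, s2⟩ := hB s' cfg' U' hU' hr.toRelCore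
        have s3 : Small cfg' (bits U') A (.reg (3 * d + 1)) := by
          have : bits (cfg'.reg (3 * d + 1)) ≤ A * bits U' :=
            (by rw [hreg]; exact hn : _ ≤ A * bits U).trans (Nat.mul_le_mul le_rfl (bits_mono hUU))
          exact ⟨this, this⟩
        have l3 := (small_op .mul s3 s2).2
        simp only [iterCost, mul_one]
        have m1 : bits U' ≤ bits (U' + (K + D)) := bits_mono (Nat.le_add_right _ _)
        have m2 := one_le_bits U'
        calc _ ≤ 2 * (A + B) * bits U' + 1 * bits U' := by
              rw [show emul (.reg (3 * d + 1)) (cE c) = .op .mul (.reg (3 * d + 1)) (cE c) from rfl]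
              omega
          _ ≤ (K + D) * bits U' := by rw [← add_mul]; exact Nat.mul_le_mul_right _ (by omega)
          _ ≤ _ := Nat.mul_le_mul_left _ m1
    | succ n ih =>
      intro s' cfg' U' hU' hUU hn hr hreg
      obtain ⟨e2, s2⟩ := hB s' cfg' U' hU' hr.toRelCore
      have s3 : Small cfg' (bits U') A (.reg (3 * d + 1)) := by
        have : bits (cfg'.reg (3 * d + 1)) ≤ A * bits U' :=
          (by rw [hreg]; exact hn : _ ≤ A * bits U).trans (Nat.mul_le_mul le_rfl (bits_mono hUU))
        exact ⟨this, this⟩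
      have l3 : (emul (.reg (3 * d + 1)) (cE c)).cost cfg' ≤ _ := (small_op .mul s3 s2).2
      have m2 := one_le_bits U'
      by_cases hc0 : c.eval s' = 0
      · simp only [iter, iterCost, hc0, if_true]
        refine ⟨hU'.mono (Nat.le_add_right _ _), cfg', _, .while_false ?_, hr,
          fun _ _ _ => rfl, ?_⟩
        · rw [eval_emul, e2, hc0, mul_zero]
        · simp only [mul_one]
          have m1 : bits U' ≤ bits (U' + (K + D)) := bits_mono (Nat.le_add_right _ _)
          calc _ ≤ 2 * (A + B) * bits U' + 1 * bits U' := by omega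
            _ ≤ (K + D) * bits U' := by rw [← add_mul]; exact Nat.mul_le_mul_right _ (by omega)
            _ ≤ _ := Nat.mul_le_mul_left _ m1
      · simp only [iter, iterCost, hc0, if_false]
        obtain ⟨hb, cfg2, t2, x2, hr2, fr2, l2⟩ := hp r s' cfg' U' hU' hr
        set q := cost τ r p s' with hq
        have hreg2 : cfg2.reg (3 * d + 1) = n + 1 := by rw [fr2 d hd (by omega), hreg]
        have s4 : Small cfg2 (bits (U' + K * q)) A (.reg (3 * d + 1)) := by
          have : bits (cfg2.reg (3 * d + 1)) ≤ A * bits (U' + K * q) :=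
            (by rw [hreg2]; exact hn : _ ≤ A * bits U).trans
              (Nat.mul_le_mul le_rfl (bits_mono (by omega)))
          exact ⟨this, this⟩
        obtain ⟨t3, x3, l4⟩ := exec_assign (r := r) (x := 3 * d + 1)
          (e := esub (.reg (3 * d + 1)) (.const 1)) (c := cfg2) (v := n)
          (by rw [eval_esub, eval_reg, hreg2, eval_const, Nat.add_sub_cancel])
          (small_op .sub s4 (small_const 1 (one_le_bits _)))
        have hr3 : Rel (run r p s') (assignAt cfg2 (3 * d + 1) n) := hr2.reg_congr (fun x hx => by
          simp only [assignAt, Function.update_apply]; rw [if_neg (by omega)]) rfl rfl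
        obtain ⟨hb4, cfg4, t4, x4, hr4, fr4, l5⟩ := ih _ _ (U' + K * q) hb (by omega)
          ((bits_mono (Nat.le_succ n)).trans hn) hr3 (by simp [assignAt])
        set Q := iterCost (fun s => c.eval s) (run r p) (cost τ r p) n (run r p s') with hQ
        have hle : U' + K * q + (K + D) * Q ≤ U' + (K + D) * (1 + q + Q) := by
          have : (K + D) * (1 + q + Q) = K * q + (K + D) * Q + (K + D + D * q) := by ring
          omega
        refine ⟨hb4.mono hle, cfg4, _, .while_true ?_ (.seq x2 x3) x4, hr4, ?_, ?_⟩
        · rw [eval_emul, eval_reg, hreg, e2]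
          exact mul_ne_zero (by omega) hc0
        · intro k hk hkd
          rw [fr4 k hk hkd]
          simp only [assignAt, Function.update_apply]
          rw [if_neg (by omega), fr2 k hk (by omega)]
        · set W := bits (U' + (K + D) * (1 + q + Q)) with hW
          have w1 : bits U' ≤ W := bits_mono (Nat.le_add_right _ _)
          have w2 : bits (U' + K * q) ≤ W := bits_mono (by omega)
          have w3 : bits (U' + K * q + (K + D) * Q) ≤ W := bits_mono hle
          have w4 : 1 ≤ W := m2.trans w1
          have y1 := Nat.mul_le_mul_left (2 * (A + B)) w1
          have y2 := Nat.mul_le_mul_left (K * q) w2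
          have y3 := Nat.mul_le_mul_left (2 * (2 * (A + bits 1))) w2
          have y4 := Nat.mul_le_mul_left ((K + D) * Q) w3
          calc _ ≤ 2 * (A + B) * W + 1 * W + (K * q * W + 2 * (2 * (A + bits 1)) * W) +
                (K + D) * Q * W := by omega
            _ = (D + K * q + (K + D) * Q) * W := by rw [hD]; ring
            _ ≤ _ := by
              apply Nat.mul_le_mul_right
              have : (K + D) * (1 + q + Q) = D + K * q + (K + D) * Q + (K + D * q) := by ring
              omega
  obtain ⟨hb, cfg2, t2, x2, hr2, fr2, l2⟩ := main (e.eval s) s c1 U hU le_rfl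
    (by rw [← e1]; exact s1.1) hr1 (by simp [hc1, assignAt])
  simp only [run, cost]
  set Q := iterCost (fun s => c.eval s) (run r p) (cost τ r p) (e.eval s) s with hQ
  have hle : U + (K + D) * Q ≤ U + (K + 2 * A + D + 1) * (1 + Q) := by
    have : (K + 2 * A + D + 1) * (1 + Q) = (K + D) * Q + (K + 2 * A + D + 1 + (2 * A + 1) * Q) := by
      ring
    omega
  refine ⟨hb.mono hle, cfg2, _, .seq x1 x2, hr2, ?_, ?_⟩
  · intro k hk hkd
    rw [fr2 k hk hkd]
    simp only [hc1, assignAt, Function.update_apply]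
    rw [if_neg (by omega)]
  · set W := bits (U + (K + 2 * A + D + 1) * (1 + Q)) with hW
    have w1 : bits U ≤ W := bits_mono (Nat.le_add_right _ _)
    have w2 := bits_mono hle
    calc t1 + t2 ≤ 2 * A * W + (K + D) * Q * W :=
          Nat.add_le_add (l1.trans (Nat.mul_le_mul_left _ w1)) (l2.trans (Nat.mul_le_mul_left _ w2))
      _ = (2 * A + (K + D) * Q) * W := by ring
      _ ≤ _ := by
        apply Nat.mul_le_mul_right
        have : (K + 2 * A + D + 1) * (1 + Q) =
          2 * A + (K + D) * Q + (K + D + 1 + (2 * A + 1) * Q) := by ring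
        omega

theorem Compiles.mono {M : Prog} {τ : ℕ → ℕ} {c : Cmd} {d K L : ℕ} (h : Compiles M τ c d K)
    (hKL : K ≤ L) : Compiles M τ c d L := by
  intro r s cfg U hU hr
  obtain ⟨h1, c', t, h2, h3, h4, h5⟩ := h r s cfg U hU hr
  have : U + K * cost τ r c s ≤ U + L * cost τ r c s := by gcongr
  exact ⟨h1.mono this, c', t, h2, h3, h4, h5.trans (by gcongr; exact bits_mono this)⟩

/-- Prices pay for the growth of numbers: an assigned value exceeds the old bound by at most a
constant times its price. So all numbers stay below `U` plus a multiple of the cost, and every step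
costs a constant times their bit length. The depth is universally quantified because a loop compiles
its body one level deeper. -/
theorem compile_correct {M : Prog} {τ : ℕ → ℕ} (hM : MulsIn M τ) (c : Cmd) :
    ∀ d, 3 ≤ d → ∃ K, Compiles M τ c d K := by
  induction c with
  | skip =>
    refine fun d _ => ⟨1, fun r s cfg U hU h => ⟨hU.mono (Nat.le_add_right _ _), cfg, 1, .skip _, h,
      fun _ _ _ => rfl, ?_⟩⟩
    simp only [cost, mul_one, one_mul]
    exact one_le_bits _
  | set x e =>
    intro d _
    obtain ⟨A, hA⟩ := cE_spec e
    refine ⟨2 * A + (e.slack.getD 0 + 1), fun r s cfg U hU h => ?_⟩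
    obtain ⟨e1, s1⟩ := hA s cfg U hU h.toRelCore
    obtain ⟨t1, x1, l1⟩ := exec_assign (r := r) (x := 3 * x) e1 s1
    simp only [run, cost]
    have hpr := E.one_le_price s e
    refine ⟨hU.setVar (Nat.le_add_right _ _) x ((E.eval_le_of_price hU e).trans ?_), _, t1, x1,
      h.setVar _ _, ?_, l1.trans ?_⟩
    · exact Nat.add_le_add_left (Nat.mul_le_mul_right _ (by omega)) _
    · intro k _ _
      simp only [assignAt, Function.update_apply]
      rw [if_neg (by omega)]
    · apply Nat.mul_le_mul _ (bits_mono (Nat.le_add_right _ _))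
      nlinarith
  | put k i j e =>
    intro d _
    obtain ⟨A, hA⟩ := cE_spec e
    obtain ⟨B, hB⟩ := cE_spec i
    obtain ⟨C, hC⟩ := cE_spec j
    obtain ⟨D, hD⟩ := small_eArrAddr k B C
    refine ⟨2 * (D + A) + (e.slack.getD 0 + 1), fun r s cfg U hU h => ?_⟩
    obtain ⟨e1, s1⟩ := hA s cfg U hU h.toRelCore
    obtain ⟨e2, s2⟩ := hB s cfg U hU h.toRelCore
    obtain ⟨e3, s3⟩ := hC s cfg U hU h.toRelCore
    have s4 := hD cfg (bits U) _ _ (one_le_bits U)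
      (by rw [h.base]; exact bits_mono hU.base) s2 s3
    obtain ⟨t1, x1, l1⟩ := exec_store (r := r)
      (show (eArrAddr k (cE i) (cE j)).eval cfg = arrAddr s.base k (i.eval s) (j.eval s) by
        rw [eval_eArrAddr, h.base, e2, e3]) e1 s4 s1
    simp only [run, cost]
    have hpr := E.one_le_price s e
    refine ⟨hU.setArr (Nat.le_add_right _ _) _ _ _ ((E.eval_le_of_price hU e).trans ?_), _, t1, x1,
      h.setArr _ _ _ _, fun _ _ _ => rfl, l1.trans ?_⟩
    · exact Nat.add_le_add_left (Nat.mul_le_mul_right _ (by omega)) _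
    · apply Nat.mul_le_mul _ (bits_mono (Nat.le_add_right _ _))
      nlinarith
  | flip x =>
    refine fun d _ => ⟨1, fun r s cfg U hU h => ?_⟩
    simp only [run, cost, mul_one, one_mul]
    have h1 := h.setVar x (r s.coins).toNat
    have h2 : (r s.coins).toNat ≤ U + 1 := (Bool.toNat_le _).trans (Nat.le_add_left _ _)
    have h3 := hU.setVar (Nat.le_succ U) x h2
    refine ⟨⟨h3.var, h3.arr, h3.inp, h3.base, h3.mmc⟩, _, 1, .flip _ _, ?_, ?_, one_le_bits _⟩
    · rw [h.coins]
      exact ⟨⟨h1.var, h1.base, h1.pos, h1.mmc, h1.inp, h1.arr, rfl⟩, h1.fresh⟩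
    · intro k _ _
      simp only [Function.update_apply]
      rw [if_neg (by omega)]
  | seq p q ihp ihq =>
    intro d hd
    obtain ⟨A, hA⟩ := ihp d hd
    obtain ⟨B, hB⟩ := ihq d hd
    refine ⟨A + B, fun r s cfg U hU h => ?_⟩
    obtain ⟨b1, c1, t1, x1, r1, f1, l1⟩ := (hA.mono (Nat.le_add_right A B)) r s cfg U hU h
    obtain ⟨b2, c2, t2, x2, r2, f2, l2⟩ := (hB.mono (Nat.le_add_left B A)) r _ _ _ b1 r1
    have e : U + (A + B) * (cost τ r p s + cost τ r q (run r p s)) =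
      U + (A + B) * cost τ r p s + (A + B) * cost τ r q (run r p s) := by ring
    simp only [run, cost]
    rw [e]
    refine ⟨b2, c2, _, .seq x1 x2, r2, fun k h3 hk => (f2 k h3 hk).trans (f1 k h3 hk), ?_⟩
    have w1 : bits (U + (A + B) * cost τ r p s) ≤
      bits (U + (A + B) * cost τ r p s + (A + B) * cost τ r q (run r p s)) :=
      bits_mono (Nat.le_add_right _ _)
    calc t1 + t2 ≤ _ := Nat.add_le_add (l1.trans (Nat.mul_le_mul_left _ w1)) l2
      _ = _ := by ring
  | ite e p q ihp ihq =>
    intro d hd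
    obtain ⟨A, hA⟩ := ihp d hd
    obtain ⟨B, hB⟩ := ihq d hd
    obtain ⟨C, hC⟩ := cE_spec e
    refine ⟨A + B + C + 1, fun r s cfg U hU h => ?_⟩
    obtain ⟨e1, s1⟩ := hC s cfg U hU h.toRelCore
    simp only [run, cost]
    have key : ∀ x, U + (A + B + C + 1) * x ≤ U + (A + B + C + 1) * (1 + x) := fun x => by
      gcongr; omega
    have key2 : ∀ x t, t ≤ (A + B + C + 1) * x * bits (U + (A + B + C + 1) * x) →
        (cE e).cost cfg + 1 + t ≤
          (A + B + C + 1) * (1 + x) * bits (U + (A + B + C + 1) * (1 + x)) := fun x t ht => by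
      set W := bits (U + (A + B + C + 1) * (1 + x)) with hW
      have w1 : bits U ≤ W := bits_mono (Nat.le_add_right _ _)
      have w2 := one_le_bits U
      have w3 := Nat.mul_le_mul_left ((A + B + C + 1) * x) (bits_mono (key x))
      rw [← hW] at w3
      have w4 := Nat.mul_le_mul_left C w1
      have w5 := s1.2
      calc _ ≤ C * W + 1 * W + (A + B + C + 1) * x * W := by omega
        _ = (C + 1 + (A + B + C + 1) * x) * W := by ring
        _ ≤ _ := by apply Nat.mul_le_mul_right; rw [mul_add]; omega
    by_cases h0 : e.eval s = 0
    · simp only [h0, if_true]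
      obtain ⟨b1, c1, t1, x1, r1, f1, l1⟩ := (hB.mono (L := A + B + C + 1) (by omega)) r s cfg U hU h
      exact ⟨b1.mono (key _), c1, _, .ite_false (by rw [e1, h0]) x1, r1, f1, key2 _ _ l1⟩
    · simp only [h0, if_false]
      obtain ⟨b1, c1, t1, x1, r1, f1, l1⟩ := (hA.mono (L := A + B + C + 1) (by omega)) r s cfg U hU h
      exact ⟨b1.mono (key _), c1, _, .ite_true (by rw [e1]; exact h0) x1, r1, f1, key2 _ _ l1⟩
  | loop e c p ih =>
    intro d hd
    obtain ⟨A, hA⟩ := ih (d + 1) (by omega)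
    exact compiles_loop hd hA
  | mm g A B C =>
    intro d hd
    obtain ⟨K, hK⟩ := mmProg_spec hM g A B C
    refine ⟨K + 1, fun r s cfg U hU h => ?_⟩
    obtain ⟨c1, t1, x1, r1, f1, l1⟩ := hK r s cfg U hU h
    simp only [run, cost]
    set X := 1 + s.var g * s.var g + τ (s.var g) with hX
    have hX1 : U + 1 ≤ U + (K + 1) * X := by
      have : 1 ≤ (K + 1) * X := Nat.mul_pos (by omega) (by omega)
      omega
    refine ⟨⟨fun x => (hU.var x).trans (Nat.le_add_right _ _), fun k i j => ?_,
      fun i hi => (hU.inp i hi).trans (Nat.le_add_right _ _),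
      hU.base.trans (Nat.le_add_right _ _), ?_⟩, c1, t1, x1, r1, fun k h3 _ => f1 k h3, l1.trans ?_⟩
    · simp only [St.mmStep]
      split_ifs
      · exact ((prodEntry_le _ _ _ _ _ _).trans (hU.var g)).trans (Nat.le_add_right _ _)
      · exact (hU.arr _ _ _).trans (Nat.le_add_right _ _)
    · exact (Nat.succ_le_succ hU.mmc).trans hX1
    · exact Nat.mul_le_mul (Nat.mul_le_mul_right _ (Nat.le_succ K)) (bits_mono (Nat.le_add_right _ _))

/-! ## Frames -/

/-- The command writes the variable `x`. -/
def Cmd.wVar (x : ℕ) : Cmd → Bool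
  | .skip => false
  | .set y _ => y == x
  | .put _ _ _ _ => false
  | .flip y => y == x
  | .seq p q => p.wVar x || q.wVar x
  | .ite _ p q => p.wVar x || q.wVar x
  | .loop _ _ p => p.wVar x
  | .mm _ _ _ _ => false

/-- The command writes the array `k`. -/
def Cmd.wArr (k : ℕ) : Cmd → Bool
  | .skip => false
  | .set _ _ => false
  | .put l _ _ _ => l == k
  | .flip _ => false
  | .seq p q => p.wArr k || q.wArr k
  | .ite _ p q => p.wArr k || q.wArr k
  | .loop _ _ p => p.wArr k
  | .mm _ _ _ C => C == k

/-- Since the sets of written variables and arrays are computable, a fact about the state is carried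
across a command by an appeal to `rfl`. This is how the later proofs treat everything that a command
leaves alone. -/
structure Same (c : Cmd) (s s' : St) : Prop where
  var : ∀ x, c.wVar x = false → s'.var x = s.var x
  arr : ∀ k, c.wArr k = false → s'.arr k = s.arr k
  inp : s'.inp = s.inp
  base : s'.base = s.base

theorem Same.refl (c : Cmd) (s : St) : Same c s s :=
  ⟨fun _ _ => rfl, fun _ _ => rfl, rfl, rfl⟩

theorem Same.trans {c : Cmd} {s s' s'' : St} (h : Same c s s') (h' : Same c s' s'') :
    Same c s s'' :=
  ⟨fun x hx => (h'.var x hx).trans (h.var x hx), fun k hk => (h'.arr k hk).trans (h.arr k hk),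
    h'.inp.trans h.inp, h'.base.trans h.base⟩

theorem Same.of_le {c c' : Cmd} {s s' : St} (h : Same c s s')
    (hv : ∀ x, c'.wVar x = false → c.wVar x = false)
    (ha : ∀ x, c'.wArr x = false → c.wArr x = false) : Same c' s s' :=
  ⟨fun x hx => h.var x (hv x hx), fun k hk => h.arr k (ha k hk), h.inp, h.base⟩

theorem Same.seq_left {p q : Cmd} {s s' : St} (h : Same p s s') : Same (.seq p q) s s' :=
  h.of_le (fun x hx => by simp only [Cmd.wVar, Bool.or_eq_false_iff] at hx; exact hx.1)
    (fun x hx => by simp only [Cmd.wArr, Bool.or_eq_false_iff] at hx; exact hx.1)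

theorem Same.seq_right {p q : Cmd} {s s' : St} (h : Same q s s') : Same (.seq p q) s s' :=
  h.of_le (fun x hx => by simp only [Cmd.wVar, Bool.or_eq_false_iff] at hx; exact hx.2)
    (fun x hx => by simp only [Cmd.wArr, Bool.or_eq_false_iff] at hx; exact hx.2)

theorem same_iter {p : Cmd} {f : St → St} (hf : ∀ s, Same p s (f s)) (c : St → ℕ) (n : ℕ) (s : St) :
    Same p s (iter c f n s) := by
  induction n generalizing s with
  | zero => exact .refl _ _
  | succ n ih =>
    simp only [iter]
    split_ifs
    · exact .refl _ _
    · exact (hf s).trans (ih _)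

theorem run_same (r : ℕ → Bool) (c : Cmd) (s : St) : Same c s (run r c s) := by
  induction c generalizing s with
  | skip => exact .refl _ _
  | set x e =>
    refine ⟨fun y hy => ?_, fun _ _ => rfl, rfl, rfl⟩
    have hyx : y ≠ x := by rintro rfl; simp [Cmd.wVar] at hy
    simp [run, St.setVar, Function.update_of_ne hyx]
  | put k i j e =>
    refine ⟨fun _ _ => rfl, fun l hl => ?_, rfl, rfl⟩
    have hlk : l ≠ k := by rintro rfl; simp [Cmd.wArr] at hl
    funext a b
    simp [run, St.setArr, hlk]
  | flip x =>
    refine ⟨fun y hy => ?_, fun _ _ => rfl, rfl, rfl⟩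
    have hyx : y ≠ x := by rintro rfl; simp [Cmd.wVar] at hy
    simp [run, St.setVar, Function.update_of_ne hyx]
  | seq p q ihp ihq => exact (ihp s).seq_left.trans (ihq _).seq_right
  | ite e p q ihp ihq =>
    simp only [run]
    split_ifs
    · exact ((ihq s).seq_right (p := p)).of_le (fun _ h => h) (fun _ h => h)
    · exact ((ihp s).seq_left (q := q)).of_le (fun _ h => h) (fun _ h => h)
  | loop e c p ih =>
    exact (same_iter ih (fun s => c.eval s) (e.eval s) s).of_le (fun _ h => h) (fun _ h => h)
  | mm g A B C =>
    refine ⟨fun _ _ => rfl, fun l hl => ?_, rfl, rfl⟩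
    have hlk : l ≠ C := by rintro rfl; simp [Cmd.wArr] at hl
    funext a b
    simp [run, St.mmStep, hlk]

/-! ## Correctness together with a cost bound -/

/-- From the state `s` the command reaches a state with the property `Q`, at cost at most `k`. -/
def Does (τ : ℕ → ℕ) (r : ℕ → Bool) (c : Cmd) (s : St) (k : ℕ) (Q : St → Prop) : Prop :=
  Q (run r c s) ∧ cost τ r c s ≤ k

section Rules

variable {τ : ℕ → ℕ} {r : ℕ → Bool}

theorem Does.mono {c : Cmd} {s : St} {k l : ℕ} {Q R : St → Prop} (h : Does τ r c s k Q)
    (hkl : k ≤ l) (hQR : ∀ s', Same c s s' → Q s' → R s') : Does τ r c s l R :=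
  ⟨hQR _ (run_same r c s) h.1, h.2.trans hkl⟩

theorem does_skip {s : St} {Q : St → Prop} (h : Q s) : Does τ r .skip s 1 Q := ⟨h, le_rfl⟩

theorem does_set {s : St} {Q : St → Prop} {x : ℕ} {e : E} {v : ℕ} (hv : e.eval s = v)
    (he : e.slack.isSome) (h : Q (s.setVar x v)) : Does τ r (.set x e) s 1 Q := by
  subst hv
  refine ⟨h, ?_⟩
  simp [cost, E.price, he]

theorem does_put {s : St} {Q : St → Prop} {k : ℕ} {i j e : E} {a b v : ℕ} (hi : i.eval s = a)
    (hj : j.eval s = b) (hv : e.eval s = v) (he : e.slack.isSome) (h : Q (s.setArr k a b v)) :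
    Does τ r (.put k i j e) s 1 Q := by
  subst hv hi hj
  refine ⟨h, ?_⟩
  simp [cost, E.price, he]

theorem does_seq {p q : Cmd} {s : St} {k l : ℕ} {P Q : St → Prop} (hp : Does τ r p s k P)
    (hq : ∀ s', Same p s s' → P s' → Does τ r q s' l Q) : Does τ r (.seq p q) s (k + l) Q := by
  have h := hq _ (run_same r p s) hp.1
  exact ⟨h.1, Nat.add_le_add hp.2 h.2⟩

theorem does_ite {e : E} {p q : Cmd} {s : St} {k : ℕ} {Q : St → Prop}
    (hp : e.eval s ≠ 0 → Does τ r p s k Q) (hq : e.eval s = 0 → Does τ r q s k Q) :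
    Does τ r (.ite e p q) s (1 + k) Q := by
  unfold Does
  simp only [run, cost]
  by_cases h : e.eval s = 0
  · simp only [h, if_true]; exact ⟨(hq h).1, Nat.add_le_add_left (hq h).2 _⟩
  · simp only [h, if_false]; exact ⟨(hp h).1, Nat.add_le_add_left (hp h).2 _⟩

/-- Loops with a condition: `i` counts the iterations. -/
theorem does_loop {e c : E} {p : Cmd} {s : St} {N : ℕ} (hN : e.eval s = N) (k : ℕ)
    (I : ℕ → St → Prop) (h0 : I 0 s)
    (hstep : ∀ i s', i < N → Same p s s' → I i s' → c.eval s' ≠ 0 →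
      Does τ r p s' k (I (i + 1))) (Q : St → Prop) (l : ℕ)
    (hend : ∀ i s', i ≤ N → Same p s s' → I i s' → (i = N ∨ c.eval s' = 0) →
      Q s' ∧ i ≤ l) :
    Does τ r (.loop e c p) s (2 + l * (1 + k)) Q := by
  subst hN
  -- The rounds already made are added to the remaining cost, so that the bound on the final number
  -- of rounds applies only at the end.
  suffices H : ∀ n i s', i + n = e.eval s → Same p s s' → I i s' →
      Q (iter (fun s => c.eval s) (run r p) n s') ∧
      i * (1 + k) + iterCost (fun s => c.eval s) (run r p) (cost τ r p) n s' ≤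
        1 + l * (1 + k) by
    have h := H (e.eval s) 0 s (by omega) (.refl _ _) h0
    refine ⟨h.1, ?_⟩
    simp only [cost]
    omega
  intro n
  induction n with
  | zero =>
    intro i s' hi hs hI
    obtain ⟨h1, h2⟩ := hend i s' (by omega) hs hI (.inl (by omega))
    refine ⟨h1, ?_⟩
    simp only [iterCost]
    have := Nat.mul_le_mul_right (1 + k) h2
    omega
  | succ n ih =>
    intro i s' hi hs hI
    simp only [iter, iterCost]
    by_cases hc : c.eval s' = 0
    · simp only [hc, if_true]
      obtain ⟨h1, h2⟩ := hend i s' (by omega) hs hI (.inr hc)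
      refine ⟨h1, ?_⟩
      have := Nat.mul_le_mul_right (1 + k) h2
      omega
    · simp only [hc, if_false]
      obtain ⟨h1, h2⟩ := hstep i s' (by omega) hs hI hc
      obtain ⟨h3, h4⟩ := ih (i + 1) _ (by omega) (hs.trans (run_same r p s')) h1
      refine ⟨h3, ?_⟩
      rw [add_mul] at h4
      omega

/-- The counting loop: `x` runs from `0` to `e - 1`. -/
def forN (x : ℕ) (e : E) (p : Cmd) : Cmd :=
  .seq (.set x (.const 0)) (.loop e (.const 1) (.seq p (.set x (.op .add (.var x) (.const 1)))))

theorem wVar_forN (x : ℕ) (e : E) (p : Cmd) (y : ℕ) :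
    (forN x e p).wVar y = ((x == y) || p.wVar y) := by
  simp [forN, Cmd.wVar, Bool.or_comm]

theorem wArr_forN (x : ℕ) (e : E) (p : Cmd) (y : ℕ) : (forN x e p).wArr y = p.wArr y := by
  simp [forN, Cmd.wArr]

/-- The bound is evaluated once, after `x` has been reset, hence the form of `hN`. The invariant may
not depend on `x`, since its index already counts the rounds. Each round pays 2 in addition: one for
the loop and one for the increment. -/
theorem does_forN {x : ℕ} {e : E} {p : Cmd} {s : St} {N : ℕ} (hx : p.wVar x = false)
    (hN : e.eval (s.setVar x 0) = N) (k : ℕ → ℕ) (I : ℕ → St → Prop)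
    (hI : ∀ i s v, I i s → I i (s.setVar x v)) (h0 : I 0 s)
    (hstep : ∀ i s', i < N → Same (forN x e p) s s' → s'.var x = i → I i s' →
      Does τ r p s' (k i) (I (i + 1))) :
    Does τ r (forN x e p) s (3 + ∑ i ∈ range N, (k i + 2)) (I N) := by
  suffices H : ∀ n i s', i + n = N → Same (forN x e p) s s' → s'.var x = i → I i s' →
      I N (iter (fun s => (E.const 1).eval s)
        (run r (.seq p (.set x (.op .add (.var x) (.const 1))))) n s') ∧
      iterCost (fun s => (E.const 1).eval s)
        (run r (.seq p (.set x (.op .add (.var x) (.const 1)))))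
        (cost τ r (.seq p (.set x (.op .add (.var x) (.const 1))))) n s' ≤
        1 + ∑ j ∈ range n, (k (i + j) + 2) by
    have h1 : Same (forN x e p) s (s.setVar x 0) :=
      (run_same r (.set x (.const 0)) s).seq_left
    have h := H N 0 (s.setVar x 0) (by omega) h1 (by simp [St.setVar]) (hI _ _ _ h0)
    have e1 : run r (forN x e p) s = iter (fun s => (E.const 1).eval s)
        (run r (.seq p (.set x (.op .add (.var x) (.const 1))))) (e.eval (s.setVar x 0))
        (s.setVar x 0) := rfl
    have e2 : cost τ r (forN x e p) s = 1 + (1 + iterCost (fun s => (E.const 1).eval s)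
        (run r (.seq p (.set x (.op .add (.var x) (.const 1)))))
        (cost τ r (.seq p (.set x (.op .add (.var x) (.const 1))))) (e.eval (s.setVar x 0))
        (s.setVar x 0)) := rfl
    unfold Does
    rw [e1, e2, hN]
    refine ⟨h.1, ?_⟩
    have h2 := h.2
    simp only [zero_add] at h2
    omega
  intro n
  induction n with
  | zero =>
    intro i s' hi hs hv hII
    obtain rfl : i = N := by omega
    exact ⟨hII, by simp [iterCost]⟩
  | succ n ih =>
    intro i s' hi hs hv hII
    have hst := hstep i s' (by omega) hs hv hII
    have hx' : (run r p s').var x = i := by rw [(run_same r p s').var x hx, hv]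
    have hsame : Same (forN x e p) s' (run r (.seq p (.set x (.op .add (.var x) (.const 1)))) s') :=
      (run_same r _ s').of_le (fun y hy => by
        rw [wVar_forN] at hy; simp only [Bool.or_eq_false_iff] at hy
        simp [Cmd.wVar, hy.2, hy.1]) (fun y hy => by
        rw [wArr_forN] at hy; simp [Cmd.wArr, hy])
    obtain ⟨h1, h2⟩ := ih (i + 1) (run r (.seq p (.set x (.op .add (.var x) (.const 1)))) s')
      (by omega) (hs.trans hsame) (by simp [run, St.setVar, E.eval, Op.eval, hx'])
      (hI _ _ _ hst.1)
    simp only [iter, iterCost]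
    have h1' : (E.const 1).eval s' ≠ 0 := by simp [E.eval]
    simp only [h1', if_false]
    refine ⟨h1, ?_⟩
    rw [Finset.sum_range_succ']
    have h3 : ∀ j, k (i + (j + 1)) = k (i + 1 + j) := fun j => by congr 1; omega
    simp only [h3, add_zero]
    have h4 : cost τ r (.seq p (.set x (.op .add (.var x) (.const 1)))) s' ≤ k i + 1 :=
      Nat.add_le_add hst.2 (le_of_eq rfl)
    omega

/-! ## Boolean expressions -/

end Rules

def eAnd (a b : E) : E := .op .mul a b
def eOr (a b : E) : E := .op .add a b
def eNot (a : E) : E := .op .sub (.const 1) a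
def eLt (a b : E) : E := .op .sub b a
def eLe (a b : E) : E := .op .sub (.op .add b (.const 1)) a
def eEq (a b : E) : E := .op .sub (.const 1) (.op .add (.op .sub a b) (.op .sub b a))
def eB (a : E) : E := eNot (eNot a)

@[simp] theorem eAnd_ne (s : St) (a b : E) : (eAnd a b).eval s = 0 ↔ a.eval s = 0 ∨ b.eval s = 0 :=
  Nat.mul_eq_zero
@[simp] theorem eOr_ne (s : St) (a b : E) : (eOr a b).eval s = 0 ↔ a.eval s = 0 ∧ b.eval s = 0 :=
  Nat.add_eq_zero_iff
@[simp] theorem eNot_ne (s : St) (a : E) : (eNot a).eval s = 0 ↔ ¬ a.eval s = 0 := by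
  simp only [eNot, E.eval, Op.eval]; omega
@[simp] theorem eLt_ne (s : St) (a b : E) : (eLt a b).eval s = 0 ↔ ¬ a.eval s < b.eval s := by
  simp only [eLt, E.eval, Op.eval]; omega
@[simp] theorem eLe_ne (s : St) (a b : E) : (eLe a b).eval s = 0 ↔ ¬ a.eval s ≤ b.eval s := by
  simp only [eLe, E.eval, Op.eval]; omega
@[simp] theorem eEq_ne (s : St) (a b : E) : (eEq a b).eval s = 0 ↔ ¬ a.eval s = b.eval s := by
  simp only [eEq, E.eval, Op.eval]; omega
theorem eB_eval (s : St) (a : E) : (eB a).eval s = if a.eval s = 0 then 0 else 1 := by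
  simp only [eB, eNot, E.eval, Op.eval]; split_ifs <;> omega

@[simp] theorem eval_var (s : St) (x : ℕ) : (E.var x).eval s = s.var x := rfl
@[simp] theorem eval_arr (s : St) (k : ℕ) (i j : E) :
    (E.arr k i j).eval s = s.arr k (i.eval s) (j.eval s) := rfl
@[simp] theorem eval_cst (s : St) (k : ℕ) : (E.const k).eval s = k := rfl
@[simp] theorem eval_op_add (s : St) (a b : E) :
    (E.op .add a b).eval s = a.eval s + b.eval s := rfl
@[simp] theorem eval_op_mul (s : St) (a b : E) :
    (E.op .mul a b).eval s = a.eval s * b.eval s := rfl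
@[simp] theorem eval_op_sub (s : St) (a b : E) :
    (E.op .sub a b).eval s = a.eval s - b.eval s := rfl
@[simp] theorem eval_op_div (s : St) (a b : E) :
    (E.op .div a b).eval s = a.eval s / b.eval s := rfl

@[simp] theorem setVar_var (s : St) (x v y : ℕ) :
    (s.setVar x v).var y = if y = x then v else s.var y := Function.update_apply _ _ _ _
@[simp] theorem setVar_arr (s : St) (x v : ℕ) : (s.setVar x v).arr = s.arr := rfl
@[simp] theorem setArr_var (s : St) (k i j v : ℕ) : (s.setArr k i j v).var = s.var := rfl
@[simp] theorem setArr_arr (s : St) (k i j v k' i' j' : ℕ) : (s.setArr k i j v).arr k' i' j' =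
    if k' = k ∧ i' = i ∧ j' = j then v else s.arr k' i' j' := rfl

/-! ## Filling an array, scanning two indices, filtering a list -/

section Rules2

variable {τ : ℕ → ℕ} {r : ℕ → Bool}

def fill2 (K x y : ℕ) (ex ey e : E) : Cmd :=
  forN x ex (forN y ey (.put K (.var x) (.var y) e))

theorem does_fill2 {K x y : ℕ} {ex ey e : E} {s : St} {R C : ℕ} (F : ℕ → ℕ → ℕ) (hxy : x ≠ y)
    (he : e.slack.isSome)
    (hR : ∀ s', Same (fill2 K x y ex ey e) s s' → ex.eval s' = R)
    (hC : ∀ s', Same (fill2 K x y ex ey e) s s' → ey.eval s' = C)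
    (hF : ∀ i < R, ∀ j < C, ∀ s', Same (fill2 K x y ex ey e) s s' → s'.var x = i → s'.var y = j →
      e.eval s' = F i j) :
    Does τ r (fill2 K x y ex ey e) s (3 + R * (5 + C * 3)) (fun s' =>
      ∀ i j, s'.arr K i j = if i < R ∧ j < C then F i j else s.arr K i j) := by
  have same_set : ∀ v w s', Same (fill2 K x y ex ey e) s s' → v = x ∨ v = y →
      Same (fill2 K x y ex ey e) s (s'.setVar v w) := by
    intro v w s' h hv
    refine h.trans ⟨fun z hz => ?_, fun _ _ => rfl, rfl, rfl⟩
    simp only [fill2, wVar_forN, Bool.or_eq_false_iff, beq_eq_false_iff_ne] at hz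
    rw [setVar_var, if_neg]
    rintro rfl
    rcases hv with rfl | rfl
    · exact hz.1 rfl
    · exact hz.2.1 rfl
  have h := does_forN (τ := τ) (r := r) (x := x) (e := ex)
    (p := forN y ey (.put K (.var x) (.var y) e)) (s := s) (N := R)
    (by simp [wVar_forN, Cmd.wVar, hxy.symm]) (hR _ (same_set x 0 s (.refl _ _) (.inl rfl)))
    (fun _ => 3 + ∑ j ∈ range C, (1 + 2))
    (fun i' s' => ∀ i j, s'.arr K i j = if i < i' ∧ j < C then F i j else s.arr K i j)
    (fun _ _ _ h => h) (fun i j => by simp) (by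
      intro i s1 hi hs1 hx1 hI1
      have hs1' : Same (fill2 K x y ex ey e) s s1 := hs1
      refine (does_forN (τ := τ) (r := r) (x := y) (e := ey) (p := .put K (.var x) (.var y) e)
        (s := s1) (N := C) rfl (hC _ (same_set y 0 s1 hs1' (.inr rfl))) (fun _ => 1)
        (fun j' s' => ∀ i' j, s'.arr K i' j =
          if (i' < i ∧ j < C) ∨ (i' = i ∧ j < j') then F i' j else s.arr K i' j)
        (fun _ _ _ h => h) (fun i' j => by rw [hI1]; simp) (by
          intro j s2 hj hs2 hy2 hI2
          have hx2 : s2.var x = i := by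
            rw [hs2.var x (by simp [wVar_forN, Cmd.wVar, hxy.symm]), hx1]
          have hs2' : Same (fill2 K x y ex ey e) s s2 := hs1'.trans (hs2.of_le
            (fun z hz => by
              simp only [fill2, wVar_forN, Bool.or_eq_false_iff] at hz ⊢
              exact hz.2)
            (fun z hz => by simpa only [fill2, wArr_forN] using hz))
          refine does_put (hx2 : (E.var x).eval s2 = i) (hy2 : (E.var y).eval s2 = j)
            (hF i hi j hj s2 hs2' hx2 hy2) he ?_
          intro i' j'
          rw [setArr_arr]
          by_cases h1 : i' = i ∧ j' = j
          · obtain ⟨rfl, rfl⟩ := h1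
            simp
          · rw [if_neg (by tauto), hI2]
            congr 1
            apply propext
            constructor
            · rintro (h2 | ⟨h2, h3⟩)
              · exact .inl h2
              · exact .inr ⟨h2, by omega⟩
            · rintro (h2 | ⟨h2, h3⟩)
              · exact .inl h2
              · refine .inr ⟨h2, ?_⟩
                by_contra h4
                exact h1 ⟨h2, by omega⟩)).mono le_rfl ?_
      intro s3 _ hI3 i' j
      rw [hI3]
      congr 1
      apply propext
      constructor
      · rintro (h2 | ⟨rfl, h3⟩)
        · exact ⟨by omega, h2.2⟩
        · exact ⟨by omega, h3⟩
      · rintro ⟨h2, h3⟩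
        by_cases h4 : i' = i
        · exact .inr ⟨h4, h3⟩
        · exact .inl ⟨by omega, h3⟩)
  refine h.mono ?_ fun s' _ h => h
  simp
  nlinarith

/-- Set the variable `v` to one if the condition holds for some pair of indices. -/
def scan2 (v x y : ℕ) (ex ey c : E) : Cmd :=
  forN x ex (forN y ey (.ite c (.set v (.const 1)) .skip))

theorem does_scan2 {v x y : ℕ} {ex ey c : E} {s : St} {R C : ℕ} (P : ℕ → ℕ → Prop) (hxy : x ≠ y)
    (hvx : v ≠ x) (hvy : v ≠ y)
    (hR : ∀ s', Same (scan2 v x y ex ey c) s s' → ex.eval s' = R)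
    (hC : ∀ s', Same (scan2 v x y ex ey c) s s' → ey.eval s' = C)
    (hP : ∀ i < R, ∀ j < C, ∀ s', Same (scan2 v x y ex ey c) s s' → s'.var x = i → s'.var y = j →
      (c.eval s' ≠ 0 ↔ P i j)) :
    Does τ r (scan2 v x y ex ey c) s (3 + R * (5 + C * 4)) (fun s' =>
      (s'.var v ≠ 0 ↔ s.var v ≠ 0 ∨ ∃ i < R, ∃ j < C, P i j)) := by
  have same_set : ∀ u w s', Same (scan2 v x y ex ey c) s s' → u = x ∨ u = y →
      Same (scan2 v x y ex ey c) s (s'.setVar u w) := by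
    intro u w s' h hv
    refine h.trans ⟨fun z hz => ?_, fun _ _ => rfl, rfl, rfl⟩
    simp only [scan2, wVar_forN, Bool.or_eq_false_iff, beq_eq_false_iff_ne] at hz
    rw [setVar_var, if_neg]
    rintro rfl
    rcases hv with rfl | rfl
    · exact hz.1 rfl
    · exact hz.2.1 rfl
  have h := does_forN (τ := τ) (r := r) (x := x) (e := ex)
    (p := forN y ey (.ite c (.set v (.const 1)) .skip)) (s := s) (N := R)
    (by simp [wVar_forN, Cmd.wVar, hxy.symm, hvx]) (hR _ (same_set x 0 s (.refl _ _) (.inl rfl)))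
    (fun _ => 3 + ∑ j ∈ range C, (2 + 2))
    (fun i' s' => s'.var v ≠ 0 ↔ s.var v ≠ 0 ∨ ∃ i < i', ∃ j < C, P i j)
    (fun _ _ _ h => by simpa [hvx] using h) (by simp) (by
      intro i s1 hi hs1 hx1 hI1
      have hs1' : Same (scan2 v x y ex ey c) s s1 := hs1
      refine (does_forN (τ := τ) (r := r) (x := y) (e := ey)
        (p := .ite c (.set v (.const 1)) .skip)
        (s := s1) (N := C) (by simp [Cmd.wVar, hvy]) (hC _ (same_set y 0 s1 hs1' (.inr rfl)))
        (fun _ => 2)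
        (fun j' s' => s'.var v ≠ 0 ↔ s1.var v ≠ 0 ∨ ∃ j < j', P i j)
        (fun _ _ _ h => by simpa [hvy] using h) (by simp) (by
          intro j s2 hj hs2 hy2 hI2
          have hx2 : s2.var x = i := by
            rw [hs2.var x (by simp [wVar_forN, Cmd.wVar, hxy.symm, hvx]), hx1]
          have hs2' : Same (scan2 v x y ex ey c) s s2 := hs1'.trans (hs2.of_le
            (fun z hz => by
              simp only [scan2, wVar_forN, Bool.or_eq_false_iff] at hz ⊢
              exact hz.2)
            (fun z hz => by simpa only [scan2, wArr_forN] using hz))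
          have hp := hP i hi j hj s2 hs2' hx2 hy2
          refine does_ite (k := 1) (fun hc => does_set rfl rfl ?_) (fun hc => does_skip ?_)
          · simp only [setVar_var, if_true, E.eval, ne_eq, one_ne_zero, not_false_eq_true, true_iff]
            exact .inr ⟨j, by omega, hp.1 hc⟩
          · rw [hI2]
            apply or_congr_right
            constructor
            · rintro ⟨j', h1, h2⟩
              exact ⟨j', by omega, h2⟩
            · rintro ⟨j', h1, h2⟩
              refine ⟨j', ?_, h2⟩
              by_contra h3
              obtain rfl : j' = j := by omega
              exact hp.2 h2 hc)).mono le_rfl ?_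
      intro s3 _ hI3
      rw [hI3, hI1, or_assoc]
      apply or_congr_right
      constructor
      · rintro (⟨i', h2, h3⟩ | h3)
        · exact ⟨i', by omega, h3⟩
        · exact ⟨i, by omega, h3⟩
      · rintro ⟨i', h2, h3⟩
        by_cases h4 : i' = i
        · exact .inr (h4 ▸ h3)
        · exact .inl ⟨i', by omega, h3⟩)
  refine h.mono ?_ fun s' _ h => h
  simp
  nlinarith

/-- Row `0` of the array `k` starts with the list `l`, and the variable `x` holds its length. -/
def IsList (s : St) (k x : ℕ) (l : List ℕ) : Prop :=
  s.var x = l.length ∧ ∀ i (h : i < l.length), s.arr k 0 i = l[i]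

def filt (x v cnt out : ℕ) (bound src c : E) : Cmd :=
  .seq (.set cnt (.const 0)) (forN x bound (.seq (.set v src)
    (.ite c (.seq (.put out (.const 0) (.var cnt) (.var v))
      (.set cnt (.op .add (.var cnt) (.const 1)))) .skip)))

theorem does_filt {x v cnt out : ℕ} {bound src c : E} {s : St} (l : List ℕ) (p : ℕ → Prop)
    [DecidablePred p] (hxv : v ≠ x) (hxc : cnt ≠ x) (hvc : v ≠ cnt) (hsrc : src.slack.isSome)
    (hb : ∀ s', Same (filt x v cnt out bound src c) s s' → bound.eval s' = l.length)
    (hs : ∀ i (h : i < l.length) s', Same (filt x v cnt out bound src c) s s' → s'.var x = i →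
      src.eval s' = l[i])
    (hc : ∀ z ∈ l, ∀ s', Same (filt x v cnt out bound src c) s s' → s'.var v = z →
      (c.eval s' ≠ 0 ↔ p z)) :
    Does τ r (filt x v cnt out bound src c) s (4 + 6 * l.length) (fun s' =>
      IsList s' out cnt (l.filter p)) := by
  have same_set : ∀ u w s', Same (filt x v cnt out bound src c) s s' → u = x ∨ u = v ∨ u = cnt →
      Same (filt x v cnt out bound src c) s (s'.setVar u w) := by
    intro u w s' h hv
    refine h.trans ⟨fun z hz => ?_, fun _ _ => rfl, rfl, rfl⟩
    simp only [filt, wVar_forN, Cmd.wVar, Bool.or_eq_false_iff, beq_eq_false_iff_ne] at hz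
    rw [setVar_var, if_neg]
    rintro rfl
    rcases hv with rfl | rfl | rfl
    · exact hz.2.1 rfl
    · exact hz.2.2.1 rfl
    · exact hz.1 rfl
  have key : Does τ r (filt x v cnt out bound src c) s
      (1 + (3 + ∑ i ∈ range l.length, (4 + 2))) (fun s' =>
      IsList s' out cnt ((l.take l.length).filter p)) := by
    refine does_seq (P := fun s' => s' = s.setVar cnt 0) (does_set rfl rfl rfl) ?_
    rintro s0 - rfl
    have hs0 := same_set cnt 0 s (.refl _ _) (by simp)
    refine does_forN (N := l.length) (by simp [Cmd.wVar, hxv, hxc]) (hb _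
      (same_set x 0 _ hs0 (by simp)))
      (fun _ => 4) (fun i s' => IsList s' out cnt ((l.take i).filter p)) ?_ ?_ ?_
    · intro i s' w h
      exact ⟨by simpa [hxc] using h.1, h.2⟩
    · simp [IsList]
    · intro i s1 hi hs1 hx1 hI1
      have hs1' : Same (filt x v cnt out bound src c) s s1 :=
        hs0.trans (hs1.seq_right)
      refine does_seq (k := 1) (l := 3) (does_set (hs i hi s1 hs1' hx1) hsrc
        (rfl : (fun s' => s' = s1.setVar v l[i]) _)) ?_
      rintro s2 - rfl
      have hs2 := same_set v l[i] s1 hs1' (by simp)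
      have hc2 := hc l[i] (List.getElem_mem _) _ hs2 (by simp)
      have htake : l.take (i + 1) = l.take i ++ [l[i]] := List.take_succ_eq_append_getElem hi
      refine does_ite (k := 2) (fun h1 => ?_) (fun h1 => (does_skip ?_).mono (by omega)
        fun _ _ h => h)
      · refine does_seq (k := 1) (l := 1) (P := fun s' => s' = (s1.setVar v l[i]).setArr out 0
          (s1.var cnt) l[i]) (does_put (a := 0) (b := s1.var cnt) (v := l[i]) rfl
            (by simp [hvc.symm]) (by simp) rfl rfl) (fun s3 _ h3 => ?_)
        · subst h3
          refine does_set rfl rfl ?_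
          rw [htake, List.filter_append]
          have hp : p l[i] := hc2.1 h1
          obtain ⟨ha, hb'⟩ := hI1
          constructor
          · simp [hp, ha, hvc.symm]
          · intro j hj
            simp only [List.filter_cons, hp, decide_true, if_true, List.filter_nil,
              List.length_append, List.length_singleton] at hj
            simp only [setVar_arr, setArr_arr, true_and, List.filter_cons, hp, decide_true, if_true,
              List.filter_nil]
            by_cases hj2 : j = s1.var cnt
            · subst hj2
              rw [if_pos rfl, List.getElem_append_right (by omega)]
              simp
            · rw [if_neg hj2, List.getElem_append_left (by omega)]
              exact hb' j (by omega)
      · rw [htake, List.filter_append]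
        have hp : ¬ p l[i] := fun h => hc2.2 h h1
        have : List.filter (fun b => decide (p b)) [l[i]] = [] := by simp [hp]
        rw [this, List.append_nil]
        exact ⟨by simpa [hvc.symm] using hI1.1, hI1.2⟩
  refine key.mono (by simp; omega) fun s' _ h => ?_
  rwa [List.take_length] at h

end Rules2

/-! ## Names of the variables and arrays -/

notation "vN" => (0 : ℕ)
notation "vM" => (1 : ℕ)
notation "vRES" => (2 : ℕ)
notation "vS" => (3 : ℕ)
notation "vB" => (4 : ℕ)
notation "vKB" => (5 : ℕ)
notation "vL" => (6 : ℕ)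
notation "vLB" => (7 : ℕ)
notation "vA" => (8 : ℕ)
notation "vXn" => (9 : ℕ)
notation "vY" => (10 : ℕ)
notation "vMODE" => (11 : ℕ)
notation "vYn" => (12 : ℕ)
notation "vD" => (13 : ℕ)
notation "vSn" => (14 : ℕ)
notation "vHn" => (15 : ℕ)
notation "vR" => (16 : ℕ)
notation "vC" => (17 : ℕ)
notation "vG" => (18 : ℕ)
notation "vib" => (19 : ℕ)
notation "vkb" => (20 : ℕ)
notation "vp" => (21 : ℕ)
notation "vq" => (22 : ℕ)
notation "vfi" => (23 : ℕ)
notation "vfe" => (24 : ℕ)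
notation "vj" => (25 : ℕ)
notation "vjb" => (26 : ℕ)
notation "vjc" => (27 : ℕ)
notation "vb" => (28 : ℕ)
notation "vc" => (29 : ℕ)
notation "vu" => (30 : ℕ)
notation "vyl" => (31 : ℕ)
notation "vsi" => (32 : ℕ)
notation "vz" => (33 : ℕ)
notation "vr" => (34 : ℕ)
notation "vv" => (35 : ℕ)
notation "vk" => (36 : ℕ)
notation "vXPn" => (37 : ℕ)
notation "vDLn" => (38 : ℕ)
notation "vl" => (39 : ℕ)
notation "vrr" => (40 : ℕ)
notation "vh" => (41 : ℕ)
notation "vt" => (42 : ℕ)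
notation "vKN" => (43 : ℕ)
notation "vP" => (44 : ℕ)
notation "vW" => (45 : ℕ)

notation "aADJ" => (0 : ℕ)
notation "aDEG" => (1 : ℕ)
notation "aNBR" => (2 : ℕ)
notation "aHASH" => (3 : ℕ)
notation "aH" => (4 : ℕ)
notation "aX" => (5 : ℕ)
notation "aYL" => (6 : ℕ)
notation "aSL" => (7 : ℕ)
notation "aRM" => (8 : ℕ)
notation "aCM" => (9 : ℕ)
notation "aZ" => (10 : ℕ)
notation "aPA" => (11 : ℕ)
notation "aPB" => (12 : ℕ)
notation "aPC" => (13 : ℕ)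
notation "aXP" => (14 : ℕ)
notation "aXX" => (15 : ℕ)
notation "aRLEN" => (16 : ℕ)
notation "aROWB" => (17 : ℕ)
notation "aROWC" => (18 : ℕ)
notation "aRC" => (19 : ℕ)
notation "aBKT" => (20 : ℕ)
notation "aFLAG" => (21 : ℕ)
notation "aDL" => (22 : ℕ)

/-! ## The zero pattern of a rectangular product, computed in square blocks -/

/-- The index `k * g + x`. -/
def eIdx (k x : ℕ) : E := .op .add (.op .mul (.var k) (.var vG)) (.var x)

/-- Positions beyond the true dimensions are filled with 0, so border blocks are padded to full
squares. In `prodFillB` the array `aCM` is read with its indices exchanged: it stores the second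
factor by columns. -/
def prodFillA : Cmd := fill2 aPA vp vq (.var vG) (.var vG)
  (eB (eAnd (eAnd (eLt (eIdx vib vp) (.var vR)) (eLt (eIdx vkb vq) (.var vC)))
    (.arr aRM (eIdx vib vp) (eIdx vkb vq))))

def prodFillB : Cmd := fill2 aPB vp vq (.var vG) (.var vG)
  (eB (eAnd (eLt (eIdx vkb vp) (.var vC)) (.arr aCM (.var vq) (eIdx vkb vp))))

def prodAcc : Cmd := forN vp (.var vG) (forN vq (.var vG)
  (.ite (.arr aPC (.var vp) (.var vq)) (.put aZ (eIdx vib vp) (.var vq) (.const 1)) .skip))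

def prodBlock : Cmd := .seq prodFillA (.seq prodFillB (.seq (.mm vG aPA aPB aPC) prodAcc))

def prod : Cmd := .seq (fill2 aZ vp vq (.var vR) (.var vG) (.const 0))
  (forN vib (.op .add (.op .div (.var vR) (.var vG)) (.const 1))
    (forN vkb (.op .add (.op .div (.var vC) (.var vG)) (.const 1)) prodBlock))

section

variable {τ : ℕ → ℕ} {r : ℕ → Bool}

@[simp] theorem eval_eIdx (s : St) (k x : ℕ) :
    (eIdx k x).eval s = s.var k * s.var vG + s.var x := rfl

theorem bool01_ne_zero (x : ℕ) : bool01 x ≠ 0 ↔ x ≠ 0 := by unfold bool01; omega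

theorem prodEntry_ne_zero (s : St) (g A B i j : ℕ) :
    prodEntry s g A B i j ≠ 0 ↔ ∃ k < g, s.arr A i k ≠ 0 ∧ s.arr B k j ≠ 0 := by
  simp only [prodEntry, ne_eq, Finset.sum_eq_zero_iff, mem_range, mul_eq_zero, not_forall]
  constructor
  · rintro ⟨k, hk, h⟩
    push Not at h
    exact ⟨k, hk, (bool01_ne_zero _).1 h.1, (bool01_ne_zero _).1 h.2⟩
  · rintro ⟨k, hk, h1, h2⟩
    refine ⟨k, hk, ?_⟩
    push Not
    exact ⟨(bool01_ne_zero _).2 h1, (bool01_ne_zero _).2 h2⟩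

theorem does_prodAcc {s : St} {g ib : ℕ} (hg : s.var vG = g) (hib : s.var vib = ib) :
    Does τ r prodAcc s (3 + g * (5 + g * 4)) (fun s' => ∀ i j, s'.arr aZ i j ≠ 0 ↔
      s.arr aZ i j ≠ 0 ∨ ∃ p < g, i = ib * g + p ∧ j < g ∧ s.arr aPC p j ≠ 0) := by
  have h := does_forN (τ := τ) (r := r) (x := vp) (e := .var vG) (p := forN vq (.var vG)
    (.ite (.arr aPC (.var vp) (.var vq)) (.put aZ (eIdx vib vp) (.var vq) (.const 1)) .skip))
    (s := s) (N := g) rfl (by simp [hg]) (fun _ => 3 + ∑ j ∈ range g, (2 + 2))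
    (fun p' s' => ∀ i j, s'.arr aZ i j ≠ 0 ↔
      s.arr aZ i j ≠ 0 ∨ ∃ p < p', i = ib * g + p ∧ j < g ∧ s.arr aPC p j ≠ 0)
    (fun _ _ _ h => h) (by simp) (by
      intro p s1 hp hs1 hp1 hI1
      refine (does_forN (τ := τ) (r := r) (N := g) rfl
        (by simp [hs1.var vG rfl, hg]) (fun _ => 2)
        (fun q' s' => ∀ i j, s'.arr aZ i j ≠ 0 ↔
          s1.arr aZ i j ≠ 0 ∨ (i = ib * g + p ∧ j < q' ∧ s.arr aPC p j ≠ 0))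
        (fun _ _ _ h => h) (by simp) (by
          intro q s2 hq hs2 hq2 hI2
          have hp2 : s2.var vp = p := by rw [hs2.var vp rfl, hp1]
          have hPC : s2.arr aPC = s.arr aPC := by rw [hs2.arr aPC rfl, hs1.arr aPC rfl]
          have hidx : s2.var vib * s2.var vG + s2.var vp = ib * g + p := by
            rw [hp2, hs2.var vG rfl, hs1.var vG rfl, hs2.var vib rfl, hs1.var vib rfl, hg, hib]
          refine does_ite (k := 1) (fun hc => ?_) (fun hc => does_skip ?_)
          · refine does_put (a := ib * g + p) (b := q) (v := 1) hidx hq2 rfl rfl ?_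
            simp only [eval_arr, eval_var, hp2, hq2, hPC] at hc
            intro i j
            rw [setArr_arr]
            by_cases h1 : i = ib * g + p ∧ j = q
            · obtain ⟨rfl, rfl⟩ := h1
              simp [hc]
            · rw [if_neg (by tauto), hI2]
              apply or_congr_right
              constructor
              · rintro ⟨h2, h3, h4⟩; exact ⟨h2, by omega, h4⟩
              · rintro ⟨h2, h3, h4⟩; exact ⟨h2, by omega, h4⟩
          · simp only [eval_arr, eval_var, hp2, hq2, hPC] at hc
            intro i j
            rw [hI2]
            apply or_congr_right
            constructor
            · rintro ⟨h2, h3, h4⟩; exact ⟨h2, by omega, h4⟩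
            · rintro ⟨h2, h3, h4⟩
              refine ⟨h2, ?_, h4⟩
              by_contra h5
              obtain rfl : j = q := by omega
              exact h4 hc)).mono le_rfl ?_
      intro s3 _ hI3 i j
      rw [hI3, hI1, or_assoc]
      apply or_congr_right
      constructor
      · rintro (⟨p', h2, h3⟩ | h3)
        · exact ⟨p', by omega, h3⟩
        · exact ⟨p, by omega, h3⟩
      · rintro ⟨p', h2, h3⟩
        by_cases h4 : p' = p
        · exact .inr (h4 ▸ h3)
        · exact .inl ⟨p', by omega, h3⟩)
  refine h.mono ?_ fun s' _ h => h
  simp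
  nlinarith

theorem does_prodBlock {s : St} {R C g ib kb κ : ℕ} (hR : s.var vR = R) (hC : s.var vC = C)
    (hg : s.var vG = g) (hib : s.var vib = ib) (hkb : s.var vkb = kb) (hg1 : 1 ≤ g) (hκ1 : 1 ≤ κ)
    (hκ : τ g ≤ κ * (g * g)) :
    Does τ r prodBlock s (44 * κ * (g * g)) (fun s' => ∀ i < R, ∀ j < g, s'.arr aZ i j ≠ 0 ↔
      s.arr aZ i j ≠ 0 ∨ (i / g = ib ∧ ∃ k < C, k / g = kb ∧ s.arr aRM i k ≠ 0 ∧
        s.arr aCM j k ≠ 0)) := by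
  have hA := does_fill2 (τ := τ) (r := r) (K := aPA) (x := vp) (y := vq) (ex := .var vG)
    (ey := .var vG) (e := eB (eAnd (eAnd (eLt (eIdx vib vp) (.var vR)) (eLt (eIdx vkb vq)
      (.var vC))) (.arr aRM (eIdx vib vp) (eIdx vkb vq)))) (s := s) (R := g) (C := g)
    (fun p q => if ib * g + p < R ∧ kb * g + q < C ∧ s.arr aRM (ib * g + p) (kb * g + q) ≠ 0 then 1
      else 0) (by decide) rfl (fun s' h => by rw [eval_var, h.var vG rfl, hg])
    (fun s' h => by rw [eval_var, h.var vG rfl, hg]) (by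
      intro p hp q hq s' h hp' hq'
      rw [eB_eval]
      simp only [eAnd_ne, eLt_ne, eval_eIdx, eval_var, eval_arr, h.var vG rfl, h.var vib rfl,
        h.var vkb rfl, h.var vR rfl, h.var vC rfl, h.arr aRM rfl, hp', hq', hR, hC, hg, hib, hkb]
      by_cases h1 : ib * g + p < R <;> by_cases h2 : kb * g + q < C <;>
        by_cases h3 : s.arr aRM (ib * g + p) (kb * g + q) = 0 <;> simp [h1, h2, h3])
  have hB : ∀ s1, Same prodFillA s s1 → Does τ r prodFillB s1 (3 + g * (5 + g * 3)) (fun s' =>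
      ∀ i j, s'.arr aPB i j = if i < g ∧ j < g then
        (if kb * g + i < C ∧ s.arr aCM j (kb * g + i) ≠ 0 then 1 else 0) else s1.arr aPB i j) := by
    intro s1 hs1
    refine does_fill2 (τ := τ) (r := r) (fun p q =>
      if kb * g + p < C ∧ s.arr aCM q (kb * g + p) ≠ 0 then 1 else 0) (by decide) rfl
      (fun s' h => by rw [eval_var, h.var vG rfl, hs1.var vG rfl, hg])
      (fun s' h => by rw [eval_var, h.var vG rfl, hs1.var vG rfl, hg]) ?_
    intro p hp q hq s' h hp' hq'
    rw [eB_eval]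
    simp only [eAnd_ne, eLt_ne, eval_eIdx, eval_var, eval_arr, h.var vG rfl,
      h.var vkb rfl, h.var vC rfl, h.arr aCM rfl, hs1.var vG rfl, hs1.var vkb rfl, hs1.var vC rfl,
      hs1.arr aCM rfl, hp', hq', hC, hg, hkb]
    by_cases h2 : kb * g + p < C <;>
      by_cases h3 : s.arr aCM q (kb * g + p) = 0 <;> simp [h2, h3]
  have hall := does_seq hA fun s1 hs1 h1 => does_seq (hB s1 hs1) fun s2 hs2 h2 =>
    does_seq (p := .mm vG aPA aPB aPC) (q := prodAcc) (k := 1 + g * g + τ g)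
      (P := fun s3 => s3 = s2.mmStep g aPA aPB aPC) (by
        have : s2.var vG = g := by rw [hs2.var vG rfl, hs1.var vG rfl, hg]
        unfold Does
        simp only [run, cost, this]
        exact ⟨trivial, le_rfl⟩) fun s3 hs3 h3 =>
      (does_prodAcc (τ := τ) (r := r) (s := s3) (g := g) (ib := ib)
        (by rw [hs3.var vG rfl, hs2.var vG rfl, hs1.var vG rfl, hg])
        (by rw [hs3.var vib rfl, hs2.var vib rfl, hs1.var vib rfl, hib])).mono le_rfl
        (R := fun s' => ∀ i < R, ∀ j < g, s'.arr aZ i j ≠ 0 ↔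
          s.arr aZ i j ≠ 0 ∨ (i / g = ib ∧ ∃ k < C, k / g = kb ∧ s.arr aRM i k ≠ 0 ∧
            s.arr aCM j k ≠ 0)) (by
        intro s4 _ h4 i hi j hj
        rw [h4 i j, hs3.arr aZ rfl, hs2.arr aZ rfl, hs1.arr aZ rfl]
        apply or_congr_right
        have hPC : ∀ p < g, s3.arr aPC p j ≠ 0 ↔ ∃ k < g, ib * g + p < R ∧ kb * g + k < C ∧
            s.arr aRM (ib * g + p) (kb * g + k) ≠ 0 ∧ s.arr aCM j (kb * g + k) ≠ 0 := by
          intro p hp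
          have e1 : s3.arr aPC p j = prodEntry s2 g aPA aPB p j := by
            rw [h3]; simp [St.mmStep, hp, hj]
          rw [e1, prodEntry_ne_zero]
          constructor
          · rintro ⟨k, hk, a1, a2⟩
            rw [hs2.arr aPA rfl, h1, if_pos ⟨hp, hk⟩] at a1
            rw [h2, if_pos ⟨hk, hj⟩] at a2
            have b1 := (ite_ne_right_iff.1 a1).1
            have b2 := (ite_ne_right_iff.1 a2).1
            exact ⟨k, hk, b1.1, b1.2.1, b1.2.2, b2.2⟩
          · rintro ⟨k, hk, a1, a2, a3, a4⟩
            refine ⟨k, hk, ?_, ?_⟩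
            · rw [hs2.arr aPA rfl, h1, if_pos ⟨hp, hk⟩, if_pos ⟨a1, a2, a3⟩]
              exact one_ne_zero
            · rw [h2, if_pos ⟨hk, hj⟩, if_pos ⟨a2, a4⟩]
              exact one_ne_zero
        have hdiv : ∀ a x, x < g → (a * g + x) / g = a := fun a x hx => by
          rw [add_comm, Nat.add_mul_div_right _ _ (by omega), Nat.div_eq_of_lt hx, zero_add]
        constructor
        · rintro ⟨p, hp, rfl, _, h5⟩
          obtain ⟨k, hk, a1, a2, a3, a4⟩ := (hPC p hp).1 h5
          exact ⟨hdiv _ _ hp, kb * g + k, a2, hdiv _ _ hk, a3, a4⟩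
        · rintro ⟨rfl, k, hk, rfl, a3, a4⟩
          have e1 := Nat.div_add_mod' i g
          have e2 := Nat.div_add_mod' k g
          refine ⟨i % g, Nat.mod_lt _ (by omega), e1.symm, hj, ?_⟩
          rw [hPC _ (Nat.mod_lt _ (by omega))]
          exact ⟨k % g, Nat.mod_lt _ (by omega), by rw [e1]; exact hi, by rw [e2]; exact hk,
            by rw [e1, e2]; exact a3, by rw [e2]; exact a4⟩)
  refine hall.mono ?_ fun s' _ h => h
  have h1 : g ≤ g * g := Nat.le_mul_of_pos_left _ hg1
  have h2 : g * g ≤ κ * (g * g) := Nat.le_mul_of_pos_left _ hκ1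
  have h3 : g * (5 + g * 3) = 5 * g + 3 * (g * g) := by ring
  have h4 : g * (5 + g * 4) = 5 * g + 4 * (g * g) := by ring
  rw [h3, h4, mul_assoc]
  omega

/-- An R × C matrix times a C × g matrix splits into (R/g + 1)(C/g + 1) square products of cost κg²
each. As (R/g + 1)g ≤ R + g, and likewise for C, the total is O(κ(R + g)(C + g)). The last, possibly
empty, block avoids rounding up. -/
theorem does_prod {s : St} {R C g κ : ℕ} (hR : s.var vR = R) (hC : s.var vC = C)
    (hg : s.var vG = g) (hg1 : 1 ≤ g) (hκ1 : 1 ≤ κ) (hκ : τ g ≤ κ * (g * g)) :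
    Does τ r prod s (70 * κ * ((R + g) * (C + g))) (fun s' => ∀ i < R, ∀ j < g, s'.arr aZ i j ≠ 0 ↔
      ∃ k < C, s.arr aRM i k ≠ 0 ∧ s.arr aCM j k ≠ 0) := by
  have hZ := does_fill2 (τ := τ) (r := r) (K := aZ) (x := vp) (y := vq) (ex := .var vR)
    (ey := .var vG) (e := .const 0) (s := s) (R := R) (C := g) (fun _ _ => 0) (by decide) rfl
    (fun s' h => by rw [eval_var, h.var vR rfl, hR])
    (fun s' h => by rw [eval_var, h.var vG rfl, hg]) (fun _ _ _ _ _ _ _ _ => rfl)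
  have hall := does_seq hZ fun s0 hs0 h0 =>
    does_forN (τ := τ) (r := r) (x := vib)
      (e := .op .add (.op .div (.var vR) (.var vG)) (.const 1))
      (p := forN vkb (.op .add (.op .div (.var vC) (.var vG)) (.const 1)) prodBlock)
      (s := s0) (N := R / g + 1) rfl
      (by simp [hs0.var vR rfl, hs0.var vG rfl, hR, hg])
      (fun _ => 3 + ∑ j ∈ range (C / g + 1), (44 * κ * (g * g) + 2))
      (fun ib s' => ∀ i < R, ∀ j < g, s'.arr aZ i j ≠ 0 ↔
        (i / g < ib ∧ ∃ k < C, s.arr aRM i k ≠ 0 ∧ s.arr aCM j k ≠ 0))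
      (fun _ _ _ h => h) (by
        intro i hi j hj
        rw [h0, if_pos ⟨hi, hj⟩]; simp) (by
        intro ib s1 hib hs1 hib1 hI1
        refine (does_forN (τ := τ) (r := r) (x := vkb) (N := C / g + 1) rfl
          (by simp [hs1.var vC rfl, hs1.var vG rfl, hs0.var vC rfl, hs0.var vG rfl, hC, hg])
          (fun _ => 44 * κ * (g * g))
          (fun kb s' => ∀ i < R, ∀ j < g, s'.arr aZ i j ≠ 0 ↔ s1.arr aZ i j ≠ 0 ∨
            (i / g = ib ∧ ∃ k < C, k / g < kb ∧ s.arr aRM i k ≠ 0 ∧ s.arr aCM j k ≠ 0))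
          (fun _ _ _ h => h) (by simp) (by
            intro kb s2 hkb hs2 hkb2 hI2
            have eR : s2.var vR = R := by
              rw [hs2.var vR rfl, hs1.var vR rfl, hs0.var vR rfl, hR]
            have eC : s2.var vC = C := by
              rw [hs2.var vC rfl, hs1.var vC rfl, hs0.var vC rfl, hC]
            have eG : s2.var vG = g := by
              rw [hs2.var vG rfl, hs1.var vG rfl, hs0.var vG rfl, hg]
            have eRM : s2.arr aRM = s.arr aRM := by
              rw [hs2.arr aRM rfl, hs1.arr aRM rfl, hs0.arr aRM rfl]
            have eCM : s2.arr aCM = s.arr aCM := by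
              rw [hs2.arr aCM rfl, hs1.arr aCM rfl, hs0.arr aCM rfl]
            refine (does_prodBlock eR eC eG ((hs2.var vib rfl).trans hib1) hkb2 hg1 hκ1 hκ).mono
              le_rfl ?_
            intro s3 _ h3 i hi j hj
            rw [h3 i hi j hj, hI2 i hi j hj, or_assoc, eRM, eCM]
            apply or_congr_right
            constructor
            · rintro (⟨h4, k, h5, h6, h7⟩ | ⟨h4, k, h5, h6, h7⟩)
              · exact ⟨h4, k, h5, by omega, h7⟩
              · exact ⟨h4, k, h5, by omega, h7⟩
            · rintro ⟨h4, k, h5, h6, h7⟩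
              by_cases h8 : k / g = kb
              · exact .inr ⟨h4, k, h5, h8, h7⟩
              · exact .inl ⟨h4, k, h5, by omega, h7⟩)).mono le_rfl ?_
        intro s3 _ h3 i hi j hj
        rw [h3 i hi j hj, hI1 i hi j hj]
        constructor
        · rintro (⟨h4, h5⟩ | ⟨h4, k, h5, h6, h7⟩)
          · exact ⟨by omega, h5⟩
          · exact ⟨by omega, k, h5, h7⟩
        · rintro ⟨h4, k, h5, h7⟩
          by_cases h8 : i / g = ib
          · exact .inr ⟨h8, k, h5, Nat.lt_succ_of_le (Nat.div_le_div_right h5.le), h7⟩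
          · exact .inl ⟨by omega, k, h5, h7⟩)
  refine hall.mono ?_ fun s' _ h i hi j hj => ?_
  · simp only [Finset.sum_const, card_range, smul_eq_mul]
    have a1 : (R / g + 1) * g ≤ R + g := by
      rw [add_mul, one_mul]; exact Nat.add_le_add_right (Nat.div_mul_le_self R g) _
    have a2 : (C / g + 1) * g ≤ C + g := by
      rw [add_mul, one_mul]; exact Nat.add_le_add_right (Nat.div_mul_le_self C g) _
    have a3 : 1 ≤ C / g + 1 := Nat.le_add_left _ _
    set x := R / g + 1
    set y := C / g + 1
    set Z := κ * ((R + g) * (C + g)) with hZ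
    have a4 : (x * g) * (y * g) ≤ (R + g) * (C + g) := Nat.mul_le_mul a1 a2
    have a5 : κ * ((x * g) * (y * g)) ≤ Z := Nat.mul_le_mul_left _ a4
    have gg : 1 ≤ g * g := Nat.mul_pos hg1 hg1
    have b0 : 1 ≤ κ * (g * g) := Nat.mul_pos hκ1 gg
    have b1 : x * y ≤ Z := by
      refine le_trans ?_ a5
      calc x * y ≤ (x * y) * (κ * (g * g)) := Nat.le_mul_of_pos_right _ b0
        _ = _ := by ring
    have b2 : x ≤ x * y := Nat.le_mul_of_pos_right _ a3
    have b3 : x * (y * (44 * κ * (g * g))) ≤ 44 * Z := by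
      calc x * (y * (44 * κ * (g * g))) = 44 * (κ * ((x * g) * (y * g))) := by ring
        _ ≤ _ := Nat.mul_le_mul_left _ a5
    have b4 : R * g ≤ Z := by
      calc R * g ≤ (R + g) * (C + g) := Nat.mul_le_mul (by omega) (by omega)
        _ ≤ Z := Nat.le_mul_of_pos_left _ hκ1
    have b5 : R ≤ R * g := Nat.le_mul_of_pos_right _ hg1
    have b6 : 1 ≤ x * y := Nat.mul_pos (Nat.succ_pos _) a3
    calc 3 + R * (5 + g * 3) + (3 + x * (3 + y * (44 * κ * (g * g) + 2) + 2))
        = 6 + 5 * R + 3 * (R * g) + 5 * x + 2 * (x * y) + x * (y * (44 * κ * (g * g))) := by ring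
      _ ≤ 70 * Z := by omega
      _ = _ := by rw [hZ]; ring
  · rw [h i hi j hj]
    constructor
    · rintro ⟨_, h1⟩; exact h1
    · intro h1
      exact ⟨Nat.lt_succ_of_le (Nat.div_le_div_right hi.le), h1⟩

end

/-! ## Loops over lists -/

section Lists

variable {τ : ℕ → ℕ} {r : ℕ → Bool}

theorem sum_range_getD (l : List ℕ) (f : ℕ → ℕ) :
    ∑ i ∈ range l.length, f (l.getD i 0) = (l.map f).sum := by
  induction l with
  | nil => simp
  | cons a l ih =>
    rw [List.length_cons, Finset.sum_range_succ', List.map_cons, List.sum_cons, ← ih, add_comm]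
    simp

/-- The loop `for v in l do p`, for a list stored in an array. -/
def forL (x v : ℕ) (bound src : E) (p : Cmd) : Cmd := forN x bound (.seq (.set v src) p)

/-- The invariant is indexed by the prefix already treated, and the cost is a sum over the elements,
so degree sums can be inserted directly. -/
theorem does_forL {x v : ℕ} {bound src : E} {p : Cmd} {s : St} (l : List ℕ) (hxv : v ≠ x)
    (hx : p.wVar x = false) (hsl : src.slack.isSome)
    (hb : bound.eval (s.setVar x 0) = l.length) (K : ℕ → ℕ) (I : List ℕ → St → Prop)
    (hIx : ∀ i s w, I i s → I i (s.setVar x w)) (hIv : ∀ i s w, I i s → I i (s.setVar v w))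
    (h0 : I [] s)
    (hsrc : ∀ i (h : i < l.length) s', Same (forL x v bound src p) s s' → s'.var x = i →
      src.eval s' = l[i])
    (hstep : ∀ pre z suf s', l = pre ++ z :: suf → Same (forL x v bound src p) s s' →
      s'.var v = z → I pre s' → Does τ r p s' (K z) (I (pre ++ [z]))) :
    Does τ r (forL x v bound src p) s (3 + (l.map fun z => K z + 3).sum) (I l) := by
  have h := does_forN (τ := τ) (r := r) (x := x) (e := bound) (p := .seq (.set v src) p) (s := s)
    (N := l.length) (by simp [Cmd.wVar, hxv, hx]) hb (fun i => K (l.getD i 0) + 1)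
    (fun i s' => I (l.take i) s') (fun i s' w h => hIx _ _ _ h) (by simpa using h0) (by
      intro i s1 hi hs1 hx1 hI1
      refine Does.mono (k := 1 + K (l.getD i 0)) (does_seq (does_set (hsrc i hi s1 hs1 hx1) hsl
        (rfl : (fun s' => s' = s1.setVar v l[i]) _)) ?_) (by omega) (fun _ _ h => h)
      rintro s2 - rfl
      have hs2 : Same (forL x v bound src p) s (s1.setVar v l[i]) := by
        refine hs1.trans ⟨fun z hz => ?_, fun _ _ => rfl, rfl, rfl⟩
        simp only [wVar_forN, Cmd.wVar, Bool.or_eq_false_iff, beq_eq_false_iff_ne] at hz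
        rw [setVar_var, if_neg]
        rintro rfl
        exact hz.2.1 rfl
      have h3 := hstep (l.take i) l[i] (l.drop (i + 1)) _ (by simp) hs2 (by simp)
        (hIv _ _ _ hI1)
      have h4 : l.getD i 0 = l[i] := by simp [hi]
      rw [h4, List.take_succ_eq_append_getElem hi]
      exact h3)
  refine h.mono ?_ fun s' _ h => ?_
  · rw [← sum_range_getD]
  · rwa [List.take_length] at h

theorem does_forL_any {x v w : ℕ} {bound src : E} {p : Cmd} {s : St} (l : List ℕ) (hxv : v ≠ x)
    (hwx : w ≠ x) (hwv : w ≠ v)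
    (hx : p.wVar x = false) (hsl : src.slack.isSome)
    (hb : bound.eval (s.setVar x 0) = l.length) (K : ℕ → ℕ) (P : ℕ → Prop)
    (hsrc : ∀ i (h : i < l.length) s', Same (forL x v bound src p) s s' → s'.var x = i →
      src.eval s' = l[i])
    (hstep : ∀ z ∈ l, ∀ s', Same (forL x v bound src p) s s' →
      s'.var v = z → Does τ r p s' (K z) (fun s'' => s''.var w ≠ 0 ↔ s'.var w ≠ 0 ∨ P z)) :
    Does τ r (forL x v bound src p) s (3 + (l.map fun z => K z + 3).sum)
      (fun s' => s'.var w ≠ 0 ↔ s.var w ≠ 0 ∨ ∃ z ∈ l, P z) := by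
  refine does_forL l hxv hx hsl hb K
    (fun pre s' => s'.var w ≠ 0 ↔ s.var w ≠ 0 ∨ ∃ z ∈ pre, P z)
    (fun i s w' h => by simpa [hwx] using h) (fun i s w' h => by simpa [hwv] using h)
    (by simp) hsrc ?_
  intro pre z suf s' hl hs' hv hI
  refine (hstep z (by simp [hl]) s' hs' hv).mono le_rfl ?_
  intro s2 _ h2
  rw [h2, hI]
  simp only [List.mem_append, List.mem_singleton, or_and_right, exists_or, exists_eq_left, or_assoc]

theorem sum_map_le_mul {l : List ℕ} {f : ℕ → ℕ} {k : ℕ} (h : ∀ z ∈ l, f z ≤ k) :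
    (l.map f).sum ≤ l.length * k := by
  induction l with
  | nil => simp
  | cons a l ih =>
    rw [List.map_cons, List.sum_cons, List.length_cons, add_mul, one_mul, add_comm]
    exact Nat.add_le_add (ih fun z hz => h z (List.mem_cons_of_mem _ hz)) (h a List.mem_cons_self)

theorem sum_map_mono {l : List ℕ} {f g : ℕ → ℕ} (h : ∀ z ∈ l, f z ≤ g z) :
    (l.map f).sum ≤ (l.map g).sum := List.sum_le_sum h

theorem sum_map_add' (l : List ℕ) (f g : ℕ → ℕ) :
    (l.map fun z => f z + g z).sum = (l.map f).sum + (l.map g).sum := by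
  induction l with
  | nil => rfl
  | cons a l ih => simp only [List.map_cons, List.sum_cons, ih]; omega

theorem sum_map_mul' (l : List ℕ) (f : ℕ → ℕ) (k : ℕ) :
    (l.map fun z => k * f z).sum = k * (l.map f).sum := by
  induction l with
  | nil => rfl
  | cons a l ih => simp only [List.map_cons, List.sum_cons, ih]; ring

theorem sum_map_const' (l : List ℕ) (k : ℕ) : (l.map fun _ => k).sum = l.length * k := by
  simp

theorem sum_map_subset {l : List ℕ} (hl : l.Nodup) {n : ℕ} (hn : ∀ z ∈ l, z < n) (f : ℕ → ℕ) :
    (l.map f).sum ≤ ∑ z ∈ range n, f z := by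
  rw [← List.sum_toFinset f hl]
  exact Finset.sum_le_sum_of_subset fun z hz => mem_range.2 (hn z (List.mem_toFinset.1 hz))

end Lists

/-! ## The graph, the degree threshold and the hash functions -/

/-- The search sees the graph only through these data. By `le_sq` both n and m are at most s², so s³
stands for m^(3/2); `two_s_le` makes a collision with a set of at most s elements happen with
probability at most 1/2. -/
structure Par where
  n : ℕ
  m : ℕ
  adj : ℕ → ℕ → Prop
  dec : DecidableRel adj
  symm : ∀ {u v}, adj u v → adj v u
  adj_lt : ∀ {u v}, adj u v → v < n
  nb : ℕ → List ℕ
  nodup : ∀ v, (nb v).Nodup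
  mem_nb : ∀ {v z}, z ∈ nb v ↔ adj v z
  sum_deg : ∑ v ∈ range n, (nb v).length ≤ 2 * m
  s : ℕ
  one_le_s : 1 ≤ s
  le_sq : n + m ≤ s * s
  L : ℕ
  B : ℕ
  one_le_L : 1 ≤ L
  two_s_le : 2 * (s + 1) ≤ B
  hash : ℕ → ℕ → ℕ
  hash_lt : ∀ l z, hash l z < B

attribute [instance] Par.dec

namespace Par

variable (P : Par)

def deg (v : ℕ) : ℕ := (P.nb v).length

def heavy (v : ℕ) : Prop := P.s < P.deg v

instance : DecidablePred P.heavy := fun _ => Nat.decLt _ _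

def hl : List ℕ := (List.range P.n).filter P.heavy

/-- The vertices that are neither `a` nor neighbours of `a`. -/
def far (a : ℕ) : List ℕ := (List.range P.n).filter fun z => z ≠ a ∧ ¬ P.adj a z

/-- The common neighbours of `a` and `d`, only the heavy ones if `d` is heavy. -/
def sel (a d : ℕ) : List ℕ :=
  if P.heavy d then P.hl.filter (fun z => P.adj d z ∧ P.adj a z)
  else (P.nb d).filter (fun z => P.adj a z)

variable {P}

theorem mem_hl {v : ℕ} : v ∈ P.hl ↔ P.heavy v ∧ v < P.n := by
  simp [hl, and_comm]

theorem mem_far {a z : ℕ} : z ∈ P.far a ↔ z < P.n ∧ z ≠ a ∧ ¬ P.adj a z := by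
  simp [far]

theorem nodup_far (a : ℕ) : (P.far a).Nodup := List.nodup_range.filter _

theorem sum_deg_le {l : List ℕ} (hl : l.Nodup) (hn : ∀ z ∈ l, z < P.n) :
    (l.map P.deg).sum ≤ 2 * P.m := (sum_map_subset hl hn _).trans P.sum_deg

theorem sum_deg_nb (v : ℕ) : ((P.nb v).map P.deg).sum ≤ 2 * P.m :=
  sum_deg_le (P.nodup v) fun _ hz => P.adj_lt (P.mem_nb.1 hz)

theorem sum_deg_far (a : ℕ) : ((P.far a).map P.deg).sum ≤ 2 * P.m :=
  sum_deg_le (nodup_far a) fun _ hz => (mem_far.1 hz).1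

theorem m_le : P.m ≤ P.s * P.s := (Nat.le_add_left _ _).trans P.le_sq

theorem n_le : P.n ≤ P.s * P.s := (Nat.le_add_right _ _).trans P.le_sq

/-- Each heavy vertex contributes more than `s` to a degree sum of at most 2m ≤ 2s². -/
theorem length_hl : P.hl.length ≤ 2 * P.s := by
  have h1 : P.hl.length * P.s ≤ (P.hl.map P.deg).sum := by
    rw [← sum_map_const']
    exact sum_map_mono fun z hz => (mem_hl.1 hz).1.le
  have h2 := sum_deg_le (P := P) (l := P.hl) (List.nodup_range.filter _) fun z hz => (mem_hl.1 hz).2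
  have h3 := P.m_le
  have h4 := P.one_le_s
  by_contra h
  have : (2 * P.s + 1) * P.s ≤ P.hl.length * P.s := Nat.mul_le_mul_right _ (by omega)
  nlinarith

theorem length_far (a : ℕ) : (P.far a).length ≤ P.n :=
  (List.length_filter_le _ _).trans (by simp)

theorem deg_le (v : ℕ) : P.deg v ≤ P.n := by
  have h : (P.nb v).toFinset ⊆ range P.n := fun z hz =>
    mem_range.2 (P.adj_lt (P.mem_nb.1 (List.mem_toFinset.1 hz)))
  have := Finset.card_le_card h
  rwa [List.toFinset_card_of_nodup (P.nodup v), card_range] at this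

theorem mem_sel {a d z : ℕ} :
    z ∈ P.sel a d ↔ P.adj d z ∧ P.adj a z ∧ (P.heavy d → P.heavy z) := by
  unfold sel
  split_ifs with h
  · simp only [List.mem_filter, mem_hl, decide_eq_true_eq]
    constructor
    · rintro ⟨⟨h1, h2⟩, h3, h4⟩; exact ⟨h3, h4, fun _ => h1⟩
    · rintro ⟨h1, h2, h3⟩; exact ⟨⟨h3 h, P.adj_lt h1⟩, h1, h2⟩
  · simp only [List.mem_filter, P.mem_nb, decide_eq_true_eq]
    tauto

/-- A heavy `d` admits only heavy vertices, and a light `d` has at most `s` neighbours. This is why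
`sel` distinguishes the two cases. -/
theorem length_sel_le (a d : ℕ) : (P.sel a d).length ≤ 2 * P.s := by
  unfold sel
  split_ifs with h
  · exact (List.length_filter_le _ _).trans length_hl
  · have h1 : P.deg d ≤ P.s := not_lt.1 h
    exact (List.length_filter_le _ _).trans (h1.trans (by omega))

theorem length_sel_le_deg (a d : ℕ) : (P.sel a d).length ≤ P.deg d := by
  have h : (P.sel a d).toFinset ⊆ (P.nb d).toFinset := fun z hz => by
    rw [List.mem_toFinset] at hz ⊢
    exact P.mem_nb.2 (mem_sel.1 hz).1
  have hn : (P.sel a d).Nodup := by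
    unfold sel
    split_ifs
    · exact (List.nodup_range.filter _).filter _
    · exact (P.nodup d).filter _
  have := Finset.card_le_card h
  rwa [List.toFinset_card_of_nodup (P.nodup d), List.toFinset_card_of_nodup hn] at this

end Par

/-- The state stores the graph, the list of heavy vertices and the hash values. -/
structure Base (P : Par) (s : St) : Prop where
  n : s.var vN = P.n
  sq : s.var vS = P.s
  B : s.var vB = P.B
  L : s.var vL = P.L
  LB : s.var vLB = P.L * P.B
  adj : ∀ u v, s.arr aADJ u v = 0 ↔ ¬ P.adj u v
  deg : ∀ v, s.arr aDEG 0 v = P.deg v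
  nbr : ∀ v i (h : i < (P.nb v).length), s.arr aNBR v i = (P.nb v)[i]
  hash : ∀ l < P.L, ∀ z < P.n, s.arr aHASH l z = P.hash l z
  hl : IsList s aH vHn P.hl

/-- The command does not write what `Base` speaks about. -/
def Cmd.keeps (c : Cmd) : Bool :=
  !(c.wVar vN || c.wVar vS || c.wVar vB || c.wVar vL || c.wVar vLB || c.wVar vHn ||
    c.wArr aADJ || c.wArr aDEG || c.wArr aNBR || c.wArr aHASH || c.wArr aH)

theorem IsList.congr {s s' : St} {k x : ℕ} {l : List ℕ} (h : IsList s k x l)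
    (hv : s'.var x = s.var x) (ha : s'.arr k = s.arr k) : IsList s' k x l :=
  ⟨hv.trans h.1, fun i hi => by rw [ha]; exact h.2 i hi⟩

theorem Base.same {P : Par} {s s' : St} {c : Cmd} (h : Base P s) (hs : Same c s s')
    (hk : c.keeps = true) : Base P s' := by
  simp only [Cmd.keeps, Bool.not_eq_true', Bool.or_eq_false_iff] at hk
  obtain ⟨⟨⟨⟨⟨⟨⟨⟨⟨⟨h1, h2⟩, h3⟩, h4⟩, h5⟩, h6⟩, h7⟩, h8⟩, h9⟩, h10⟩, h11⟩ := hk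
  exact ⟨(hs.var _ h1).trans h.n, (hs.var _ h2).trans h.sq, (hs.var _ h3).trans h.B,
    (hs.var _ h4).trans h.L, (hs.var _ h5).trans h.LB, by rw [hs.arr _ h7]; exact h.adj,
    by rw [hs.arr _ h8]; exact h.deg, by rw [hs.arr _ h9]; exact h.nbr,
    by rw [hs.arr _ h10]; exact h.hash, h.hl.congr (hs.var _ h6) (hs.arr _ h11)⟩

theorem Base.setVar {P : Par} {s : St} (h : Base P s) (x v : ℕ)
    (hx : (Cmd.set x (.const 0)).keeps = true) : Base P (s.setVar x v) := by
  refine h.same (c := .set x (.const 0)) ⟨fun y hy => ?_, fun _ _ => rfl, rfl, rfl⟩ hx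
  simp only [Cmd.wVar, beq_eq_false_iff_ne] at hy
  rw [setVar_var, if_neg (Ne.symm hy)]

/-! ## Searching two vertices that complete `a` and `d` -/

def selD : Cmd :=
  .ite (eLt (.var vS) (.arr aDEG (.const 0) (.var vD)))
    (filt vfi vfe vSn aSL (.var vHn) (.arr aH (.const 0) (.var vfi))
      (eAnd (.arr aADJ (.var vD) (.var vfe)) (.arr aADJ (.var vA) (.var vfe))))
    (filt vfi vfe vSn aSL (.arr aDEG (.const 0) (.var vD)) (.arr aNBR (.var vD) (.var vfi))
      (.arr aADJ (.var vA) (.var vfe)))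

/-- The entry `0` or `1`: neither the `p`-th selected vertex nor `d` sees the `q`-th vertex. -/
def eMiss : E := eB (eAnd
  (eNot (.arr aADJ (.arr aSL (.const 0) (.var vp)) (.arr aYL (.const 0) (.var vq))))
  (eNot (.arr aADJ (.var vD) (.arr aYL (.const 0) (.var vq)))))

/-- A zero entry of the product means that no vertex of the list is missed by both candidates and
`d`. A nonzero mode switches off the requirement that the pair be flagged for the current `a`. -/
def checkScan : Cmd := scan2 vRES vp vq (.var vR) (.var vG)
  (eAnd (eNot (.arr aZ (.var vp) (.var vq)))
    (eAnd (.arr aADJ (.arr aSL (.const 0) (.var vp)) (.arr aSL (.const 0) (.var vq)))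
      (eOr (.var vMODE) (eEq (.arr aFLAG (.arr aSL (.const 0) (.var vp))
        (.arr aSL (.const 0) (.var vq))) (.op .add (.var vA) (.const 1))))))

def checkMain : Cmd :=
  .seq (.set vR (.var vSn)) (.seq (.set vG (.var vSn)) (.seq (.set vC (.var vYn))
    (.seq (fill2 aRM vp vq (.var vR) (.var vC) eMiss)
      (.seq (fill2 aCM vp vq (.var vG) (.var vC) eMiss) (.seq prod checkScan)))))

def checkD : Cmd := .seq selD (.ite (.var vSn) checkMain .skip)

/-- What `checkD` looks for. -/
def Par.Found (P : Par) (s : St) (a d : ℕ) (Y : List ℕ) : Prop :=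
  ∃ p ∈ P.sel a d, ∃ q ∈ P.sel a d, P.adj p q ∧ (s.var vMODE ≠ 0 ∨ s.arr aFLAG p q = a + 1) ∧
    ∀ y ∈ Y, P.adj p y ∨ P.adj q y ∨ P.adj d y

section Check

variable {τ : ℕ → ℕ} {r : ℕ → Bool} {P : Par} {κ : ℕ}

theorem does_selD {s : St} {a d : ℕ} (hb : Base P s) (hd : s.var vD = d) (ha : s.var vA = a) :
    Does τ r selD s (5 + 12 * P.s) (fun s' => IsList s' aSL vSn (P.sel a d)) := by
  refine (does_ite (k := 4 + 12 * P.s) (fun h => ?_) (fun h => ?_)).mono (by omega)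
    (fun _ _ h => h)
  · have hh : P.heavy d := by
      simpa [hb.deg, hb.sq, hd, Par.heavy] using h
    refine (does_filt P.hl (fun z => P.adj d z ∧ P.adj a z) (by decide) (by decide)
      (by decide) rfl ?_ ?_ ?_).mono ?_ ?_
    · intro s' hs'
      rw [eval_var, hs'.var vHn rfl, hb.hl.1]
    · intro i hi s' hs' hx
      rw [eval_arr, hs'.arr aH rfl, eval_var, hx, eval_cst, hb.hl.2 i hi]
    · intro z hz s' hs' hx
      simp [hs'.arr aADJ rfl, hx, hs'.var vD rfl, hs'.var vA rfl, hd, ha, hb.adj]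
    · have := P.length_hl; omega
    · intro s' _ h; rwa [Par.sel, if_pos hh]
  · have hh : ¬ P.heavy d := by
      simpa [hb.deg, hb.sq, hd, Par.heavy] using h
    have hh' : P.deg d ≤ P.s := not_lt.1 hh
    refine (does_filt (P.nb d) (fun z => P.adj a z) (by decide) (by decide)
      (by decide) rfl ?_ ?_ ?_).mono ?_ ?_
    · intro s' hs'
      rw [eval_arr, hs'.arr aDEG rfl, eval_cst, hb.deg, eval_var, hs'.var vD rfl, hd, Par.deg]
    · intro i hi s' hs' hx
      rw [eval_arr, hs'.arr aNBR rfl, eval_var, eval_var, hx, hs'.var vD rfl, hd, hb.nbr]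
    · intro z hz s' hs' hx
      simp [hs'.arr aADJ rfl, hx, hs'.var vA rfl, ha, hb.adj]
    · unfold Par.deg at hh'; omega
    · intro s' _ h; rwa [Par.sel, if_neg hh]

theorem does_set_eq {s : St} {x : ℕ} {e : E} {v : ℕ} (hv : e.eval s = v) (he : e.slack.isSome) :
    Does τ r (.set x e) s 1 (fun s' => s' = s.setVar x v) := does_set hv he rfl

/-- An entry of the product is nonzero exactly when some y in `Y` is seen by none of p, q and d.
Both factors use the same incidence of misses, since the second one is stored by columns. -/
theorem does_checkMain {s : St} {a d : ℕ} {S Y : List ℕ} (hb : Base P s) (hd : s.var vD = d)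
    (ha : s.var vA = a) (hS : IsList s aSL vSn S) (hY : IsList s aYL vYn Y) (hS1 : 1 ≤ S.length)
    (hκ1 : 1 ≤ κ) (hκ : τ S.length ≤ κ * (S.length * S.length)) :
    Does τ r checkMain s (200 * κ * (S.length * (S.length + Y.length))) (fun s' =>
      s'.var vRES ≠ 0 ↔ s.var vRES ≠ 0 ∨ ∃ p ∈ S, ∃ q ∈ S, P.adj p q ∧
        (s.var vMODE ≠ 0 ∨ s.arr aFLAG p q = a + 1) ∧
        ∀ y ∈ Y, P.adj p y ∨ P.adj q y ∨ P.adj d y) := by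
  set g := S.length with hg
  have hmiss : ∀ i < g, ∀ k < Y.length, ∀ s', s'.arr aADJ = s.arr aADJ → s'.arr aSL = s.arr aSL →
      s'.arr aYL = s.arr aYL → s'.var vD = d → s'.var vp = i → s'.var vq = k →
      eMiss.eval s' = if P.adj (S.getD i 0) (Y.getD k 0) ∨ P.adj d (Y.getD k 0) then 0 else 1 := by
    intro i hi k hk s' h1 h2 h3 h4 h5 h6
    unfold eMiss
    rw [eB_eval]
    simp only [eAnd_ne, eNot_ne, eval_arr, eval_var, eval_cst, h1, h2, h3, h4, h5, h6, hb.adj,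
      not_not, hS.2 i hi, hY.2 k hk]
    simp [hk, hg ▸ hi]
  have hall : Does τ r checkMain s (1 + (1 + (1 + ((3 + g * (5 + Y.length * 3)) +
      ((3 + g * (5 + Y.length * 3)) + (70 * κ * ((g + g) * (Y.length + g)) +
        (3 + g * (5 + g * 4)))))))) (fun s' =>
      s'.var vRES ≠ 0 ↔ s.var vRES ≠ 0 ∨ ∃ p < g, ∃ q < g, P.adj (S.getD p 0) (S.getD q 0) ∧
        (s.var vMODE ≠ 0 ∨ s.arr aFLAG (S.getD p 0) (S.getD q 0) = a + 1) ∧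
        ∀ y ∈ Y, P.adj (S.getD p 0) y ∨ P.adj (S.getD q 0) y ∨ P.adj d y) := by
    refine does_seq (does_set_eq hS.1 rfl) ?_
    rintro _ - rfl
    refine does_seq (does_set_eq (v := g) (by simpa using hS.1) rfl) ?_
    rintro _ - rfl
    refine does_seq (does_set_eq (v := Y.length) (by simpa using hY.1) rfl) ?_
    rintro s0 - hs0
    have e0 : ∀ k, s0.arr k = s.arr k := fun k => by rw [hs0]; rfl
    refine does_seq (does_fill2 (R := g) (C := Y.length) (fun i k =>
      if P.adj (S.getD i 0) (Y.getD k 0) ∨ P.adj d (Y.getD k 0) then 0 else 1) (by decide) rfl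
      (fun s' h => by rw [eval_var, h.var vR rfl, hs0]; simp [hg])
      (fun s' h => by rw [eval_var, h.var vC rfl, hs0]; simp) (fun i hi k hk s' h hx hy => ?_)) ?_
    · exact hmiss i hi k hk s' (by rw [h.arr aADJ rfl, e0]) (by rw [h.arr aSL rfl, e0])
        (by rw [h.arr aYL rfl, e0]) (by rw [h.var vD rfl, hs0]; simpa using hd) hx hy
    intro s1 hs1 h1
    refine does_seq (does_fill2 (R := g) (C := Y.length) (fun i k =>
      if P.adj (S.getD i 0) (Y.getD k 0) ∨ P.adj d (Y.getD k 0) then 0 else 1) (by decide) rfl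
      (fun s' h => by rw [eval_var, h.var vG rfl, hs1.var vG rfl, hs0]; simp)
      (fun s' h => by rw [eval_var, h.var vC rfl, hs1.var vC rfl, hs0]; simp)
      (fun i hi k hk s' h hx hy => ?_)) ?_
    · exact hmiss i hi k hk s' (by rw [h.arr aADJ rfl, hs1.arr aADJ rfl, e0])
        (by rw [h.arr aSL rfl, hs1.arr aSL rfl, e0])
        (by rw [h.arr aYL rfl, hs1.arr aYL rfl, e0])
        (by rw [h.var vD rfl, hs1.var vD rfl, hs0]; simpa using hd) hx hy
    intro s2 hs2 h2
    refine does_seq (does_prod (R := g) (C := Y.length) (g := g) (κ := κ)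
      (by rw [hs2.var vR rfl, hs1.var vR rfl, hs0]; simp [hg])
      (by rw [hs2.var vC rfl, hs1.var vC rfl, hs0]; simp)
      (by rw [hs2.var vG rfl, hs1.var vG rfl, hs0]; simp) hS1 hκ1 hκ) ?_
    intro s3 hs3 h3
    have eV : ∀ v, prod.wVar v = false → (fill2 aRM vp vq (.var vR) (.var vC) eMiss).wVar v = false →
        v ≠ vR → v ≠ vG → v ≠ vC → s3.var v = s.var v := by
      intro v k1 k2 k3 k4 k5
      rw [hs3.var v k1, hs2.var v k2, hs1.var v k2, hs0]
      simp [k3, k4, k5]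
    have eA : ∀ k, prod.wArr k = false → (fill2 aRM vp vq (.var vR) (.var vC) eMiss).wArr k = false →
        (fill2 aCM vp vq (.var vR) (.var vC) eMiss).wArr k = false → s3.arr k = s.arr k := by
      intro v k1 k2 k3
      rw [hs3.arr v k1, hs2.arr v k3, hs1.arr v k2, e0]
    refine (does_scan2 (R := g) (C := g) (fun p q => P.adj (S.getD p 0) (S.getD q 0) ∧
        (s.var vMODE ≠ 0 ∨ s.arr aFLAG (S.getD p 0) (S.getD q 0) = a + 1) ∧
        ∀ y ∈ Y, P.adj (S.getD p 0) y ∨ P.adj (S.getD q 0) y ∨ P.adj d y) (by decide) (by decide)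
        (by decide)
      (fun s' h => by simp [h.var vR rfl, hs3.var vR rfl, hs2.var vR rfl, hs1.var vR rfl, hs0, hg])
      (fun s' h => by simp [h.var vG rfl, hs3.var vG rfl, hs2.var vG rfl, hs1.var vG rfl, hs0])
      ?_).mono le_rfl ?_
    · intro p hp q hq s' h hx hy
      have hz := h3 p hp q hq
      have hz' : s3.arr aZ p q = 0 ↔
          ∀ y ∈ Y, P.adj (S.getD p 0) y ∨ P.adj (S.getD q 0) y ∨ P.adj d y := by
        rw [← not_iff_not, ← ne_eq, hz]
        push Not
        simp only [hs2.arr aRM rfl, h1, h2]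
        constructor
        · rintro ⟨k, hk, k1, k2⟩
          rw [if_pos ⟨hp, hk⟩] at k1
          rw [if_pos ⟨hq, hk⟩] at k2
          simp only [ne_eq, ite_eq_left_iff, one_ne_zero, imp_false, not_not, not_or] at k1 k2
          refine ⟨Y.getD k 0, by simp [hk], k1.1, k2⟩
        · rintro ⟨y, hy, k1, k2, k3⟩
          obtain ⟨k, hk, rfl⟩ := List.getElem_of_mem hy
          refine ⟨k, hk, ?_, ?_⟩
          · rw [if_pos ⟨hp, hk⟩, if_neg (by simpa [hk] using ⟨k1, k3⟩)]; exact one_ne_zero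
          · rw [if_pos ⟨hq, hk⟩, if_neg (by simpa [hk] using ⟨k2, k3⟩)]; exact one_ne_zero
      have hSp : s.arr aSL 0 p = S.getD p 0 := by rw [hS.2 p hp]; simp [hg ▸ hp]
      have hSq : s.arr aSL 0 q = S.getD q 0 := by rw [hS.2 q hq]; simp [hg ▸ hq]
      simp only [ne_eq, eAnd_ne, eOr_ne, eEq_ne, eNot_ne, eval_arr, eval_var, eval_cst,
        eval_op_add, h.arr aZ rfl, h.arr aADJ rfl, h.arr aSL rfl, h.arr aFLAG rfl, h.var vMODE rfl,
        h.var vA rfl, hx, hy, eA aADJ rfl rfl rfl, eA aSL rfl rfl rfl, eA aFLAG rfl rfl rfl, hSp,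
        hSq, eV vMODE rfl rfl (by decide) (by decide) (by decide), ha,
        eV vA rfl rfl (by decide) (by decide) (by decide), hb.adj, hz']
      tauto
    · intro s4 _ h4
      rw [h4, eV vRES rfl rfl (by decide) (by decide) (by decide)]
  refine hall.mono ?_ fun s' _ h => ?_
  · have b1 : 1 ≤ g * g := Nat.mul_pos hS1 hS1
    have b2 : g ≤ g * g := Nat.le_mul_of_pos_left _ hS1
    have b3 : g * g + g * Y.length ≤ κ * (g * g + g * Y.length) := Nat.le_mul_of_pos_left _ hκ1
    calc _ = 12 + 15 * g + 6 * (g * Y.length) + 4 * (g * g) +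
          140 * (κ * (g * g + g * Y.length)) := by ring
      _ ≤ 200 * (κ * (g * g + g * Y.length)) := by omega
      _ = _ := by ring
  · rw [h]
    apply or_congr_right
    constructor
    · rintro ⟨p, hp, q, hq, hh⟩
      exact ⟨_, by simp [hg ▸ hp], _, by simp [hg ▸ hq], hh⟩
    · rintro ⟨p, hp, q, hq, hh⟩
      obtain ⟨i, hi, rfl⟩ := List.getElem_of_mem hp
      obtain ⟨j, hj, rfl⟩ := List.getElem_of_mem hq
      exact ⟨i, hi, j, hj, by simpa [hi, hj] using hh⟩

theorem does_checkD {s : St} {a d : ℕ} {Y : List ℕ} (hb : Base P s) (hd : s.var vD = d)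
    (ha : s.var vA = a) (hY : IsList s aYL vYn Y) (hκ1 : 1 ≤ κ)
    (hκ : ∀ g, 1 ≤ g → g ≤ 2 * P.s + 2 → τ g ≤ κ * (g * g)) :
    Does τ r checkD s (7 + 12 * P.s +
      200 * κ * ((P.sel a d).length * ((P.sel a d).length + Y.length))) (fun s' =>
      s'.var vRES ≠ 0 ↔ s.var vRES ≠ 0 ∨ P.Found s a d Y) := by
  refine (does_seq (does_selD hb hd ha) (l := 1 + (1 +
    200 * κ * ((P.sel a d).length * ((P.sel a d).length + Y.length)))) fun s1 hs1 h1 =>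
    does_ite (fun h => ?_) (fun h => ?_)).mono (by omega) (fun _ _ h => h)
  · rw [eval_var, h1.1] at h
    refine (does_checkMain (hb.same hs1 rfl) (by rw [hs1.var vD rfl, hd])
      (by rw [hs1.var vA rfl, ha]) h1 (hY.congr (hs1.var vYn rfl) (hs1.arr aYL rfl))
      (Nat.pos_of_ne_zero h) hκ1 (hκ _ (Nat.pos_of_ne_zero h)
        ((P.length_sel_le a d).trans (by omega)))).mono (by omega) ?_
    intro s2 _ h2
    rw [h2, hs1.var vRES rfl, hs1.var vMODE rfl, hs1.arr aFLAG rfl, Par.Found]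
  -- Without candidates no product is formed: its block size would be 0.
  · rw [eval_var, h1.1, List.length_eq_zero_iff] at h
    refine (does_skip ?_).mono (by omega) (fun _ _ h => h)
    rw [hs1.var vRES rfl, Par.Found, h]
    simp

/-- Run `checkD` for all common neighbours `d` of `a` and of the vertex in the variable `x`. -/
def checkAll (x : ℕ) : Cmd := forL vj vD (.arr aDEG (.const 0) (.var x)) (.arr aNBR (.var x) (.var vj))
  (.ite (.arr aADJ (.var vA) (.var vD)) checkD .skip)

theorem does_checkAll {s : St} {a x w : ℕ} {Y : List ℕ} (hb : Base P s)
    (hx : (checkAll x).wVar x = false) (hw : s.var x = w)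
    (ha : s.var vA = a) (hY : IsList s aYL vYn Y) (hκ1 : 1 ≤ κ)
    (hκ : ∀ g, 1 ≤ g → g ≤ 2 * P.s + 2 → τ g ≤ κ * (g * g)) :
    Does τ r (checkAll x) s (3 + ((P.nb w).map fun d => 8 + 12 * P.s +
      200 * κ * ((P.sel a d).length * ((P.sel a d).length + Y.length)) + 3).sum) (fun s' =>
      s'.var vRES ≠ 0 ↔ s.var vRES ≠ 0 ∨ ∃ d ∈ P.nb w, P.adj a d ∧ P.Found s a d Y) := by
  have hk : (checkAll x).keeps = true := rfl
  have hxj : x ≠ vj := by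
    rintro rfl
    simp [checkAll, forL, wVar_forN] at hx
  refine does_forL_any (P.nb w) (by decide) (by decide) (by decide) rfl rfl
    (by simp [hxj, hb.deg, hw, Par.deg]) _ (fun d => P.adj a d ∧ P.Found s a d Y) ?_ ?_
  · intro i hi s' hs' hx'
    rw [eval_arr, eval_var, eval_var, hx', hs'.var x hx, hw, hs'.arr aNBR rfl, hb.nbr]
  · intro d hd s' hs' hv
    have hs'' : Same (checkAll x) s s' := hs'
    have hF : P.Found s' a d Y ↔ P.Found s a d Y := by
      unfold Par.Found
      rw [hs''.var vMODE rfl, hs''.arr aFLAG rfl]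
    have hb' := hb.same hs'' rfl
    refine (does_ite (k := 7 + 12 * P.s +
      200 * κ * ((P.sel a d).length * ((P.sel a d).length + Y.length))) (fun h => ?_)
      (fun h => ?_)).mono (by omega) (fun _ _ h => h)
    · have h' : P.adj a d := by
        simpa [hb'.adj, hv, hs''.var vA rfl, ha] using h
      refine (does_checkD hb' hv (by rw [hs''.var vA rfl, ha]) (hY.congr (hs''.var vYn rfl)
        (hs''.arr aYL rfl)) hκ1 hκ).mono le_rfl ?_
      intro s2 _ h2
      rw [h2, hF]
      tauto
    · have h' : ¬ P.adj a d := by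
        simpa [hb'.adj, hv, hs''.var vA rfl, ha] using h
      refine (does_skip ?_).mono (by omega) (fun _ _ h => h)
      tauto

end Check

/-! ## The sets of vertices that are not dominated by three given vertices -/

/-- The vertices that see none of `a`, `b`, `c`. -/
def Par.un (P : Par) (a b c : ℕ) : List ℕ :=
  ((P.far a).filter fun z => ¬ P.adj b z).filter fun z => ¬ P.adj c z

theorem Par.mem_un {P : Par} {a b c z : ℕ} :
    z ∈ P.un a b c ↔ z ∈ P.far a ∧ ¬ P.adj b z ∧ ¬ P.adj c z := by
  simp [Par.un, and_comm (a := ¬ P.adj c z)]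

/-- `FLAG b c = a + 1` is only set if all vertices that see none of `a`, `b`, `c` are heavy. -/
def FlagOK (P : Par) (s : St) : Prop :=
  ∀ p q a, s.arr aFLAG p q = a + 1 → ∀ z ∈ P.un a p q, P.heavy z

/-- The rows stored so far; the pairs in `done` have been treated. -/
structure Rows (P : Par) (a : ℕ) (done : ℕ → ℕ → Prop) (s : St) : Prop where
  len : ∀ i < s.var vr, s.arr aRLEN 0 i = (P.un a (s.arr aROWB 0 i) (s.arr aROWC 0 i)).length
  small : ∀ i < s.var vr, s.arr aRLEN 0 i ≤ P.s
  row : ∀ i < s.var vr, ∀ j (h : j < (P.un a (s.arr aROWB 0 i) (s.arr aROWC 0 i)).length),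
    s.arr aXX i j = (P.un a (s.arr aROWB 0 i) (s.arr aROWC 0 i))[j]
  tri : ∀ i < s.var vr, P.adj a (s.arr aROWB 0 i) ∧ P.adj a (s.arr aROWC 0 i) ∧
    P.adj (s.arr aROWB 0 i) (s.arr aROWC 0 i)
  bkt : ∀ v ∈ P.far a, ∀ k < s.arr aRC 0 v, s.arr aBKT v k < s.var vr
  light : ∀ v ∈ P.far a, s.arr aRC 0 v ≠ 0 → ¬ P.heavy v
  sum : ((P.far a).map fun v => s.arr aRC 0 v).sum = s.var vr
  cov : ∀ b c, done b c → (P.un a b c).length ≤ P.s →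
    ((∀ z ∈ P.un a b c, P.heavy z) ∧ s.arr aFLAG b c = a + 1) ∨
    ∃ v ∈ P.un a b c, ∃ k < s.arr aRC 0 v, s.arr aROWB 0 (s.arr aBKT v k) = b ∧
      s.arr aROWC 0 (s.arr aBKT v k) = c
  flag : FlagOK P s

/-- The command does not write what `Rows` speaks about. -/
def Cmd.keepsRows (c : Cmd) : Bool :=
  !(c.wVar vr || c.wArr aRLEN || c.wArr aROWB || c.wArr aROWC || c.wArr aXX || c.wArr aRC ||
    c.wArr aBKT || c.wArr aFLAG)

theorem Rows.same {P : Par} {a : ℕ} {done : ℕ → ℕ → Prop} {s s' : St} {c : Cmd}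
    (h : Rows P a done s) (hs : Same c s s') (hk : c.keepsRows = true) : Rows P a done s' := by
  simp only [Cmd.keepsRows, Bool.not_eq_true', Bool.or_eq_false_iff] at hk
  obtain ⟨⟨⟨⟨⟨⟨⟨h1, h2⟩, h3⟩, h4⟩, h5⟩, h6⟩, h7⟩, h8⟩ := hk
  have e1 := hs.var _ h1
  have e2 := hs.arr _ h2
  have e3 := hs.arr _ h3
  have e4 := hs.arr _ h4
  have e5 := hs.arr _ h5
  have e6 := hs.arr _ h6
  have e7 := hs.arr _ h7
  have e8 := hs.arr _ h8
  obtain ⟨f1, f2, f3, f4, f5, f6, f7, f8, f9⟩ := h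
  constructor
  · rwa [e1, e2, e3, e4]
  · rwa [e1, e2]
  · rwa [e1, e3, e4, e5]
  · rwa [e1, e3, e4]
  · rwa [e1, e6, e7]
  · rwa [e6]
  · rwa [e1, e6]
  · rwa [e8, e6, e7, e3, e4]
  · unfold FlagOK at f9 ⊢; rwa [e8]

theorem Rows.setVar {P : Par} {a : ℕ} {done : ℕ → ℕ → Prop} {s : St} (h : Rows P a done s)
    (x v : ℕ) (hx : x ≠ vr) : Rows P a done (s.setVar x v) := by
  obtain ⟨f1, f2, f3, f4, f5, f6, f7, f8, f9⟩ := h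
  have e1 : (s.setVar x v).var vr = s.var vr := by rw [setVar_var, if_neg hx.symm]
  constructor
  · rwa [e1]
  · rwa [e1]
  · rwa [e1]
  · rwa [e1]
  · rwa [e1]
  · exact f6
  · rwa [e1]
  · exact f8
  · exact f9

theorem Rows.congr_done {P : Par} {a : ℕ} {done done' : ℕ → ℕ → Prop} {s : St}
    (h : Rows P a done s) (hd : ∀ b c, done' b c → done b c) : Rows P a done' s :=
  { h with cov := fun b c hbc => h.cov b c (hd b c hbc) }

/-! ## The commands that build the rows -/

/-- `vu` counts the vertices found that see none of a, b, c, and `vsi` is the position of the scan.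
`vyl` remembers a light one among them as its number plus 1, so that 0 can mean none. -/
def scanBody : Cmd := .seq (.set vz (.arr aXP (.const 0) (.var vsi)))
  (.seq (.ite (.arr aADJ (.var vc) (.var vz)) .skip
    (.seq (.put aXX (.var vr) (.var vu) (.var vz)) (.seq (.set vu (.op .add (.var vu) (.const 1)))
      (.ite (eLt (.var vS) (.arr aDEG (.const 0) (.var vz))) .skip
        (.set vyl (.op .add (.var vz) (.const 1)))))))
    (.set vsi (.op .add (.var vsi) (.const 1))))

/-- The scan breaks off once more than `s` vertices have been found: then no light d can complete
the pair. -/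
def scanC : Cmd := .seq (.set vu (.const 0)) (.seq (.set vyl (.const 0)) (.seq (.set vsi (.const 0))
  (.loop (.var vXPn) (eLe (.var vu) (.var vS)) scanBody)))

def storeRow : Cmd := .seq (.set vv (.op .sub (.var vyl) (.const 1)))
  (.seq (.put aRLEN (.const 0) (.var vr) (.var vu)) (.seq (.put aROWB (.const 0) (.var vr) (.var vb))
    (.seq (.put aROWC (.const 0) (.var vr) (.var vc))
      (.seq (.put aBKT (.var vv) (.arr aRC (.const 0) (.var vv)) (.var vr))
        (.seq (.put aRC (.const 0) (.var vv) (.op .add (.arr aRC (.const 0) (.var vv)) (.const 1)))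
          (.set vr (.op .add (.var vr) (.const 1))))))))

def rowsC : Cmd := .seq scanC (.ite (eLe (.var vu) (.var vS)) (.ite (.var vyl) storeRow
  (.put aFLAG (.var vb) (.var vc) (.op .add (.var vA) (.const 1)))) .skip)

def rowsB : Cmd := .seq (filt vfi vfe vXPn aXP (.var vXn) (.arr aX (.const 0) (.var vfi))
    (eNot (.arr aADJ (.var vb) (.var vfe))))
  (forL vjc vc (.arr aDEG (.const 0) (.var vb)) (.arr aNBR (.var vb) (.var vjc))
    (.ite (.arr aADJ (.var vA) (.var vc)) rowsC .skip))

/-- Only the bucket sizes are reset. Old entries of buckets, rows and flags may stay, because rows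
and buckets are read below the current counts and a flag carries the number of its vertex a. -/
def clearRC : Cmd := forL vj vv (.var vXn) (.arr aX (.const 0) (.var vj))
  (.put aRC (.const 0) (.var vv) (.const 0))

def buildRows : Cmd := .seq (.set vr (.const 0)) (.seq clearRC
  (forL vjb vb (.arr aDEG (.const 0) (.var vY)) (.arr aNBR (.var vY) (.var vjb))
    (.ite (eAnd (.arr aADJ (.var vA) (.var vb)) (eLt (.var vS) (.arr aDEG (.const 0) (.var vb))))
      rowsB .skip)))

section Build

variable {τ : ℕ → ℕ} {r : ℕ → Bool} {P : Par}

theorem does_put_eq {s : St} {k : ℕ} {i j e : E} {a b v : ℕ} (hi : i.eval s = a)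
    (hj : j.eval s = b) (hv : e.eval s = v) (he : e.slack.isSome) :
    Does τ r (.put k i j e) s 1 (fun s' => s' = s.setArr k a b v) := does_put hi hj hv he rfl

/-- Each step either meets a neighbour of c or increases `vu`, which stops at s + 1. So the number
of steps is at most the number of neighbours of c in the list plus s + 1, and not the length of the
list. -/
theorem does_scanC {s : St} {c : ℕ} {XP : List ℕ} (hb : Base P s) (hc : s.var vc = c)
    (hX : IsList s aXP vXPn XP) :
    Does τ r scanC s (5 + ((XP.filter fun z => P.adj c z).length + P.s + 1) * 8) (fun s' =>
      (s'.var vu ≤ P.s → s'.var vu = (XP.filter fun z => ¬ P.adj c z).length ∧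
        (∀ j (h : j < (XP.filter fun z => ¬ P.adj c z).length),
          s'.arr aXX (s.var vr) j = (XP.filter fun z => ¬ P.adj c z)[j]) ∧
        ((s'.var vyl = 0 ∧ ∀ z ∈ XP, ¬ P.adj c z → P.heavy z) ∨
          ∃ z ∈ XP, ¬ P.adj c z ∧ ¬ P.heavy z ∧ s'.var vyl = z + 1)) ∧
      (P.s < s'.var vu → P.s < (XP.filter fun z => ¬ P.adj c z).length) ∧
      ∀ i, i ≠ s.var vr → s'.arr aXX i = s.arr aXX i) := by
  refine Does.mono (does_seq (does_set_eq (v := 0) rfl rfl) ?_ (l := 1 + (1 + (2 +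
    ((XP.filter fun z => P.adj c z).length + P.s + 1) * (1 + 7))))) (by omega) (fun _ _ h => h)
  rintro _ - rfl
  refine does_seq (does_set_eq (v := 0) rfl rfl) ?_
  rintro _ - rfl
  refine does_seq (does_set_eq (v := 0) rfl rfl) ?_
  rintro s0 - hs0
  have e0 : ∀ v, v ≠ vu → v ≠ vyl → v ≠ vsi → s0.var v = s.var v := fun v h1 h2 h3 => by
    rw [hs0]; simp [h1, h2, h3]
  have a0 : s0.arr = s.arr := by rw [hs0]; rfl
  refine does_loop (N := XP.length) ?_ 7 (fun i s' => s'.var vsi = i ∧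
    s'.var vu = ((XP.take i).filter fun z => ¬ P.adj c z).length ∧ s'.var vu ≤ P.s + 1 ∧
    (∀ j (h : j < ((XP.take i).filter fun z => ¬ P.adj c z).length),
      s'.arr aXX (s.var vr) j = ((XP.take i).filter fun z => ¬ P.adj c z)[j]) ∧
    ((s'.var vyl = 0 ∧ ∀ z ∈ XP.take i, ¬ P.adj c z → P.heavy z) ∨
      ∃ z ∈ XP.take i, ¬ P.adj c z ∧ ¬ P.heavy z ∧ s'.var vyl = z + 1) ∧
    ∀ i, i ≠ s.var vr → s'.arr aXX i = s.arr aXX i) ?_ ?_ _ _ ?_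
  · rw [eval_var, e0 _ (by decide) (by decide) (by decide), hX.1]
  · rw [hs0]; simp
  · rintro i s1 hi hs1 ⟨i1, i2, i3, i4, i5, i6⟩ hcond
    have hS : s1.var vS = P.s := by
      rw [hs1.var vS rfl, e0 _ (by decide) (by decide) (by decide), hb.sq]
    have hr : s1.var vr = s.var vr := by
      rw [hs1.var vr rfl, e0 _ (by decide) (by decide) (by decide)]
    have hc1 : s1.var vc = c := by
      rw [hs1.var vc rfl, e0 _ (by decide) (by decide) (by decide), hc]
    have hadj : s1.arr aADJ = s.arr aADJ := by rw [hs1.arr aADJ rfl, a0]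
    have hdeg : s1.arr aDEG = s.arr aDEG := by rw [hs1.arr aDEG rfl, a0]
    have hul : s1.var vu ≤ P.s := by
      simpa [hS] using hcond
    have htake : XP.take (i + 1) = XP.take i ++ [XP[i]] := List.take_succ_eq_append_getElem hi
    refine Does.mono (k := 1 + (5 + 1)) (does_seq (does_set_eq (v := XP[i]) ?_ rfl) ?_) (by omega)
      (fun _ _ h => h)
    · rw [eval_arr, eval_cst, eval_var, i1, hs1.arr aXP rfl, a0, hX.2 i hi]
    rintro s2 - hs2
    have a2 : s2.arr = s1.arr := by rw [hs2]; rfl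
    have e2 : ∀ v, v ≠ vz → s2.var v = s1.var v := fun v hv => by rw [hs2]; simp [hv]
    have z2 : s2.var vz = XP[i] := by rw [hs2]; simp
    refine does_seq (P := fun s' => s'.var vsi = i ∧
      s'.var vu = ((XP.take (i + 1)).filter fun z => ¬ P.adj c z).length ∧ s'.var vu ≤ P.s + 1 ∧
      (∀ j (h : j < ((XP.take (i + 1)).filter fun z => ¬ P.adj c z).length),
        s'.arr aXX (s.var vr) j = ((XP.take (i + 1)).filter fun z => ¬ P.adj c z)[j]) ∧
      ((s'.var vyl = 0 ∧ ∀ z ∈ XP.take (i + 1), ¬ P.adj c z → P.heavy z) ∨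
        ∃ z ∈ XP.take (i + 1), ¬ P.adj c z ∧ ¬ P.heavy z ∧ s'.var vyl = z + 1) ∧
      ∀ i, i ≠ s.var vr → s'.arr aXX i = s.arr aXX i) ?_ ?_
    · refine does_ite (k := 4) (fun h => ?_) (fun h => ?_)
      · have hz : P.adj c XP[i] := by
          simpa [a2, hadj, hb.adj, z2, e2 vc (by decide), hc1] using h
        have hf : (XP.take (i + 1)).filter (fun z => ¬ P.adj c z) =
            (XP.take i).filter (fun z => ¬ P.adj c z) := by
          rw [htake, List.filter_append]; simp [hz]
        simp only [hf]
        refine (does_skip ?_).mono (by omega) (fun _ _ h => h)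
        refine ⟨by rw [e2 _ (by decide), i1], by rw [e2 _ (by decide), i2],
          by rw [e2 _ (by decide)]; exact i3, by rw [a2]; exact i4, ?_, by rw [a2]; exact i6⟩
        rw [e2 _ (by decide), htake]
        rcases i5 with ⟨j1, j2⟩ | ⟨z, j1, j2⟩
        · refine .inl ⟨j1, fun z hz' hz2 => ?_⟩
          rcases List.mem_append.1 hz' with h3 | h3
          · exact j2 z h3 hz2
          · rw [List.mem_singleton.1 h3] at hz2; exact absurd hz hz2
        · exact .inr ⟨z, List.mem_append_left _ j1, j2⟩
      · have hz : ¬ P.adj c XP[i] := by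
          simpa [a2, hadj, hb.adj, z2, e2 vc (by decide), hc1] using h
        have hf : (XP.take (i + 1)).filter (fun z => ¬ P.adj c z) =
            (XP.take i).filter (fun z => ¬ P.adj c z) ++ [XP[i]] := by
          rw [htake, List.filter_append]; simp [hz]
        simp only [hf]
        refine does_seq (does_put_eq (a := s.var vr) (b := s1.var vu) (v := XP[i])
          (by rw [eval_var, e2 _ (by decide), hr]) (by rw [eval_var, e2 _ (by decide)])
          (by rw [eval_var, z2]) rfl) (l := 1 + 2) ?_
        rintro s3 - hs3
        refine does_seq (does_set_eq (v := s1.var vu + 1) (by rw [hs3]; simp [e2]) rfl) ?_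
        rintro s4 - hs4
        have e4 : ∀ v, v ≠ vz → v ≠ vu → s4.var v = s1.var v := fun v h1 h2 => by
          rw [hs4, hs3]; simp [h2, e2 v h1]
        have u4 : s4.var vu = s1.var vu + 1 := by rw [hs4]; simp
        have z4 : s4.var vz = XP[i] := by rw [hs4, hs3]; simp [z2]
        have a4 : ∀ k i' j', s4.arr k i' j' = if k = aXX ∧ i' = s.var vr ∧ j' = s1.var vu then
            XP[i] else s1.arr k i' j' := by
          intro k i' j'; rw [hs4, hs3]; simp [a2]
        have hX4 : ∀ j (h : j < ((XP.take i).filter (fun z => ¬ P.adj c z) ++ [XP[i]]).length),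
            s4.arr aXX (s.var vr) j =
              ((XP.take i).filter (fun z => ¬ P.adj c z) ++ [XP[i]])[j] := by
          intro j hj
          rw [a4]
          by_cases hju : j = s1.var vu
          · subst hju
            rw [if_pos ⟨rfl, rfl, rfl⟩, List.getElem_append_right (by omega)]
            simp
          · rw [if_neg (by tauto)]
            simp only [List.length_append, List.length_singleton] at hj
            rw [List.getElem_append_left (by omega)]
            exact i4 j (by omega)
        have hXo : ∀ i, i ≠ s.var vr → s4.arr aXX i = s.arr aXX i := by
          intro i' hi'
          funext j
          rw [a4, if_neg (by tauto), i6 i' hi']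
        refine does_ite (k := 1) (fun h => does_skip ?_) (fun h =>
          does_set (v := XP[i] + 1) (by simp [z4]) rfl ?_)
        · have hz2 : P.heavy XP[i] := by
            simpa [a4, hdeg, hb.deg, z4, e4 vS (by decide) (by decide), hS, Par.heavy] using h
          refine ⟨by rw [e4 _ (by decide) (by decide), i1], by rw [u4, i2]; simp, by omega, hX4, ?_,
            hXo⟩
          rw [e4 _ (by decide) (by decide), htake]
          rcases i5 with ⟨j1, j2⟩ | ⟨z, j1, j2⟩
          · refine .inl ⟨j1, fun z hz' hz3 => ?_⟩
            rcases List.mem_append.1 hz' with h3 | h3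
            · exact j2 z h3 hz3
            · rwa [List.mem_singleton.1 h3]
          · exact .inr ⟨z, List.mem_append_left _ j1, j2⟩
        · have hz2 : ¬ P.heavy XP[i] := by
            simpa [a4, hdeg, hb.deg, z4, e4 vS (by decide) (by decide), hS, Par.heavy] using h
          refine ⟨?_, ?_, ?_, hX4, .inr ⟨XP[i], by rw [htake]; exact List.mem_append_right _ (List.mem_singleton_self _), hz, hz2,
            by rw [setVar_var, if_pos rfl]⟩, hXo⟩
          · rw [setVar_var, if_neg (by decide), e4 _ (by decide) (by decide), i1]
          · rw [setVar_var, if_neg (by decide), u4, i2]; simp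
          · rw [setVar_var, if_neg (by decide), u4]; omega
    · rintro s3 - ⟨j1, j2, j3, j4, j5, j6⟩
      refine does_set (v := i + 1) (by simp [j1]) rfl ?_
      exact ⟨by simp, j2, j3, j4, j5, j6⟩
  · rintro i s1 hi hs1 ⟨i1, i2, i3, i4, i5, i6⟩ hend
    have hS : s1.var vS = P.s := by
      rw [hs1.var vS rfl, e0 _ (by decide) (by decide) (by decide), hb.sq]
    have hsub : ((XP.take i).filter fun z => ¬ P.adj c z).length ≤
        (XP.filter fun z => ¬ P.adj c z).length := ((List.take_sublist i XP).filter _).length_le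
    refine ⟨⟨fun hu => ?_, fun hu => by omega, i6⟩, ?_⟩
    · have hiN : i = XP.length := by
        rcases hend with h | h
        · exact h
        · simp [hS] at h; omega
      rw [hiN, List.take_length] at i5
      have ht : XP.take i = XP := by rw [hiN, List.take_length]
      refine ⟨by rw [i2, ht], fun j hj => ?_, i5⟩
      rw [i4 j (by rw [ht]; exact hj)]
      simp only [ht]
    -- Split the prefix read so far into neighbours and non-neighbours of c; the latter are counted
    -- by `vu`, which is at most s + 1.
    · have h1 : ((XP.take i).filter fun z => P.adj c z).length ≤
          (XP.filter fun z => P.adj c z).length := ((List.take_sublist i XP).filter _).length_le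
      have h2 := List.length_eq_length_filter_add (l := XP.take i) (fun z => decide (P.adj c z))
      have h3 : (List.filter (fun x => !decide (P.adj c x)) (XP.take i)).length =
          ((XP.take i).filter fun z => ¬ P.adj c z).length := by simp
      rw [h3, ← i2, List.length_take] at h2
      omega

theorem does_storeRow {s : St} {y : ℕ} (hy : s.var vyl = y + 1) :
    Does τ r storeRow s 7 (fun s' => s'.var vr = s.var vr + 1 ∧
      (∀ i, s'.arr aRLEN 0 i = if i = s.var vr then s.var vu else s.arr aRLEN 0 i) ∧
      (∀ i, s'.arr aROWB 0 i = if i = s.var vr then s.var vb else s.arr aROWB 0 i) ∧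
      (∀ i, s'.arr aROWC 0 i = if i = s.var vr then s.var vc else s.arr aROWC 0 i) ∧
      (∀ v k, s'.arr aBKT v k = if v = y ∧ k = s.arr aRC 0 y then s.var vr else s.arr aBKT v k) ∧
      (∀ v, s'.arr aRC 0 v = if v = y then s.arr aRC 0 y + 1 else s.arr aRC 0 v)) := by
  refine does_seq (l := 6) (does_set_eq (v := y) (by simp [hy]) rfl) ?_
  rintro _ - rfl
  refine does_seq (l := 5) (does_put_eq (a := 0) (b := s.var vr) (v := s.var vu) (by simp) (by simp)
    (by simp) rfl) ?_
  rintro _ - rfl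
  refine does_seq (l := 4) (does_put_eq (a := 0) (b := s.var vr) (v := s.var vb) (by simp) (by simp)
    (by simp) rfl) ?_
  rintro _ - rfl
  refine does_seq (l := 3) (does_put_eq (a := 0) (b := s.var vr) (v := s.var vc) (by simp) (by simp)
    (by simp) rfl) ?_
  rintro _ - rfl
  refine does_seq (l := 2) (does_put_eq (a := y) (b := s.arr aRC 0 y) (v := s.var vr) (by simp)
    (by simp) (by simp) rfl) ?_
  rintro _ - rfl
  refine does_seq (l := 1) (does_put_eq (a := 0) (b := y) (v := s.arr aRC 0 y + 1) (by simp)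
    (by simp) (by simp) rfl) ?_
  rintro _ - rfl
  refine does_set (v := s.var vr + 1) (by simp) rfl ?_
  simp

theorem sum_map_update {l : List ℕ} (hl : l.Nodup) {y : ℕ} (hy : y ∈ l) (f : ℕ → ℕ) :
    (l.map fun v => if v = y then f y + 1 else f v).sum = (l.map f).sum + 1 := by
  induction l with
  | nil => simp at hy
  | cons a l ih =>
    rw [List.nodup_cons] at hl
    by_cases h : a = y
    · subst h
      have h1 : (l.map fun v => if v = a then f a + 1 else f v) = l.map f := by
        apply List.map_congr_left
        intro v hv
        rw [if_neg]
        rintro rfl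
        exact hl.1 hv
      simp only [List.map_cons, List.sum_cons, h1, if_true]
      omega
    · have := ih hl.2 ((List.mem_cons.1 hy).resolve_left (Ne.symm h))
      simp only [List.map_cons, List.sum_cons, if_neg h, this]
      omega

/-- The new row goes to the end of the bucket of y, so the entries counted earlier keep their
meaning. Each row lies in exactly one bucket, and therefore the bucket sizes add up to the number of
rows. -/
theorem Rows.store {a b c y : ℕ} {done : ℕ → ℕ → Prop} {s s' : St} (h : Rows P a done s)
    (ht : P.adj a b ∧ P.adj a c ∧ P.adj b c) (hy : y ∈ P.un a b c) (hyl : ¬ P.heavy y)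
    (hs : (P.un a b c).length ≤ P.s)
    (hXX : ∀ j (h : j < (P.un a b c).length), s'.arr aXX (s.var vr) j = (P.un a b c)[j])
    (hXo : ∀ i, i ≠ s.var vr → s'.arr aXX i = s.arr aXX i) (hF : s'.arr aFLAG = s.arr aFLAG)
    (h1 : s'.var vr = s.var vr + 1)
    (h2 : ∀ i, s'.arr aRLEN 0 i = if i = s.var vr then (P.un a b c).length else s.arr aRLEN 0 i)
    (h3 : ∀ i, s'.arr aROWB 0 i = if i = s.var vr then b else s.arr aROWB 0 i)
    (h4 : ∀ i, s'.arr aROWC 0 i = if i = s.var vr then c else s.arr aROWC 0 i)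
    (h5 : ∀ v k, s'.arr aBKT v k = if v = y ∧ k = s.arr aRC 0 y then s.var vr else s.arr aBKT v k)
    (h6 : ∀ v, s'.arr aRC 0 v = if v = y then s.arr aRC 0 y + 1 else s.arr aRC 0 v) :
    Rows P a (fun b' c' => done b' c' ∨ (b' = b ∧ c' = c)) s' := by
  have hyf := (Par.mem_un.1 hy).1
  have key : ∀ i < s.var vr + 1, i = s.var vr ∨ (i < s.var vr ∧ i ≠ s.var vr) := by omega
  constructor
  · intro i hi
    rw [h1] at hi
    rw [h2, h3, h4]
    rcases key i hi with rfl | ⟨hi, hn⟩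
    · simp
    · simp only [if_neg hn]; exact h.len i hi
  · intro i hi
    rw [h1] at hi
    rw [h2]
    rcases key i hi with rfl | ⟨hi, hn⟩
    · simpa using hs
    · simp only [if_neg hn]; exact h.small i hi
  · intro i hi
    rw [h1] at hi
    rw [h3, h4]
    rcases key i hi with rfl | ⟨hi, hn⟩
    · simpa using hXX
    · simp only [if_neg hn, hXo i hn]; exact h.row i hi
  · intro i hi
    rw [h1] at hi
    rw [h3, h4]
    rcases key i hi with rfl | ⟨hi, hn⟩
    · simpa using ht
    · simp only [if_neg hn]; exact h.tri i hi
  · intro v hv k hk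
    rw [h6] at hk
    rw [h1, h5]
    split_ifs with h7
    · omega
    · have : k < s.arr aRC 0 v := by
        split_ifs at hk with h8
        · subst h8
          simp only [true_and] at h7
          omega
        · exact hk
      have := h.bkt v hv k this
      omega
  · intro v hv hk
    rw [h6] at hk
    split_ifs at hk with h7
    · rwa [h7]
    · exact h.light v hv hk
  · simp only [h6, h1]
    rw [sum_map_update (Par.nodup_far a) hyf (fun v => s.arr aRC 0 v), h.sum]
  · intro b' c' hd hl
    rcases hd with hd | ⟨rfl, rfl⟩
    · rcases h.cov b' c' hd hl with h7 | ⟨v, hv, k, hk, h8, h9⟩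
      · exact .inl ⟨h7.1, by rw [hF]; exact h7.2⟩
      · have hb := h.bkt v (Par.mem_un.1 hv).1 k hk
        -- An old entry has index below the old size of its bucket, so the store behind the end of
        -- the bucket of y misses it.
        have e5 : s'.arr aBKT v k = s.arr aBKT v k := by
          rw [h5, if_neg]
          rintro ⟨rfl, rfl⟩
          omega
        refine .inr ⟨v, hv, k, ?_, ?_, ?_⟩
        · rw [h6]; split_ifs with h10
          · subst h10; omega
          · exact hk
        · rw [e5, h3, if_neg (by omega), h8]
        · rw [e5, h4, if_neg (by omega), h9]
    · refine .inr ⟨y, hy, s.arr aRC 0 y, by rw [h6]; simp, ?_, ?_⟩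
      · rw [h5, if_pos ⟨rfl, rfl⟩, h3, if_pos rfl]
      · rw [h5, if_pos ⟨rfl, rfl⟩, h4, if_pos rfl]
  · have := h.flag; unfold FlagOK at this ⊢; rwa [hF]

/-- The three outcomes of the scan match the coverage condition: a light vertex was found and the
row is filed under it; all vertices are heavy and the pair is flagged; or there are more than `s` of
them and nothing is required. -/
theorem does_rowsC {s : St} {a b c : ℕ} {done : ℕ → ℕ → Prop} (hb : Base P s)
    (ha : s.var vA = a) (hvb : s.var vb = b) (hvc : s.var vc = c)
    (ht : P.adj a b ∧ P.adj a c ∧ P.adj b c)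
    (hX : IsList s aXP vXPn ((P.far a).filter fun z => ¬ P.adj b z)) (hR : Rows P a done s) :
    Does τ r rowsC s (14 + (((P.far a).filter fun z => P.adj c z).length + P.s + 1) * 8)
      (fun s' => Rows P a (fun b' c' => done b' c' ∨ (b' = b ∧ c' = c)) s' ∧
        s'.var vr ≤ s.var vr + 1) := by
  have hcov : (((P.far a).filter fun z => ¬ P.adj b z).filter fun z => P.adj c z).length ≤
      ((P.far a).filter fun z => P.adj c z).length :=
    ((List.filter_sublist (l := P.far a)).filter _).length_le
  refine (does_seq (does_scanC hb hvc hX) (l := 1 + (1 + 7)) fun s1 hs1 h1 => ?_).mono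
    (by omega) (fun _ _ h => h)
  obtain ⟨k1, k2, k3⟩ := h1
  have r1 : s1.var vr = s.var vr := hs1.var vr rfl
  have hR1 : Rows P a done s1 := by
    have e2 := hs1.arr aRLEN rfl
    have e3 := hs1.arr aROWB rfl
    have e4 := hs1.arr aROWC rfl
    have e6 := hs1.arr aRC rfl
    have e7 := hs1.arr aBKT rfl
    have e8 := hs1.arr aFLAG rfl
    obtain ⟨f1, f2, f3, f4, f5, f6, f7, f8, f9⟩ := hR
    constructor
    · rwa [r1, e2, e3, e4]
    · rwa [r1, e2]
    · rw [r1, e3, e4]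
      intro i hi
      rw [k3 i (by omega)]
      exact f3 i hi
    · rwa [r1, e3, e4]
    · rwa [r1, e6, e7]
    · rwa [e6]
    · rwa [r1, e6]
    · rwa [e8, e6, e7, e3, e4]
    · unfold FlagOK at f9 ⊢; rwa [e8]
  have b1 : s1.var vb = b := by rw [hs1.var vb rfl, hvb]
  have c1 : s1.var vc = c := by rw [hs1.var vc rfl, hvc]
  have S1 : s1.var vS = P.s := by rw [hs1.var vS rfl, hb.sq]
  refine does_ite (fun h => does_ite (fun h' => ?_) (fun h' => ?_)) (fun h => ?_)
  · have hu : s1.var vu ≤ P.s := by simpa [S1] using h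
    obtain ⟨u1, u2, u3⟩ := k1 hu
    rcases u3 with ⟨u3, -⟩ | ⟨y, y1, y2, y3, y4⟩
    · exact absurd u3 h'
    have hy : y ∈ P.un a b c := by
      rw [Par.un, List.mem_filter]
      exact ⟨y1, by simpa using y2⟩
    refine (does_storeRow y4).mono le_rfl ?_
    rintro s2 hs2 ⟨g1, g2, g3, g4, g5, g6⟩
    refine ⟨hR1.store ht hy y3 (by unfold Par.un; omega) ?_ ?_ (hs2.arr aFLAG rfl) g1 ?_ ?_ ?_ g5 g6,
      by omega⟩
    · rw [hs2.arr aXX rfl, r1]; exact u2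
    · rw [hs2.arr aXX rfl]; exact fun _ _ => rfl
    · rw [u1] at g2; exact g2
    · rw [b1] at g3; exact g3
    · rw [c1] at g4; exact g4
  · have hu : s1.var vu ≤ P.s := by simpa [S1] using h
    obtain ⟨u1, u2, u3⟩ := k1 hu
    rcases u3 with ⟨-, u3⟩ | ⟨y, y1, y2, y3, y4⟩
    swap
    · rw [eval_var, y4] at h'; omega
    have hheavy : ∀ z ∈ P.un a b c, P.heavy z := by
      intro z hz
      obtain ⟨z1, z2, z3⟩ := Par.mem_un.1 hz
      exact u3 z (by simp [z1, z2]) z3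
    refine (does_put_eq (a := b) (b := c) (v := a + 1) (by rw [eval_var, b1]) (by rw [eval_var, c1])
      (by simp [hs1.var vA rfl, ha]) rfl).mono (by omega) ?_
    rintro s2 hs2 rfl
    obtain ⟨f1, f2, f3, f4, f5, f6, f7, f8, f9⟩ := hR1
    refine ⟨⟨by simpa using f1, by simpa using f2, by simpa using f3, by simpa using f4,
      by simpa using f5, by simpa using f6, by simpa using f7, ?_, ?_⟩, by simp [r1]⟩
    · intro b' c' hd hl
      by_cases hbc : b' = b ∧ c' = c
      · obtain ⟨rfl, rfl⟩ := hbc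
        exact .inl ⟨hheavy, by simp⟩
      · have := f8 b' c' (hd.resolve_right hbc) hl
        simpa [hbc] using this
    · intro p q a' hf
      rw [setArr_arr] at hf
      split_ifs at hf with h7
      · obtain ⟨-, rfl, rfl⟩ := h7
        obtain rfl : a = a' := by omega
        exact hheavy
      · exact f9 p q a' hf
  · have hu : P.s < s1.var vu := by simpa [S1] using h
    have hl := k2 hu
    refine (does_skip ?_).mono (by omega) (fun _ _ h => h)
    refine ⟨{ hR1 with cov := ?_ }, by omega⟩
    rintro b' c' (hd | ⟨rfl, rfl⟩) hl'
    · exact hR1.cov b' c' hd hl'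
    · unfold Par.un at hl'; omega

theorem does_rowsB {s : St} {a b : ℕ} {done : ℕ → ℕ → Prop} (hb : Base P s)
    (ha : s.var vA = a) (hvb : s.var vb = b) (hab : P.adj a b)
    (hX : IsList s aX vXn (P.far a)) (hR : Rows P a done s) :
    Does τ r rowsB s (7 + 6 * (P.far a).length + ((P.nb b).map fun c =>
      15 + (((P.far a).filter fun z => P.adj c z).length + P.s + 1) * 8 + 3).sum)
      (fun s' => Rows P a (fun b' c' => done b' c' ∨ (b' = b ∧ P.adj b c' ∧ P.adj a c')) s' ∧
        s'.var vr ≤ s.var vr + P.deg b) := by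
  refine (does_seq (does_filt (P.far a) (fun z => ¬ P.adj b z) (by decide) (by decide)
      (by decide) rfl ?_ ?_ ?_) (l := 3 + ((P.nb b).map fun c =>
      15 + (((P.far a).filter fun z => P.adj c z).length + P.s + 1) * 8 + 3).sum)
      fun s1 hs1 h1 => ?_).mono (by omega) (fun _ _ h => h)
  · intro s' hs'
    rw [eval_var, hs'.var vXn rfl, hX.1]
  · intro i hi s' hs' hx
    rw [eval_arr, hs'.arr aX rfl, eval_var, hx, eval_cst, hX.2 i hi]
  · intro z hz s' hs' hx
    simp [hs'.arr aADJ rfl, hx, hs'.var vb rfl, hvb, hb.adj]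
  have hb1 := hb.same hs1 rfl
  have hR1 := hR.same hs1 rfl
  have b1 : s1.var vb = b := by rw [hs1.var vb rfl, hvb]
  have a1 : s1.var vA = a := by rw [hs1.var vA rfl, ha]
  refine (does_forL (P.nb b) (by decide) rfl rfl (by simp [b1, hb1.deg, Par.deg]) _
    (fun pre s' => Rows P a (fun b' c' => done b' c' ∨ (b' = b ∧ c' ∈ pre ∧ P.adj a c')) s' ∧
      s'.var vr ≤ s.var vr + pre.length) ?_ ?_ ?_ ?_ ?_).mono le_rfl ?_
  · exact fun _ _ _ h => ⟨h.1.setVar _ _ (by decide), h.2⟩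
  · exact fun _ _ _ h => ⟨h.1.setVar _ _ (by decide), h.2⟩
  · exact ⟨by simpa using hR1, by simp [hs1.var vr rfl]⟩
  · intro i hi s' hs' hx'
    rw [eval_arr, eval_var, eval_var, hx', hs'.var vb rfl, b1, hs'.arr aNBR rfl, hb1.nbr]
  · intro pre c suf s2 hl hs2 hc2 hI2
    have hb2 := hb1.same hs2 rfl
    have hbc : P.adj b c := P.mem_nb.1 (by simp [hl])
    refine (does_ite (k := 14 + (((P.far a).filter fun z => P.adj c z).length + P.s + 1) * 8)
      (fun h => ?_) (fun h => ?_)).mono (by omega) (fun _ _ h => h)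
    · have hac : P.adj a c := by simpa [hb2.adj, hc2, hs2.var vA rfl, a1] using h
      refine (does_rowsC hb2 (by rw [hs2.var vA rfl, a1]) (by rw [hs2.var vb rfl, b1]) hc2
        ⟨hab, hac, hbc⟩ (h1.congr (hs2.var vXPn rfl) (hs2.arr aXP rfl)) hI2.1).mono le_rfl ?_
      rintro s3 - ⟨h3, h4⟩
      refine ⟨h3.congr_done ?_, ?_⟩
      · intro b' c'
        simp only [List.mem_append, List.mem_singleton]
        tauto
      · have := hI2.2; simp; omega
    · have hac : ¬ P.adj a c := by simpa [hb2.adj, hc2, hs2.var vA rfl, a1] using h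
      refine (does_skip ⟨hI2.1.congr_done ?_, ?_⟩).mono (by omega) (fun _ _ h => h)
      · intro b' c'
        simp only [List.mem_append, List.mem_singleton]
        rintro (h5 | ⟨h5, (h6 | rfl), h7⟩)
        · exact .inl h5
        · exact .inr ⟨h5, h6, h7⟩
        · exact absurd h7 hac
      · have := hI2.2; simp; omega
  · rintro s2 - ⟨h3, h4⟩
    exact ⟨h3.congr_done fun b' c' => by simp only [P.mem_nb]; exact id, h4⟩

theorem does_clearRC {s : St} {X : List ℕ} (hX : IsList s aX vXn X) :
    Does τ r clearRC s (3 + 4 * X.length) (fun s' => ∀ v ∈ X, s'.arr aRC 0 v = 0) := by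
  refine (does_forL X (by decide) rfl rfl (by simp [hX.1]) (fun _ => 1)
    (fun pre s' => ∀ v ∈ pre, s'.arr aRC 0 v = 0) (fun _ _ _ h => h) (fun _ _ _ h => h) (by simp)
    ?_ ?_).mono ?_ (fun _ _ h => h)
  · intro i hi s' hs' hx'
    rw [eval_arr, eval_var, hx', hs'.arr aX rfl, eval_cst, hX.2 i hi]
  · intro pre c suf s2 hl hs2 hc2 hI2
    refine does_put (a := 0) (b := c) (v := 0) rfl hc2 rfl rfl ?_
    intro v hv
    rw [setArr_arr]
    split_ifs with h
    · rfl
    · rcases List.mem_append.1 hv with h1 | h1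
      · exact hI2 v h1
      · exact absurd ⟨rfl, rfl, List.mem_singleton.1 h1⟩ h
  · simp; omega

/-- One row at most is made for each heavy neighbour b of y and each neighbour c of b, and these
pairs number at most the sum of deg b over N(y), which is at most 2m. -/
theorem does_buildRows {s : St} {a y : ℕ} (hb : Base P s) (ha : s.var vA = a)
    (hy : s.var vY = y) (hX : IsList s aX vXn (P.far a)) (hF : FlagOK P s) :
    Does τ r buildRows s (7 + 4 * (P.far a).length + ((P.nb y).map fun b =>
      8 + 6 * (P.far a).length + ((P.nb b).map fun c =>
      15 + (((P.far a).filter fun z => P.adj c z).length + P.s + 1) * 8 + 3).sum + 3).sum)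
      (fun s' => Rows P a (fun b c => P.adj y b ∧ P.heavy b ∧ P.adj a b ∧ P.adj b c ∧ P.adj a c) s'
        ∧ s'.var vr ≤ 2 * P.m) := by
  refine (does_seq (does_set_eq (v := 0) rfl rfl) (l := 3 + 4 * (P.far a).length + (3 +
      ((P.nb y).map fun b =>
      8 + 6 * (P.far a).length + ((P.nb b).map fun c =>
      15 + (((P.far a).filter fun z => P.adj c z).length + P.s + 1) * 8 + 3).sum + 3).sum))
      ?_).mono (by omega) (fun _ _ h => h)
  rintro s0 hs0 e0
  have hX0 : IsList s0 aX vXn (P.far a) := hX.congr (hs0.var vXn rfl) (hs0.arr aX rfl)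
  refine does_seq (does_clearRC hX0) fun s1 hs1 h1 => ?_
  have r1 : s1.var vr = 0 := by rw [hs1.var vr rfl, e0]; simp
  have hb1 := (hb.same hs0 rfl).same hs1 rfl
  have a1 : s1.var vA = a := by rw [hs1.var vA rfl, hs0.var vA rfl, ha]
  have y1 : s1.var vY = y := by rw [hs1.var vY rfl, hs0.var vY rfl, hy]
  have F1 : FlagOK P s1 := by
    unfold FlagOK at hF ⊢
    rwa [hs1.arr aFLAG rfl, hs0.arr aFLAG rfl]
  refine (does_forL (P.nb y) (by decide) rfl rfl (by simp [y1, hb1.deg, Par.deg]) _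
    (fun pre s' => Rows P a (fun b c => b ∈ pre ∧ P.heavy b ∧ P.adj a b ∧ P.adj b c ∧ P.adj a c) s' ∧
      s'.var vr ≤ (pre.map P.deg).sum) ?_ ?_ ?_ ?_ ?_).mono le_rfl ?_
  · exact fun _ _ _ h => ⟨h.1.setVar _ _ (by decide), h.2⟩
  · exact fun _ _ _ h => ⟨h.1.setVar _ _ (by decide), h.2⟩
  · refine ⟨⟨by simp [r1], by simp [r1], by simp [r1], by simp [r1], ?_, ?_, ?_, by simp, F1⟩,
      by simp [r1]⟩
    · intro v hv; rw [h1 v hv]; omega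
    · intro v hv; rw [h1 v hv]; simp
    · rw [List.map_congr_left (g := fun _ => 0) h1, r1]; simp
  · intro i hi s' hs' hx'
    rw [eval_arr, eval_var, eval_var, hx', hs'.var vY rfl, y1, hs'.arr aNBR rfl, hb1.nbr]
  · intro pre b suf s2 hl hs2 hb2 hI2
    have hB2 := hb1.same hs2 rfl
    refine (does_ite (k := 7 + 6 * (P.far a).length + ((P.nb b).map fun c =>
      15 + (((P.far a).filter fun z => P.adj c z).length + P.s + 1) * 8 + 3).sum)
      (fun h => ?_) (fun h => ?_)).mono (by omega) (fun _ _ h => h)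
    · have hab : P.adj a b ∧ P.heavy b := by
        simpa [hB2.adj, hB2.deg, hB2.sq, hb2, hs2.var vA rfl, a1, Par.heavy] using h
      refine (does_rowsB hB2 (by rw [hs2.var vA rfl, a1]) hb2 hab.1
        (hX0.congr (by rw [hs2.var vXn rfl, hs1.var vXn rfl])
          (by rw [hs2.arr aX rfl, hs1.arr aX rfl])) hI2.1).mono le_rfl ?_
      rintro s3 - ⟨h3, h4⟩
      refine ⟨h3.congr_done ?_, ?_⟩
      · intro b' c'
        simp only [List.mem_append, List.mem_singleton]
        rintro ⟨h5 | rfl, h6⟩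
        · exact .inl ⟨h5, h6⟩
        · exact .inr ⟨rfl, h6.2.2⟩
      · have := hI2.2; simp; omega
    · have hab : ¬ (P.adj a b ∧ P.heavy b) := by
        have : P.adj a b → ¬ P.heavy b := by
          simpa [hB2.adj, hB2.deg, hB2.sq, hb2, hs2.var vA rfl, a1, Par.heavy,
            or_iff_not_imp_left] using h
        tauto
      refine (does_skip ⟨hI2.1.congr_done ?_, ?_⟩).mono (by omega) (fun _ _ h => h)
      · intro b' c'
        simp only [List.mem_append, List.mem_singleton]
        rintro ⟨h5 | rfl, h6⟩
        · exact ⟨h5, h6⟩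
        · exact absurd ⟨h6.2.1, h6.1⟩ hab
      · have := hI2.2; simp; omega
  · rintro s2 - ⟨h3, h4⟩
    exact ⟨h3.congr_done fun b' c' => by simp only [P.mem_nb]; exact id,
      h4.trans (P.sum_deg_nb y)⟩

end Build

/-! ## Hashed rows and columns -/

/-- The hash functions separate every light neighbourhood from every other vertex. -/
def Par.Good (P : Par) : Prop :=
  ∀ d z, d < P.n → z < P.n → ¬ P.heavy d → ¬ P.adj d z →
    ∃ l < P.L, ∀ w ∈ P.nb d, P.hash l w ≠ P.hash l z

/-- In row `k` of the array `K`, write `v` at the hash values of the elements of the `k`-th set. -/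
def hashFill (K : ℕ) (eR src len elt : E) (v : ℕ) : Cmd :=
  forN vk eR (.seq (.set vrr src) (forN vl (.var vL) (forN vt len
    (.put K (.var vk) (.op .add (.op .mul (.var vl) (.var vB)) (.arr aHASH (.var vl) elt))
      (.const v)))))

/-- A row is 1 at the hash values of the vertices still to be covered. A column is 1 except at the
hash values of the neighbours of d. A common 1 thus exhibits a vertex whose hash value no neighbour
of d takes. -/
def procFill : Cmd :=
  .seq (fill2 aRM vp vq (.var vR) (.var vC) (.const 0))
  (.seq (hashFill aRM (.var vR) (.arr aBKT (.var vv) (.var vk)) (.arr aRLEN (.const 0) (.var vrr))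
    (.arr aXX (.var vrr) (.var vt)) 1)
  (.seq (fill2 aCM vp vq (.var vG) (.var vC) (.const 1))
  (hashFill aCM (.var vG) (.arr aDL (.const 0) (.var vk)) (.arr aDEG (.const 0) (.var vrr))
    (.arr aNBR (.var vrr) (.var vt)) 0)))

def procScan : Cmd := scan2 vRES vp vq (.var vR) (.var vG)
  (eAnd (eNot (.arr aZ (.var vp) (.var vq)))
    (eAnd (.arr aADJ (.arr aROWB (.const 0) (.arr aBKT (.var vv) (.var vp)))
        (.arr aDL (.const 0) (.var vq)))
      (.arr aADJ (.arr aROWC (.const 0) (.arr aBKT (.var vv) (.var vp)))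
        (.arr aDL (.const 0) (.var vq)))))

def procMain : Cmd := .seq (.set vR (.arr aRC (.const 0) (.var vv))) (.seq (.set vG (.var vDLn))
  (.seq (.set vC (.var vLB)) (.seq procFill (.seq prod procScan))))

def procV : Cmd := .seq (filt vfi vfe vDLn aDL (.arr aDEG (.const 0) (.var vv))
    (.arr aNBR (.var vv) (.var vfi))
    (eAnd (.arr aADJ (.var vA) (.var vfe)) (eNot (eLt (.var vS) (.arr aDEG (.const 0) (.var vfe))))))
  (.ite (eAnd (.arr aRC (.const 0) (.var vv)) (.var vDLn)) procMain .skip)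

def procAll : Cmd := forL vjb vv (.var vXn) (.arr aX (.const 0) (.var vjb)) procV

/-- The `k`-th row of the bucket of `v` together with `d` is a solution. -/
def Par.Hit (P : Par) (s : St) (a v : ℕ) : Prop :=
  ∃ k < s.arr aRC 0 v, ∃ d ∈ P.nb v, P.adj a d ∧ ¬ P.heavy d ∧
    P.adj (s.arr aROWB 0 (s.arr aBKT v k)) d ∧ P.adj (s.arr aROWC 0 (s.arr aBKT v k)) d ∧
    ∀ z ∈ P.un a (s.arr aROWB 0 (s.arr aBKT v k)) (s.arr aROWC 0 (s.arr aBKT v k)), P.adj d z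

section Proc

variable {τ : ℕ → ℕ} {r : ℕ → Bool} {P : Par} {κ : ℕ}

/-- Two facts are recorded: hash positions hold the new value, and no other position changed. Both
are needed, because the procedure writes ones into a zero matrix as well as zeros into a matrix of
ones. -/
theorem does_hashFill {K : ℕ} {eR src len elt : E} {v : ℕ} {s : St} {R : ℕ} {id : ℕ → ℕ}
    {W : ℕ → List ℕ}
    (hsrc : src.slack.isSome)
    (hb : ∀ s', Same (hashFill K eR src len elt v) s s' → Base P s')
    (hR : ∀ s', Same (hashFill K eR src len elt v) s s' → eR.eval s' = R)
    (hid : ∀ k < R, ∀ s', Same (hashFill K eR src len elt v) s s' → s'.var vk = k →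
      src.eval s' = id k)
    (hlen : ∀ k < R, ∀ s', Same (hashFill K eR src len elt v) s s' → s'.var vrr = id k →
      len.eval s' = (W k).length)
    (helt : ∀ k < R, ∀ j (h : j < (W k).length), ∀ s', Same (hashFill K eR src len elt v) s s' →
      s'.var vrr = id k → s'.var vt = j → elt.eval s' = (W k)[j])
    (hn : ∀ k < R, ∀ z ∈ W k, z < P.n) (hs : ∀ k < R, (W k).length ≤ P.s) :
    Does τ r (hashFill K eR src len elt v) s (3 + R * (6 + P.L * (5 + P.s * 3))) (fun s' =>
      (∀ i < R, ∀ l < P.L, ∀ z ∈ W i, s'.arr K i (l * P.B + P.hash l z) = v) ∧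
      ∀ i q, s'.arr K i q = s.arr K i q ∨ (i < R ∧ s'.arr K i q = v ∧
        ∃ l < P.L, ∃ z ∈ W i, q = l * P.B + P.hash l z)) := by
  set c := hashFill K eR src len elt v with hc
  have sv : ∀ s' x w, Same c s s' → x = vk ∨ x = vrr ∨ x = vl ∨ x = vt →
      Same c s (s'.setVar x w) := by
    intro s' x w h hx
    refine h.trans ⟨fun z hz => ?_, fun _ _ => rfl, rfl, rfl⟩
    simp only [hc, hashFill, wVar_forN, Cmd.wVar, Bool.or_eq_false_iff, beq_eq_false_iff_ne] at hz
    rw [setVar_var, if_neg]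
    rintro rfl
    rcases hx with rfl | rfl | rfl | rfl <;> tauto
  have sub : ∀ (c' : Cmd) s1 s2, Same c s s1 → Same c' s1 s2 →
      (∀ x, c.wVar x = false → c'.wVar x = false) → (∀ x, c.wArr x = false → c'.wArr x = false) →
      Same c s s2 := fun c' s1 s2 h1 h2 h3 h4 => h1.trans (h2.of_le h3 h4)
  refine (does_forN (N := R) rfl (hR _ (sv _ _ _ (.refl _ _) (.inl rfl)))
    (fun _ => 1 + (3 + ∑ _j ∈ range P.L, ((3 + P.s * 3) + 2)))
    (fun k s' => (∀ i < k, ∀ l < P.L, ∀ z ∈ W i, s'.arr K i (l * P.B + P.hash l z) = v) ∧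
      ∀ i q, s'.arr K i q = s.arr K i q ∨ (i < k ∧ s'.arr K i q = v ∧
        ∃ l < P.L, ∃ z ∈ W i, q = l * P.B + P.hash l z))
    (fun _ _ _ h => h) (by simp) ?_).mono ?_ (fun _ _ h => h)
  · intro k s1 hk1 hs1 hv1 hI1
    have hs1' : Same c s s1 := hs1
    refine does_seq (does_set_eq (hid k hk1 s1 hs1' hv1) hsrc) ?_
    rintro _ - rfl
    have hs2 := sv s1 vrr (id k) hs1' (by tauto)
    refine (does_forN (N := P.L) rfl (by simpa using (hb _ hs2).L)
      (fun _ => 3 + P.s * 3)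
      (fun l' s' => (∀ l < l', ∀ z ∈ W k, s'.arr K k (l * P.B + P.hash l z) = v) ∧
        ∀ i q, s'.arr K i q = s1.arr K i q ∨ (i = k ∧ s'.arr K i q = v ∧
          ∃ l < l', ∃ z ∈ W k, q = l * P.B + P.hash l z))
      (fun _ _ _ h => h) (by simp) ?_).mono le_rfl ?_
    · intro l s3 hl hs3 hv3 hI3
      have hs3' : Same c s s3 := sub _ _ _ hs2 hs3
        (fun x hx => by
          simp only [hc, hashFill, wVar_forN, Cmd.wVar, Bool.or_eq_false_iff] at hx ⊢; tauto)
        (fun x hx => by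
          simp only [hc, hashFill, wArr_forN, Cmd.wArr, Bool.or_eq_false_iff] at hx ⊢; tauto)
      have k3 : s3.var vk = k := by rw [hs3.var vk rfl]; simpa using hv1
      have rr3 : s3.var vrr = id k := by rw [hs3.var vrr rfl]; simp
      refine (does_forN (N := (W k).length) rfl
        (hlen k hk1 _ (sv _ _ _ hs3' (by tauto)) (by simpa using rr3))
        (fun _ => 1)
        (fun j' s' => (∀ j (h : j < (W k).length), j < j' →
            s'.arr K k (l * P.B + P.hash l (W k)[j]) = v) ∧
          ∀ i q, s'.arr K i q = s3.arr K i q ∨ (i = k ∧ s'.arr K i q = v ∧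
            ∃ z ∈ W k, q = l * P.B + P.hash l z))
        (fun _ _ _ h => h) (by simp) ?_).mono ?_ ?_
      · intro j s4 hj hs4 hv4 hI4
        have hs4' : Same c s s4 := sub _ _ _ hs3' hs4
          (fun x hx => by
            simp only [hc, hashFill, wVar_forN, Cmd.wVar, Bool.or_eq_false_iff] at hx ⊢; tauto)
          (fun x hx => by
            simp only [hc, hashFill, wArr_forN, Cmd.wArr, Bool.or_eq_false_iff] at hx ⊢; tauto)
        have hz : (W k)[j] ∈ W k := List.getElem_mem _
        have hb4 := hb _ hs4'
        have e4 := helt k hk1 j hj s4 hs4' (by rw [hs4.var vrr rfl, rr3]) hv4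
        refine does_put (a := k) (b := l * P.B + P.hash l (W k)[j]) (v := v) ?_ ?_ rfl rfl ?_
        · rw [eval_var, hs4.var vk rfl, k3]
        · rw [eval_op_add, eval_op_mul, eval_arr, e4, eval_var, eval_var, hs4.var vl rfl, hv3,
            hb4.B, hb4.hash l hl _ (hn k hk1 _ hz)]
        refine ⟨?_, ?_⟩
        · intro j' h1 h2
          rw [setArr_arr]
          split_ifs with h3
          · rfl
          · refine hI4.1 j' h1 ?_
            by_contra h4
            obtain rfl : j' = j := by omega
            exact h3 ⟨rfl, rfl, rfl⟩
        · intro i q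
          rw [setArr_arr]
          split_ifs with h3
          · exact .inr ⟨h3.2.1, rfl, _, hz, h3.2.2⟩
          · exact hI4.2 i q
      · have := hs k hk1
        simp only [sum_const, card_range, smul_eq_mul]
        have := Nat.mul_le_mul_right 3 this
        omega
      · rintro s4 - ⟨h4, h5⟩
        refine ⟨?_, ?_⟩
        · intro l1 hl1 z hz
          by_cases h6 : l1 = l
          · subst h6
            obtain ⟨j, hj, rfl⟩ := List.getElem_of_mem hz
            exact h4 j hj hj
          · rcases h5 k (l1 * P.B + P.hash l1 z) with h7 | h7
            · rw [h7]; exact hI3.1 l1 (by omega) z hz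
            · exact h7.2.1
        · intro i q
          rcases h5 i q with h6 | ⟨h6, h7, z, hz, h8⟩
          · rw [h6]
            rcases hI3.2 i q with h7 | ⟨h7, h8, l1, h9, h10⟩
            · exact .inl h7
            · exact .inr ⟨h7, h8, l1, by omega, h10⟩
          · exact .inr ⟨h6, h7, l, by omega, z, hz, h8⟩
    · rintro s3 - ⟨h4, h5⟩
      refine ⟨?_, ?_⟩
      · intro i hi l hl z hz
        by_cases h6 : i = k
        · subst h6; exact h4 l hl z hz
        · rcases h5 i (l * P.B + P.hash l z) with h7 | h7
          · rw [h7]; exact hI1.1 i (by omega) l hl z hz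
          · exact absurd h7.1 h6
      · intro i q
        rcases h5 i q with h6 | ⟨rfl, h7, h8⟩
        · rw [h6]
          rcases hI1.2 i q with h7 | ⟨h7, h8⟩
          · exact .inl h7
          · exact .inr ⟨by omega, h8⟩
        · exact .inr ⟨by omega, h7, h8⟩
  · simp only [sum_const, card_range, smul_eq_mul]
    apply le_of_eq
    ring

theorem hash_index_inj {B l l' x y : ℕ} (hx : x < B) (hy : y < B) (h : l * B + x = l' * B + y) :
    l = l' ∧ x = y := by
  have h1 : (l * B + x) / B = l := by
    rw [mul_comm, Nat.mul_add_div (by omega), Nat.div_eq_of_lt hx, add_zero]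
  have h2 : (l' * B + y) / B = l' := by
    rw [mul_comm, Nat.mul_add_div (by omega), Nat.div_eq_of_lt hy, add_zero]
  have : l = l' := by rw [← h1, ← h2, h]
  subst this
  exact ⟨rfl, by omega⟩

theorem does_procFill {s : St} {a v : ℕ} {D : List ℕ} {done : ℕ → ℕ → Prop} (hb : Base P s)
    (hvv : s.var vv = v) (hv : v ∈ P.far a)
    (hRows : Rows P a done s) (hR : s.var vR = s.arr aRC 0 v) (hG : s.var vG = D.length)
    (hC : s.var vC = P.L * P.B) (hD : IsList s aDL vDLn D) (hDl : ∀ d ∈ D, ¬ P.heavy d) :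
    Does τ r procFill s (12 + (s.arr aRC 0 v + D.length) * (11 + 5 * (P.L * P.B))) (fun s' =>
      ∀ i < s.arr aRC 0 v, ∀ j < D.length,
        (∃ k < P.L * P.B, s'.arr aRM i k ≠ 0 ∧ s'.arr aCM j k ≠ 0) ↔
        ∃ l < P.L, ∃ z ∈ P.un a (s.arr aROWB 0 (s.arr aBKT v i)) (s.arr aROWC 0 (s.arr aBKT v i)),
          ∀ w ∈ P.nb (D.getD j 0), P.hash l w ≠ P.hash l z) := by
  set R := s.arr aRC 0 v with hRdef
  set U := fun i => P.un a (s.arr aROWB 0 (s.arr aBKT v i)) (s.arr aROWC 0 (s.arr aBKT v i)) with hU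
  -- Every filed set and every light neighbourhood has at most `s` elements, so entering its hash
  -- values costs no more, up to a constant, than the row of length `L * B` itself.
  have hlb : P.L * (5 + P.s * 3) ≤ 2 * (P.L * P.B) := by
    have h1 := P.two_s_le
    have h2 := P.one_le_s
    calc P.L * (5 + P.s * 3) ≤ P.L * (2 * P.B) := Nat.mul_le_mul_left _ (by omega)
      _ = _ := by ring
  have hUn : ∀ i, ∀ z ∈ U i, z < P.n := fun i z hz => (Par.mem_far.1 (Par.mem_un.1 hz).1).1
  refine (does_seq (does_fill2 (R := R) (C := P.L * P.B) (fun _ _ => 0) (by decide) rfl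
    (fun s' h => by rw [eval_var, h.var vR rfl, hR])
    (fun s' h => by rw [eval_var, h.var vC rfl, hC]) (fun _ _ _ _ _ _ _ _ => rfl))
    fun s1 hs1 h1 => does_seq (does_hashFill (P := P) (R := R) (id := fun k => s.arr aBKT v k)
      (W := U) rfl (fun s' h => (hb.same hs1 rfl).same h rfl)
      (fun s' h => by rw [eval_var, h.var vR rfl, hs1.var vR rfl, hR]) ?_ ?_ ?_
      (fun k _ => hUn k) ?_)
    fun s2 hs2 h2 => does_seq (does_fill2 (R := D.length) (C := P.L * P.B) (fun _ _ => 1)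
      (by decide) rfl
      (fun s' h => by rw [eval_var, h.var vG rfl, hs2.var vG rfl, hs1.var vG rfl, hG])
      (fun s' h => by rw [eval_var, h.var vC rfl, hs2.var vC rfl, hs1.var vC rfl, hC])
      (fun _ _ _ _ _ _ _ _ => rfl))
    fun s3 hs3 h3 => (does_hashFill (P := P) (R := D.length) (id := fun k => D.getD k 0)
      (W := fun k => P.nb (D.getD k 0)) rfl
      (fun s' h => (((hb.same hs1 rfl).same hs2 rfl).same hs3 rfl).same h rfl)
      (fun s' h => by rw [eval_var, h.var vG rfl, hs3.var vG rfl, hs2.var vG rfl, hs1.var vG rfl, hG])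
      ?_ ?_ ?_ (fun k hk z hz => P.adj_lt (P.mem_nb.1 hz)) ?_).mono le_rfl ?_).mono ?_
      (fun _ _ h => h)
  · intro k hk s' h hx
    rw [eval_arr, eval_var, eval_var, hx, h.arr aBKT rfl, hs1.arr aBKT rfl, h.var vv rfl,
      hs1.var vv rfl, hvv]
  · intro k hk s' h hx
    rw [eval_arr, eval_var, eval_cst, hx, h.arr aRLEN rfl, hs1.arr aRLEN rfl]
    exact hRows.len _ (hRows.bkt v hv k hk)
  · intro k hk j hj s' h hx hx'
    rw [eval_arr, eval_var, eval_var, hx, hx', h.arr aXX rfl, hs1.arr aXX rfl]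
    exact hRows.row _ (hRows.bkt v hv k hk) j hj
  · intro k hk
    have := hRows.small _ (hRows.bkt v hv k hk)
    rwa [hRows.len _ (hRows.bkt v hv k hk)] at this
  · intro k hk s' h hx
    rw [eval_arr, eval_var, eval_cst, hx, h.arr aDL rfl, hs3.arr aDL rfl, hs2.arr aDL rfl,
      hs1.arr aDL rfl, hD.2 k hk]
    simp [hk]
  · intro k hk s' h hx
    rw [eval_arr, eval_var, eval_cst, hx, h.arr aDEG rfl, hs3.arr aDEG rfl, hs2.arr aDEG rfl,
      hs1.arr aDEG rfl, hb.deg, Par.deg]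
  · intro k hk j hj s' h hx hx'
    rw [eval_arr, eval_var, eval_var, hx, hx', h.arr aNBR rfl, hs3.arr aNBR rfl, hs2.arr aNBR rfl,
      hs1.arr aNBR rfl, hb.nbr]
  · intro k hk
    exact not_lt.1 (hDl (D.getD k 0) (by simp [hk]))
  · rintro s4 hs4 ⟨h4, h5⟩ i hi j hj
    obtain ⟨g4, g5⟩ := h2
    have eRM : s4.arr aRM = s2.arr aRM := by rw [hs4.arr aRM rfl, hs3.arr aRM rfl]
    rw [eRM]
    constructor
    · rintro ⟨k, hk, k1, k2⟩
      rcases g5 i k with k3 | ⟨-, -, l, hl, z, hz, rfl⟩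
      · rw [k3, h1, if_pos ⟨hi, hk⟩] at k1
        exact absurd rfl k1
      · refine ⟨l, hl, z, hz, fun w hw hwz => k2 ?_⟩
        rw [← hwz]
        exact h4 j hj l hl w hw
    · rintro ⟨l, hl, z, hz, hw⟩
      have hlt : l * P.B + P.hash l z < P.L * P.B := by
        have h6 := P.hash_lt l z
        calc l * P.B + P.hash l z < l * P.B + P.B := by omega
          _ = (l + 1) * P.B := by ring
          _ ≤ _ := Nat.mul_le_mul_right _ hl
      refine ⟨l * P.B + P.hash l z, hlt, ?_, ?_⟩
      · rw [g4 i hi l hl z hz]; exact one_ne_zero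
      · rcases h5 j (l * P.B + P.hash l z) with k3 | ⟨-, -, l', hl', w, hw', k4⟩
        · rw [k3, h3, if_pos ⟨hj, hlt⟩]; exact one_ne_zero
        · obtain ⟨rfl, k5⟩ := hash_index_inj (P.hash_lt _ _) (P.hash_lt _ _) k4
          exact absurd k5.symm (hw w hw')
  · have e1 := Nat.mul_le_mul_left R hlb
    have e2 := Nat.mul_le_mul_left D.length hlb
    calc _ = 12 + 11 * R + 11 * D.length + 3 * (R * (P.L * P.B)) + 3 * (D.length * (P.L * P.B)) +
          R * (P.L * (5 + P.s * 3)) + D.length * (P.L * (5 + P.s * 3)) := by ring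
      _ ≤ 12 + 11 * R + 11 * D.length + 3 * (R * (P.L * P.B)) + 3 * (D.length * (P.L * P.B)) +
          R * (2 * (P.L * P.B)) + D.length * (2 * (P.L * P.B)) := by omega
      _ = _ := by ring

/-- A separated vertex is never a neighbour of d, whatever the hash functions are. Only the
converse, that every uncovered vertex is separated by some function, needs `Good`. -/
theorem hash_sep_iff (hG : P.Good) {d : ℕ} (hdn : d < P.n) (hd : ¬ P.heavy d) {U : List ℕ}
    (hU : ∀ z ∈ U, z < P.n) :
    (∃ l < P.L, ∃ z ∈ U, ∀ w ∈ P.nb d, P.hash l w ≠ P.hash l z) ↔ ¬ ∀ z ∈ U, P.adj d z := by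
  push Not
  constructor
  · rintro ⟨l, hl, z, hz, h⟩
    exact ⟨z, hz, fun ha => h z (P.mem_nb.2 ha) rfl⟩
  · rintro ⟨z, hz, h⟩
    obtain ⟨l, hl, h'⟩ := hG d z hdn (hU z hz) hd h
    exact ⟨l, hl, z, hz, h'⟩

/-- For every row in the bucket the vertex v has to be covered by d, so only the neighbours of v are
candidates. A nonempty bucket belongs to a light v, which leaves at most `s` columns and keeps the
block size in the range of `hκ`. -/
theorem does_procV {s : St} {a v : ℕ} {done : ℕ → ℕ → Prop} (hb : Base P s)
    (ha : s.var vA = a) (hvv : s.var vv = v) (hv : v ∈ P.far a) (hRows : Rows P a done s)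
    (hκ1 : 1 ≤ κ) (hκ : ∀ g, 1 ≤ g → g ≤ 2 * P.s + 2 → τ g ≤ κ * (g * g)) :
    Does τ r procV s (6 + 6 * P.deg v + 200 * κ * ((s.arr aRC 0 v + P.deg v) * (P.L * P.B)))
      (fun s' => P.Good → (s'.var vRES ≠ 0 ↔ s.var vRES ≠ 0 ∨ P.Hit s a v)) := by
  set D := (P.nb v).filter fun d => P.adj a d ∧ ¬ P.heavy d with hDdef
  set R := s.arr aRC 0 v with hRdef
  refine (does_seq (does_filt (P.nb v) (fun d => P.adj a d ∧ ¬ P.heavy d) (by decide) (by decide)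
      (by decide) rfl ?_ ?_ ?_) (l := 1 + (1 + 200 * κ * ((R + P.deg v) * (P.L * P.B))))
      fun s1 hs1 h1 => ?_).mono (by unfold Par.deg; omega) (fun _ _ h => h)
  · intro s' hs'
    rw [eval_arr, hs'.arr aDEG rfl, eval_cst, hb.deg, eval_var, hs'.var vv rfl, hvv, Par.deg]
  · intro i hi s' hs' hx
    rw [eval_arr, hs'.arr aNBR rfl, eval_var, eval_var, hx, hs'.var vv rfl, hvv, hb.nbr]
  · intro z hz s' hs' hx
    simp [hs'.arr aADJ rfl, hx, hs'.var vA rfl, ha, hb.adj, hs'.arr aDEG rfl, hb.deg,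
      hs'.var vS rfl, hb.sq, Par.heavy]
  have hD1 : ∀ d ∈ D, ¬ P.heavy d := fun d hd => by
    simp only [hDdef, List.mem_filter, decide_eq_true_eq] at hd; exact hd.2.2
  have hDn : ∀ d ∈ D, d < P.n := fun d hd => by
    simp only [hDdef, List.mem_filter] at hd; exact P.adj_lt (P.mem_nb.1 hd.1)
  have hDdeg : D.length ≤ P.deg v := List.length_filter_le _ _
  have hb1 := hb.same hs1 rfl
  have hRows1 := hRows.same hs1 rfl
  have v1 : s1.var vv = v := by rw [hs1.var vv rfl, hvv]
  have RC1 : s1.arr aRC = s.arr aRC := hs1.arr aRC rfl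
  refine does_ite (fun h => ?_) (fun h => ?_)
  · have hne : R ≠ 0 ∧ D.length ≠ 0 := by
      simp only [ne_eq, eAnd_ne, eval_arr, eval_var, eval_cst, v1, RC1, h1.1, not_or] at h
      exact h
    have hvl := hRows.light v hv hne.1
    have hgs : D.length ≤ P.s := hDdeg.trans (not_lt.1 hvl)
    set g := D.length with hg
    have hall : Does τ r procMain s1 (1 + (1 + (1 + ((12 + (R + g) * (11 + 5 * (P.L * P.B))) +
        (70 * κ * ((R + g) * (P.L * P.B + g)) + (3 + R * (5 + g * 4))))))) (fun s' =>
        P.Good → (s'.var vRES ≠ 0 ↔ s.var vRES ≠ 0 ∨ P.Hit s a v)) := by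
      refine does_seq (does_set_eq (v := R) (by simp [v1, RC1, hRdef]) rfl) ?_
      rintro _ - rfl
      refine does_seq (does_set_eq (v := g) (by rw [eval_var, setVar_var, if_neg (by decide)]; exact h1.1) rfl) ?_
      rintro _ - rfl
      refine does_seq (does_set_eq (v := P.L * P.B) (by simpa using hb1.LB) rfl) ?_
      rintro s2 - hs2
      have a2 : s2.arr = s1.arr := by rw [hs2]; rfl
      have e2 : ∀ x, x ≠ vR → x ≠ vG → x ≠ vC → s2.var x = s1.var x := fun x h1 h2 h3 => by
        rw [hs2]; simp [h1, h2, h3]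
      have hb2 : Base P s2 := by
        rw [hs2]; exact ((hb1.setVar _ _ rfl).setVar _ _ rfl).setVar _ _ rfl
      have hRows2 : Rows P a done s2 := by
        rw [hs2]
        exact ((hRows1.setVar _ _ (by decide)).setVar _ _ (by decide)).setVar _ _ (by decide)
      have RC2 : s2.arr aRC 0 v = R := by rw [a2, RC1]
      have BK2 : s2.arr aBKT = s.arr aBKT := by rw [a2, hs1.arr aBKT rfl]
      have RB2 : s2.arr aROWB = s.arr aROWB := by rw [a2, hs1.arr aROWB rfl]
      have RC2' : s2.arr aROWC = s.arr aROWC := by rw [a2, hs1.arr aROWC rfl]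
      have hD2 : IsList s2 aDL vDLn D :=
        h1.congr (e2 _ (by decide) (by decide) (by decide)) (by rw [a2])
      have hfill := does_procFill (τ := τ) (r := r) hb2 (v := v)
        (by rw [e2 _ (by decide) (by decide) (by decide), v1]) hv hRows2
        (by rw [RC2, hs2]; simp) (D := D) (by rw [hs2]; simp [hg]) (by rw [hs2]; simp) hD2 hD1
      rw [RC2] at hfill
      refine does_seq hfill fun s3 hs3 h3 => ?_
      refine does_seq (does_prod (R := R) (C := P.L * P.B) (g := g) (κ := κ)
        (by rw [hs3.var vR rfl, hs2]; simp) (by rw [hs3.var vC rfl, hs2]; simp)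
        (by rw [hs3.var vG rfl, hs2]; simp) (by omega) hκ1
        (hκ g (by omega) (by omega))) fun s4 hs4 h4 => ?_
      refine (does_scan2 (R := R) (C := g) (fun k j =>
        s4.arr aZ k j = 0 ∧ P.adj (s.arr aROWB 0 (s.arr aBKT v k)) (D.getD j 0) ∧
          P.adj (s.arr aROWC 0 (s.arr aBKT v k)) (D.getD j 0)) (by decide) (by decide) (by decide)
        (fun s' h => by simp [h.var vR rfl, hs4.var vR rfl, hs3.var vR rfl, hs2])
        (fun s' h => by simp [h.var vG rfl, hs4.var vG rfl, hs3.var vG rfl, hs2])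
        ?_).mono le_rfl ?_
      · intro p hp q hq s' h hx hy
        have hadj : s'.arr aADJ = s2.arr aADJ := by
          rw [h.arr aADJ rfl, hs4.arr aADJ rfl, hs3.arr aADJ rfl]
        have hRB : s'.arr aROWB = s.arr aROWB := by
          rw [h.arr aROWB rfl, hs4.arr aROWB rfl, hs3.arr aROWB rfl, RB2]
        have hRC : s'.arr aROWC = s.arr aROWC := by
          rw [h.arr aROWC rfl, hs4.arr aROWC rfl, hs3.arr aROWC rfl, RC2']
        have hBK : s'.arr aBKT = s.arr aBKT := by
          rw [h.arr aBKT rfl, hs4.arr aBKT rfl, hs3.arr aBKT rfl, BK2]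
        have hDL : s'.arr aDL 0 q = D.getD q 0 := by
          rw [h.arr aDL rfl, hs4.arr aDL rfl, hs3.arr aDL rfl, hD2.2 q hq]; simp [hg ▸ hq]
        have hvv' : s'.var vv = v := by
          rw [h.var vv rfl, hs4.var vv rfl, hs3.var vv rfl,
            e2 _ (by decide) (by decide) (by decide), v1]
        simp only [ne_eq, eAnd_ne, eNot_ne, eval_arr, eval_var, eval_cst, h.arr aZ rfl, hx, hy, hadj,
          hRB, hRC, hBK, hDL, hvv', hb2.adj]
        tauto
      · intro s5 _ h5 hGood
        have r4 : s4.var vRES = s.var vRES := by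
          rw [hs4.var vRES rfl, hs3.var vRES rfl, e2 _ (by decide) (by decide) (by decide),
            hs1.var vRES rfl]
        rw [h5, r4]
        apply or_congr_right
        have hz : ∀ k < R, ∀ j < g, (s4.arr aZ k j = 0 ↔
            ∀ z ∈ P.un a (s.arr aROWB 0 (s.arr aBKT v k)) (s.arr aROWC 0 (s.arr aBKT v k)),
              P.adj (D.getD j 0) z) := by
          intro k hk j hj
          have hm : D.getD j 0 ∈ D := by simp [hg ▸ hj]
          rw [← not_iff_not, ← ne_eq, h4 k hk j hj, h3 k hk j hj, RB2, RC2', BK2,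
            hash_sep_iff hGood (hDn _ hm) (hD1 _ hm)
              fun z hz => (Par.mem_far.1 (Par.mem_un.1 hz).1).1]
        constructor
        · rintro ⟨k, hk, j, hj, k1, k2, k3⟩
          have hm : D.getD j 0 ∈ D := by simp [hg ▸ hj]
          have hm' := hm
          simp only [hDdef, List.mem_filter, decide_eq_true_eq] at hm'
          exact ⟨k, hk, D.getD j 0, hm'.1, hm'.2.1, hm'.2.2, k2, k3, (hz k hk j hj).1 k1⟩
        · rintro ⟨k, hk, d, k1, k2, k3, k4, k5, k6⟩
          have hm : d ∈ D := by
            simp only [hDdef, List.mem_filter, decide_eq_true_eq]; exact ⟨k1, k2, k3⟩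
          obtain ⟨j, hj, hjd⟩ := List.getElem_of_mem hm
          have hjd' : D.getD j 0 = d := by simp [hj, hjd]
          exact ⟨k, hk, j, hj, (hz k hk j hj).2 (by rw [hjd']; exact k6), by rwa [hjd'],
            by rwa [hjd']⟩
    refine hall.mono ?_ fun _ _ h => h
    have hB : 4 ≤ P.L * P.B := by
      have := P.two_s_le
      have := P.one_le_s
      calc 4 ≤ 1 * P.B := by omega
        _ ≤ _ := Nat.mul_le_mul_right _ P.one_le_L
    have hgB : g ≤ P.L * P.B := by
      have := P.two_s_le
      calc g ≤ 1 * P.B := by omega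
        _ ≤ _ := Nat.mul_le_mul_right _ P.one_le_L
    set LB := P.L * P.B
    have f1 : (R + g) * LB ≤ (R + P.deg v) * LB := Nat.mul_le_mul_right _ (by omega)
    have f2 : (R + g) * (LB + g) ≤ 2 * ((R + g) * LB) := by
      calc (R + g) * (LB + g) ≤ (R + g) * (LB + LB) := Nat.mul_le_mul_left _ (by omega)
        _ = _ := by ring
    have f3 : R * g ≤ (R + g) * LB := Nat.mul_le_mul (by omega) hgB
    have f4 : 4 * (R + g) ≤ (R + g) * LB := by rw [mul_comm]; exact Nat.mul_le_mul_left _ hB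
    have f5 := Nat.mul_le_mul_left (70 * κ) f2
    have f6 : (R + g) * LB ≤ κ * ((R + g) * LB) := Nat.le_mul_of_pos_left _ hκ1
    have f7 := Nat.mul_le_mul_left (200 * κ) f1
    have f8 : 2 ≤ R + g := by omega
    calc _ = 18 + 11 * (R + g) + 5 * ((R + g) * LB) + 5 * R + 4 * (R * g) +
          70 * κ * ((R + g) * (LB + g)) := by ring
      _ ≤ 18 + 11 * (R + g) + 5 * ((R + g) * LB) + 5 * R + 4 * (R * g) +
          70 * κ * (2 * ((R + g) * LB)) := by omega
      _ = 18 + 11 * (R + g) + 5 * ((R + g) * LB) + 5 * R + 4 * (R * g) +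
          140 * (κ * ((R + g) * LB)) := by ring
      _ ≤ 200 * (κ * ((R + g) * LB)) := by omega
      _ = 200 * κ * ((R + g) * LB) := by ring
      _ ≤ _ := f7.trans (Nat.le_add_left _ _)
  · have hne : R ≠ 0 → D.length = 0 := by
      simp only [eAnd_ne, eval_arr, eval_var, eval_cst, v1, RC1, h1.1] at h
      exact h.resolve_left
    refine (does_skip ?_).mono (by omega) (fun _ _ h => h)
    intro _
    rw [hs1.var vRES rfl, iff_self_or]
    rintro ⟨k, hk, d, k1, k2, k3, -⟩
    have hm : d ∈ D := by
      simp only [hDdef, List.mem_filter, decide_eq_true_eq]; exact ⟨k1, k2, k3⟩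
    have := hne (by omega)
    rw [List.length_eq_zero_iff] at this
    rw [this] at hm
    simp at hm

/-- Over all v, the rows number at most 2m by `Rows.sum`, and so do the columns, up to the same
degree bound. Hence the products cost O(κ·m·L·B) altogether. -/
theorem does_procAll {s : St} {a : ℕ} {done : ℕ → ℕ → Prop} (hb : Base P s)
    (ha : s.var vA = a) (hX : IsList s aX vXn (P.far a)) (hRows : Rows P a done s)
    (hr : s.var vr ≤ 2 * P.m)
    (hκ1 : 1 ≤ κ) (hκ : ∀ g, 1 ≤ g → g ≤ 2 * P.s + 2 → τ g ≤ κ * (g * g)) :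
    Does τ r procAll s (3 + 9 * P.n + 12 * P.m + 800 * κ * (P.m * (P.L * P.B)))
      (fun s' => P.Good → (s'.var vRES ≠ 0 ↔ s.var vRES ≠ 0 ∨ ∃ v ∈ P.far a, P.Hit s a v)) := by
  refine (does_forL (P.far a) (by decide) rfl rfl (by simp [hX.1]) (fun v =>
    6 + 6 * P.deg v + 200 * κ * ((s.arr aRC 0 v + P.deg v) * (P.L * P.B)))
    (fun pre s' => P.Good → (s'.var vRES ≠ 0 ↔ s.var vRES ≠ 0 ∨ ∃ v ∈ pre, P.Hit s a v))
    (fun _ _ _ h => by simpa using h) (fun _ _ _ h => by simpa using h) (by simp)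
    ?_ ?_).mono ?_ (fun _ _ h => h)
  · intro i hi s' hs' hx'
    rw [eval_arr, eval_var, hx', hs'.arr aX rfl, eval_cst, hX.2 i hi]
  · intro pre v suf s2 hl hs2 hv2 hI2
    have hs2' : Same procAll s s2 := hs2
    have hRC : s2.arr aRC = s.arr aRC := hs2'.arr aRC rfl
    have hp := does_procV (τ := τ) (r := r) (hb.same hs2' rfl) (by rw [hs2'.var vA rfl, ha]) hv2
      (by simp [hl]) (hRows.same hs2' rfl) hκ1 hκ
    rw [hRC] at hp
    refine hp.mono le_rfl fun s3 _ h3 hG => ?_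
    have hH : P.Hit s2 a v ↔ P.Hit s a v := by
      unfold Par.Hit
      rw [hRC, hs2'.arr aROWB rfl, hs2'.arr aROWC rfl, hs2'.arr aBKT rfl]
    rw [h3 hG, hI2 hG, hH]
    simp only [List.mem_append, List.mem_singleton, or_and_right, exists_or, exists_eq_left,
      or_assoc]
  · have e1 : ((P.far a).map fun v => 6 + 6 * P.deg v +
        200 * κ * ((s.arr aRC 0 v + P.deg v) * (P.L * P.B)) + 3).sum =
        (P.far a).length * 9 + 6 * ((P.far a).map P.deg).sum + 200 * κ * (P.L * P.B) *
          (((P.far a).map fun v => s.arr aRC 0 v).sum + ((P.far a).map P.deg).sum) := by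
      rw [← sum_map_const', ← sum_map_mul', ← sum_map_add', ← sum_map_add', ← sum_map_mul',
        ← sum_map_add']
      congr 1
      apply List.map_congr_left
      intro v _
      ring
    rw [e1, hRows.sum]
    have e2 := P.sum_deg_far a
    have e3 := P.length_far a
    have e4 : s.var vr + ((P.far a).map P.deg).sum ≤ 4 * P.m := by omega
    have e5 := Nat.mul_le_mul_left (200 * κ * (P.L * P.B)) e4
    have e6 : 200 * κ * (P.L * P.B) * (4 * P.m) = 800 * κ * (P.m * (P.L * P.B)) := by ring
    omega

end Proc

/-! ## Dominating cliques that contain a given vertex -/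

/-- `a`, `b`, `c`, `d` form a dominating clique. -/
structure Par.Tri (P : Par) (a b c d : ℕ) : Prop where
  ab : P.adj a b
  ac : P.adj a c
  ad : P.adj a d
  bc : P.adj b c
  bd : P.adj b d
  cd : P.adj c d
  dom : ∀ z ∈ P.far a, P.adj b z ∨ P.adj c z ∨ P.adj d z

def Par.DomA (P : Par) (a : ℕ) : Prop := ∃ b c d, P.Tri a b c d

section Math

variable {P : Par}

theorem Par.Tri.rot {a b c d : ℕ} (h : P.Tri a b c d) : P.Tri a c d b :=
  ⟨h.ac, h.ad, h.ab, h.cd, P.symm h.bc, P.symm h.bd, fun z hz => by have := h.dom z hz; tauto⟩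

theorem Par.Tri.swap {a b c d : ℕ} (h : P.Tri a b c d) : P.Tri a c b d :=
  ⟨h.ac, h.ab, h.ad, P.symm h.bc, h.cd, h.bd, fun z hz => by have := h.dom z hz; tauto⟩

/-- The role of a is not special: a vertex far from b is either a neighbour of a or far from a,
since a itself is adjacent to b. -/
theorem Par.Tri.exch {a b c d : ℕ} (h : P.Tri a b c d) : P.Tri b a c d := by
  refine ⟨P.symm h.ab, h.bc, h.bd, h.ac, h.ad, h.cd, fun z hz => ?_⟩
  obtain ⟨h1, h2, h3⟩ := Par.mem_far.1 hz
  by_cases h4 : P.adj a z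
  · exact .inl h4
  · have h5 : z ≠ a := by rintro rfl; exact h3 (P.symm h.ab)
    have := h.dom z (Par.mem_far.2 ⟨h1, h5, h4⟩)
    tauto

/-- Rename the clique so that d covers y. If d is light, or all three are heavy, the first
alternative holds. Otherwise d is heavy and another vertex is light; rename again so that the one
covering y is called b and the light one d. -/
theorem Par.DomA.light_cases {a y : ℕ} (h : P.DomA a) (hy : y ∈ P.far a) :
    (∃ b c d, P.Tri a b c d ∧ P.adj d y ∧ (P.heavy d → P.heavy b ∧ P.heavy c)) ∨
    ∃ b c d, P.Tri a b c d ∧ P.adj y b ∧ P.heavy b ∧ ¬ P.heavy d := by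
  obtain ⟨b, c, d, h, hd⟩ : ∃ b c d, P.Tri a b c d ∧ P.adj d y := by
    obtain ⟨b, c, d, h⟩ := h
    rcases h.dom y hy with h1 | h1 | h1
    · exact ⟨c, d, b, h.rot, h1⟩
    · exact ⟨d, b, c, h.rot.rot, h1⟩
    · exact ⟨b, c, d, h, h1⟩
  by_cases h1 : P.heavy d
  · by_cases h2 : P.heavy b
    · by_cases h3 : P.heavy c
      · exact .inl ⟨b, c, d, h, hd, fun _ => ⟨h2, h3⟩⟩
      · exact .inr ⟨d, b, c, h.rot.rot, P.symm hd, h1, h3⟩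
    -- The rotation has order three, so this permutation produces the order d, c, b.
    · exact .inr ⟨d, c, b, h.rot.rot.rot.rot.rot.swap.rot, P.symm hd, h1, h2⟩
  · exact .inl ⟨b, c, d, h, hd, fun h => absurd h h1⟩

/-- If b, c, d include a light vertex, put it last; if not, all are heavy. -/
theorem Par.DomA.heavy_order {a : ℕ} (h : P.DomA a) :
    ∃ b c d, P.Tri a b c d ∧ (P.heavy d → P.heavy b ∧ P.heavy c) := by
  obtain ⟨b, c, d, h⟩ := h
  by_cases h2 : P.heavy b
  · by_cases h3 : P.heavy c
    · exact ⟨b, c, d, h, fun _ => ⟨h2, h3⟩⟩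
    · exact ⟨d, b, c, h.rot.rot, fun h => absurd h h3⟩
  · exact ⟨c, d, b, h.rot, fun h => absurd h h2⟩

/-- What a, b and c miss has to be covered by d alone. -/
theorem Par.length_un_le {a b c d : ℕ} (h : P.Tri a b c d) : (P.un a b c).length ≤ P.deg d := by
  have hn : (P.un a b c).Nodup := ((Par.nodup_far a).filter _).filter _
  have hs : (P.un a b c).toFinset ⊆ (P.nb d).toFinset := fun z hz => by
    rw [List.mem_toFinset] at hz ⊢
    obtain ⟨h1, h2, h3⟩ := Par.mem_un.1 hz
    exact P.mem_nb.2 (((h.dom z h1).resolve_left h2).resolve_left h3)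
  have := Finset.card_le_card hs
  rwa [List.toFinset_card_of_nodup (P.nodup d), List.toFinset_card_of_nodup hn] at this

/-- Count the adjacent pairs from the other side: each x in `X` has at most deg x neighbours in the
duplicate-free list. -/
theorem Par.sum_cover_le {l : List ℕ} (hl : l.Nodup) (X : List ℕ) :
    (l.map fun c => (X.filter fun z => P.adj c z).length).sum ≤ (X.map P.deg).sum := by
  induction X with
  | nil => simp
  | cons x X ih =>
    have h1 : ∀ c, ((x :: X).filter fun z => P.adj c z).length =
        (if P.adj c x then 1 else 0) + (X.filter fun z => P.adj c z).length := by
      intro c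
      by_cases h : P.adj c x <;> simp [h, add_comm]
    have h2 : (l.map fun c => if P.adj c x then 1 else 0).sum ≤ P.deg x := by
      have h3 : (l.map fun c => if P.adj c x then 1 else 0).sum =
          (l.filter fun c => P.adj c x).length := by
        clear hl ih h1
        induction l with
        | nil => rfl
        | cons c l ih => by_cases h : P.adj c x <;> simp [h, ih, add_comm]
      rw [h3]
      have hs : (l.filter fun c => P.adj c x).toFinset ⊆ (P.nb x).toFinset := fun z hz => by
        simp only [List.mem_toFinset, List.mem_filter, decide_eq_true_eq] at hz ⊢
        exact P.mem_nb.2 (P.symm hz.2)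
      have := Finset.card_le_card hs
      rwa [List.toFinset_card_of_nodup (P.nodup x), List.toFinset_card_of_nodup (hl.filter _)] at this
    simp only [h1, List.map_cons, List.sum_cons]
    rw [sum_map_add']
    omega

theorem Par.length_heavy_far (a : ℕ) : ((P.far a).filter P.heavy).length ≤ 2 * P.s :=
  ((List.filter_sublist (l := List.range P.n)).filter _).length_le.trans Par.length_hl

end Math

/-! ## The search for a given vertex `a` -/

def listX : Cmd := filt vfi vfe vXn aX (.var vN) (.var vfi)
  (eAnd (eNot (eEq (.var vfe) (.var vA))) (eNot (.arr aADJ (.var vA) (.var vfe))))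

def findY : Cmd := .seq (.set vY (.arr aX (.const 0) (.const 0)))
  (forL vj vv (.var vXn) (.arr aX (.const 0) (.var vj))
    (.ite (eLt (.arr aDEG (.const 0) (.var vv)) (.arr aDEG (.const 0) (.var vY)))
      (.set vY (.var vv)) .skip))

def copyX (c : E) : Cmd := filt vfi vfe vYn aYL (.var vXn) (.arr aX (.const 0) (.var vfi)) c

/-- Mode 1 lets the first check test all of X without flags. Mode 0 is set afterwards so that the
final pass trusts only flagged pairs. -/
def lightCase : Cmd := .seq (.set vMODE (.const 1)) (.seq (copyX (.const 1)) (.seq (checkAll vY)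
  (.seq (.set vMODE (.const 0)) (.seq buildRows procAll))))

def heavyPart : Cmd := .seq (copyX (eLt (.var vS) (.arr aDEG (.const 0) (.var vfe)))) (checkAll vA)

/-- If X is empty or its vertex of least degree is heavy, then all of X is heavy, and mode 1 tells
the final pass that no flags are needed. -/
def perA : Cmd := .seq listX (.seq findY (.seq (.ite (eAnd (.var vXn)
  (eNot (eLt (.var vS) (.arr aDEG (.const 0) (.var vY))))) lightCase (.set vMODE (.const 1)))
  heavyPart))

section PerA

variable {τ : ℕ → ℕ} {r : ℕ → Bool} {P : Par} {κ : ℕ}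

theorem does_listX {s : St} {a : ℕ} (hb : Base P s) (ha : s.var vA = a) :
    Does τ r listX s (4 + 6 * P.n) (fun s' => IsList s' aX vXn (P.far a)) := by
  refine (does_filt (List.range P.n) (fun z => z ≠ a ∧ ¬ P.adj a z) (by decide) (by decide)
      (by decide) rfl ?_ ?_ ?_).mono (by simp) (fun _ _ h => h)
  · intro s' hs'
    rw [eval_var, hs'.var vN rfl, hb.n, List.length_range]
  · intro i hi s' hs' hx
    rw [eval_var, hx, List.getElem_range]
  · intro z hz s' hs' hx
    simp [hs'.arr aADJ rfl, hx, hs'.var vA rfl, ha, hb.adj]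

theorem does_findY {s : St} {X : List ℕ} (hb : Base P s) (hX : IsList s aX vXn X) :
    Does τ r findY s (4 + 5 * X.length) (fun s' => X ≠ [] →
      s'.var vY ∈ X ∧ ∀ v ∈ X, P.deg (s'.var vY) ≤ P.deg v) := by
  refine (does_seq (does_set_eq rfl rfl) (l := 3 + 5 * X.length) ?_).mono (by omega)
    (fun _ _ h => h)
  rintro s0 hs0 h0
  have hb0 := hb.same hs0 rfl
  refine (does_forL X (by decide) rfl rfl (by simp [hs0.var vXn rfl, hX.1]) (fun _ => 2)
    (fun pre s' => (X ≠ [] → s'.var vY ∈ X) ∧ ∀ v ∈ pre, P.deg (s'.var vY) ≤ P.deg v)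
    (fun _ _ _ h => by simpa using h) (fun _ _ _ h => by simpa using h) ?_ ?_ ?_).mono ?_ ?_
  · refine ⟨fun hne => ?_, by simp⟩
    have h1 : 0 < X.length := List.length_pos_iff.2 hne
    have : s0.var vY = X[0] := by
      rw [h0]; simpa using hX.2 0 h1
    rw [this]
    exact List.getElem_mem _
  · intro i hi s' hs' hx'
    rw [eval_arr, eval_var, hx', hs'.arr aX rfl, hs0.arr aX rfl, eval_cst, hX.2 i hi]
  · intro pre v suf s2 hl hs2 hv2 hI2
    have hb2 : Base P s2 := hb0.same hs2 rfl
    refine does_ite (k := 1) (fun h => ?_) (fun h => ?_)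
    · have h1 : P.deg v < P.deg (s2.var vY) := by simpa [hb2.deg, hv2] using h
      refine does_set (v := v) hv2 rfl ⟨fun _ => by simp [hl], ?_⟩
      intro w hw
      simp only [setVar_var, if_true]
      rcases List.mem_append.1 hw with h2 | h2
      · exact h1.le.trans (hI2.2 w h2)
      · rw [List.mem_singleton.1 h2]
    · have h1 : P.deg (s2.var vY) ≤ P.deg v := by simpa [hb2.deg, hv2] using h
      refine does_skip ⟨hI2.1, ?_⟩
      intro w hw
      rcases List.mem_append.1 hw with h2 | h2
      · exact hI2.2 w h2
      · rwa [List.mem_singleton.1 h2]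
  · simp; omega
  · exact fun s' _ h hne => ⟨h.1 hne, h.2⟩

theorem does_copyX {s : St} {X : List ℕ} {c : E} {p : ℕ → Prop} [DecidablePred p]
    (hX : IsList s aX vXn X)
    (hc : ∀ z ∈ X, ∀ s', Same (copyX c) s s' → s'.var vfe = z → (c.eval s' ≠ 0 ↔ p z)) :
    Does τ r (copyX c) s (4 + 6 * X.length) (fun s' => IsList s' aYL vYn (X.filter p)) := by
  refine does_filt X p (by decide) (by decide) (by decide) rfl ?_ ?_ hc
  · intro s' hs'
    rw [eval_var, hs'.var vXn rfl, hX.1]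
  · intro i hi s' hs' hx
    rw [eval_arr, hs'.arr aX rfl, eval_var, hx, eval_cst, hX.2 i hi]

/-! ### Cost estimates for one vertex -/

theorem sum_check_le (a w : ℕ) (q : ℕ) : ((P.nb w).map fun d => 8 + 12 * P.s +
      200 * κ * ((P.sel a d).length * ((P.sel a d).length + q)) + 3).sum ≤
    P.deg w * (11 + 12 * P.s) + 200 * κ * ((2 * P.s + q) *
      ((P.nb w).map fun d => (P.sel a d).length).sum) := by
  rw [Par.deg, ← sum_map_const', ← sum_map_mul', ← sum_map_mul', ← sum_map_add']
  apply sum_map_mono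
  intro d _
  have h1 := P.length_sel_le a d
  have h2 : (P.sel a d).length * ((P.sel a d).length + q) ≤
      (2 * P.s + q) * (P.sel a d).length := by
    rw [mul_comm]; exact Nat.mul_le_mul_right _ (by omega)
  have := Nat.mul_le_mul_left (200 * κ) h2
  omega

theorem le_LB : P.s ≤ P.L * P.B := by
  have := P.two_s_le
  calc P.s ≤ 1 * P.B := by omega
    _ ≤ _ := Nat.mul_le_mul_right _ P.one_le_L

/-- By minimality the degree of y occurs at least |X| times in the degree sum. -/
theorem deg_mul_far_le {a y : ℕ} (hy : ∀ v ∈ P.far a, P.deg y ≤ P.deg v) :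
    (P.far a).length * P.deg y ≤ 2 * P.m := by
  rw [← sum_map_const']
  exact (sum_map_mono hy).trans (P.sum_deg_far a)

/-- There are deg y choices of d, each with at most 2s candidates and |X| columns. The square part
contributes s²·deg y ≤ s³, and the rest s·|X|·deg y, which is at most 2sm. -/
theorem cost_checkY {a y : ℕ} (hyl : ¬ P.heavy y) (hy : ∀ v ∈ P.far a, P.deg y ≤ P.deg v) :
    ((P.nb y).map fun d => 8 + 12 * P.s +
      200 * κ * ((P.sel a d).length * ((P.sel a d).length + (P.far a).length)) + 3).sum ≤
    (23 + 1600 * κ) * (P.s * P.s * P.s) := by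
  refine (sum_check_le a y _).trans ?_
  have h1 : P.deg y ≤ P.s := not_lt.1 hyl
  have h2 : ((P.nb y).map fun d => (P.sel a d).length).sum ≤ P.deg y * (2 * P.s) :=
    sum_map_le_mul fun d _ => P.length_sel_le a d
  have h3 := deg_mul_far_le hy
  have h4 := P.m_le
  have h5 := P.one_le_s
  have h6 : (2 * P.s + (P.far a).length) * ((P.nb y).map fun d => (P.sel a d).length).sum ≤
      8 * (P.s * P.s * P.s) := by
    calc _ ≤ (2 * P.s + (P.far a).length) * (P.deg y * (2 * P.s)) := Nat.mul_le_mul_left _ h2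
      _ = 4 * (P.s * P.s) * P.deg y + 2 * P.s * ((P.far a).length * P.deg y) := by ring
      _ ≤ 4 * (P.s * P.s) * P.s + 2 * P.s * (2 * (P.s * P.s)) :=
        Nat.add_le_add (Nat.mul_le_mul_left _ h1) (Nat.mul_le_mul_left _ (by omega))
      _ = _ := by ring
  have h7 := Nat.mul_le_mul_left (200 * κ) h6
  have h8 : P.deg y * (11 + 12 * P.s) ≤ 23 * (P.s * P.s * P.s) := by
    calc _ ≤ P.s * (23 * P.s) := Nat.mul_le_mul h1 (by omega)
      _ = 23 * (P.s * P.s * 1) := by ring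
      _ ≤ _ := by gcongr
  calc _ ≤ 23 * (P.s * P.s * P.s) + 200 * κ * (8 * (P.s * P.s * P.s)) := Nat.add_le_add h8 h7
    _ = _ := by ring

/-- Here d ranges over all neighbours of a, which may be many. The candidates for d number at most
deg d, so their total is at most 2m, while both dimensions that multiply it are O(s). -/
theorem cost_checkA (a : ℕ) {q : ℕ} (hq : q ≤ 2 * P.s) :
    ((P.nb a).map fun d => 8 + 12 * P.s +
      200 * κ * ((P.sel a d).length * ((P.sel a d).length + q)) + 3).sum ≤
    (23 + 1600 * κ) * (P.s * P.s * P.s) := by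
  refine (sum_check_le a a _).trans ?_
  have h1 : P.deg a ≤ P.s * P.s := (P.deg_le a).trans P.n_le
  have h2 : ((P.nb a).map fun d => (P.sel a d).length).sum ≤ 2 * P.m :=
    (sum_map_mono fun d _ => P.length_sel_le_deg a d).trans (P.sum_deg_nb a)
  have h4 := P.m_le
  have h5 := P.one_le_s
  have h6 : (2 * P.s + q) * ((P.nb a).map fun d => (P.sel a d).length).sum ≤
      8 * (P.s * P.s * P.s) := by
    calc _ ≤ (4 * P.s) * (2 * (P.s * P.s)) := Nat.mul_le_mul (by omega) (by omega)
      _ = _ := by ring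
  have h7 := Nat.mul_le_mul_left (200 * κ) h6
  have h8 : P.deg a * (11 + 12 * P.s) ≤ 23 * (P.s * P.s * P.s) := by
    calc _ ≤ (P.s * P.s) * (23 * P.s) := Nat.mul_le_mul h1 (by omega)
      _ = _ := by ring
  calc _ ≤ 23 * (P.s * P.s * P.s) + 200 * κ * (8 * (P.s * P.s * P.s)) := Nat.add_le_add h8 h7
    _ = _ := by ring

/-- For fixed b, the scans over all c meet at most 2m neighbours in X (`sum_cover_le`) and at most s
+ 1 other vertices each. There are at most s vertices b, and their degrees sum to at most 2m, so
both parts are O(s³). -/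
theorem cost_build {a y : ℕ} (hyl : ¬ P.heavy y) (hy : ∀ v ∈ P.far a, P.deg y ≤ P.deg v) :
    ((P.nb y).map fun b =>
      8 + 6 * (P.far a).length + ((P.nb b).map fun c =>
      15 + (((P.far a).filter fun z => P.adj c z).length + P.s + 1) * 8 + 3).sum + 3).sum ≤
    107 * (P.s * P.s * P.s) := by
  have h1 : P.deg y ≤ P.s := not_lt.1 hyl
  have h3 := deg_mul_far_le hy
  have h4 := P.m_le
  have h5 := P.one_le_s
  have key : ∀ b, ((P.nb b).map fun c =>
      15 + (((P.far a).filter fun z => P.adj c z).length + P.s + 1) * 8 + 3).sum ≤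
      P.deg b * (26 + 8 * P.s) + 8 * (2 * P.m) := by
    intro b
    have e1 : ((P.nb b).map fun c =>
        15 + (((P.far a).filter fun z => P.adj c z).length + P.s + 1) * 8 + 3).sum =
        P.deg b * (26 + 8 * P.s) + 8 *
          ((P.nb b).map fun c => ((P.far a).filter fun z => P.adj c z).length).sum := by
      rw [Par.deg, ← sum_map_const', ← sum_map_mul', ← sum_map_add']
      congr 1
      apply List.map_congr_left
      intro c _
      ring
    rw [e1]
    have := (Par.sum_cover_le (P.nodup b) (P.far a)).trans (P.sum_deg_far a)
    omega
  have e2 : ((P.nb y).map fun b =>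
      8 + 6 * (P.far a).length + ((P.nb b).map fun c =>
      15 + (((P.far a).filter fun z => P.adj c z).length + P.s + 1) * 8 + 3).sum + 3).sum ≤
      P.deg y * (11 + 6 * (P.far a).length + 8 * (2 * P.m)) +
        (26 + 8 * P.s) * ((P.nb y).map P.deg).sum := by
    rw [Par.deg, ← sum_map_const', ← sum_map_mul', ← sum_map_add']
    apply sum_map_mono
    intro b _
    have := key b
    rw [mul_comm (P.deg b)] at this
    omega
  refine e2.trans ?_
  have e3 := P.sum_deg_nb y
  set S3 := P.s * P.s * P.s with hS3
  have f1 : P.s * P.s ≤ S3 := Nat.le_mul_of_pos_right _ h5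
  have f2 : P.s ≤ P.s * P.s := Nat.le_mul_of_pos_right _ h5
  have f3 : P.deg y * (8 * (2 * P.m)) ≤ 16 * S3 := by
    calc _ ≤ P.s * (8 * (2 * (P.s * P.s))) := Nat.mul_le_mul h1 (by omega)
      _ = _ := by rw [hS3]; ring
  have f4 : (26 + 8 * P.s) * ((P.nb y).map P.deg).sum ≤ 52 * (P.s * P.s) + 16 * S3 := by
    calc _ ≤ (26 + 8 * P.s) * (2 * (P.s * P.s)) := Nat.mul_le_mul_left _ (by omega)
      _ = _ := by rw [hS3]; ring
  calc _ = 11 * P.deg y + 6 * ((P.far a).length * P.deg y) + P.deg y * (8 * (2 * P.m)) +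
        (26 + 8 * P.s) * ((P.nb y).map P.deg).sum := by ring
    _ ≤ _ := by omega

/-- The part of the search that relies on a light vertex `y` outside the neighbourhood of `a`. -/
theorem does_lightCase {s : St} {a y : ℕ} (hb : Base P s) (ha : s.var vA = a) (hvy : s.var vY = y)
    (hX : IsList s aX vXn (P.far a)) (hF : FlagOK P s) (hyX : y ∈ P.far a)
    (hyl : ¬ P.heavy y) (hy : ∀ v ∈ P.far a, P.deg y ≤ P.deg v)
    (hκ1 : 1 ≤ κ) (hκ : ∀ g, 1 ≤ g → g ≤ 2 * P.s + 2 → τ g ≤ κ * (g * g)) :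
    Does τ r lightCase s (3000 * κ * (P.s * P.s * (P.L * P.B))) (fun s' => FlagOK P s' ∧
      s'.var vMODE = 0 ∧ (P.Good → (s.var vRES ≠ 0 → s'.var vRES ≠ 0) ∧
      (s'.var vRES ≠ 0 → s.var vRES ≠ 0 ∨ P.DomA a) ∧
      (P.DomA a → s'.var vRES ≠ 0 ∨ ∃ b c d, P.Tri a b c d ∧ ¬ P.heavy d ∧
        s'.arr aFLAG b c = a + 1))) := by
  refine (does_seq (does_set_eq (v := 1) rfl rfl) ?_ (l := (4 + 6 * (P.far a).length) + ((3 +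
    (23 + 1600 * κ) * (P.s * P.s * P.s)) + (1 + ((7 + 4 * (P.far a).length +
    107 * (P.s * P.s * P.s)) + (3 + 9 * P.n + 12 * P.m + 800 * κ * (P.m * (P.L * P.B)))))))).mono ?_
    (fun _ _ h => h)
  · intro s1 hs1 e1
    refine does_seq (does_copyX (p := fun _ => True) (hX.congr (hs1.var vXn rfl) (hs1.arr aX rfl))
      (fun z _ s' _ _ => by simp)) fun s2 hs2 h2 => ?_
    have hfT : (P.far a).filter (fun _ => decide True) = P.far a := by simp
    rw [hfT] at h2
    have hb2 := (hb.same hs1 rfl).same hs2 rfl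
    have m2 : s2.var vMODE = 1 := by rw [hs2.var vMODE rfl, e1]; simp
    have a2 : s2.var vA = a := by rw [hs2.var vA rfl, hs1.var vA rfl, ha]
    refine does_seq ((does_checkAll (τ := τ) (r := r) (x := vY) (w := y) hb2 rfl
      (by rw [hs2.var vY rfl, hs1.var vY rfl, hvy]) a2 h2 hκ1 hκ).mono
      (Nat.add_le_add_left (cost_checkY hyl hy) 3) fun _ _ h => h) fun s3 hs3 h3 => ?_
    refine does_seq (does_set_eq (v := 0) rfl rfl) ?_
    intro s4 hs4 e4
    have hb4 := (hb2.same hs3 rfl).same hs4 rfl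
    have a4 : s4.var vA = a := by rw [hs4.var vA rfl, hs3.var vA rfl, a2]
    have X4 : IsList s4 aX vXn (P.far a) := hX.congr
      (by rw [hs4.var vXn rfl, hs3.var vXn rfl, hs2.var vXn rfl, hs1.var vXn rfl])
      (by rw [hs4.arr aX rfl, hs3.arr aX rfl, hs2.arr aX rfl, hs1.arr aX rfl])
    have F4 : FlagOK P s4 := by
      unfold FlagOK at hF ⊢
      rwa [hs4.arr aFLAG rfl, hs3.arr aFLAG rfl, hs2.arr aFLAG rfl, hs1.arr aFLAG rfl]
    have y4 : s4.var vY = y := by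
      rw [hs4.var vY rfl, hs3.var vY rfl, hs2.var vY rfl, hs1.var vY rfl, hvy]
    refine does_seq ((does_buildRows (τ := τ) (r := r) hb4 a4 y4 X4 F4).mono
      (Nat.add_le_add_left (cost_build hyl hy) _) fun _ _ h => h) fun s5 hs5 h5 => ?_
    obtain ⟨R5, r5⟩ := h5
    refine (does_procAll (hb4.same hs5 rfl) (by rw [hs5.var vA rfl, a4])
      (X4.congr (hs5.var vXn rfl) (hs5.arr aX rfl)) R5 r5 hκ1 hκ).mono le_rfl fun s6 hs6 h6 => ?_
    have F6 : s6.arr aFLAG = s5.arr aFLAG := hs6.arr aFLAG rfl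
    refine ⟨?_, ?_, fun hG => ?_⟩
    · have := R5.flag
      unfold FlagOK at this ⊢; rwa [F6]
    · rw [hs6.var vMODE rfl, hs5.var vMODE rfl, e4]; simp
    have h6 := h6 hG
    rw [hs5.var vRES rfl, hs4.var vRES rfl, h3, hs2.var vRES rfl, hs1.var vRES rfl] at h6
    refine ⟨fun h => h6.2 (.inl (.inl h)), fun h => ?_, fun h => ?_⟩
    -- Soundness: the result was set before, or by the check over N(y), which inspects all of X, or
    -- by a row whose missed vertices all see d.
    · rcases h6.1 h with (h7 | ⟨d, hd, had, p, hp, q, hq, hpq, -, hdom⟩) |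
        ⟨v, hv, k, hk, d, hd, had, hdl, hbd, hcd, hdom⟩
      · exact .inl h7
      · obtain ⟨p1, p2, -⟩ := Par.mem_sel.1 hp
        obtain ⟨q1, q2, -⟩ := Par.mem_sel.1 hq
        exact .inr ⟨p, q, d, p2, q2, had, hpq, P.symm p1, P.symm q1, hdom⟩
      · obtain ⟨t1, t2, t3⟩ := R5.tri _ (R5.bkt v hv k hk)
        refine .inr ⟨_, _, d, t1, t2, had, t3, hbd, hcd, fun z hz => ?_⟩
        by_contra hcon
        push Not at hcon
        exact hcon.2.2 (hdom z (Par.mem_un.2 ⟨hz, hcon.1, hcon.2.1⟩))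
    -- Completeness: the first alternative is found by the check over N(y). In the second the light
    -- d forces the missed set to be small, so the pair is either flagged or filed under a light
    -- vertex.
    · rcases h.light_cases hyX with ⟨b, c, d, ht, hdy, hh⟩ | ⟨b, c, d, ht, hyb, hbh, hdl⟩
      · refine .inl (h6.2 (.inl (.inr ⟨d, P.mem_nb.2 (P.symm hdy), ht.ad, b, Par.mem_sel.2
          ⟨P.symm ht.bd, ht.ab, fun h => (hh h).1⟩, c, Par.mem_sel.2
          ⟨P.symm ht.cd, ht.ac, fun h => (hh h).2⟩, ht.bc, .inl (by rw [m2]; exact one_ne_zero),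
          ht.dom⟩)))
      · have hlen : (P.un a b c).length ≤ P.s := (Par.length_un_le ht).trans (not_lt.1 hdl)
        rcases R5.cov b c ⟨hyb, hbh, ht.ab, ht.bc, ht.ac⟩ hlen with ⟨-, h7⟩ | ⟨v, hv, k, hk, hB, hC⟩
        · exact .inr ⟨b, c, d, ht, hdl, by rw [F6, h7]⟩
        · have hun : ∀ z ∈ P.un a b c, P.adj d z := fun z hz => by
            obtain ⟨z1, z2, z3⟩ := Par.mem_un.1 hz
            exact ((ht.dom z z1).resolve_left z2).resolve_left z3
          refine .inl (h6.2 (.inr ⟨v, (Par.mem_un.1 hv).1, k, hk, d,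
            P.mem_nb.2 (P.symm (hun v hv)), ht.ad, hdl, ?_, ?_, ?_⟩))
          · rw [hB]; exact ht.bd
          · rw [hC]; exact ht.cd
          · rw [hB, hC]; exact hun
  · have f0 := P.one_le_s
    have f1 : P.s * P.s * P.s ≤ P.s * P.s * (P.L * P.B) := Nat.mul_le_mul_left _ le_LB
    have f2 : P.s * P.s ≤ P.s * P.s * P.s := Nat.le_mul_of_pos_right _ f0
    have f3 : P.s ≤ P.s * P.s := Nat.le_mul_of_pos_right _ f0
    have f4 := P.n_le
    have f5 := P.m_le
    have f6 := P.length_far a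
    have f7 : P.m * (P.L * P.B) ≤ P.s * P.s * (P.L * P.B) := Nat.mul_le_mul_right _ f5
    set Z := P.s * P.s * (P.L * P.B)
    have g1 : Z ≤ κ * Z := Nat.le_mul_of_pos_left _ hκ1
    have g2 : κ * (P.m * (P.L * P.B)) ≤ κ * Z := Nat.mul_le_mul_left _ f7
    have g3 : κ * (P.s * P.s * P.s) ≤ κ * Z := Nat.mul_le_mul_left _ f1
    calc _ = 19 + 10 * (P.far a).length + 9 * P.n + 12 * P.m + 130 * (P.s * P.s * P.s) +
          1600 * (κ * (P.s * P.s * P.s)) + 800 * (κ * (P.m * (P.L * P.B))) := by ring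
      _ ≤ 3000 * (κ * Z) := by omega
      _ = _ := by ring

theorem does_heavyPart {s : St} {a : ℕ} (hb : Base P s) (ha : s.var vA = a)
    (hX : IsList s aX vXn (P.far a))
    (hκ1 : 1 ≤ κ) (hκ : ∀ g, 1 ≤ g → g ≤ 2 * P.s + 2 → τ g ≤ κ * (g * g)) :
    Does τ r heavyPart s (1700 * κ * (P.s * P.s * (P.L * P.B))) (fun s' =>
      (s'.var vRES ≠ 0 ↔ s.var vRES ≠ 0 ∨ ∃ d ∈ P.nb a, P.adj a d ∧
        P.Found s a d ((P.far a).filter P.heavy))) := by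
  refine (does_seq (does_copyX (p := P.heavy) hX (fun z _ s' hs' hx => by
      rw [ne_eq, eLt_ne, not_not, eval_var, eval_arr, eval_cst, eval_var, hx, hs'.var vS rfl,
        hb.sq, hs'.arr aDEG rfl, hb.deg, Par.heavy])) fun s1 hs1 h1 =>
    ((does_checkAll (τ := τ) (r := r) (x := vA) (w := a) (hb.same hs1 rfl) rfl
      (by rw [hs1.var vA rfl, ha]) (by rw [hs1.var vA rfl, ha]) h1 hκ1 hκ).mono
      (Nat.add_le_add_left (cost_checkA a (P.length_heavy_far a)) 3) fun s2 _ h2 => ?_)).mono ?_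
    fun _ _ h => h
  · rw [h2, hs1.var vRES rfl]
    unfold Par.Found
    rw [hs1.var vMODE rfl, hs1.arr aFLAG rfl]
  · have f0 := P.one_le_s
    have f1 : P.s * P.s * P.s ≤ P.s * P.s * (P.L * P.B) := Nat.mul_le_mul_left _ le_LB
    have f2 : P.s * P.s ≤ P.s * P.s * P.s := Nat.le_mul_of_pos_right _ f0
    have f3 : P.s ≤ P.s * P.s := Nat.le_mul_of_pos_right _ f0
    have f4 := P.n_le
    have f6 := P.length_far a
    set Z := P.s * P.s * (P.L * P.B)
    have g1 : Z ≤ κ * Z := Nat.le_mul_of_pos_left _ hκ1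
    have g3 : κ * (P.s * P.s * P.s) ≤ κ * Z := Nat.mul_le_mul_left _ f1
    calc _ = 7 + 6 * (P.far a).length + 23 * (P.s * P.s * P.s) +
          1600 * (κ * (P.s * P.s * P.s)) := by ring
      _ ≤ 1700 * (κ * Z) := by omega
      _ = _ := by ring

/-- The flags of earlier vertices survive, because `FlagOK` quantifies over all vertices a; this
makes the lemma applicable again and again in the outer loop without clearing the array. -/
theorem does_perA {s : St} {a : ℕ} (hb : Base P s) (ha : s.var vA = a) (hF : FlagOK P s)
    (hκ1 : 1 ≤ κ) (hκ : ∀ g, 1 ≤ g → g ≤ 2 * P.s + 2 → τ g ≤ κ * (g * g)) :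
    Does τ r perA s (5000 * κ * (P.s * P.s * (P.L * P.B))) (fun s' => FlagOK P s' ∧
      (P.Good → (s'.var vRES ≠ 0 ↔ s.var vRES ≠ 0 ∨ P.DomA a))) := by
  refine (does_seq (does_listX hb ha) fun s1 hs1 h1 => does_seq (does_findY (hb.same hs1 rfl) h1)
    fun s2 hs2 h2 => does_seq (k := 1 + 3000 * κ * (P.s * P.s * (P.L * P.B)))
    (P := fun s' => FlagOK P s' ∧ (P.Good → (s.var vRES ≠ 0 → s'.var vRES ≠ 0) ∧
      (s'.var vRES ≠ 0 → s.var vRES ≠ 0 ∨ P.DomA a) ∧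
      (P.DomA a → s'.var vRES ≠ 0 ∨ ∃ b c d, P.Tri a b c d ∧ (P.heavy d → P.heavy b ∧ P.heavy c) ∧
        (s'.var vMODE ≠ 0 ∨ s'.arr aFLAG b c = a + 1))) ∧
      -- A nonzero mode must certify by itself that the final pass may ignore light vertices.
      (s'.var vMODE ≠ 0 → ∀ z ∈ P.far a, P.heavy z)) ?_ fun s3 hs3 h3 =>
      (does_heavyPart (a := a) (((hb.same hs1 rfl).same hs2 rfl).same hs3 rfl)
        (by rw [hs3.var vA rfl, hs2.var vA rfl, hs1.var vA rfl, ha])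
        ((h1.congr (hs2.var vXn rfl) (hs2.arr aX rfl)).congr (hs3.var vXn rfl) (hs3.arr aX rfl))
        hκ1 hκ).mono le_rfl ?_).mono ?_ (fun _ _ h => h)
  · have hb2 := (hb.same hs1 rfl).same hs2 rfl
    have X2 := h1.congr (hs2.var vXn rfl) (hs2.arr aX rfl)
    have a2 : s2.var vA = a := by rw [hs2.var vA rfl, hs1.var vA rfl, ha]
    have r2 : s2.var vRES = s.var vRES := by rw [hs2.var vRES rfl, hs1.var vRES rfl]
    have F2 : FlagOK P s2 := by
      unfold FlagOK at hF ⊢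
      rwa [hs2.arr aFLAG rfl, hs1.arr aFLAG rfl]
    refine does_ite (fun h => ?_) (fun h => ?_)
    · have h' : P.far a ≠ [] ∧ ¬ P.heavy (s2.var vY) := by
        simpa [X2.1, hb2.deg, hb2.sq, Par.heavy] using h
      obtain ⟨hyX, hy⟩ := h2 h'.1
      refine (does_lightCase hb2 a2 rfl X2 F2 hyX h'.2 hy hκ1 hκ).mono le_rfl ?_
      rintro s3 - ⟨F3, m3, h3⟩
      rw [r2] at h3
      refine ⟨F3, fun hG => ⟨(h3 hG).1, (h3 hG).2.1, fun hD => ?_⟩, fun h => absurd m3 h⟩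
      rcases (h3 hG).2.2 hD with h4 | ⟨b, c, d, ht, hd, hf⟩
      · exact .inl h4
      · exact .inr ⟨b, c, d, ht, fun h => absurd h hd, .inr hf⟩
    · have h' : P.far a ≠ [] → P.heavy (s2.var vY) := by
        have : P.far a = [] ∨ P.heavy (s2.var vY) := by
          simpa [X2.1, hb2.deg, hb2.sq, Par.heavy] using h
        tauto
      refine (does_set (v := 1) rfl rfl ?_).mono ?_ (fun _ _ h => h)
      · refine ⟨F2, fun _ => ⟨?_, ?_, fun hD => .inr ?_⟩, fun _ z hz => ?_⟩
        · simp [r2]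
        · simp only [setVar_var]
          rw [if_neg (by decide), r2]
          exact .inl
        · obtain ⟨b, c, d, ht, hh⟩ := hD.heavy_order
          exact ⟨b, c, d, ht, hh, .inl (by simp)⟩
        · have hne := List.ne_nil_of_mem hz
          exact lt_of_lt_of_le (h' hne) ((h2 hne).2 z hz)
      · have : 1 ≤ κ * (P.s * P.s * (P.L * P.B)) :=
          Nat.mul_pos hκ1 (Nat.mul_pos (Nat.mul_pos P.one_le_s P.one_le_s)
            (P.one_le_s.trans le_LB))
        calc 1 ≤ 3000 * (κ * (P.s * P.s * (P.L * P.B))) := by omega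
          _ = _ := by ring
  · intro s4 hs4 h4
    obtain ⟨F3, h3, M3⟩ := h3
    refine ⟨?_, fun hG => ?_⟩
    · unfold FlagOK at F3 ⊢
      rwa [hs4.arr aFLAG rfl]
    obtain ⟨h5, h6, h7⟩ := h3 hG
    rw [h4]
    constructor
    · rintro (h8 | ⟨d, hd, had, p, hp, q, hq, hpq, hfl, hdom⟩)
      · exact h6 h8
      · obtain ⟨p1, p2, -⟩ := Par.mem_sel.1 hp
        obtain ⟨q1, q2, -⟩ := Par.mem_sel.1 hq
        refine .inr ⟨p, q, d, p2, q2, had, hpq, P.symm p1, P.symm q1, fun z hz => ?_⟩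
        -- The final pass tests heavy vertices only. A vertex that was missed is nevertheless heavy,
        -- by the mode or by the flag, so it has been tested.
        by_contra hcon
        push Not at hcon
        have hzh : P.heavy z := by
          rcases hfl with hfl | hfl
          · exact M3 hfl z hz
          · exact F3 p q a hfl z (Par.mem_un.2 ⟨hz, hcon.1, hcon.2.1⟩)
        rcases hdom z (by simp [hz, hzh]) with h8 | h8 | h8
        · exact hcon.1 h8
        · exact hcon.2.1 h8
        · exact hcon.2.2 h8
    · rintro (h8 | h8)
      · exact .inl (h5 h8)
      · rcases h7 h8 with h9 | ⟨b, c, d, ht, hh, hf⟩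
        · exact .inl h9
        · exact .inr ⟨d, P.mem_nb.2 ht.ad, ht.ad, b, Par.mem_sel.2
            ⟨P.symm ht.bd, ht.ab, fun h => (hh h).1⟩, c, Par.mem_sel.2
            ⟨P.symm ht.cd, ht.ac, fun h => (hh h).2⟩, ht.bc, hf,
            fun z hz => ht.dom z (List.mem_filter.1 hz).1⟩
  · have f1 : P.s * P.s ≤ P.s * P.s * (P.L * P.B) :=
      Nat.le_mul_of_pos_right _ (P.one_le_s.trans le_LB)
    have f2 : 1 ≤ P.s * P.s := Nat.mul_pos P.one_le_s P.one_le_s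
    have f4 := P.n_le
    have f6 := P.length_far a
    set Z := P.s * P.s * (P.L * P.B)
    have g1 : Z ≤ κ * Z := Nat.le_mul_of_pos_left _ hκ1
    calc _ = 9 + 6 * P.n + 5 * (P.far a).length + 4700 * (κ * Z) := by ring
      _ ≤ 5000 * (κ * Z) := by omega
      _ = _ := by ring

/-! ## The whole search -/

def findW : Cmd := .seq (.set vW (.const 0)) (forN vv (.var vN)
  (.ite (eLt (.arr aDEG (.const 0) (.var vv)) (.arr aDEG (.const 0) (.var vW)))
    (.set vW (.var vv)) .skip))

def searchAll : Cmd := .seq findW (.seq (.set vA (.var vW)) (.seq perA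
  (forL vP vA (.arr aDEG (.const 0) (.var vW)) (.arr aNBR (.var vW) (.var vP)) perA)))

theorem does_findW {s : St} (hb : Base P s) (hn : 1 ≤ P.n) :
    Does τ r findW s (4 + 4 * P.n) (fun s' =>
      s'.var vW < P.n ∧ ∀ v < P.n, P.deg (s'.var vW) ≤ P.deg v) := by
  refine (does_seq (does_set_eq (v := 0) rfl rfl) (l := 3 + 4 * P.n) ?_).mono (by omega)
    (fun _ _ h => h)
  rintro s0 hs0 h0
  have hb0 := hb.same hs0 rfl
  refine (does_forN (N := P.n) rfl (by simp [hb0.n]) (fun _ => 2)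
    (fun i s' => s'.var vW < P.n ∧ ∀ v < i, P.deg (s'.var vW) ≤ P.deg v)
    (fun _ _ _ h => by simpa using h) ?_ ?_).mono ?_ (fun _ _ h => h)
  · rw [h0]; simpa using Nat.pos_of_ne_zero (by omega)
  · intro i s2 hi hs2 hv2 hI2
    have hb2 : Base P s2 := hb0.same hs2 rfl
    refine does_ite (k := 1) (fun h => ?_) (fun h => ?_)
    · have h1 : P.deg i < P.deg (s2.var vW) := by simpa [hb2.deg, hv2] using h
      refine does_set (v := i) hv2 rfl ⟨by simpa using hi, ?_⟩
      intro w hw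
      simp only [setVar_var, if_true]
      by_cases h2 : w = i
      · rw [h2]
      · exact h1.le.trans (hI2.2 w (by omega))
    · have h1 : P.deg (s2.var vW) ≤ P.deg i := by simpa [hb2.deg, hv2] using h
      refine does_skip ⟨hI2.1, ?_⟩
      intro w hw
      by_cases h2 : w = i
      · rwa [h2]
      · exact hI2.2 w (by omega)
  · simp; omega

/-- If w is not in the clique, some clique vertex is adjacent to it, and by symmetry that vertex can
be called a. -/
theorem exists_domA_nbr {w : ℕ} (hw : w < P.n) (h : ∃ a, P.DomA a) :
    P.DomA w ∨ ∃ a ∈ P.nb w, P.DomA a := by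
  obtain ⟨a, b, c, d, h⟩ := h
  by_cases h1 : w = a
  · subst h1; exact .inl ⟨_, _, _, h⟩
  by_cases h2 : P.adj a w
  · exact .inr ⟨a, P.mem_nb.2 (P.symm h2), _, _, _, h⟩
  rcases h.dom w (Par.mem_far.2 ⟨hw, h1, h2⟩) with h3 | h3 | h3
  · exact .inr ⟨b, P.mem_nb.2 (P.symm h3), _, _, _, h.exch⟩
  · exact .inr ⟨c, P.mem_nb.2 (P.symm h3), _, _, _, h.rot.exch⟩
  · exact .inr ⟨d, P.mem_nb.2 (P.symm h3), _, _, _, h.rot.rot.exch⟩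

/-- `δ` is the minimum degree. The n degrees are all at least δ, so nδ ≤ 2m, and δ + 1 vertices are
tried. -/
theorem does_searchAll {s : St} (hb : Base P s) (hn : 1 ≤ P.n) (hF : FlagOK P s)
    (hres : s.var vRES = 0)
    (hκ1 : 1 ≤ κ) (hκ : ∀ g, 1 ≤ g → g ≤ 2 * P.s + 2 → τ g ≤ κ * (g * g)) :
    ∃ δ, P.n * δ ≤ 2 * P.m ∧
    Does τ r searchAll s ((δ + 1) * (6000 * κ * (P.s * P.s * (P.L * P.B)))) (fun s' =>
      P.Good → (s'.var vRES ≠ 0 ↔ ∃ a, P.DomA a)) := by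
  obtain ⟨w, hw, hwmin, hW⟩ : ∃ w, w < P.n ∧ (∀ v < P.n, P.deg w ≤ P.deg v) ∧
      Does τ r findW s (4 + 4 * P.n) (fun s' => s'.var vW = w) := by
    have h := does_findW (τ := τ) (r := r) hb hn
    exact ⟨_, h.1.1, h.1.2, rfl, h.2⟩
  refine ⟨P.deg w, ?_, ?_⟩
  · calc P.n * P.deg w = ∑ v ∈ range P.n, P.deg w := by simp
      _ ≤ ∑ v ∈ range P.n, P.deg v := Finset.sum_le_sum fun v hv => hwmin v (mem_range.1 hv)
      _ ≤ _ := P.sum_deg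
  refine (does_seq hW fun s1 hs1 e1 => does_seq (does_set_eq (v := w) (by rw [eval_var, e1]) rfl) (l :=
    5000 * κ * (P.s * P.s * (P.L * P.B)) + (3 + ((P.nb w).map fun _ =>
      5000 * κ * (P.s * P.s * (P.L * P.B)) + 3).sum)) fun s2 hs2 e2 => ?_).mono ?_ (fun _ _ h => h)
  · have hb2 := (hb.same hs1 rfl).same hs2 rfl
    have F2 : FlagOK P s2 := by
      unfold FlagOK at hF ⊢
      rwa [hs2.arr aFLAG rfl, hs1.arr aFLAG rfl]
    refine does_seq (does_perA hb2 (a := w) (by rw [e2]; simp) F2 hκ1 hκ) fun s3 hs3 h3 => ?_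
    have r3 : s2.var vRES = 0 := by rw [hs2.var vRES rfl, hs1.var vRES rfl, hres]
    rw [r3] at h3
    have hb3 := hb2.same hs3 rfl
    have w3 : s3.var vW = w := by rw [hs3.var vW rfl, hs2.var vW rfl, e1]
    refine (does_forL (P.nb w) (by decide) rfl rfl (by simp [w3, hb3.deg, Par.deg]) _
      (fun pre s' => FlagOK P s' ∧ (P.Good → (s'.var vRES ≠ 0 ↔ P.DomA w ∨ ∃ a ∈ pre, P.DomA a)))
      (fun _ _ _ h => ⟨h.1, by simpa using h.2⟩) (fun _ _ _ h => ⟨h.1, by simpa using h.2⟩)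
      ⟨h3.1, fun hG => by simpa using h3.2 hG⟩ ?_ ?_).mono le_rfl ?_
    · intro i hi s' hs' hx'
      rw [eval_arr, eval_var, eval_var, hx', hs'.var vW rfl, w3, hs'.arr aNBR rfl, hb3.nbr]
    · intro pre a suf s4 hl hs4 hv4 hI4
      refine (does_perA (hb3.same hs4 rfl) hv4 hI4.1 hκ1 hκ).mono le_rfl ?_
      rintro s5 - ⟨F5, h5⟩
      refine ⟨F5, fun hG => ?_⟩
      rw [h5 hG, hI4.2 hG]
      simp only [List.mem_append, List.mem_singleton, or_and_right, exists_or, exists_eq_left,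
        or_assoc]
    · rintro s4 - ⟨-, h4⟩ hG
      rw [h4 hG]
      constructor
      · rintro (h | ⟨a, -, h⟩)
        · exact ⟨_, h⟩
        · exact ⟨_, h⟩
      · exact exists_domA_nbr hw
  · have f1 : P.s * P.s ≤ P.s * P.s * (P.L * P.B) :=
      Nat.le_mul_of_pos_right _ (P.one_le_s.trans le_LB)
    have f2 : 1 ≤ P.s * P.s := Nat.mul_pos P.one_le_s P.one_le_s
    have f4 := P.n_le
    set Z := P.s * P.s * (P.L * P.B)
    have g1 : Z ≤ κ * Z := Nat.le_mul_of_pos_left _ hκ1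
    have g2 : 5000 * κ * Z = 5000 * (κ * Z) := by ring
    have g3 : 6000 * κ * Z = 6000 * (κ * Z) := by ring
    rw [sum_map_const', g2, g3, ← Par.deg]
    set K := κ * Z
    have g4 : P.deg w * (5000 * K + 3) ≤ P.deg w * (6000 * K) := Nat.mul_le_mul_left _ (by omega)
    rw [add_mul]
    omega

end PerA

/-! ## The adjacency lists of an edge list -/

section Edges

variable {n : ℕ}

def edgeNb (e : Fin n × Fin n) (v : ℕ) : List ℕ :=
  if (e.1 : ℕ) = v then [(e.2 : ℕ)] else if (e.2 : ℕ) = v then [(e.1 : ℕ)] else []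

/-- The neighbours appear in the order of the edge list, which is the order in which `readEdges`
appends them, so the array and the list agree entry by entry. -/
def nbOf (L : List (Fin n × Fin n)) (v : ℕ) : List ℕ := L.flatMap fun e => edgeNb e v

theorem nbOf_cons (e : Fin n × Fin n) (L : List (Fin n × Fin n)) (v : ℕ) :
    nbOf (e :: L) v = edgeNb e v ++ nbOf L v := rfl

theorem nbOf_append (L : List (Fin n × Fin n)) (e : Fin n × Fin n) (v : ℕ) :
    nbOf (L ++ [e]) v = nbOf L v ++ edgeNb e v := by simp [nbOf]

def natAdj (G : SimpleGraph (Fin n)) (u v : ℕ) : Prop :=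
  ∃ (hu : u < n) (hv : v < n), G.Adj ⟨u, hu⟩ ⟨v, hv⟩

theorem mem_edgeNb {e : Fin n × Fin n} (he : e.1 ≠ e.2) {v z : ℕ} :
    z ∈ edgeNb e v ↔ ((e.1 : ℕ) = v ∧ (e.2 : ℕ) = z) ∨ ((e.2 : ℕ) = v ∧ (e.1 : ℕ) = z) := by
  have he' : (e.1 : ℕ) ≠ e.2 := fun h => he (Fin.ext h)
  unfold edgeNb
  split_ifs with h1 h2
  · simp [h1, eq_comm]
    intro h2 h3; omega
  · simp [h1, h2, eq_comm]
  · simp [h1, h2]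

theorem IsEdgeList.ne {G : SimpleGraph (Fin n)} {L : List (Fin n × Fin n)} (h : IsEdgeList G L)
    {e : Fin n × Fin n} (he : e ∈ L) : e.1 ≠ e.2 := by
  have := (h.2 e.1 e.2).2 (List.mem_map.2 ⟨e, he, rfl⟩)
  exact this.ne

theorem mem_nbOf {L : List (Fin n × Fin n)} (h : ∀ e ∈ L, e.1 ≠ e.2) {v z : ℕ} :
    z ∈ nbOf L v ↔ ∃ e ∈ L, ((e.1 : ℕ) = v ∧ (e.2 : ℕ) = z) ∨ ((e.2 : ℕ) = v ∧ (e.1 : ℕ) = z) := by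
  simp only [nbOf, List.mem_flatMap]
  exact ⟨fun ⟨e, he, hz⟩ => ⟨e, he, (mem_edgeNb (h e he)).1 hz⟩,
    fun ⟨e, he, hz⟩ => ⟨e, he, (mem_edgeNb (h e he)).2 hz⟩⟩

theorem mem_nbOf_iff {G : SimpleGraph (Fin n)} {L : List (Fin n × Fin n)} (h : IsEdgeList G L)
    {v z : ℕ} : z ∈ nbOf L v ↔ natAdj G v z := by
  rw [mem_nbOf fun e he => IsEdgeList.ne h he]
  constructor
  · rintro ⟨e, he, ⟨rfl, rfl⟩ | ⟨rfl, rfl⟩⟩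
    · exact ⟨e.1.2, e.2.2, (h.2 e.1 e.2).2 (List.mem_map.2 ⟨e, he, rfl⟩)⟩
    · exact ⟨e.2.2, e.1.2, ((h.2 e.1 e.2).2 (List.mem_map.2 ⟨e, he, rfl⟩)).symm⟩
  · rintro ⟨hu, hv, hadj⟩
    obtain ⟨e, he, h2⟩ := List.mem_map.1 ((h.2 _ _).1 hadj)
    refine ⟨e, he, ?_⟩
    rcases Sym2.eq_iff.1 h2 with ⟨h3, h4⟩ | ⟨h3, h4⟩
    · exact .inl ⟨by rw [h3], by rw [h4]⟩
    · exact .inr ⟨by rw [h4], by rw [h3]⟩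

theorem nodup_nbOf {L : List (Fin n × Fin n)} (h : ∀ e ∈ L, e.1 ≠ e.2)
    (hL : (L.map fun e => s(e.1, e.2)).Nodup) (v : ℕ) : (nbOf L v).Nodup := by
  induction L with
  | nil => simp [nbOf]
  | cons e L ih =>
    rw [List.map_cons, List.nodup_cons] at hL
    rw [nbOf_cons, List.nodup_append]
    refine ⟨?_, ih (fun e he => h e (List.mem_cons_of_mem _ he)) hL.2, ?_⟩
    · unfold edgeNb; split_ifs <;> simp
    · rintro a ha b hb rfl
      rw [mem_edgeNb (h e List.mem_cons_self)] at ha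
      obtain ⟨e', he', hb⟩ := (mem_nbOf fun e he => h e (List.mem_cons_of_mem _ he)).1 hb
      refine hL.1 (List.mem_map.2 ⟨e', he', ?_⟩)
      rw [Sym2.eq_iff]
      simp only [Fin.ext_iff]
      omega

theorem sum_length_nbOf (L : List (Fin n × Fin n)) :
    ∑ v ∈ range n, (nbOf L v).length ≤ 2 * L.length := by
  induction L with
  | nil => simp [nbOf]
  | cons e L ih =>
    have h1 : ∀ v, (edgeNb e v).length ≤
        (if (e.1 : ℕ) = v then 1 else 0) + (if (e.2 : ℕ) = v then 1 else 0) := by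
      intro v; unfold edgeNb; split_ifs <;> simp
    have h2 : ∑ v ∈ range n, (edgeNb e v).length ≤ 2 := by
      refine (Finset.sum_le_sum fun v _ => h1 v).trans ?_
      rw [Finset.sum_add_distrib, Finset.sum_ite_eq, Finset.sum_ite_eq]
      split_ifs <;> omega
    simp only [nbOf_cons, List.length_append, Finset.sum_add_distrib, List.length_cons]
    omega

end Edges

/-! ## Reading the edges -/

def edgeStep : Cmd := .seq (.set vp (.inp (.op .mul (.const 2) (.var vj))))
  (.seq (.set vq (.inp (.op .add (.op .mul (.const 2) (.var vj)) (.const 1))))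
  (.seq (.put aADJ (.var vp) (.var vq) (.const 1)) (.seq (.put aADJ (.var vq) (.var vp) (.const 1))
  (.seq (.put aNBR (.var vp) (.arr aDEG (.const 0) (.var vp)) (.var vq))
  (.seq (.put aDEG (.const 0) (.var vp) (.op .add (.arr aDEG (.const 0) (.var vp)) (.const 1)))
  (.seq (.put aNBR (.var vq) (.arr aDEG (.const 0) (.var vq)) (.var vp))
  (.put aDEG (.const 0) (.var vq) (.op .add (.arr aDEG (.const 0) (.var vq)) (.const 1)))))))))

def readEdges : Cmd := forN vj (.var vM) edgeStep

/-- The base is one more than the input needs, so that it is positive even without edges; the extra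
cell holds 0. -/
def initSt {n : ℕ} (L : List (Fin n × Fin n)) : St where
  var x := if x = 0 then n else if x = 1 then L.length else 0
  arr _ _ _ := 0
  inp := (graphInput L).mem
  base := 2 * L.length + 1
  mmc := 0
  coins := 0

structure EdgesRead {n : ℕ} (L : List (Fin n × Fin n)) (s : St) : Prop where
  adj : ∀ u v, s.arr aADJ u v = 0 ↔ v ∉ nbOf L u
  deg : ∀ v, s.arr aDEG 0 v = (nbOf L v).length
  nbr : ∀ v i (h : i < (nbOf L v).length), s.arr aNBR v i = (nbOf L v)[i]

section Pre

variable {τ : ℕ → ℕ} {r : ℕ → Bool}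

theorem graphInput_mem {n : ℕ} (L : List (Fin n × Fin n)) {i : ℕ} (h : i < L.length) :
    (graphInput L).mem (2 * i) = (L[i].1 : ℕ) ∧ (graphInput L).mem (2 * i + 1) = (L[i].2 : ℕ) := by
  have h1 : 2 * i / 2 = i := by omega
  have h2 : (2 * i + 1) / 2 = i := by omega
  have h3 : (2 * i + 1) % 2 = 1 := by omega
  simp [graphInput, h1, h2, h3, h]

/-- The endpoints differ, so appending to the list of the first does not disturb the length read for
the second. -/
theorem does_edgeStep {n : ℕ} {L : List (Fin n × Fin n)} {s : St} {e : Fin n × Fin n}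
    (he : e.1 ≠ e.2) (hs : EdgesRead L s)
    (h1 : (E.inp (.op .mul (.const 2) (.var vj))).eval s = e.1)
    (h2 : (E.inp (.op .add (.op .mul (.const 2) (.var vj)) (.const 1))).eval s = e.2) :
    Does τ r edgeStep s 8 (EdgesRead (L ++ [e])) := by
  have he' : (e.1 : ℕ) ≠ e.2 := fun h => he (Fin.ext h)
  obtain ⟨ha, hd, hn⟩ := hs
  refine does_seq (l := 7) (does_set_eq h1 rfl) ?_
  rintro _ - rfl
  refine does_seq (l := 6) (does_set_eq (v := e.2) h2 rfl) ?_
  rintro _ - rfl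
  refine does_seq (l := 5) (does_put_eq (a := e.1) (b := e.2) (v := 1) (by simp) (by simp) rfl rfl) ?_
  rintro _ - rfl
  refine does_seq (l := 4) (does_put_eq (a := e.2) (b := e.1) (v := 1) (by simp) (by simp) rfl rfl) ?_
  rintro _ - rfl
  refine does_seq (l := 3) (does_put_eq (a := e.1) (b := (nbOf L e.1).length) (v := e.2) (by simp)
    (by simp [hd]) (by simp) rfl) ?_
  rintro _ - rfl
  refine does_seq (l := 2) (does_put_eq (a := 0) (b := e.1) (v := (nbOf L e.1).length + 1) rfl
    (by simp) (by simp [hd]) rfl) ?_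
  rintro _ - rfl
  refine does_seq (l := 1) (does_put_eq (a := e.2) (b := (nbOf L e.2).length) (v := e.1) (by simp)
    (by simp [hd, he'.symm]) (by simp) rfl) ?_
  rintro _ - rfl
  refine does_put (a := 0) (b := e.2) (v := (nbOf L e.2).length + 1) rfl
    (by simp) (by simp [hd, he'.symm]) rfl ?_
  constructor
  · intro u v
    have hm : v ∈ edgeNb e u ↔ (u = e.1 ∧ v = e.2) ∨ (u = e.2 ∧ v = e.1) := by
      rw [mem_edgeNb he]; tauto
    simp only [setArr_arr, setVar_arr, nbOf_append, List.mem_append, not_or, hm]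
    by_cases c1 : u = e.1 ∧ v = e.2
    · simp [c1]
    · by_cases c2 : u = e.2 ∧ v = e.1
      · simp [c2]
      · simp [c1, c2, ha]
  · intro v
    rw [nbOf_append, List.length_append]
    simp only [setArr_arr, setVar_arr, edgeNb, eq_comm (a := v)]
    by_cases c1 : (e.1 : ℕ) = v
    · subst c1; simp [he'.symm]
    · by_cases c2 : (e.2 : ℕ) = v
      · subst c2; simp [he']
      · simp [c1, c2, hd]
  · intro v i hi
    simp only [nbOf_append, List.length_append] at hi ⊢
    simp only [setArr_arr, setVar_arr, edgeNb, eq_comm (a := v)] at hi ⊢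
    by_cases c1 : (e.1 : ℕ) = v
    · subst c1
      simp only [if_true, List.length_singleton, he'.symm, true_and, false_and, and_false,
        if_false] at hi ⊢
      by_cases c3 : i = (nbOf L e.1).length
      · subst c3; simp
      · rw [List.getElem_append_left (by omega)]
        simpa [c3] using hn _ i (by omega)
    · by_cases c2 : (e.2 : ℕ) = v
      · subst c2
        simp only [if_true, List.length_singleton, he', true_and, false_and, and_false,
          if_false] at hi ⊢
        by_cases c3 : i = (nbOf L e.2).length
        · subst c3; simp
        · rw [List.getElem_append_left (by omega)]
          simpa [c3] using hn _ i (by omega)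
      · simp only [c1, c2, if_false, List.length_nil, add_zero, false_and, and_false] at hi ⊢
        rw [List.getElem_append_left hi]
        simpa using hn v i hi

theorem does_readEdges {n : ℕ} {L : List (Fin n × Fin n)} (hL : ∀ e ∈ L, e.1 ≠ e.2) :
    Does τ r readEdges (initSt L) (3 + 10 * L.length) (EdgesRead L) := by
  refine (does_forN (N := L.length) rfl (by simp [initSt]) (fun _ => 8)
    (fun i s => EdgesRead (L.take i) s) (fun _ _ _ h => ⟨h.1, h.2, h.3⟩) ?_ ?_).mono ?_ ?_
  · exact ⟨fun u v => by simp [initSt, nbOf], fun v => by simp [initSt, nbOf],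
      fun v i h => by simp [nbOf] at h⟩
  · intro i s hi hs hx hI
    have ht : L.take (i + 1) = L.take i ++ [L[i]] := List.take_succ_eq_append_getElem hi
    obtain ⟨g1, g2⟩ := graphInput_mem L hi
    have hb : s.base = 2 * L.length + 1 := hs.base
    have hin : s.inp = (graphInput L).mem := hs.inp
    rw [ht]
    refine does_edgeStep (hL _ (List.getElem_mem _)) hI ?_ ?_
    · simp only [E.eval, Op.eval, hx, hb, hin, g1]
      rw [if_pos (by omega)]
    · simp only [E.eval, Op.eval, hx, hb, hin, g2]
      rw [if_pos (by omega)]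
  · simp; omega
  · intro s _ h; simpa using h

/-! ## The parameters -/

/-- Sums of variables and products are charged their value. The parameters are small enough for this
to be harmless. -/
theorem does_set_price {s : St} {x : ℕ} {e : E} {v : ℕ} (hv : e.eval s = v) :
    Does τ r (.set x e) s (1 + v) (fun s' => s' = s.setVar x v) := by
  subst hv
  refine ⟨rfl, ?_⟩
  simp only [cost, E.price]
  split_ifs <;> omega

def sqrtCmd : Cmd := .seq (.set vS (.const 1)) (.loop (.op .add (.var vN) (.var vM))
  (eLe (.op .mul (.var vS) (.var vS)) (.op .add (.var vN) (.var vM)))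
  (.set vS (.op .add (.var vS) (.const 1))))

theorem does_sqrtCmd {s : St} {n m : ℕ} (hn : s.var vN = n) (hm : s.var vM = m) :
    Does τ r sqrtCmd s (3 + 2 * Nat.sqrt (n + m)) (fun s' => s'.var vS = Nat.sqrt (n + m) + 1) := by
  refine (does_seq (does_set_eq (v := 1) rfl rfl) (l := 2 + Nat.sqrt (n + m) * (1 + 1)) ?_).mono
    (by omega) (fun _ _ h => h)
  rintro s0 hs0 e0
  refine does_loop (N := n + m) (by simp [hs0.var vN rfl, hs0.var vM rfl, hn, hm]) 1
    (fun i s' => s'.var vS = i + 1 ∧ i * i ≤ n + m) (by simp [e0]) ?_ _ _ ?_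
  · rintro i s1 hi hs1 ⟨i1, i2⟩ hc
    have h1 : (i + 1) * (i + 1) ≤ n + m := by
      simpa [i1, hs1.var vN rfl, hs1.var vM rfl, hs0.var vN rfl, hs0.var vM rfl, hn, hm] using hc
    exact does_set (v := i + 1 + 1) (by simp [i1]) rfl ⟨by simp, h1⟩
  · rintro i s1 hi hs1 ⟨i1, i2⟩ hend
    have h1 : i ≤ Nat.sqrt (n + m) := Nat.le_sqrt.2 i2
    refine ⟨?_, h1⟩
    have h2 : n + m < (i + 1) * (i + 1) := by
      rcases hend with rfl | hend
      · nlinarith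
      · simpa [i1, hs1.var vN rfl, hs1.var vM rfl, hs0.var vN rfl, hs0.var vM rfl, hn, hm] using hend
    have h3 := Nat.sqrt_lt.2 h2
    omega

/-- The smallest power of two above the value of `e`, and its exponent. -/
def doubling (x k : ℕ) (e : E) : Cmd := .seq (.set x (.const 1)) (.seq (.set k (.const 0))
  (.loop e (eLe (.var x) e) (.seq (.set x (.op .add (.var x) (.var x)))
    (.set k (.op .add (.var k) (.const 1))))))

theorem does_doubling {x k : ℕ} {e : E} {s : St} {v : ℕ} (hxk : x ≠ k)
    (he : ∀ s', Same (doubling x k e) s s' → e.eval s' = v) :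
    Does τ r (doubling x k e) s (4 + Nat.size v * (3 + 2 * v)) (fun s' =>
      s'.var x = 2 ^ Nat.size v ∧ s'.var k = Nat.size v) := by
  have same_set : ∀ u w s', Same (doubling x k e) s s' → u = x ∨ u = k →
      Same (doubling x k e) s (s'.setVar u w) := by
    intro u w s' h hv
    refine h.trans ⟨fun z hz => ?_, fun _ _ => rfl, rfl, rfl⟩
    simp only [doubling, Cmd.wVar, Bool.or_eq_false_iff, beq_eq_false_iff_ne] at hz
    rw [setVar_var, if_neg]
    rintro rfl
    rcases hv with rfl | rfl
    · exact hz.1 rfl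
    · exact hz.2.1 rfl
  refine (does_seq (does_set_eq (v := 1) rfl rfl) (l := 1 + (2 + Nat.size v * (1 + (2 + 2 * v))))
    ?_).mono (by ring_nf; omega) (fun _ _ h => h)
  rintro s0 - e0
  refine does_seq (does_set_eq (v := 0) rfl rfl) ?_
  rintro s1 - e1
  have hs1 : Same (doubling x k e) s s1 := by
    rw [e1, e0]
    exact same_set _ _ _ (same_set _ _ _ (.refl _ _) (.inl rfl)) (.inr rfl)
  have sub : ∀ s2, Same (.seq (.set x (.op .add (.var x) (.var x)))
      (.set k (.op .add (.var k) (.const 1)))) s1 s2 → Same (doubling x k e) s s2 := fun s2 h =>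
    hs1.trans (h.of_le (fun z hz => by
      simp only [doubling, Cmd.wVar, Bool.or_eq_false_iff] at hz ⊢; tauto) (fun z hz => rfl))
  refine does_loop (N := v) (he _ hs1) _ (fun i s' => s'.var k = i ∧ s'.var x = 2 ^ i ∧
    ∀ j < i, 2 ^ j ≤ v) (by rw [e1, e0]; simp [hxk]) ?_ _ _ ?_
  · rintro i s2 hi hs2 ⟨i1, i2, i3⟩ hc
    have h1 : 2 ^ i ≤ v := by simpa [i2, he _ (sub _ hs2)] using hc
    -- The loop condition gives 2^i ≤ v, so the doubled value costs at most 2v + 1.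
    refine Does.mono (does_seq (does_set_price (v := 2 ^ i + 2 ^ i) (by simp [i2])) (l := 1) ?_)
      (l := 2 + 2 * v) (by omega) (fun _ _ h => h)
    rintro _ - rfl
    refine does_set (v := i + 1) (by simp [hxk.symm, i1]) rfl ⟨by simp, ?_, fun j hj => ?_⟩
    · simp [hxk]; ring
    · by_cases h2 : j = i
      · rwa [h2]
      · exact i3 j (by omega)
  · rintro i s2 hi hs2 ⟨i1, i2, i3⟩ hend
    have h1 : v < 2 ^ i := by
      rcases hend with rfl | hend
      · exact Nat.lt_two_pow_self
      · simpa [i2, he _ (sub _ hs2)] using hend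
    have h2 : Nat.size v = i := by
      refine le_antisymm (Nat.size_le.2 h1) ?_
      by_contra h3
      have := i3 (Nat.size v) (by omega)
      have := Nat.lt_size_self v
      omega
    rw [h2]
    exact ⟨⟨i2, i1⟩, le_rfl⟩

/-! ## Random hash functions -/

/-- The number with the binary digits `r a, r (a + 1), …`. -/
def hval (r : ℕ → Bool) (a : ℕ) : ℕ → ℕ
  | 0 => 0
  | t + 1 => hval r a t + hval r a t + (r (a + t)).toNat

theorem hval_lt (r : ℕ → Bool) (a t : ℕ) : hval r a t < 2 ^ t := by
  induction t with
  | zero => simp [hval]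
  | succ t ih =>
    have : (r (a + t)).toNat ≤ 1 := Bool.toNat_le _
    rw [hval, pow_succ]
    omega

def hashBits : Cmd := forN vt (.var vKB) (.seq (.flip vp)
  (.set vh (.op .add (.op .add (.var vh) (.var vh)) (.var vp))))

def hashGen : Cmd := forN vl (.var vL) (forN vz (.var vN)
  (.seq (.set vh (.const 0)) (.seq hashBits (.put aHASH (.var vl) (.var vz) (.var vh)))))

/-- Building the number bit by bit is charged its successive values, which form a geometric series;
hence the bound is a multiple of 2^K. -/
theorem does_hashBits {s : St} {K : ℕ} (hK : s.var vKB = K) (hh : s.var vh = 0) :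
    Does τ r hashBits s (3 + 6 * 2 ^ K) (fun s' => s'.var vh = hval r s.coins K ∧
      s'.coins = s.coins + K) := by
  refine (does_forN (N := K) rfl (by simp [hK]) (fun t => 2 + 2 ^ (t + 1))
    (fun t s' => s'.var vh = hval r s.coins t ∧ s'.coins = s.coins + t)
    (fun _ _ _ h => by simpa [St.setVar] using h) ⟨by simp [hh, hval], rfl⟩ ?_).mono ?_
    (fun _ _ h => h)
  · rintro t s1 ht hs1 hx ⟨i1, i2⟩
    have hlt := hval_lt r s.coins (t + 1)
    refine Does.mono (does_seq (k := 1) (P := fun s' => s' = { s1.setVar vp (r s1.coins).toNat with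
      coins := s1.coins + 1 }) ⟨rfl, le_rfl⟩ ?_ (l := 1 + hval r s.coins (t + 1))) (by omega)
      (fun _ _ h => h)
    rintro _ - rfl
    refine (does_set_price (v := hval r s.coins (t + 1)) ?_).mono le_rfl ?_
    · simp [St.setVar, hval, i1, i2]
    · rintro _ - rfl
      exact ⟨by simp, by simp [St.setVar, i2]; omega⟩
  · have h1 : ∀ K, ∑ t ∈ range K, (2 + 2 ^ (t + 1) + 2) + 2 = 4 * K + 2 * 2 ^ K := by
      intro K
      induction K with
      | zero => simp
      | succ K ih => rw [Finset.sum_range_succ, pow_succ]; omega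
    have h2 := h1 K
    have h3 : K < 2 ^ K := Nat.lt_two_pow_self
    omega

/-- The coins are consumed in order, so the hash value of z under function l uses its own block of K
coins starting at (l·n + z)·K. Disjoint blocks are what makes the values independent. -/
theorem does_hashGen {s : St} {K L n : ℕ} (hK : s.var vKB = K) (hL : s.var vL = L)
    (hn : s.var vN = n) (hc : s.coins = 0) :
    Does τ r hashGen s (3 + L * (5 + n * (7 + 6 * 2 ^ K))) (fun s' =>
      ∀ l < L, ∀ z < n, s'.arr aHASH l z = hval r ((l * n + z) * K) K) := by
  refine (does_forN (N := L) rfl (by simp [hL]) (fun _ => 3 + n * (5 + 6 * 2 ^ K + 2))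
    (fun l' s' => s'.coins = l' * n * K ∧ ∀ l < l', ∀ z < n,
      s'.arr aHASH l z = hval r ((l * n + z) * K) K)
    (fun _ _ _ h => h) (by simp [hc]) ?_).mono ?_ (fun _ _ h => h.2)
  · rintro l s1 hl hs1 hv1 ⟨i1, i2⟩
    refine (does_forN (N := n) rfl (by simp [hs1.var vN rfl, hn]) (fun _ => 5 + 6 * 2 ^ K)
      (fun z' s' => s'.coins = (l * n + z') * K ∧ ∀ l' z, z < n → (l' < l ∨ (l' = l ∧ z < z')) →
        s'.arr aHASH l' z = hval r ((l' * n + z) * K) K)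
      (fun _ _ _ h => h) ⟨by simpa using i1, ?_⟩ ?_).mono ?_ ?_
    · intro l' z hz h; exact i2 l' (by omega) z hz
    · rintro z s2 hz hs2 hv2 ⟨j1, j2⟩
      refine Does.mono (does_seq (does_set_eq (v := 0) rfl rfl) (l := (3 + 6 * 2 ^ K) + 1) ?_)
        (by omega) (fun _ _ h => h)
      rintro s3 hs3 e3
      have c3 : s3.coins = (l * n + z) * K := by rw [e3]; exact j1
      refine does_seq (does_hashBits (K := K) (by rw [hs3.var vKB rfl, hs2.var vKB rfl,
        hs1.var vKB rfl, hK]) (by rw [e3]; simp)) fun s4 hs4 h4 => ?_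
      rw [c3] at h4
      refine does_put (a := l) (b := z) (v := hval r ((l * n + z) * K) K)
        (by rw [eval_var, hs4.var vl rfl, hs3.var vl rfl, hs2.var vl rfl, hv1])
        (by rw [eval_var, hs4.var vz rfl, hs3.var vz rfl, hv2]) h4.1 rfl ⟨?_, ?_⟩
      · change s4.coins = _
        rw [h4.2]; ring
      · intro l' z' hz' h
        rw [setArr_arr]
        split_ifs with h5
        · rw [h5.2.1, h5.2.2]
        · rw [hs4.arr aHASH rfl, hs3.arr aHASH rfl]
          refine j2 l' z' hz' ?_
          rcases h with h | ⟨h6, h7⟩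
          · exact .inl h
          · refine .inr ⟨h6, ?_⟩
            by_contra h8
            exact h5 ⟨rfl, h6, by omega⟩
    · simp
    · rintro s2 - ⟨j1, j2⟩
      refine ⟨by rw [j1]; ring, fun l' hl' z hz => j2 l' z hz (by omega)⟩
  · simp only [sum_const, card_range, smul_eq_mul]
    apply le_of_eq; ring

/-- The command does not flip coins. -/
def Cmd.noFlip : Cmd → Bool
  | .flip _ => false
  | .seq p q => p.noFlip && q.noFlip
  | .ite _ p q => p.noFlip && q.noFlip
  | .loop _ _ p => p.noFlip
  | _ => true

theorem run_coins (c : Cmd) (h : c.noFlip = true) (s : St) : (run r c s).coins = s.coins := by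
  induction c generalizing s with
  | skip => rfl
  | set x e => rfl
  | put k i j e => rfl
  | flip x => simp [Cmd.noFlip] at h
  | seq p q ihp ihq =>
    simp only [Cmd.noFlip, Bool.and_eq_true] at h
    rw [run, ihq h.2, ihp h.1]
  | ite e p q ihp ihq =>
    simp only [Cmd.noFlip, Bool.and_eq_true] at h
    simp only [run]
    split_ifs
    · exact ihq h.2 s
    · exact ihp h.1 s
  | loop e c p ih =>
    simp only [Cmd.noFlip] at h
    simp only [run]
    generalize e.eval s = N
    induction N generalizing s with
    | zero => rfl
    | succ N ihN =>
      simp only [iter]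
      split_ifs
      · rfl
      · rw [ihN, ih h]
  | mm g A B C => rfl

theorem Does.coins {c : Cmd} {s : St} {k : ℕ} {Q : St → Prop} (h : Does τ r c s k Q)
    (hc : c.noFlip = true) : Does τ r c s k fun s' => s'.coins = s.coins ∧ Q s' :=
  ⟨⟨run_coins c hc s, h.1⟩, h.2⟩

end Pre

/-! ## The program -/

/-- In the number of hash functions, the summand 2 pays for the union bound over pairs of vertices
and c for the required error probability. -/
def paramCmd (c : ℕ) : Cmd := .seq sqrtCmd
  (.seq (filt vfi vfe vHn aH (.var vN) (.var vfi) (eLt (.var vS) (.arr aDEG (.const 0) (.var vfe))))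
  (.seq (doubling vB vKB (.op .add (.op .mul (.const 2) (.var vS)) (.const 1)))
  (.seq (doubling vP vKN (.var vN)) (.seq (.set vL (.op .mul (.const (c + 2)) (.var vKN)))
  (.set vLB (.op .mul (.var vL) (.var vB)))))))

def mainCmd (c : ℕ) : Cmd := .seq readEdges (.seq (paramCmd c) (.seq hashGen (.seq searchAll
  (.set vN (eB (.var vRES))))))

section Main

variable {n : ℕ}

def sizeS (n m : ℕ) : ℕ := Nat.sqrt (n + m) + 1

/-- The bit length of 2S + 1 gives 2^K > 2S + 1, that is, at least 2(S + 1) hash values. -/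
def bitsB (n m : ℕ) : ℕ := Nat.size (2 * sizeS n m + 1)

def numL (c n : ℕ) : ℕ := (c + 2) * Nat.size n

theorem one_le_size {n : ℕ} (hn : 1 ≤ n) : 1 ≤ Nat.size n := Nat.size_pos.2 hn

/-- The graph together with the parameters and hash functions that the program uses. -/
noncomputable def mkPar {G : SimpleGraph (Fin n)} {L : List (Fin n × Fin n)} (h : IsEdgeList G L) (hn : 1 ≤ n)
    (c : ℕ) (r : ℕ → Bool) : Par where
  n := n
  m := L.length
  adj := natAdj G
  dec := fun _ _ => Classical.dec _
  symm := fun ⟨h1, h2, h3⟩ => ⟨h2, h1, h3.symm⟩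
  adj_lt := fun ⟨_, h, _⟩ => h
  nb := nbOf L
  nodup := nodup_nbOf (fun _ he => IsEdgeList.ne h he) h.1
  mem_nb := mem_nbOf_iff h
  sum_deg := sum_length_nbOf L
  s := sizeS n L.length
  one_le_s := Nat.le_add_left _ _
  le_sq := (Nat.lt_succ_sqrt (n + L.length)).le
  L := numL c n
  B := 2 ^ bitsB n L.length
  one_le_L := Nat.mul_pos (Nat.succ_pos _) (one_le_size hn)
  two_s_le := Nat.lt_size_self _
  hash := fun l z => hval r ((l * n + z) * bitsB n L.length) (bitsB n L.length)
  hash_lt := fun _ _ => hval_lt _ _ _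

variable {τ : ℕ → ℕ} {r : ℕ → Bool} {κ : ℕ}

/-- No coin is flipped before `hashGen`, as `Does.coins` certifies, so the hash values sit at the
coin positions prescribed by `mkPar`. Preprocessing is absorbed in the cost of the search for one
vertex. -/
theorem does_mainCmd {G : SimpleGraph (Fin n)} {L : List (Fin n × Fin n)} (h : IsEdgeList G L)
    (hn : 1 ≤ n) (c : ℕ) (hκ1 : 1 ≤ κ)
    (hκ : ∀ g, 1 ≤ g → g ≤ 2 * sizeS n L.length + 2 → τ g ≤ κ * (g * g)) :
    ∃ δ, n * δ ≤ 2 * L.length ∧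
    Does τ r (mainCmd c) (initSt L) ((δ + 1) * (7000 * κ * (sizeS n L.length * sizeS n L.length *
      (numL c n * 2 ^ bitsB n L.length)))) (fun s' => (mkPar h hn c r).Good →
      ((∃ a, (mkPar h hn c r).DomA a) ∧ s'.var vN = 1) ∨
      ((¬ ∃ a, (mkPar h hn c r).DomA a) ∧ s'.var vN = 0)) := by
  set P := mkPar h hn c r with hP
  set S := sizeS n L.length with hS
  set K := bitsB n L.length with hK
  set m := L.length with hm
  -- the states after reading the edges and after computing the parameters
  have hread := (does_readEdges (τ := τ) (r := r) (L := L) fun e he => IsEdgeList.ne h he).coins rfl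
  obtain ⟨s1, hs1, ⟨c1, h1⟩, hr1⟩ : ∃ s1, Same readEdges (initSt L) s1 ∧
      (s1.coins = 0 ∧ EdgesRead L s1) ∧
      Does τ r readEdges (initSt L) (3 + 10 * m) (fun s' => s' = s1) :=
    ⟨_, run_same r _ _, hread.1, rfl, hread.2⟩
  have n1 : s1.var vN = n := by rw [hs1.var vN rfl]; rfl
  have m1 : s1.var vM = m := by rw [hs1.var vM rfl]; rfl
  have hpar : Does τ r (paramCmd c) s1 ((3 + 2 * Nat.sqrt (n + m)) + ((4 + 6 * n) +
      ((4 + K * (3 + 2 * (2 * S + 1))) + ((4 + Nat.size n * (3 + 2 * n)) + ((1 + numL c n) +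
      (1 + numL c n * 2 ^ K)))))) (fun s' => s'.var vS = S ∧ s'.var vB = 2 ^ K ∧ s'.var vKB = K ∧
      s'.var vL = numL c n ∧ s'.var vLB = numL c n * 2 ^ K ∧ IsList s' aH vHn P.hl) := by
    refine does_seq (does_sqrtCmd n1 m1) fun s2 hs2 h2 => ?_
    have d2 : s2.arr aDEG = s1.arr aDEG := hs2.arr aDEG rfl
    have n2 : s2.var vN = n := by rw [hs2.var vN rfl, n1]
    have hfilt : Does τ r (filt vfi vfe vHn aH (.var vN) (.var vfi)
        (eLt (.var vS) (.arr aDEG (.const 0) (.var vfe)))) s2 (4 + 6 * n)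
        (fun s' => IsList s' aH vHn P.hl) := by
      refine (does_filt (List.range n) P.heavy (by decide) (by decide) (by decide) rfl
        ?_ ?_ ?_).mono (by simp) fun _ _ h => h
      · intro s' h
        rw [eval_var, h.var vN rfl, n2, List.length_range]
      · intro i hi s' _ hx
        rw [eval_var, hx, List.getElem_range]
      · intro z _ s' h hx
        rw [ne_eq, eLt_ne, not_not, eval_var, eval_arr, eval_cst, eval_var, hx, h.var vS rfl, h2,
          h.arr aDEG rfl, d2, h1.deg]
        rfl
    refine does_seq hfilt fun s3 hs3 h3 => ?_
    have S3 : s3.var vS = S := by rw [hs3.var vS rfl, h2]; rfl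
    refine does_seq (does_doubling (v := 2 * S + 1) (by decide)
      fun s' h => by simp [h.var vS rfl, S3]) fun s4 hs4 h4 => ?_
    refine does_seq (does_doubling (v := n) (by decide)
      fun s' h => by simp [h.var vN rfl, hs4.var vN rfl, hs3.var vN rfl, n2]) fun s5 hs5 h5 => ?_
    refine does_seq (does_set_price (v := numL c n) (by simp [h5.2, numL])) fun s6 hs6 h6 => ?_
    have B6 : s6.var vB = 2 ^ K := by rw [hs6.var vB rfl, hs5.var vB rfl, h4.1]; rfl
    have L6 : s6.var vL = numL c n := by rw [h6]; simp
    refine (does_set_price (v := numL c n * 2 ^ K) (by simp [B6, L6])).mono le_rfl ?_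
    rintro s7 hs7 h7
    refine ⟨?_, ?_, ?_, ?_, by rw [h7]; simp, ?_⟩
    · rw [hs7.var vS rfl, hs6.var vS rfl, hs5.var vS rfl, hs4.var vS rfl, S3]
    · rw [hs7.var vB rfl, B6]
    · rw [hs7.var vKB rfl, hs6.var vKB rfl, hs5.var vKB rfl, h4.2]; rfl
    · rw [hs7.var vL rfl, L6]
    · exact h3.congr (by rw [hs7.var vHn rfl, hs6.var vHn rfl, hs5.var vHn rfl, hs4.var vHn rfl])
        (by rw [hs7.arr aH rfl, hs6.arr aH rfl, hs5.arr aH rfl, hs4.arr aH rfl])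
  have hpar' := hpar.coins rfl
  obtain ⟨s2, hs2, ⟨c2, S2, B2, K2, L2, LB2, H2⟩, hr2⟩ : ∃ s2, Same (paramCmd c) s1 s2 ∧
      (s2.coins = s1.coins ∧ s2.var vS = S ∧ s2.var vB = 2 ^ K ∧ s2.var vKB = K ∧
      s2.var vL = numL c n ∧ s2.var vLB = numL c n * 2 ^ K ∧ IsList s2 aH vHn P.hl) ∧
      Does τ r (paramCmd c) s1 ((3 + 2 * Nat.sqrt (n + m)) + ((4 + 6 * n) +
      ((4 + K * (3 + 2 * (2 * S + 1))) + ((4 + Nat.size n * (3 + 2 * n)) + ((1 + numL c n) +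
      (1 + numL c n * 2 ^ K)))))) (fun s' => s' = s2) :=
    ⟨_, run_same r _ _, hpar'.1, rfl, hpar'.2⟩
  have n2 : s2.var vN = n := by rw [hs2.var vN rfl, n1]
  have hhash := does_hashGen (τ := τ) (r := r) K2 L2 n2 (c2.trans c1)
  obtain ⟨s3, hs3, h3, hr3⟩ : ∃ s3, Same hashGen s2 s3 ∧
      (∀ l < numL c n, ∀ z < n, s3.arr aHASH l z = hval r ((l * n + z) * K) K) ∧
      Does τ r hashGen s2 (3 + numL c n * (5 + n * (7 + 6 * 2 ^ K))) (fun s' => s' = s3) :=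
    ⟨_, run_same r _ _, hhash.1, rfl, hhash.2⟩
  have hb3 : Base P s3 := by
    have e : ∀ k, hashGen.wArr k = false → (paramCmd c).wArr k = false → s3.arr k = s1.arr k :=
      fun k h h' => by rw [hs3.arr k h, hs2.arr k h']
    refine ⟨by rw [hs3.var vN rfl, n2]; rfl, by rw [hs3.var vS rfl, S2]; rfl,
      by rw [hs3.var vB rfl, B2]; rfl, by rw [hs3.var vL rfl, L2]; rfl,
      by rw [hs3.var vLB rfl, LB2]; rfl, fun u v => ?_, fun v => ?_, fun v i hi => ?_, h3,
      H2.congr (hs3.var vHn rfl) (hs3.arr aH rfl)⟩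
    · rw [e aADJ rfl rfl, h1.adj, mem_nbOf_iff h]; rfl
    · rw [e aDEG rfl rfl, h1.deg]; rfl
    · rw [e aNBR rfl rfl, h1.nbr v i hi]; rfl
  have hflag : FlagOK P s3 := by
    intro p q a hf
    rw [hs3.arr aFLAG rfl, hs2.arr aFLAG rfl, hs1.arr aFLAG rfl] at hf
    exact absurd hf (Nat.succ_ne_zero a).symm
  have hres : s3.var vRES = 0 := by
    rw [hs3.var vRES rfl, hs2.var vRES rfl, hs1.var vRES rfl]; rfl
  obtain ⟨δ, hδ, hsearch⟩ := does_searchAll (τ := τ) (r := r) hb3 hn hflag hres hκ1 hκ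
  refine ⟨δ, hδ, (does_seq hr1 fun _ _ e => does_seq (e ▸ hr2) fun _ _ e => does_seq (e ▸ hr3)
    fun _ _ e => does_seq (e ▸ hsearch) fun s4 _ h4 =>
      (does_set_eq rfl rfl).mono le_rfl ?_).mono ?_ fun _ _ h => h⟩
  · rintro _ - rfl hG
    have h5 := h4 hG
    rw [setVar_var, if_pos rfl, eB_eval, eval_var]
    by_cases h6 : s4.var vRES = 0
    · rw [if_pos h6]
      exact .inr ⟨fun h7 => (h5.2 h7) h6, rfl⟩
    · rw [if_neg h6]
      exact .inl ⟨h5.1 h6, rfl⟩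
  · have e1 : n ≤ S * S := P.n_le
    have e2 : m ≤ S * S := P.m_le
    have e3 : 1 ≤ S := P.one_le_s
    have e4 : 1 ≤ numL c n := P.one_le_L
    have e5 : 2 * (S + 1) ≤ 2 ^ K := P.two_s_le
    have e6 : Nat.size n ≤ numL c n := Nat.le_mul_of_pos_left _ (Nat.succ_pos _)
    have e7 : K ≤ 2 * S + 1 := Nat.size_le.2 Nat.lt_two_pow_self
    have e8 : Nat.sqrt (n + m) ≤ S := Nat.le_succ _
    have hunit : P.s * P.s * (P.L * P.B) = S * S * (numL c n * 2 ^ K) := rfl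
    rw [hunit]
    set Lh := numL c n
    set B := 2 ^ K
    set Z := S * S * (Lh * B) with hZ
    have f1 : S * S ≤ Z := Nat.le_mul_of_pos_right _ (Nat.mul_pos e4 (by omega))
    have f2 : S ≤ S * S := Nat.le_mul_of_pos_right _ e3
    have f3 : Lh * B ≤ Z := Nat.le_mul_of_pos_left _ (Nat.mul_pos e3 e3)
    have f4 : Lh ≤ Lh * B := Nat.le_mul_of_pos_right _ (by omega)
    have f5 : K * (3 + 2 * (2 * S + 1)) ≤ 27 * (S * S) := by
      calc _ ≤ (2 * S + 1) * (3 + 2 * (2 * S + 1)) := Nat.mul_le_mul_right _ e7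
        _ ≤ (3 * S) * (9 * S) := Nat.mul_le_mul (by omega) (by omega)
        _ = _ := by ring
    have f6 : Lh * (S * S) ≤ Z := by
      calc Lh * (S * S) ≤ Lh * (S * S) * B := Nat.le_mul_of_pos_right _ (by omega)
        _ = Z := by rw [hZ]; ring
    have f7 : Nat.size n * (3 + 2 * n) ≤ 3 * Lh + 2 * (Lh * (S * S)) := by
      calc _ ≤ Lh * (3 + 2 * (S * S)) := Nat.mul_le_mul e6 (by omega)
        _ = _ := by ring
    have f8 : Lh * (n * B) ≤ Z := by
      calc Lh * (n * B) ≤ Lh * (S * S * B) := by gcongr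
        _ = Z := by rw [hZ]; ring
    have f9 : Lh * n ≤ Lh * (S * S) := Nat.mul_le_mul_left _ e1
    have f10 : Z ≤ κ * Z := Nat.le_mul_of_pos_left _ hκ1
    have f11 : κ * Z ≤ (δ + 1) * (κ * Z) := Nat.le_mul_of_pos_left _ (Nat.succ_pos _)
    calc _ = 24 + 10 * m + 2 * Nat.sqrt (n + m) + 6 * n + K * (3 + 2 * (2 * S + 1)) +
          Nat.size n * (3 + 2 * n) + 6 * Lh + Lh * B + 7 * (Lh * n) + 6 * (Lh * (n * B)) +
          6000 * ((δ + 1) * (κ * Z)) := by ring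
      _ ≤ 7000 * ((δ + 1) * (κ * Z)) := by omega
      _ = _ := by ring

end Main

/-! ## The hash functions are good with high probability -/

section Prob

instance : IsProbabilityMeasure coinMeasure := by
  unfold coinMeasure; infer_instance

theorem coin_cylinder (T : Finset ℕ) (g : ℕ → Bool) :
    coinMeasure (Set.pi T fun k => {g k}) = 2⁻¹ ^ #T := by
  unfold coinMeasure
  rw [Measure.infinitePi_pi _ fun i _ => measurableSet_singleton _]
  simp

/-- The probability that every coin `a i` agrees with the coin `b i`. -/
theorem coin_match {I : Type*} [Fintype I] (a b : I → ℕ) (ha : Function.Injective a)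
    (hab : ∀ i j, a i ≠ b j) :
    coinMeasure {r | ∀ i, r (a i) = r (b i)} ≤ 2⁻¹ ^ Fintype.card I := by
  classical
  set U := univ.image b
  set A := univ.image a
  have hd : Disjoint U A := by
    rw [Finset.disjoint_left]
    intro k h1 h2
    obtain ⟨j, -, rfl⟩ := mem_image.1 h1
    obtain ⟨i, -, h⟩ := mem_image.1 h2
    exact hab i j h
  let ext : (U → Bool) → ℕ → Bool := fun f k => if h : k ∈ U then f ⟨k, h⟩ else false
  let val : (U → Bool) → ℕ → Bool := fun f k =>
    if h : ∃ i, a i = k then ext f (b h.choose) else ext f k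
  -- Guess the coins on `U`; the event then fixes those on `A`. This gives 2^|U| cylinders, each of
  -- probability 2^(-|U|-|A|).
  have hsub : {r : ℕ → Bool | ∀ i, r (a i) = r (b i)} ⊆
      ⋃ f ∈ (univ : Finset (U → Bool)), Set.pi (U ∪ A : Finset ℕ) fun k => {val f k} := by
    intro r hr
    simp only [Set.mem_iUnion, mem_univ, exists_const]
    refine ⟨fun k => r k, fun k hk => ?_⟩
    rw [Finset.mem_coe, mem_union] at hk
    rw [Set.mem_singleton_iff]
    have hext : ∀ i, ext (fun k => r k) (b i) = r (b i) := fun i => by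
      have : b i ∈ U := mem_image_of_mem _ (mem_univ i)
      simp [ext, this]
    simp only [val]
    split_ifs with h
    · rw [hext, ← hr, h.choose_spec]
    · rcases hk with hk | hk
      · obtain ⟨i, -, rfl⟩ := mem_image.1 hk
        rw [hext]
      · obtain ⟨i, -, rfl⟩ := mem_image.1 hk
        exact absurd ⟨i, rfl⟩ h
  refine (measure_mono hsub).trans ((measure_biUnion_finset_le _ _).trans ?_)
  simp only [coin_cylinder]
  rw [card_union_of_disjoint hd, card_image_of_injective _ ha, sum_const, card_univ, card_univ,
    Fintype.card_fun, Fintype.card_bool, Fintype.card_coe, nsmul_eq_mul, pow_add, ← mul_assoc]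
  push_cast
  rw [← mul_pow, ENNReal.mul_inv_cancel (by norm_num) (by norm_num), one_pow, one_mul]

theorem hval_inj {r r' : ℕ → Bool} {a b K : ℕ} (h : hval r a K = hval r' b K) :
    ∀ t < K, r (a + t) = r' (b + t) := by
  induction K with
  | zero => intro t ht; omega
  | succ K ih =>
    simp only [hval] at h
    have h1 : (r (a + K)).toNat ≤ 1 := Bool.toNat_le _
    have h2 : (r' (b + K)).toNat ≤ 1 := Bool.toNat_le _
    intro t ht
    by_cases h3 : t = K
    · subst h3
      have h3 : (r (a + t)).toNat = (r' (b + t)).toNat := by omega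
      revert h3
      cases r (a + t) <;> cases r' (b + t) <;> simp
    · exact ih (by omega) t (by omega)

variable {n : ℕ} {G : SimpleGraph (Fin n)} {L : List (Fin n × Fin n)}

/-- All hash values of `z` under `l` functions occur on the set `D`. -/
theorem measure_collide {n z K l : ℕ} {D : Finset ℕ} (hD : ∀ w ∈ D, w < n ∧ w ≠ z)
    (hz : z < n) (hK : 2 * #D ≤ 2 ^ K) :
    coinMeasure {r | ∀ i < l, ∃ w ∈ D, hval r ((i * n + w) * K) K = hval r ((i * n + z) * K) K} ≤
      2⁻¹ ^ l := by
  classical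
  -- Choose for each function an element of `D` with which z collides. A collision means that K
  -- coins of one block equal those of another.
  have hsub : {r | ∀ i < l, ∃ w ∈ D, hval r ((i * n + w) * K) K = hval r ((i * n + z) * K) K} ⊆
      ⋃ w ∈ Fintype.piFinset fun _ : Fin l => D, {r | ∀ p : Fin l × Fin K,
        r ((p.1 * n + w p.1) * K + p.2) = r ((p.1 * n + z) * K + p.2)} := by
    intro r hr
    have hr' : ∀ i : Fin l, ∃ w ∈ D,
        hval r ((i * n + w) * K) K = hval r ((i * n + z) * K) K := fun i => hr i i.2
    choose w hw hv using hr'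
    simp only [Set.mem_iUnion]
    exact ⟨w, Fintype.mem_piFinset.2 hw, fun p => hval_inj (hv p.1) p.2 p.2.2⟩
  refine (measure_mono hsub).trans ((measure_biUnion_finset_le _ _).trans ?_)
  have hle : ∀ w ∈ Fintype.piFinset fun _ : Fin l => D, coinMeasure {r | ∀ p : Fin l × Fin K,
      r ((p.1 * n + w p.1) * K + p.2) = r ((p.1 * n + z) * K + p.2)} ≤ 2⁻¹ ^ (l * K) := by
    intro w hw
    have hw' := Fintype.mem_piFinset.1 hw
    refine (coin_match _ _ ?_ ?_).trans (by simp)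
    · rintro ⟨i, t⟩ ⟨j, u⟩ h
      obtain ⟨h1, h2⟩ := hash_index_inj t.2 u.2 h
      obtain ⟨h3, -⟩ := hash_index_inj (hD _ (hw' i)).1 (hD _ (hw' j)).1 h1
      rw [Prod.mk.injEq]
      exact ⟨Fin.ext h3, Fin.ext h2⟩
    · rintro ⟨i, t⟩ ⟨j, u⟩ h
      obtain ⟨h1, -⟩ := hash_index_inj t.2 u.2 h
      exact (hD _ (hw' i)).2 (hash_index_inj (hD _ (hw' i)).1 hz h1).2
  refine (Finset.sum_le_sum hle).trans ?_
  rw [sum_const, Fintype.card_piFinset_const, nsmul_eq_mul, mul_comm l K, pow_mul]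
  push_cast
  rw [← mul_pow]
  -- The |D|^l choices of probability 2^(-lK) each give (|D|/2^K)^l, and the base is at most 1/2.
  refine pow_le_pow_left₀ (zero_le) ?_ l
  have h2 : (2 : ℝ≥0∞) * #D ≤ 2 ^ K := by exact_mod_cast hK
  rw [← ENNReal.inv_pow, ← div_eq_mul_inv]
  refine ENNReal.div_le_of_le_mul ?_
  calc (#D : ℝ≥0∞) = 2⁻¹ * (2 * #D) := by
        rw [← mul_assoc, ENNReal.inv_mul_cancel (by norm_num) (by norm_num), one_mul]
    _ ≤ _ := by gcongr

/-- For each of the n² pairs of a light d and a vertex z outside N(d), all l functions fail with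
probability at most 2^(-l), and 2^l ≥ n^(c+2). Being light and non-adjacent does not depend on the
coins, so a pair without these properties contributes the empty event. -/
theorem measure_good (h : IsEdgeList G L) (hn : 1 ≤ n) (c : ℕ) :
    1 - ((n : ℝ≥0∞) ^ c)⁻¹ ≤ coinMeasure {r | (mkPar h hn c r).Good} := by
  classical
  set K := bitsB n L.length with hK
  set l := numL c n with hl
  set bad : ℕ → ℕ → Set (ℕ → Bool) := fun d z => {r | (nbOf L d).length ≤ sizeS n L.length ∧
    z ∉ nbOf L d ∧ ∀ i < l, ∃ w ∈ (nbOf L d).toFinset,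
      hval r ((i * n + w) * K) K = hval r ((i * n + z) * K) K} with hbad
  have hbad_le : ∀ d, ∀ z < n, coinMeasure (bad d z) ≤ 2⁻¹ ^ l := by
    intro d z hz
    by_cases h1 : (nbOf L d).length ≤ sizeS n L.length ∧ z ∉ nbOf L d
    · refine (measure_mono fun r hr => hr.2.2).trans (measure_collide (fun w hw => ?_) hz ?_)
      · rw [List.mem_toFinset] at hw
        exact ⟨((mem_nbOf_iff h).1 hw).2.1, fun he => h1.2 (he ▸ hw)⟩
      · have h2 := (nbOf L d).toFinset_card_le
        have h3 : 2 * sizeS n L.length + 1 < 2 ^ K := Nat.lt_size_self _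
        omega
    · have : bad d z = ∅ := by
        ext r
        simp only [hbad, Set.mem_ofPred_eq, Set.mem_empty_iff_false, iff_false]
        tauto
      rw [this, measure_empty]
      exact zero_le
  have hcover : (Set.univ : Set (ℕ → Bool)) ⊆ {r | (mkPar h hn c r).Good} ∪
      ⋃ d ∈ range n, ⋃ z ∈ range n, bad d z := by
    intro r _
    by_cases hg : (mkPar h hn c r).Good
    · exact .inl hg
    refine .inr ?_
    unfold Par.Good at hg
    push Not at hg
    obtain ⟨d, z, hd, hz, hh, ha, hcol⟩ := hg
    simp only [Set.mem_iUnion, mem_range]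
    refine ⟨d, hd, z, hz, not_lt.1 hh, fun hm => ha ((mem_nbOf_iff h).1 hm), fun i hi => ?_⟩
    obtain ⟨w, hw, he⟩ := hcol i hi
    exact ⟨w, List.mem_toFinset.2 hw, he⟩
  have hsum : coinMeasure (⋃ d ∈ range n, ⋃ z ∈ range n, bad d z) ≤ ((n : ℝ≥0∞) ^ c)⁻¹ := by
    refine (measure_biUnion_finset_le _ _).trans ?_
    refine (Finset.sum_le_sum fun d _ => (measure_biUnion_finset_le _ _).trans
      (Finset.sum_le_sum fun z hz => hbad_le d z (mem_range.1 hz))).trans ?_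
    simp only [sum_const, card_range, nsmul_eq_mul]
    have hn0 : (n : ℝ≥0∞) ≠ 0 := by exact_mod_cast (by omega : n ≠ 0)
    have hnt : (n : ℝ≥0∞) ≠ ⊤ := ENNReal.natCast_ne_top n
    have hpow : (n : ℝ≥0∞) ^ (c + 2) ≤ 2 ^ l := by
      have h1 : n ^ (c + 2) ≤ 2 ^ l := by
        rw [hl, numL, mul_comm, pow_mul]
        exact Nat.pow_le_pow_left (Nat.lt_size_self n).le _
      exact_mod_cast h1
    rw [← ENNReal.inv_pow]
    calc (n : ℝ≥0∞) * (n * (2 ^ l)⁻¹) ≤ n * (n * ((n : ℝ≥0∞) ^ (c + 2))⁻¹) := by gcongr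
      _ = ((n : ℝ≥0∞) ^ c)⁻¹ := by
        rw [pow_add, ENNReal.mul_inv (.inr (ENNReal.pow_ne_top hnt)) (.inr (pow_ne_zero _ hn0)),
          ← mul_assoc, ← mul_assoc, mul_comm _ ((n : ℝ≥0∞) ^ c)⁻¹, mul_assoc, ← sq,
          ENNReal.mul_inv_cancel (pow_ne_zero _ hn0) (ENNReal.pow_ne_top hnt), mul_one]
  rw [tsub_le_iff_right]
  calc (1 : ℝ≥0∞) = coinMeasure Set.univ := measure_univ.symm
    _ ≤ _ := (measure_mono hcover).trans (measure_union_le _ _)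
    _ ≤ _ := by gcongr

end Prob

/-! ## The running time of matrix multiplication -/

/-- The least worst-case time for each size is a single function τ that meets the bounds for all ε
at once, although the constants vary with ε. -/
theorem exists_mulsIn {ω : ℝ} (hω : MatMulInTime ω) : ∃ (M : Prog) (τ : ℕ → ℕ), MulsIn M τ ∧
    ∀ ε : ℝ, 0 < ε → ∃ C : ℝ, ∀ g : ℕ, 1 ≤ g → (τ g : ℝ) ≤ C * (g : ℝ) ^ (ω + ε) := by
  obtain ⟨M, hM⟩ := hω
  set R : ℕ → Set ℕ := fun g => {T | ∀ A B : Matrix (Fin g) (Fin g) ℕ, (∀ i j, A i j ≤ 1) →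
    (∀ i j, B i j ≤ 1) → ∃ (s : Config) (t : ℕ), Exec (fun _ => false) M (matMulInput A B) s t ∧
      (∀ i j : Fin g, s.mem (2 * (g * g) + (i * g + j)) = (A * B) i j) ∧ t ≤ T} with hR
  have key : ∀ ε : ℝ, 0 < ε → ∃ C : ℝ, 0 ≤ C ∧
      ∀ g : ℕ, 1 ≤ g → ⌊C * (g : ℝ) ^ (ω + ε)⌋₊ ∈ R g := by
    intro ε hε
    -- The exponent 0 restricts the entries to at most 1, which is all that the supports of arrays
    -- need.
    obtain ⟨C, hC⟩ := hM 0 ε hε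
    refine ⟨max C 0, le_max_right _ _, fun g hg A B hA hB => ?_⟩
    obtain ⟨s, t, h1, h2, h3⟩ := hC g hg A B (by simpa using hA) (by simpa using hB) fun _ => false
    refine ⟨s, t, h1, h2, Nat.le_floor (h3.trans ?_)⟩
    exact mul_le_mul_of_nonneg_right (le_max_left _ _) (by positivity)
  refine ⟨M, fun g => sInf (R g), fun g hg => ?_, fun ε hε => ?_⟩
  · obtain ⟨C, _, hC⟩ := key 1 one_pos
    exact Nat.sInf_mem ⟨_, hC g hg⟩
  · obtain ⟨C, hC0, hC⟩ := key ε hε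
    exact ⟨C, fun g hg => (Nat.cast_le.2 (Nat.sInf_le (hC g hg))).trans
      (Nat.floor_le (by positivity))⟩

/-! ### The exponent of matrix multiplication is at least two -/

/-- A program changes at most as many memory cells as its cost. -/
theorem exists_changed {r : ℕ → Bool} {p : Prog} {s s' : Config} {t : ℕ} (h : Exec r p s s' t) :
    ∃ F : Finset ℕ, #F ≤ t ∧ ∀ a ∉ F, s'.mem a = s.mem a := by
  classical
  induction h with
  | skip | assign | flip | while_false => exact ⟨∅, by simp, fun _ _ => rfl⟩
  | store a e s =>
    refine ⟨{a.eval s}, ?_, fun b hb => ?_⟩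
    · have := one_le_bits (a.eval s)
      simp only [card_singleton]; omega
    · simp only [mem_singleton] at hb
      simp [hb]
  | seq _ _ ih1 ih2 =>
    obtain ⟨F, h1, h2⟩ := ih1
    obtain ⟨F', h3, h4⟩ := ih2
    refine ⟨F ∪ F', (card_union_le _ _).trans (by omega), fun a ha => ?_⟩
    simp only [mem_union, not_or] at ha
    rw [h4 a ha.2, h2 a ha.1]
  | ite_true _ _ ih | ite_false _ _ ih =>
    obtain ⟨F, h1, h2⟩ := ih
    exact ⟨F, by omega, h2⟩
  | while_true _ _ _ ih1 ih2 =>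
    obtain ⟨F, h1, h2⟩ := ih1
    obtain ⟨F', h3, h4⟩ := ih2
    refine ⟨F ∪ F', (card_union_le _ _).trans (by omega), fun a ha => ?_⟩
    simp only [mem_union, not_or] at ha
    rw [h4 a ha.2, h2 a ha.1]

/-- The product of two all-ones matrices has g² nonzero entries in cells that are 0 initially, and
each changed cell costs at least 1. -/
theorem sq_le_of_mulsIn {M : Prog} {τ : ℕ → ℕ} (hM : MulsIn M τ) {g : ℕ} (hg : 1 ≤ g) :
    g * g ≤ τ g := by
  obtain ⟨s, t, h1, h2, h3⟩ := hM g hg (Matrix.of fun _ _ => 1) (Matrix.of fun _ _ => 1)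
    (fun _ _ => le_rfl) fun _ _ => le_rfl
  obtain ⟨F, h4, h5⟩ := exists_changed h1
  have h6 : Finset.Ico (2 * (g * g)) (3 * (g * g)) ⊆ F := by
    intro a ha
    rw [mem_Ico] at ha
    by_contra hF
    have hb : a - 2 * (g * g) < g * g := by omega
    have h7 := h2 ⟨(a - 2 * (g * g)) / g, Nat.div_lt_of_lt_mul hb⟩
      ⟨(a - 2 * (g * g)) % g, Nat.mod_lt _ hg⟩
    have h8 : 2 * (g * g) + ((a - 2 * (g * g)) / g * g + (a - 2 * (g * g)) % g) = a := by
      rw [Nat.div_add_mod']; omega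
    simp only [h8, Matrix.mul_apply] at h7
    have h9 := h5 a hF
    have h10 : ¬ a < g * g := by omega
    have h11 : ¬ a - g * g < g * g := by omega
    simp [matMulInput, h10, h11, h7] at h9
    omega
  have h7 := card_le_card h6
  simp only [Nat.card_Ico] at h7
  omega

/-- If ω were below 2, take ε to be half the gap: then g^ε would stay bounded. -/
theorem two_le_of_bound {ω : ℝ} {τ : ℕ → ℕ} (hsq : ∀ g, 1 ≤ g → g * g ≤ τ g)
    (hτ : ∀ ε : ℝ, 0 < ε → ∃ C : ℝ, ∀ g : ℕ, 1 ≤ g → (τ g : ℝ) ≤ C * (g : ℝ) ^ (ω + ε)) :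
    2 ≤ ω := by
  by_contra! h
  obtain ⟨C, hC⟩ := hτ ((2 - ω) / 2) (by linarith)
  have h1 : Filter.Tendsto (fun g : ℕ => (g : ℝ) ^ ((2 - ω) / 2)) Filter.atTop Filter.atTop :=
    (tendsto_rpow_atTop (by linarith)).comp tendsto_natCast_atTop_atTop
  obtain ⟨g, hg1, hg⟩ := ((h1.eventually_gt_atTop C).and (Filter.eventually_ge_atTop 1)).exists
  have hg0 : (0 : ℝ) < g := by exact_mod_cast hg
  have h2 : (g : ℝ) * g ≤ C * (g : ℝ) ^ (ω + (2 - ω) / 2) :=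
    le_trans (by exact_mod_cast hsq g hg) (hC g hg)
  have h3 : (g : ℝ) * g = (g : ℝ) ^ ((2 - ω) / 2) * (g : ℝ) ^ (ω + (2 - ω) / 2) := by
    rw [← Real.rpow_add hg0, ← pow_two, ← Real.rpow_natCast]
    congr 1; push_cast; ring
  rw [h3] at h2
  exact absurd (le_of_mul_le_mul_right h2 (by positivity)) (not_le.2 hg1)

/-! ## Dominating cliques with four vertices -/

theorem hasDominatingPattern_iff {n : ℕ} {G : SimpleGraph (Fin n)} {L : List (Fin n × Fin n)}
    (h : IsEdgeList G L) (hn : 1 ≤ n) (c : ℕ) (r : ℕ → Bool) :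
    HasDominatingPattern (⊤ : SimpleGraph (Fin 4)) G ↔ ∃ a, (mkPar h hn c r).DomA a := by
  constructor
  · rintro ⟨D, hD, ⟨e⟩⟩
    set f : Fin 4 → Fin n := fun i => (e.symm i : Fin n) with hf
    have hadj : ∀ i j, i ≠ j → natAdj G (f i) (f j) := fun i j hij =>
      ⟨(f i).2, (f j).2, e.symm.map_rel_iff.2 hij⟩
    refine ⟨f 0, f 1, f 2, f 3, hadj _ _ (by decide), hadj _ _ (by decide), hadj _ _ (by decide),
      hadj _ _ (by decide), hadj _ _ (by decide), hadj _ _ (by decide), fun z hz => ?_⟩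
    obtain ⟨h1, h2, h3⟩ := Par.mem_far.1 hz
    have h1 : z < n := h1
    have hex : ∀ x ∈ D, ∃ i, f i = x := fun x hx => ⟨e ⟨x, hx⟩, by simp [hf]⟩
    have : ∃ i : Fin 4, i ≠ 0 ∧ natAdj G (f i) z := by
      rcases hD ⟨z, h1⟩ with hz | ⟨u, hu, huz⟩
      -- A vertex far from a is not in the clique, since its members other than a are adjacent to a.
      · obtain ⟨i, hi⟩ := hex _ hz
        have hi0 : i ≠ 0 := by
          rintro rfl
          exact h2 (by rw [hi])
        refine absurd (hadj 0 i hi0.symm) ?_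
        rw [hi]; exact h3
      · obtain ⟨i, rfl⟩ := hex _ hu
        refine ⟨i, ?_, (f i).2, h1, huz⟩
        rintro rfl
        exact h3 ⟨(f 0).2, h1, huz⟩
    obtain ⟨i, hi, hz⟩ := this
    fin_cases i
    · exact absurd rfl hi
    · exact .inl hz
    · exact .inr (.inl hz)
    · exact .inr (.inr hz)
  · rintro ⟨a, b, c', d, ⟨ha, hb, hab⟩, ⟨_, hc, hac⟩, ⟨_, hd, had⟩, ⟨_, _, hbc⟩, ⟨_, _, hbd⟩,
      ⟨_, _, hcd⟩, hdom⟩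
    set f : Fin 4 → Fin n := ![⟨a, ha⟩, ⟨b, hb⟩, ⟨c', hc⟩, ⟨d, hd⟩] with hf
    have hadj : ∀ i j, i ≠ j → G.Adj (f i) (f j) := by
      intro i j hij
      fin_cases i <;> fin_cases j <;> first
        | exact absurd rfl hij
        | assumption
        | exact SimpleGraph.Adj.symm (by assumption)
    have hinj : Function.Injective f := fun i j hij => by
      by_contra hne
      exact (hadj i j hne).ne hij
    refine ⟨Set.range f, fun v => ?_, ⟨SimpleGraph.Iso.symm ⟨Equiv.ofInjective f hinj, ?_⟩⟩⟩
    · by_cases hva : (v : ℕ) = a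
      · exact .inl ⟨0, Fin.ext hva.symm⟩
      by_cases hadj' : natAdj G a v
      · exact .inr ⟨f 0, ⟨0, rfl⟩, hadj'.2.2⟩
      rcases hdom v (Par.mem_far.2 ⟨v.2, hva, hadj'⟩) with h1 | h1 | h1
      · exact .inr ⟨f 1, ⟨1, rfl⟩, h1.2.2⟩
      · exact .inr ⟨f 2, ⟨2, rfl⟩, h1.2.2⟩
      · exact .inr ⟨f 3, ⟨3, rfl⟩, h1.2.2⟩
    · intro i j
      exact ⟨fun hij h => hij.ne (by rw [h]), fun hij => hadj i j hij⟩

/-- A nonempty independent set in a clique is a single vertex, with surplus 1 - 3 = -2, which loses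
against the empty set with surplus 0. -/
theorem rho_top : rho (⊤ : SimpleGraph (Fin 4)) = -1 := by
  classical
  unfold rho
  rw [if_neg]
  intro hne
  obtain ⟨⟨hind, _⟩, hmax⟩ := (exists_isRhoSet (⊤ : SimpleGraph (Fin 4))).choose_spec
  set S := (exists_isRhoSet (⊤ : SimpleGraph (Fin 4))).choose
  obtain ⟨x, hx⟩ := hne
  have h1 : S = {x} := by
    refine eq_singleton_iff_unique_mem.2 ⟨hx, fun y hy => ?_⟩
    by_contra hxy
    exact hind y hy x hx hxy
  have h2 : openNbhd (⊤ : SimpleGraph (Fin 4)) S = univ.erase x := by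
    ext v
    simp [openNbhd, h1, eq_comm]
  have h3 := hmax ∅ ⟨by simp, by simp⟩
  rw [surplus, surplus, h2, h1] at h3
  simp [openNbhd, card_erase_of_mem] at h3

theorem patternTime_top (n m : ℕ) :
    patternTime (⊤ : SimpleGraph (Fin 4)) n m = (m : ℝ) ^ ((5 : ℝ) / 2) / (n : ℝ) := by
  rw [patternTime, rho_top]
  norm_num [Real.rpow_neg_one]
  exact (div_eq_inv_mul _ _).symm

/-! ## The program -/

/-- The program `c`, compiled with `M` for matrix products, on the input of a graph algorithm. -/
def onGraph (M : Prog) (c : Cmd) : Prog :=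
  .seq (.assign 3 (.reg 1)) (.seq (.assign 1 (eadd (emul (.const 2) (.reg 1)) (.const 1)))
    (compile M 3 c))

theorem graphInput_mem_of_le {n : ℕ} (L : List (Fin n × Fin n)) {a : ℕ} (h : 2 * L.length ≤ a) :
    (graphInput L).mem a = 0 := by
  have h1 : ¬ a / 2 < L.length := by omega
  simp [graphInput, h1]

theorem graphInput_mem_le {n : ℕ} (L : List (Fin n × Fin n)) (a : ℕ) :
    (graphInput L).mem a ≤ n := by
  simp only [graphInput]
  split_ifs
  · exact (Fin.is_lt _).le
  · exact (Fin.is_lt _).le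
  · exact Nat.zero_le _

theorem initSt_bdd {n : ℕ} (L : List (Fin n × Fin n)) : (initSt L).Bdd (n + 2 * L.length + 1) := by
  refine ⟨fun x => ?_, fun _ _ _ => Nat.zero_le _, fun i _ => ?_, ?_, Nat.zero_le _⟩
  · simp only [initSt]; split_ifs <;> omega
  · exact (graphInput_mem_le L i).trans (by omega)
  · simp only [initSt]; omega

/-- Register 1 holds the base in compiled programs, so the number of edges first moves to register
3, the place of variable 1. All memory behind the input is 0, which gives the empty arrays and the
fresh copies. -/
theorem exec_onGraph {M : Prog} {τ : ℕ → ℕ} {c : Cmd} {K : ℕ} (hc : Compiles M τ c 3 K) {n : ℕ}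
    (L : List (Fin n × Fin n)) (r : ℕ → Bool) :
    ∃ s t, Exec r (onGraph M c) (graphInput L) s t ∧ s.reg 0 = (run r c (initSt L)).var 0 ∧
      t ≤ (100 + K * cost τ r c (initSt L)) *
        bits (n + 2 * L.length + 1 + K * cost τ r c (initSt L)) := by
  set U := n + 2 * L.length + 1 with hU
  have hb := one_le_bits U
  have s1 : Small (graphInput L) (bits U) 1 (.reg 1) := small_reg (bits_mono (by
    simp only [graphInput]; simp; omega))
  obtain ⟨t1, x1, l1⟩ := exec_assign (r := r) (x := 3) rfl s1
  set c1 := assignAt (graphInput L) 3 (Expr.eval (graphInput L) (.reg 1)) with hc1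
  have s2 : Small c1 (bits U) 1 (.reg 1) := small_reg (bits_mono (by
    simp [hc1, assignAt, graphInput]; omega))
  have s3 := small_op .add (small_op .mul (small_const 2 hb) s2) (small_const 1 hb)
  obtain ⟨t2, x2, l2⟩ := exec_assign (r := r) (x := 1) rfl s3
  set c2 := assignAt c1 1 (Expr.eval c1 (eadd (emul (.const 2) (.reg 1)) (.const 1))) with hc2
  have hrel : Rel (initSt L) c2 := by
    have hbase : (initSt L).base = 2 * L.length + 1 := rfl
    refine ⟨⟨fun x => ?_, ?_, Nat.succ_pos _, ?_, fun i _ => rfl, fun k i j => ?_, rfl⟩,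
      fun t a _ => ?_⟩
    · have h3 : 3 * x ≠ 1 := by omega
      rcases Nat.lt_or_ge x 2 with hx | hx
      · interval_cases x <;> simp [hc2, hc1, assignAt, graphInput, initSt, Function.update]
      · have h4 : 3 * x ≠ 3 := by omega
        have h5 : x ≠ 0 := by omega
        have h6 : x ≠ 1 := by omega
        simp [hc2, hc1, assignAt, graphInput, initSt, Function.update, h3, h5, h6]
    · simp [hc2, hc1, assignAt, graphInput, initSt]
    · simp [hc2, hc1, assignAt, graphInput, initSt]
    · exact graphInput_mem_of_le L ((Nat.le_succ _).trans (le_arrAddr _ k i j))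
    · exact graphInput_mem_of_le L ((Nat.le_succ _).trans (le_mmAddr _ t a))
  obtain ⟨_, s, t3, x3, h3, _, l3⟩ := hc r _ _ U (initSt_bdd L) hrel
  refine ⟨s, _, .seq x1 (.seq x2 x3), h3.var 0, ?_⟩
  have h4 : bits U ≤ bits (U + K * cost τ r c (initSt L)) := bits_mono (Nat.le_add_right _ _)
  have h5 : bits 2 = 3 := by decide
  have h6 : bits 1 = 2 := by decide
  rw [h5, h6] at l2
  rw [add_mul]
  have : 2 * 1 * bits U + 2 * (2 * (2 * (3 + 1) + 2)) * bits U ≤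
      100 * bits (U + K * cost τ r c (initSt L)) := by
    rw [← add_mul]; exact Nat.mul_le_mul (by norm_num) h4
  omega

theorem decidesWHP_onGraph {M : Prog} {τ : ℕ → ℕ} (hM : MulsIn M τ) (c : ℕ) :
    DecidesWHP (onGraph M (mainCmd c)) c
      (fun _ G => HasDominatingPattern (⊤ : SimpleGraph (Fin 4)) G) := by
  intro n hn G L h
  obtain ⟨K, hK⟩ := compile_correct hM (mainCmd c) 3 le_rfl
  refine ⟨fun r => ?_, (measure_good h hn c).trans (measure_mono fun r hr => ?_)⟩
  · obtain ⟨s, t, h1, _⟩ := exec_onGraph hK L r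
    exact ⟨s, t, h1⟩
  · obtain ⟨s, t, h1, h2, _⟩ := exec_onGraph hK L r
    obtain ⟨δ, _, hd, _⟩ := does_mainCmd (τ := τ) (r := r)
      -- Only correctness matters here, so a crude κ that dominates all the relevant values of τ
      -- will do.
      (κ := 1 + ∑ g ∈ range (2 * sizeS n L.length + 3), τ g) h hn c (Nat.le_add_right _ _)
      fun g hg hg' => by
        have h1 : τ g ≤ ∑ g ∈ range (2 * sizeS n L.length + 3), τ g :=
          Finset.single_le_sum (f := τ) (fun _ _ => Nat.zero_le _) (mem_range.2 (by omega))
        have h2 : 1 ≤ g * g := Nat.mul_pos hg hg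
        nlinarith
    refine ⟨s, t, h1, ?_⟩
    beta_reduce
    rw [hasDominatingPattern_iff h hn c r, h2]
    exact hd hr

/-! ## The running time -/

theorem two_pow_size_le {x : ℕ} (hx : 1 ≤ x) : 2 ^ Nat.size x ≤ 2 * x := by
  have h1 : 0 < Nat.size x := Nat.size_pos.2 hx
  have h2 : 2 ^ (Nat.size x - 1) ≤ x := Nat.lt_size.1 (by omega)
  calc 2 ^ Nat.size x = 2 * 2 ^ (Nat.size x - 1) := by rw [← pow_succ']; congr 1; omega
    _ ≤ 2 * x := Nat.mul_le_mul_left 2 h2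

/-- The bit length is at most logarithmic, and log x ≤ x^η/η. -/
theorem bits_le_rpow {η : ℝ} (hη : 0 < η) :
    ∃ C : ℝ, 0 ≤ C ∧ ∀ x : ℕ, 1 ≤ x → (bits x : ℝ) ≤ C * (x : ℝ) ^ η := by
  refine ⟨3 + 2 / η, by positivity, fun x hx => ?_⟩
  have hx1 : (1 : ℝ) ≤ x := by exact_mod_cast hx
  have h1 : (2 : ℝ) ^ Nat.size x ≤ 2 * x := by exact_mod_cast two_pow_size_le hx
  have h2 := Real.log_le_log (by positivity) h1
  rw [Real.log_pow, Real.log_mul (by norm_num) (by positivity)] at h2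
  have h3 := Real.log_le_rpow_div (zero_le_one.trans hx1) hη
  have h4 := Real.one_le_rpow hx1 hη.le
  have h5 : (1 : ℝ) / 2 < Real.log 2 := by have := Real.log_two_gt_d9; linarith
  have h6 : (0 : ℝ) ≤ (x : ℝ) ^ η / η := by positivity
  have h7 : (Nat.size x : ℝ) - 1 ≤ 2 * ((x : ℝ) ^ η / η) := by
    by_contra! h
    nlinarith
  have h8 : (bits x : ℝ) = Nat.size x + 1 := by simp [bits]
  have h9 : (3 + 2 / η) * (x : ℝ) ^ η = 3 * (x : ℝ) ^ η + 2 * ((x : ℝ) ^ η / η) := by ring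
  rw [h8, h9]
  linarith

theorem sizeS_le {n m : ℕ} (hn : 1 ≤ n) (hnm : n ≤ m) : (sizeS n m : ℝ) ≤ 3 * Real.sqrt m := by
  have hm1 : (1 : ℝ) ≤ m := by exact_mod_cast hn.trans hnm
  have h1 : 1 ≤ Real.sqrt m := Real.one_le_sqrt.2 hm1
  have h2 : ((Nat.sqrt (n + m) : ℕ) : ℝ) ≤ 2 * Real.sqrt m := by
    refine Real.nat_sqrt_le_real_sqrt.trans ?_
    rw [Real.sqrt_le_left (by positivity), mul_pow, Real.sq_sqrt (by positivity)]
    have : (n : ℝ) ≤ m := by exact_mod_cast hnm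
    push_cast
    linarith
  simp only [sizeS]
  push_cast
  linarith

/-- The bound `m ^ ((ω + 3) / 2) / n`. -/
noncomputable def cliqueTime (ω : ℝ) (n m : ℕ) : ℝ := (m : ℝ) ^ ((ω + 3) / 2) / (n : ℝ)

/-- From n ≤ m and ω ≥ 2 follows m·n ≤ m² ≤ m^((ω+3)/2). Thus small powers of m and the input size
can be absorbed in powers of the time bound. -/
theorem le_cliqueTime {ω : ℝ} (hω : 2 ≤ ω) {n m : ℕ} (hn : 1 ≤ n) (hnm : n ≤ m) :
    (m : ℝ) ≤ cliqueTime ω n m := by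
  have hm1 : (1 : ℝ) ≤ m := by exact_mod_cast hn.trans hnm
  have hn1 : (1 : ℝ) ≤ n := by exact_mod_cast hn
  have hnm' : (n : ℝ) ≤ m := by exact_mod_cast hnm
  rw [cliqueTime, le_div_iff₀ (by linarith)]
  calc (m : ℝ) * n ≤ m * m := by gcongr
    _ = (m : ℝ) ^ (2 : ℝ) := by norm_num [pow_two]
    _ ≤ _ := Real.rpow_le_rpow_of_exponent_le hm1 (by linarith)

/-- Up to m^η-factors the cost is (m/n)·κ·m·√m, for the number of vertices a, the price of a square,
S² and the number of hash values; with κ about m^((ω-2)/2) this is m^((ω+3)/2)/n. -/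
theorem cost_mainCmd_le {ω η C : ℝ} {τ : ℕ → ℕ} (hω : 2 ≤ ω) (hη : 0 < η) (hC : 0 ≤ C)
    (hτ : ∀ g : ℕ, 1 ≤ g → (τ g : ℝ) ≤ C * (g : ℝ) ^ (ω + η)) (c : ℕ) :
    ∃ C' : ℝ, 0 ≤ C' ∧ ∀ n : ℕ, 1 ≤ n → ∀ (G : SimpleGraph (Fin n)) (L : List (Fin n × Fin n)),
      IsEdgeList G L → n ≤ L.length → ∀ r : ℕ → Bool,
      (cost τ r (mainCmd c) (initSt L) : ℝ) ≤ C' * cliqueTime ω n L.length ^ (1 + 2 * η) := by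
  obtain ⟨B, hB0, hB⟩ := bits_le_rpow hη
  set p := ω - 2 + η with hp
  have hp0 : 0 < p := by linarith
  refine ⟨3 * (7000 * (C * 8 ^ p + 1) * (9 * ((c + 2) * B * 14))), by positivity,
    fun n hn G L h hnm r => ?_⟩
  set m := L.length with hm
  have hm1 : (1 : ℝ) ≤ m := by exact_mod_cast hn.trans hnm
  have hm0 : (0 : ℝ) < m := by linarith
  have hn1 : (1 : ℝ) ≤ n := by exact_mod_cast hn
  have hnm' : (n : ℝ) ≤ m := by exact_mod_cast hnm
  set q := Real.sqrt m with hq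
  have hq1 : 1 ≤ q := Real.one_le_sqrt.2 hm1
  have hS : (sizeS n m : ℝ) ≤ 3 * q := sizeS_le hn hnm
  -- Block sizes are at most 2S + 2 ≤ 8√m, and g^(ω+η) = g^p·g² with p > 0, so the largest g
  -- determines κ.
  set κ := ⌊C * (8 * q) ^ p⌋₊ + 1 with hκ
  have hκle : (κ : ℝ) ≤ (C * 8 ^ p + 1) * q ^ p := by
    have h1 : ((⌊C * (8 * q) ^ p⌋₊ : ℕ) : ℝ) ≤ C * (8 * q) ^ p := Nat.floor_le (by positivity)
    have h2 : 1 ≤ q ^ p := Real.one_le_rpow hq1 hp0.le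
    have h3 : (8 * q) ^ p = 8 ^ p * q ^ p := Real.mul_rpow (by norm_num) (by positivity)
    rw [hκ]; push_cast
    rw [h3] at h1 ⊢
    linarith
  have hκτ : ∀ g, 1 ≤ g → g ≤ 2 * sizeS n m + 2 → τ g ≤ κ * (g * g) := by
    intro g hg hg'
    have hg0 : (0 : ℝ) < g := by exact_mod_cast hg
    have h1 : (g : ℝ) ≤ 8 * q := by
      have : (g : ℝ) ≤ 2 * sizeS n m + 2 := by exact_mod_cast hg'
      linarith
    have h2 : (g : ℝ) ^ (ω + η) = (g : ℝ) ^ p * (g * g) := by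
      rw [← pow_two, ← Real.rpow_natCast, ← Real.rpow_add hg0]
      congr 1; push_cast; ring
    have h3 : (g : ℝ) ^ p ≤ (8 * q) ^ p := Real.rpow_le_rpow hg0.le h1 hp0.le
    have h4 : (τ g : ℝ) ≤ κ * (g * g) := by
      refine (hτ g hg).trans ?_
      rw [h2, ← mul_assoc]
      refine mul_le_mul_of_nonneg_right ?_ (by positivity)
      have h5 : C * (8 * q) ^ p ≤ κ := by
        rw [hκ]; push_cast; exact (Nat.lt_floor_add_one _).le
      exact (mul_le_mul_of_nonneg_left h3 hC).trans h5
    exact_mod_cast h4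
  obtain ⟨δ, hδ, _, hcost⟩ := does_mainCmd (τ := τ) (r := r) (κ := κ) h hn c
    (Nat.le_add_left _ _) hκτ
  have hδ' : (δ : ℝ) + 1 ≤ 3 * m / n := by
    rw [le_div_iff₀ (by linarith)]
    have : (n : ℝ) * δ ≤ 2 * m := by exact_mod_cast hδ
    nlinarith
  have hL : (numL c n : ℝ) ≤ (c + 2) * B * (m : ℝ) ^ η := by
    have h1 : (Nat.size n : ℝ) ≤ B * (m : ℝ) ^ η := by
      refine le_trans ?_ ((hB n hn).trans (mul_le_mul_of_nonneg_left
        (Real.rpow_le_rpow (by positivity) hnm' hη.le) hB0))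
      simp [bits]
    rw [numL]; push_cast
    rw [mul_assoc]
    gcongr
  have h2B : (2 : ℝ) ^ bitsB n m ≤ 14 * q := by
    have h1 : (2 : ℝ) ^ bitsB n m ≤ 2 * (2 * sizeS n m + 1) := by
      exact_mod_cast two_pow_size_le (x := 2 * sizeS n m + 1) (by omega)
    linarith
  have hT := le_cliqueTime hω hn hnm
  have hT1 : 1 ≤ cliqueTime ω n m := hm1.trans hT
  have hcost' : (cost τ r (mainCmd c) (initSt L) : ℝ) ≤ ((δ : ℝ) + 1) * (7000 * κ *
      (sizeS n m * sizeS n m * (numL c n * 2 ^ bitsB n m))) := by exact_mod_cast hcost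
  have hqp : (q : ℝ) ^ p = (m : ℝ) ^ (p / 2) := by
    rw [hq, Real.sqrt_eq_rpow, ← Real.rpow_mul hm0.le]
    congr 1; ring
  have hq3 : (m : ℝ) * (q * q * q) = (m : ℝ) ^ ((5 : ℝ) / 2) := by
    rw [hq, Real.mul_self_sqrt hm0.le, Real.sqrt_eq_rpow]
    nth_rw 1 [← Real.rpow_one (m : ℝ)]
    nth_rw 2 [← Real.rpow_one (m : ℝ)]
    rw [← Real.rpow_add hm0, ← Real.rpow_add hm0]
    norm_num
  have hexp : (m : ℝ) ^ ((5 : ℝ) / 2) * (m : ℝ) ^ (p / 2) * (m : ℝ) ^ η =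
      (m : ℝ) ^ ((ω + 3) / 2) * (m : ℝ) ^ (3 * η / 2) := by
    rw [← Real.rpow_add hm0, ← Real.rpow_add hm0, ← Real.rpow_add hm0]
    congr 1; rw [hp]; ring
  -- The surplus exponent is η/2 from κ and η from the number of hash functions; as m is at most the
  -- time bound, it fits into the exponent 2η.
  have hlast : (m : ℝ) ^ (3 * η / 2) ≤ cliqueTime ω n m ^ (2 * η) :=
    (Real.rpow_le_rpow hm0.le hT (by positivity)).trans
      (Real.rpow_le_rpow_of_exponent_le hT1 (by linarith))
  have hfin : cliqueTime ω n m ^ (1 + 2 * η) =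
      cliqueTime ω n m * cliqueTime ω n m ^ (2 * η) := by
    rw [Real.rpow_add (by linarith), Real.rpow_one]
  calc (cost τ r (mainCmd c) (initSt L) : ℝ)
      ≤ (3 * m / n) * (7000 * ((C * 8 ^ p + 1) * q ^ p) *
        ((3 * q) * (3 * q) * ((c + 2) * B * (m : ℝ) ^ η * (14 * q)))) := by
        refine hcost'.trans ?_
        gcongr
    _ = 3 * (7000 * (C * 8 ^ p + 1) * (9 * ((c + 2) * B * 14))) *
        ((m * (q * q * q)) * q ^ p * (m : ℝ) ^ η / n) := by ring
    _ = 3 * (7000 * (C * 8 ^ p + 1) * (9 * ((c + 2) * B * 14))) *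
        (cliqueTime ω n m * (m : ℝ) ^ (3 * η / 2)) := by
        rw [hq3, hqp, hexp, cliqueTime]; ring
    _ ≤ _ := by
        rw [hfin]
        gcongr

/-- The logarithmic overhead of the machine is at most a constant times the η-th power of input size
plus cost. -/
theorem time_le_of_cost_le {η : ℝ} (hη : 0 < η) (hη1 : η ≤ 1 / 5) (K : ℕ) {C : ℝ} (hC : 0 ≤ C) :
    ∃ C' : ℝ, ∀ (T : ℝ) (U k t : ℕ), 1 ≤ T → 1 ≤ U → (U : ℝ) ≤ 4 * T →
      (k : ℝ) ≤ C * T ^ (1 + 2 * η) → t ≤ (100 + K * k) * bits (U + K * k) →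
      (t : ℝ) ≤ C' * T ^ (1 + 5 * η) := by
  obtain ⟨B, hB0, hB⟩ := bits_le_rpow hη
  have hD : 0 ≤ K * C := by positivity
  refine ⟨(100 + K * C) * (B * (4 + K * C) ^ η), fun T U k t hT1 hU1 hU hk ht => ?_⟩
  have hT0 : 0 ≤ T := zero_le_one.trans hT1
  have hTp : T ≤ T ^ (1 + 2 * η) := by
    conv_lhs => rw [← Real.rpow_one T]
    exact Real.rpow_le_rpow_of_exponent_le hT1 (by linarith)
  have hKk : (K : ℝ) * k ≤ K * (C * T ^ (1 + 2 * η)) :=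
    mul_le_mul_of_nonneg_left hk (Nat.cast_nonneg K)
  have hV : ((U + K * k : ℕ) : ℝ) ≤ (4 + K * C) * T ^ (1 + 2 * η) := by
    push_cast
    linarith
  have hb : (bits (U + K * k) : ℝ) ≤ B * ((4 + K * C) ^ η * T ^ ((1 + 2 * η) * η)) := by
    refine (hB _ (by omega)).trans (mul_le_mul_of_nonneg_left ?_ hB0)
    refine (Real.rpow_le_rpow (Nat.cast_nonneg _) hV hη.le).trans_eq ?_
    rw [Real.mul_rpow (by linarith) (Real.rpow_nonneg hT0 _), ← Real.rpow_mul hT0]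
  have ht' : (t : ℝ) ≤ (100 + K * k) * bits (U + K * k) := by exact_mod_cast ht
  have ha : (100 + K * k : ℝ) ≤ (100 + K * C) * T ^ (1 + 2 * η) := by linarith
  calc (t : ℝ) ≤ (100 + K * C) * T ^ (1 + 2 * η) *
        (B * ((4 + K * C) ^ η * T ^ ((1 + 2 * η) * η))) :=
        ht'.trans (mul_le_mul ha hb (Nat.cast_nonneg _) (by positivity))
    _ = (100 + K * C) * (B * (4 + K * C) ^ η) *
        (T ^ (1 + 2 * η) * T ^ ((1 + 2 * η) * η)) := by ring
    _ ≤ _ := by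
        rw [← Real.rpow_add (by linarith)]
        refine mul_le_mul_of_nonneg_left ?_ (by positivity)
        -- The exponents compare as (1 + 2η)(1 + η) = 1 + 3η + 2η² ≤ 1 + 5η.
        exact Real.rpow_le_rpow_of_exponent_le hT1 (by nlinarith)

theorem runsInTime_onGraph {ω : ℝ} {M : Prog} {τ : ℕ → ℕ} (hM : MulsIn M τ) (hω : 2 ≤ ω)
    (hτ : ∀ ε : ℝ, 0 < ε → ∃ C : ℝ, ∀ g : ℕ, 1 ≤ g → (τ g : ℝ) ≤ C * (g : ℝ) ^ (ω + ε)) (c : ℕ) :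
    RunsInTime (onGraph M (mainCmd c)) (cliqueTime ω) := by
  intro ε hε
  obtain ⟨η, hη0, hη1, hηε⟩ : ∃ η : ℝ, 0 < η ∧ η ≤ 1 / 5 ∧ 5 * η ≤ ε :=
    -- A fifth of ε covers the total loss 5η; the minimum with 1 keeps η at most 1/5.
    ⟨min ε 1 / 5, by positivity, by linarith [min_le_right ε 1], by linarith [min_le_left ε 1]⟩
  obtain ⟨C, hC⟩ := hτ η hη0
  obtain ⟨C₁, hC₁, hcost⟩ := cost_mainCmd_le (C := max C 0) hω hη0 (le_max_right _ _)
    (fun g hg => (hC g hg).trans (mul_le_mul_of_nonneg_right (le_max_left _ _) (by positivity))) c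
  obtain ⟨K, hK⟩ := compile_correct hM (mainCmd c) 3 le_rfl
  obtain ⟨C₂, hC₂⟩ := time_le_of_cost_le hη0 hη1 K hC₁
  refine ⟨max C₂ 0, fun n hn G L h hnm r => ?_⟩
  obtain ⟨s, t, h1, _, ht⟩ := exec_onGraph hK L r
  refine ⟨s, t, h1, ?_⟩
  have hT := le_cliqueTime hω hn hnm
  have hm1 : (1 : ℝ) ≤ L.length := by exact_mod_cast hn.trans hnm
  have hnm' : (n : ℝ) ≤ L.length := by exact_mod_cast hnm
  have hT1 := hm1.trans hT
  have hU : ((n + 2 * L.length + 1 : ℕ) : ℝ) ≤ 4 * cliqueTime ω n L.length := by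
    push_cast
    linarith
  refine (hC₂ _ _ _ t hT1 (Nat.le_add_left _ _) hU (hcost n hn G L h hnm r) ht).trans ?_
  exact mul_le_mul (le_max_left _ _) (Real.rpow_le_rpow_of_exponent_le hT1 (by linarith))
    (Real.rpow_nonneg (zero_le_one.trans hT1) _) (le_max_right _ _)


end DomClique

theorem mainTheorem4 (ω : ℝ) (hω : MatMulInTime ω) :
    (∀ c : ℕ, ∃ A : RAM.Prog,
      DecidesWHP A c (fun n G => HasDominatingPattern (⊤ : SimpleGraph (Fin 4)) G) ∧
      RunsInTime A (fun n m => (m : ℝ) ^ ((ω + 3) / 2) / (n : ℝ)) ∧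
      (ω = 2 → RunsInTime A (patternTime (⊤ : SimpleGraph (Fin 4))))) ∧
    (ω = 2 → ∀ n m : ℕ, 1 ≤ n → 1 ≤ m →
      (m : ℝ) ^ ((ω + 3) / 2) / (n : ℝ) = (m : ℝ) ^ ((5 : ℝ) / 2) / (n : ℝ) ∧
      (m : ℝ) ^ ((5 : ℝ) / 2) / (n : ℝ) = patternTime (⊤ : SimpleGraph (Fin 4)) n m) := by
  obtain ⟨M, τ, hM, hτ⟩ := DomClique.exists_mulsIn hω
  have h2 : 2 ≤ ω := DomClique.two_le_of_bound (fun _ hg => DomClique.sq_le_of_mulsIn hM hg) hτ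
  have htime := DomClique.runsInTime_onGraph hM h2 hτ
  have hexp : ω = 2 → (ω + 3) / 2 = 5 / 2 := fun h => by rw [h]; norm_num
  refine ⟨fun c => ⟨_, DomClique.decidesWHP_onGraph hM c, htime c, fun h => ?_⟩, fun h n m _ _ =>
    ⟨by rw [hexp h], (DomClique.patternTime_top n m).symm⟩⟩
  have : patternTime (⊤ : SimpleGraph (Fin 4)) = DomClique.cliqueTime ω := by
    funext n m
    rw [DomClique.patternTime_top, DomClique.cliqueTime, hexp h]
  rw [this]
  exact htime c
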